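/- A straight-line program (SLP) of size $m\ge 1$ over an alphabet $\Sigma$ is a grammar with variables $X_1,\dots,X_m$ and exactly one production for each variable, of the form $X_i\to a$ with $a\in\Sigma$ or $X_i\to X_pX_q$ with $p,q<i$; it represents the string derived from $X_m$. A scoring function assigns arbitrary real costs to the deletion of each letter, the insertion of each letter, and the replacement of each letter by each letter. The edit distance of $A=a_1\cdots a_r$ and $B=b_1\cdots b_s$ under a scoring function is $T[r,s]$, where $T[0,0]=0$, $T[i,0]=T[i-1,0]+\mathrm{del}(a_i)$, $T[0,j]=T[0,j-1]+\mathrm{ins}(b_j)$ and $$T[i,j]=\min\{T[i-1,j]+\mathrm{del}(a_i),\;T[i,j-1]+\mathrm{ins}(b_j),\;T[i-1,j-1]+\mathrm{rep}(a_i,b_j)\}.$$ The machine model is a random access machine that handles words (natural numbers below a bound $W$) with unit-cost addition, truncated subtraction, multiplication, integer division, comparison and indirect addressing, and real numbers with unit-cost copying, addition, subtraction and comparison. **Theorem.** There are a single program and absolute constants $c,k$ such that the following holds for every finite alphabet $\Sigma=\{0,\dots,\sigma-1\}$, every scoring function on $\Sigma$, and every two SLPs over $\Sigma$ of total size $n$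 representing strings $A,B$ of total length $N$. Given the two SLPs and the table of costs in its memory, and with word bound any $W\ge (n+N+\sigma)^k$ (that is, words of $O(\log(n+N+\sigma))$ bits), the program halts, without overflow, in time at most $c\,n^{2/3}N^{4/3}$ with the edit distance of $A$ and $B$ as its output. If moreover the costs are nonnegative, $\mathrm{rep}(a,a)=0$, and the triangle inequalities $\mathrm{rep}(a,c)\le\mathrm{rep}(a,b)+\mathrm{rep}(b,c)$, $\mathrm{del}(a)\le\mathrm{rep}(a,b)+\mathrm{del}(b)$ and $\mathrm{ins}(b)\le\mathrm{ins}(a)+\mathrm{rep}(a,b)$ hold for all letters $a,b,c$ (in particular if the costs come from a metric on $\Sigma\cup\{\varepsilon\}$), then the output is the minimum total cost of a finite sequence of deletions, insertions and replacements of single letters, at any positions, that transforms $A$ into $B$. -/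

import Mathlib

/-! ### Straight-line programs

The variables are numbered `0, 1, …, size - 1`; the last one derives the string. -/

/-- The right-hand side of the production of the `i`-th variable: a terminal `a`, or a product
`X_p X_q` with `p, q < i`. -/
inductive SLPRule (α : Type) (i : ℕ) : Type
  | term (a : α) : SLPRule α i
  | pair (p q : Fin i) : SLPRule α i

/-- A straight-line program over `α`: exactly one production for each of its `size` variables. -/
structure SLP (α : Type) where
  size : ℕ
  size_pos : 0 < size
  rule : (i : Fin size) → SLPRule α i

namespace SLP

/-- The string derived from the `i`-th variable. -/
def derive {α : Type} (S : SLP α) (i : ℕ) (hi : i < S.size) : List α :=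
  match S.rule ⟨i, hi⟩ with
  | .term a => [a]
  | .pair p q =>
      S.derive p.1 (lt_trans p.2 hi) ++ S.derive q.1 (lt_trans q.2 hi)
termination_by i
decreasing_by
  · exact p.2
  · exact q.2

/-- The string represented by the program: the one derived from its last variable. -/
def word {α : Type} (S : SLP α) : List α :=
  S.derive (S.size - 1) (Nat.sub_lt S.size_pos Nat.one_pos)

end SLP

/-! ### Edit distance -/

/-- A scoring function: arbitrary real costs for the deletion of each letter, the insertion of each
letter, and the replacement of each letter by each letter. -/
structure Scoring (α : Type) where
  delete : α → ℝ
  insert : α → ℝ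
  replace : α → α → ℝ

namespace Scoring

/-- The cost of deleting the letter at position `i` (counted from `0`) of `A`. -/
def deleteAt {α : Type} (C : Scoring α) (A : List α) (i : ℕ) : ℝ :=
  if h : i < A.length then C.delete A[i] else 0

/-- The cost of inserting the letter at position `j` (counted from `0`) of `B`. -/
def insertAt {α : Type} (C : Scoring α) (B : List α) (j : ℕ) : ℝ :=
  if h : j < B.length then C.insert B[j] else 0

/-- The cost of replacing the letter at position `i` of `A` by the one at position `j` of `B`. -/
def replaceAt {α : Type} (C : Scoring α) (A B : List α) (i j : ℕ) : ℝ :=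
  if h : i < A.length ∧ j < B.length then C.replace (A[i]'h.1) (B[j]'h.2) else 0

/-- The table of the standard dynamic program, for `i ≤ A.length` and `j ≤ B.length`: the entry
`(i, j)` belongs to the prefix of length `i` of `A` and the prefix of length `j` of `B`. -/
noncomputable def table {α : Type} (C : Scoring α) (A B : List α) : ℕ → ℕ → ℝ
  | 0, 0 => 0
  | i + 1, 0 => C.table A B i 0 + C.deleteAt A i
  | 0, j + 1 => C.table A B 0 j + C.insertAt B j
  | i + 1, j + 1 =>
      min (C.table A B i (j + 1) + C.deleteAt A i)
        (min (C.table A B (i + 1) j + C.insertAt B j)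
          (C.table A B i j + C.replaceAt A B i j))

/-- The edit distance as computed by the standard dynamic program, that is, the weight of a lightest
path through the dynamic programming grid. -/
noncomputable def editDistance {α : Type} (C : Scoring α) (A B : List α) : ℝ :=
  C.table A B A.length B.length

end Scoring

/-! Edit distance as the minimum cost of a transformation. -/

/-- One elementary operation anywhere in the string `A` turns it into `B`, at the given cost. -/
inductive EditStep {α : Type} (C : Scoring α) : List α → List α → ℝ → Prop
  | delete (u v : List α) (a : α) : EditStep C (u ++ a :: v) (u ++ v) (C.delete a)
  | insert (u v : List α) (b : α) : EditStep C (u ++ v) (u ++ b :: v) (C.insert b)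
  | replace (u v : List α) (a b : α) :
      EditStep C (u ++ a :: v) (u ++ b :: v) (C.replace a b)

/-- A finite sequence of elementary operations turns `A` into `B`, at the given total cost. -/
inductive Transforms {α : Type} (C : Scoring α) : List α → List α → ℝ → Prop
  | refl (A : List α) : Transforms C A A 0
  | step {A B D : List α} {c d : ℝ} :
      Transforms C A B c → EditStep C B D d → Transforms C A D (c + d)

/-- The costs, read as distances on the alphabet enlarged by the empty word, are nonnegative, vanish
for the replacement of a letter by itself, and satisfy the triangle inequality along replacements.
Every metric on the enlarged alphabet has these properties; symmetry and definiteness are not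
required. -/
structure IsMetricScoring {α : Type} (C : Scoring α) : Prop where
  delete_nonneg : ∀ a, 0 ≤ C.delete a
  insert_nonneg : ∀ a, 0 ≤ C.insert a
  replace_nonneg : ∀ a b, 0 ≤ C.replace a b
  replace_self : ∀ a, C.replace a a = 0
  replace_triangle : ∀ a b c, C.replace a c ≤ C.replace a b + C.replace b c
  delete_triangle : ∀ a b, C.delete a ≤ C.replace a b + C.delete b
  insert_triangle : ∀ a b, C.insert b ≤ C.insert a + C.replace a b

/-! ### The machine model

A random access machine with natural-number words below a bound `W` (words of `log₂ W` bits) and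
with real numbers, which can only be copied, added, subtracted and compared. Both kinds of data live
in variables (registers), of which a program uses finitely many, and in a random access memory
addressed by words. Programs are structured, and the evaluation of each constant, variable, memory
cell, operation or test, and each assignment, costs one unit of time. -/

namespace RAM

/-- The contents of the variables and of the memory, for words and for reals. -/
structure State where
  nvar : ℕ → ℕ
  nmem : ℕ → ℕ
  rvar : ℕ → ℝ
  rmem : ℕ → ℝ

/-- Arithmetic operations on words. -/
inductive Op : Type
  | add
  | sub
  | mul
  | div

/-- Subtraction is truncated at `0`, division is rounded down, and a quotient by `0` is `0`. -/
def Op.eval : Op → ℕ → ℕ → ℕ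
  | .add, a, b => a + b
  | .sub, a, b => a - b
  | .mul, a, b => a * b
  | .div, a, b => a / b

/-- Word expressions; `load e` is the content of the word memory at the address `e`. -/
inductive NExp : Type
  | lit (k : ℕ)
  | var (x : ℕ)
  | load (e : NExp)
  | op (o : Op) (e f : NExp)

namespace NExp

def eval (s : State) : NExp → ℕ
  | lit k => k
  | var x => s.nvar x
  | load e => s.nmem (e.eval s)
  | op o e f => o.eval (e.eval s) (f.eval s)

def cost : NExp → ℕ
  | lit _ => 1
  | var _ => 1
  | load e => e.cost + 1
  | op _ e f => e.cost + f.cost + 1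

/-- The value of the expression and all intermediate values are words: no overflow occurs. -/
def Fits (W : ℕ) (s : State) : NExp → Prop
  | lit k => k < W
  | var x => s.nvar x < W
  | load e => e.Fits W s ∧ s.nmem (e.eval s) < W
  | op o e f => e.Fits W s ∧ f.Fits W s ∧ o.eval (e.eval s) (f.eval s) < W

end NExp

/-- Real expressions; `load e` is the content of the real memory at the address `e`. -/
inductive RExp : Type
  | zero
  | var (x : ℕ)
  | load (e : NExp)
  | add (e f : RExp)
  | sub (e f : RExp)

namespace RExp

noncomputable def eval (s : State) : RExp → ℝ
  | zero => 0
  | var x => s.rvar x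
  | load e => s.rmem (e.eval s)
  | add e f => e.eval s + f.eval s
  | sub e f => e.eval s - f.eval s

def cost : RExp → ℕ
  | zero => 1
  | var _ => 1
  | load e => e.cost + 1
  | add e f => e.cost + f.cost + 1
  | sub e f => e.cost + f.cost + 1

/-- All addresses computed on the way are words. -/
def Fits (W : ℕ) (s : State) : RExp → Prop
  | zero => True
  | var _ => True
  | load e => e.Fits W s
  | add e f => e.Fits W s ∧ f.Fits W s
  | sub e f => e.Fits W s ∧ f.Fits W s

end RExp

/-- Tests: comparisons of words, comparisons of reals, and Boolean combinations. -/
inductive Test : Type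
  | nlt (e f : NExp)
  | neq (e f : NExp)
  | rle (e f : RExp)
  | neg (b : Test)
  | conj (b c : Test)

namespace Test

/-- The test succeeds; `neq` tests the equality of two words. -/
def Holds (s : State) : Test → Prop
  | nlt e f => e.eval s < f.eval s
  | neq e f => e.eval s = f.eval s
  | rle e f => e.eval s ≤ f.eval s
  | neg b => ¬ b.Holds s
  | conj b c => b.Holds s ∧ c.Holds s

def cost : Test → ℕ
  | nlt e f => e.cost + f.cost + 1
  | neq e f => e.cost + f.cost + 1
  | rle e f => e.cost + f.cost + 1
  | neg b => b.cost + 1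
  | conj b c => b.cost + c.cost + 1

/-- All words computed on the way are below the bound; both parts of a conjunction are
evaluated. -/
def Fits (W : ℕ) (s : State) : Test → Prop
  | nlt e f => e.Fits W s ∧ f.Fits W s
  | neq e f => e.Fits W s ∧ f.Fits W s
  | rle e f => e.Fits W s ∧ f.Fits W s
  | neg b => b.Fits W s
  | conj b c => b.Fits W s ∧ c.Fits W s

end Test

/-- Programs. -/
inductive Prog : Type
  | skip
  | nset (x : ℕ) (e : NExp)
  | rset (x : ℕ) (e : RExp)
  | nstore (a e : NExp)
  | rstore (a : NExp) (e : RExp)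
  | seq (p q : Prog)
  | ite (b : Test) (p q : Prog)
  | loop (b : Test) (p : Prog)

/-- `Exec W p s t s'`: on a machine with words below `W`, the program `p` started in the state `s`
halts in the state `s'` after time exactly `t`, without any overflow. `loop b p` repeats `p` as long
as the test `b` succeeds. -/
inductive Exec (W : ℕ) : Prog → State → ℕ → State → Prop
  | skip (s : State) : Exec W .skip s 1 s
  | nset (s : State) (x : ℕ) (e : NExp) (he : e.Fits W s) :
      Exec W (.nset x e) s (e.cost + 1)
        { s with nvar := Function.update s.nvar x (e.eval s) }
  | rset (s : State) (x : ℕ) (e : RExp) (he : e.Fits W s) :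
      Exec W (.rset x e) s (e.cost + 1)
        { s with rvar := Function.update s.rvar x (e.eval s) }
  | nstore (s : State) (a e : NExp) (ha : a.Fits W s) (he : e.Fits W s) :
      Exec W (.nstore a e) s (a.cost + e.cost + 1)
        { s with nmem := Function.update s.nmem (a.eval s) (e.eval s) }
  | rstore (s : State) (a : NExp) (e : RExp) (ha : a.Fits W s) (he : e.Fits W s) :
      Exec W (.rstore a e) s (a.cost + e.cost + 1)
        { s with rmem := Function.update s.rmem (a.eval s) (e.eval s) }
  | seq {p q : Prog} {s₀ s₁ s₂ : State} {t₁ t₂ : ℕ} :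
      Exec W p s₀ t₁ s₁ → Exec W q s₁ t₂ s₂ → Exec W (.seq p q) s₀ (t₁ + t₂) s₂
  | ite_true {b : Test} {p q : Prog} {s s' : State} {t : ℕ} :
      b.Fits W s → b.Holds s → Exec W p s t s' → Exec W (.ite b p q) s (b.cost + t) s'
  | ite_false {b : Test} {p q : Prog} {s s' : State} {t : ℕ} :
      b.Fits W s → ¬ b.Holds s → Exec W q s t s' → Exec W (.ite b p q) s (b.cost + t) s'
  | loop_true {b : Test} {p : Prog} {s₀ s₁ s₂ : State} {t₁ t₂ : ℕ} :
      b.Fits W s₀ → b.Holds s₀ → Exec W p s₀ t₁ s₁ → Exec W (.loop b p) s₁ t₂ s₂ →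
        Exec W (.loop b p) s₀ (b.cost + t₁ + t₂) s₂
  | loop_false {b : Test} {p : Prog} {s : State} :
      b.Fits W s → ¬ b.Holds s → Exec W (.loop b p) s b.cost s

end RAM

/-! ### The input -/

/-- The three words that encode a production: `0, a, 0` for a terminal `a`, and `1, p, q` for a
product of the variables `p` and `q`. -/
def SLPRule.code {σ i : ℕ} : SLPRule (Fin σ) i → ℕ → ℕ
  | .term a, j => if j = 1 then a.1 else 0
  | .pair p q, j => if j = 0 then 1 else if j = 1 then p.1 else q.1

/-- A straight-line program as an array of words: the production of the variable `i` occupies the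
cells `3 * i`, `3 * i + 1` and `3 * i + 2`. -/
def SLP.code {σ : ℕ} (S : SLP (Fin σ)) (m : ℕ) : ℕ :=
  if h : m / 3 < S.size then (S.rule ⟨m / 3, h⟩).code (m % 3) else 0

/-- A scoring function as an array of reals: the cost of replacing `a` by `b` is in the cell
`a * σ + b`, that of deleting `a` in `σ * σ + a`, and that of inserting `a` in `σ * σ + σ + a`. -/
noncomputable def costTable {σ : ℕ} (C : Scoring (Fin σ)) (m : ℕ) : ℝ :=
  if h : m < σ * σ then
    C.replace ⟨m / σ, Nat.div_lt_of_lt_mul h⟩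
      ⟨m % σ, Nat.mod_lt m (Nat.pos_of_ne_zero fun h0 => by simp [h0] at h)⟩
  else if h : m - σ * σ < σ then C.delete ⟨m - σ * σ, h⟩
  else if h : m - (σ * σ + σ) < σ then C.insert ⟨m - (σ * σ + σ), h⟩
  else 0

/-- The machine at the start: the sizes of the two straight-line programs and of the alphabet are in
the word variables `0`, `1`, `2`, the two programs are in the word memory, one after the other, the
costs are in the real memory, and everything else is `0`. -/
noncomputable def initialState {σ : ℕ} (C : Scoring (Fin σ))
    (S T : SLP (Fin σ)) : RAM.State where
  nvar x := if x = 0 then S.size else if x = 1 then T.size else if x = 2 then σ else 0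
  nmem m := if m < 3 * S.size then S.code m else T.code (m - 3 * S.size)
  rvar _ := 0
  rmem := costTable C

/-! The dynamic program computes the weight of a lightest path between opposite corners of an
acyclic grid, so costs of either sign are harmless (`Scoring.grid_dist_zero`). Cut the grid into
blocks. Of a block with p rows and q columns only the distances from its left and upper side to its
lower and right side matter. By the exchange argument for crossing paths they form a Monge matrix
(`GridCosts.dist_monge`). Once they are tabulated, a vector of distances is pushed from the inputs
of the block to its outputs by a (min,+) product with a totally monotone matrix. The SMAWK algorithm
does this in time O(p+q) instead of O(pq) (`RAM.minimaProg_run`, `RAM.applyProg_run`).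

Compression makes the tables affordable. The derivation tree of each program is cut bottom-up into
blocks of at most x letters: at a node, the last block of the left part and the first block of the
right part are merged if the result is short enough. Neighbouring blocks then have total size more
than x, so there are O(N/x) of them (`SLPTree.length_blocks_mul_le`). A block is determined by the
variable at the node where it was created (`SLPTree.Coherent.block`), so at most n different blocks
and subblocks occur. The table of a pair of blocks is built from the tables of two smaller pairs.
Each of its O(x) rows is a unit vector pushed across two adjacent blocks, which costs O(x) per row
(`RAM.unionProg_run`). All tables together cost O(n²x²). Afterwards one vector, starting at the
upper left corner, is pushed across all O((N/x)²) pairs of blocks at cost O(x) each, that is O(N²/x)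
in total (`RAM.sweepProg_run`). The partition itself costs O(N + N²/x). With x close to (N/n)^(2/3)
both main terms are n^(2/3)N^(4/3). When this value is below 1, x = 1 is used and the number of
pairs is bounded by N² instead (`RAM.sq_mul_pairBound_le`).

One indexing convention makes the vector work in place: entries are numbered by the diagonal (column
minus row) on which a vertex lies. Input and output of a block with the same number lie on the same
diagonal, so a push overwrites a window of consecutive entries and leaves the others alone. The
vector is finite on an interval of indices only, which is maintained explicitly because the machine
has no infinite reals.

On the side of the machine, loop-free pieces are handled by weakest preconditions, loops by time
credits, and everything that a piece of program does not touch by a syntactic check of its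
assignments (`RAM.Exec.frame`).

For the last claim, a table entry is the least cost of an alignment of two prefixes, for any costs.
The metric hypotheses allow each elementary operation that follows an alignment to be absorbed into
it without increasing the cost (`Aligns.step`). -/

set_option linter.unusedSimpArgs false

/-! ### Reasoning about programs -/

namespace RAM

namespace State

/-- Assignment of a word variable. -/
def setN (s : State) (x v : ℕ) : State := { s with nvar := Function.update s.nvar x v }

/-- Assignment of a real variable. -/
def setR (s : State) (x : ℕ) (v : ℝ) : State := { s with rvar := Function.update s.rvar x v }

/-- Assignment of a cell of the word memory. -/
def stN (s : State) (a v : ℕ) : State := { s with nmem := Function.update s.nmem a v }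

/-- Assignment of a cell of the real memory. -/
def stR (s : State) (a : ℕ) (v : ℝ) : State := { s with rmem := Function.update s.rmem a v }

/-- The word memory above the address in variable `3` is used as 64 interleaved arrays. -/
def A (s : State) (f j : ℕ) : ℕ := s.nmem (s.nvar 3 + 64 * j + f)

/-- The real memory above the address in variable `4` is used as 4 interleaved arrays. -/
def B (s : State) (f j : ℕ) : ℝ := s.rmem (s.nvar 4 + 4 * j + f)

/-- Assignment of an entry of a word array. -/
def stA (s : State) (f j v : ℕ) : State := s.stN (s.nvar 3 + 64 * j + f) v

/-- Assignment of an entry of a real array. -/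
def stB (s : State) (f j : ℕ) (v : ℝ) : State := s.stR (s.nvar 4 + 4 * j + f) v

variable (s : State) (x v a f j : ℕ) (r : ℝ)

@[simp] theorem setN_nvar (y : ℕ) :
    (s.setN x v).nvar y = if y = x then v else s.nvar y := by
  simp [setN, Function.update_apply]
@[simp] theorem setN_nmem : (s.setN x v).nmem = s.nmem := rfl
@[simp] theorem setN_rmem : (s.setN x v).rmem = s.rmem := rfl
@[simp] theorem stA_nvar : (s.stA f j v).nvar = s.nvar := rfl
@[simp] theorem stA_rmem : (s.stA f j v).rmem = s.rmem := rfl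
@[simp] theorem stB_nvar : (s.stB f j r).nvar = s.nvar := rfl
@[simp] theorem stB_nmem : (s.stB f j r).nmem = s.nmem := rfl
@[simp] theorem setR_rvar (y : ℕ) :
    (s.setR x r).rvar y = if y = x then r else s.rvar y := by
  simp [setR, Function.update_apply]

@[simp] theorem setN_A (h : x ≠ 3) (g k : ℕ) : (s.setN x v).A g k = s.A g k := by
  simp [A, Ne.symm h]
@[simp] theorem setN_B (h : x ≠ 4) (g k : ℕ) : (s.setN x v).B g k = s.B g k := by
  simp [B, Ne.symm h]
@[simp] theorem stA_B (g k : ℕ) : (s.stA f j v).B g k = s.B g k := rfl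
@[simp] theorem stB_A (g k : ℕ) : (s.stB f j r).A g k = s.A g k := rfl

-- Array `f` occupies the residue class of `f` modulo 64 above the base address, so different arrays
-- never share a cell.
@[simp] theorem stA_A (g k : ℕ) (hf : f < 64) (hg : g < 64) :
    (s.stA f j v).A g k = if g = f ∧ k = j then v else s.A g k := by
  have : s.nvar 3 + 64 * k + g = s.nvar 3 + 64 * j + f ↔ g = f ∧ k = j := by omega
  simp [A, stA, stN, Function.update_apply, this]

@[simp] theorem stB_B (g k : ℕ) (hf : f < 4) (hg : g < 4) :
    (s.stB f j r).B g k = if g = f ∧ k = j then r else s.B g k := by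
  have : s.nvar 4 + 4 * k + g = s.nvar 4 + 4 * j + f ↔ g = f ∧ k = j := by omega
  simp [B, stB, stR, Function.update_apply, this]

theorem stA_nmem_low (m : ℕ) (hm : m < s.nvar 3) : (s.stA f j v).nmem m = s.nmem m := by
  have : m ≠ s.nvar 3 + 64 * j + f := by omega
  simp [stA, stN, this]

theorem stB_rmem_low (m : ℕ) (hm : m < s.nvar 4) : (s.stB f j r).rmem m = s.rmem m := by
  have : m ≠ s.nvar 4 + 4 * j + f := by omega
  simp [stB, stR, this]

end State

instance : Add NExp := ⟨.op .add⟩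
instance : Sub NExp := ⟨.op .sub⟩
instance : Mul NExp := ⟨.op .mul⟩
instance : Div NExp := ⟨.op .div⟩
instance : Add RExp := ⟨.add⟩

namespace NExp

/-- The address of the entry `e` of the word array `f`. -/
def adr (f : ℕ) (e : NExp) : NExp :=
  .op .add (.op .add (.var 3) (.op .mul (.lit 64) e)) (.lit f)

/-- The entry `e` of the word array `f`. -/
def ld (f : ℕ) (e : NExp) : NExp := .load (adr f e)

/-- The address of the entry `e` of the real array `f`. -/
def radr (f : ℕ) (e : NExp) : NExp :=
  .op .add (.op .add (.var 4) (.op .mul (.lit 4) e)) (.lit f)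

variable (W : ℕ) (s : State) (e e' : NExp) (f k x : ℕ)

@[simp] theorem eval_add : (e + e').eval s = e.eval s + e'.eval s := rfl
@[simp] theorem eval_sub : (e - e').eval s = e.eval s - e'.eval s := rfl
@[simp] theorem eval_mul : (e * e').eval s = e.eval s * e'.eval s := rfl
@[simp] theorem eval_div : (e / e').eval s = e.eval s / e'.eval s := rfl
@[simp] theorem eval_lit : (NExp.lit k).eval s = k := rfl
@[simp] theorem eval_var : (NExp.var x).eval s = s.nvar x := rfl
@[simp] theorem eval_load : (NExp.load e).eval s = s.nmem (e.eval s) := rfl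
@[simp] theorem eval_ld : (ld f e).eval s = s.A f (e.eval s) := rfl
@[simp] theorem fits_add :
    (e + e').Fits W s ↔ e.Fits W s ∧ e'.Fits W s ∧ e.eval s + e'.eval s < W := Iff.rfl
-- Truncated subtraction never exceeds its first argument, which is a word already; hence no third
-- condition.
@[simp] theorem fits_sub :
    (e - e').Fits W s ↔ e.Fits W s ∧ e'.Fits W s := by
  refine ⟨fun h => ⟨h.1, h.2.1⟩, fun h => ⟨h.1, h.2, ?_⟩⟩
  have : e.eval s < W := by
    cases e with
    | lit k => exact h.1
    | var x => exact h.1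
    | load e => exact h.1.2
    | op o e f => exact h.1.2.2
  exact lt_of_le_of_lt (Nat.sub_le _ _) this
@[simp] theorem fits_mul :
    (e * e').Fits W s ↔ e.Fits W s ∧ e'.Fits W s ∧ e.eval s * e'.eval s < W := Iff.rfl
@[simp] theorem fits_div :
    (e / e').Fits W s ↔ e.Fits W s ∧ e'.Fits W s ∧ e.eval s / e'.eval s < W := Iff.rfl
@[simp] theorem fits_lit : (NExp.lit k).Fits W s ↔ k < W := Iff.rfl
@[simp] theorem fits_var : (NExp.var x).Fits W s ↔ s.nvar x < W := Iff.rfl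
@[simp] theorem fits_load : (NExp.load e).Fits W s ↔ e.Fits W s ∧ s.nmem (e.eval s) < W := Iff.rfl

-- The final address dominates all intermediate results, so a single inequality controls the whole
-- computation of the address.
@[simp] theorem fits_adr (hf : f < 64) : (adr f e).Fits W s ↔
    e.Fits W s ∧ 64 < W ∧ s.nvar 3 + 64 * e.eval s + f < W := by
  constructor
  · rintro ⟨⟨h1, ⟨h2, h3, h4⟩, h5⟩, h6, h7⟩
    exact ⟨h3, h2, h7⟩
  · rintro ⟨h1, h2, h3⟩
    refine ⟨⟨?_, ⟨h2, h1, ?_⟩, ?_⟩, ?_, h3⟩ <;>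
      simp only [Fits, NExp.eval, Op.eval] <;> omega

@[simp] theorem fits_ld (hf : f < 64) : (ld f e).Fits W s ↔
    (e.Fits W s ∧ 64 < W ∧ s.nvar 3 + 64 * e.eval s + f < W) ∧ s.A f (e.eval s) < W := by
  rw [← fits_adr W s e f hf]; rfl

@[simp] theorem fits_radr (hf : f < 4) : (radr f e).Fits W s ↔
    e.Fits W s ∧ 4 < W ∧ s.nvar 4 + 4 * e.eval s + f < W := by
  constructor
  · rintro ⟨⟨h1, ⟨h2, h3, h4⟩, h5⟩, h6, h7⟩
    exact ⟨h3, h2, h7⟩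
  · rintro ⟨h1, h2, h3⟩
    refine ⟨⟨?_, ⟨h2, h1, ?_⟩, ?_⟩, ?_, h3⟩ <;>
      simp only [Fits, NExp.eval, Op.eval] <;> omega

end NExp

namespace RExp

/-- The entry `e` of the real array `f`. -/
def ld (f : ℕ) (e : NExp) : RExp := .load (.radr f e)

variable (W : ℕ) (s : State) (e e' : RExp) (a : NExp) (f x : ℕ)

@[simp] theorem eval_add : (e + e').eval s = e.eval s + e'.eval s := rfl
@[simp] theorem eval_zero : RExp.zero.eval s = 0 := rfl
@[simp] theorem eval_load : (RExp.load a).eval s = s.rmem (a.eval s) := rfl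
@[simp] theorem eval_ld : (ld f a).eval s = s.B f (a.eval s) := rfl
@[simp] theorem fits_add : (e + e').Fits W s ↔ e.Fits W s ∧ e'.Fits W s := Iff.rfl
@[simp] theorem fits_zero : RExp.zero.Fits W s ↔ True := Iff.rfl
@[simp] theorem fits_load : (RExp.load a).Fits W s ↔ a.Fits W s := Iff.rfl
@[simp] theorem fits_ld (hf : f < 4) : (ld f a).Fits W s ↔
    a.Fits W s ∧ 4 < W ∧ s.nvar 4 + 4 * a.eval s + f < W :=
  NExp.fits_radr W s a f hf

end RExp

namespace Test

variable (W : ℕ) (s : State) (e e' : NExp) (r r' : RExp) (b b' : Test)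

@[simp] theorem holds_nlt : (nlt e e').Holds s ↔ e.eval s < e'.eval s := Iff.rfl
@[simp] theorem holds_neq : (neq e e').Holds s ↔ e.eval s = e'.eval s := Iff.rfl
@[simp] theorem holds_rle : (rle r r').Holds s ↔ r.eval s ≤ r'.eval s := Iff.rfl
@[simp] theorem holds_neg : (neg b).Holds s ↔ ¬ b.Holds s := Iff.rfl
@[simp] theorem holds_conj : (conj b b').Holds s ↔ b.Holds s ∧ b'.Holds s := Iff.rfl
@[simp] theorem fits_nlt : (nlt e e').Fits W s ↔ e.Fits W s ∧ e'.Fits W s := Iff.rfl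
@[simp] theorem fits_neq : (neq e e').Fits W s ↔ e.Fits W s ∧ e'.Fits W s := Iff.rfl
@[simp] theorem fits_rle : (rle r r').Fits W s ↔ r.Fits W s ∧ r'.Fits W s := Iff.rfl
@[simp] theorem fits_neg : (neg b).Fits W s ↔ b.Fits W s := Iff.rfl
@[simp] theorem fits_conj : (conj b b').Fits W s ↔ b.Fits W s ∧ b'.Fits W s := Iff.rfl

end Test

namespace Prog

/-- Assignment to an entry of a word array. -/
def sta (f : ℕ) (e v : NExp) : Prog := .nstore (.adr f e) v

/-- Assignment to an entry of a real array. -/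
def stb (f : ℕ) (e : NExp) (v : RExp) : Prog := .rstore (.radr f e) v

/-- The weakest precondition of a program without loops. -/
def wp (W : ℕ) : Prog → (State → Prop) → State → Prop
  | .skip, Q, s => Q s
  | .nset x e, Q, s => e.Fits W s ∧ Q (s.setN x (e.eval s))
  | .rset x e, Q, s => e.Fits W s ∧ Q (s.setR x (e.eval s))
  | .nstore a e, Q, s => a.Fits W s ∧ e.Fits W s ∧ Q (s.stN (a.eval s) (e.eval s))
  | .rstore a e, Q, s => a.Fits W s ∧ e.Fits W s ∧ Q (s.stR (a.eval s) (e.eval s))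
  | .seq p q, Q, s => wp W p (wp W q Q) s
  | .ite b p q, Q, s => b.Fits W s ∧ (b.Holds s → wp W p Q s) ∧ (¬ b.Holds s → wp W q Q s)
  | .loop _ _, _, _ => False

variable (W : ℕ) (Q : State → Prop) (s : State)

@[simp] theorem wp_skip : wp W .skip Q s ↔ Q s := Iff.rfl
@[simp] theorem wp_nset (x : ℕ) (e : NExp) :
    wp W (.nset x e) Q s ↔ e.Fits W s ∧ Q (s.setN x (e.eval s)) := Iff.rfl
@[simp] theorem wp_rset (x : ℕ) (e : RExp) :
    wp W (.rset x e) Q s ↔ e.Fits W s ∧ Q (s.setR x (e.eval s)) := Iff.rfl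
@[simp] theorem wp_sta (f : ℕ) (e v : NExp) (hf : f < 64) : wp W (.sta f e v) Q s ↔
    (e.Fits W s ∧ 64 < W ∧ s.nvar 3 + 64 * e.eval s + f < W) ∧ v.Fits W s ∧
      Q (s.stA f (e.eval s) (v.eval s)) := by
  rw [← NExp.fits_adr W s e f hf]; rfl
@[simp] theorem wp_stb (f : ℕ) (e : NExp) (v : RExp) (hf : f < 4) : wp W (.stb f e v) Q s ↔
    (e.Fits W s ∧ 4 < W ∧ s.nvar 4 + 4 * e.eval s + f < W) ∧ v.Fits W s ∧
      Q (s.stB f (e.eval s) (v.eval s)) := by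
  rw [← NExp.fits_radr W s e f hf]; rfl
@[simp] theorem wp_seq (p q : Prog) : wp W (.seq p q) Q s ↔ wp W p (wp W q Q) s := Iff.rfl
@[simp] theorem wp_ite (b : Test) (p q : Prog) : wp W (.ite b p q) Q s ↔
    b.Fits W s ∧ (b.Holds s → wp W p Q s) ∧ (¬ b.Holds s → wp W q Q s) := Iff.rfl

/-- A bound on the running time of a program without loops. -/
def maxCost : Prog → ℕ
  | .skip => 1
  | .nset _ e => e.cost + 1
  | .rset _ e => e.cost + 1
  | .nstore a e => a.cost + e.cost + 1
  | .rstore a e => a.cost + e.cost + 1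
  | .seq p q => p.maxCost + q.maxCost
  | .ite b p q => b.cost + max p.maxCost q.maxCost
  | .loop _ _ => 0

/-- All assignments are to word variables in `V`, to word arrays in `F` and to real arrays
in `R`. -/
def writes (V F R : List ℕ) : Prog → Bool
  | .skip => true
  | .nset x _ => decide (x ∈ V)
  | .rset _ _ => false
  | .nstore (.op .add (.op .add (.var 3) (.op .mul (.lit 64) _)) (.lit f)) _ =>
      decide (f ∈ F) && decide (f < 64)
  | .nstore _ _ => false
  | .rstore (.op .add (.op .add (.var 4) (.op .mul (.lit 4) _)) (.lit f)) _ =>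
      decide (f ∈ R) && decide (f < 4)
  | .rstore _ _ => false
  | .seq p q => p.writes V F R && q.writes V F R
  | .ite _ p q => p.writes V F R && q.writes V F R
  | .loop _ p => p.writes V F R

end Prog

/-- The states `s` and `s'` agree except for the word variables in `V`, the word arrays in `F`, the
real arrays in `R` and the real variables. -/
structure Frame (V F R : List ℕ) (s s' : State) : Prop where
  nvar : ∀ x, x ∉ V → s'.nvar x = s.nvar x
  A : ∀ f, f ∉ F → f < 64 → ∀ j, s'.A f j = s.A f j
  B : ∀ f, f ∉ R → f < 4 → ∀ j, s'.B f j = s.B f j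
  low : ∀ m, m < s.nvar 3 → s'.nmem m = s.nmem m
  rlow : ∀ m, m < s.nvar 4 → s'.rmem m = s.rmem m

theorem Frame.refl (V F R : List ℕ) (s : State) : Frame V F R s s := by
  constructor <;> intros <;> rfl

theorem Frame.trans {V F R : List ℕ} {s₀ s₁ s₂ : State} (h3 : 3 ∉ V) (h4 : 4 ∉ V)
    (h : Frame V F R s₀ s₁) (h' : Frame V F R s₁ s₂) : Frame V F R s₀ s₂ where
  nvar x hx := by rw [h'.nvar x hx, h.nvar x hx]
  A f hf hf' j := by rw [h'.A f hf hf', h.A f hf hf']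
  B f hf hf' j := by rw [h'.B f hf hf', h.B f hf hf']
  low m hm := by rw [h'.low m (by rw [h.nvar 3 h3]; exact hm), h.low m hm]
  rlow m hm := by rw [h'.rlow m (by rw [h.nvar 4 h4]; exact hm), h.rlow m hm]

theorem Frame.mono {V F R V' F' R' : List ℕ} {s s' : State} (h : Frame V F R s s')
    (hV : V ⊆ V') (hF : F ⊆ F') (hR : R ⊆ R') : Frame V' F' R' s s' where
  nvar x hx := h.nvar x fun h => hx (hV h)
  A f hf := h.A f fun h => hf (hF h)
  B f hf := h.B f fun h => hf (hR h)
  low := h.low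
  rlow := h.rlow

/-- Since the variables `3` and `4` keep their values, the bases of the arrays do not move, and a
store into one array affects neither the other arrays nor the input below the base. The hypothesis
on `writes` is decidable, so for a concrete program the whole frame is obtained by evaluation. -/
theorem Exec.frame {W : ℕ} {V F R : List ℕ} (h3 : 3 ∉ V) (h4 : 4 ∉ V) {p : Prog} {s s' : State}
    {t : ℕ} (h : Exec W p s t s') (hp : p.writes V F R = true) : Frame V F R s s' := by
  induction h with
  | skip s => exact Frame.refl ..
  | nset s x e he =>
    simp only [Prog.writes, decide_eq_true_eq] at hp
    have hx3 : x ≠ 3 := fun h => h3 (h ▸ hp)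
    have hx4 : x ≠ 4 := fun h => h4 (h ▸ hp)
    refine ⟨fun y hy => ?_, fun f _ _ j => State.setN_A s x _ hx3 f j,
      fun f _ _ j => State.setN_B s x _ hx4 f j, fun _ _ => rfl, fun _ _ => rfl⟩
    have : y ≠ x := fun h => hy (h ▸ hp)
    simp [this]
  | rset s x e he => simp [Prog.writes] at hp
  | nstore s a e ha he =>
    unfold Prog.writes at hp
    split at hp <;> simp_all
    rename_i f _ heq
    obtain ⟨rfl, rfl⟩ := heq
    refine ⟨fun _ _ => rfl, fun g hg hg' j => ?_, fun _ _ _ _ => rfl, fun m hm => ?_,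
      fun _ _ => rfl⟩
    · exact (State.stA_A s _ _ _ g j hp.2 hg').trans
        (if_neg (by rintro ⟨rfl, -⟩; exact hg hp.1))
    · exact State.stA_nmem_low s _ _ _ m hm
  | rstore s a e ha he =>
    unfold Prog.writes at hp
    split at hp <;> simp_all
    rename_i f _ heq
    obtain ⟨rfl, rfl⟩ := heq
    refine ⟨fun _ _ => rfl, fun _ _ _ _ => rfl, fun g hg hg' j => ?_, fun _ _ => rfl,
      fun m hm => ?_⟩
    · exact (State.stB_B s _ _ _ g j hp.2 hg').trans
        (if_neg (by rintro ⟨rfl, -⟩; exact hg hp.1))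
    · exact State.stB_rmem_low s _ _ _ m hm
  | seq _ _ ih₁ ih₂ =>
    simp only [Prog.writes, Bool.and_eq_true] at hp
    exact (ih₁ hp.1).trans h3 h4 (ih₂ hp.2)
  | ite_true _ _ _ ih =>
    simp only [Prog.writes, Bool.and_eq_true] at hp
    exact ih hp.1
  | ite_false _ _ _ ih =>
    simp only [Prog.writes, Bool.and_eq_true] at hp
    exact ih hp.2
  | loop_true _ _ _ _ ih₁ ih₂ => exact (ih₁ hp).trans h3 h4 (ih₂ hp)
  | loop_false => exact Frame.refl ..

/-- The program `p` started in `s` halts within time `τ` in a state with the property `Q`. -/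
def Run (W : ℕ) (p : Prog) (s : State) (τ : ℕ) (Q : State → Prop) : Prop :=
  ∃ t s', Exec W p s t s' ∧ t ≤ τ ∧ Q s'

namespace Run

variable {W : ℕ} {p q : Prog} {s : State} {τ τ' c : ℕ} {Q Q' : State → Prop} {b : Test}

theorem mono (h : Run W p s τ Q) (hτ : τ ≤ τ') (hQ : ∀ s', Q s' → Q' s') : Run W p s τ' Q' := by
  obtain ⟨t, s', h1, h2, h3⟩ := h
  exact ⟨t, s', h1, h2.trans hτ, hQ _ h3⟩

theorem frame (h : Run W p s τ Q) (V F R : List ℕ) (hp : p.writes V F R = true) (h3 : 3 ∉ V)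
    (h4 : 4 ∉ V) : Run W p s τ (fun s' => Q s' ∧ Frame V F R s s') := by
  obtain ⟨t, s', h1, h2, hQ⟩ := h
  exact ⟨t, s', h1, h2, hQ, h1.frame h3 h4 hp⟩

theorem seq (h : Run W p s τ (fun s' => Run W q s' τ' Q)) : Run W (.seq p q) s (τ + τ') Q := by
  obtain ⟨t, s', h1, h2, t', s'', h3, h4, h5⟩ := h
  exact ⟨_, s'', .seq h1 h3, by omega, h5⟩

theorem ite (hb : b.Fits W s) (h : b.Holds s → Run W p s τ Q) (h' : ¬ b.Holds s → Run W q s τ Q) :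
    Run W (.ite b p q) s (b.cost + τ) Q := by
  by_cases hs : b.Holds s
  · obtain ⟨t, s', h1, h2, h3⟩ := h hs
    exact ⟨_, s', .ite_true hb hs h1, by omega, h3⟩
  · obtain ⟨t, s', h1, h2, h3⟩ := h' hs
    exact ⟨_, s', .ite_false hb hs h1, by omega, h3⟩

theorem of_wp (h : p.wp W Q s) : Run W p s p.maxCost Q := by
  induction p generalizing s Q with
  | skip => exact ⟨_, _, .skip s, le_rfl, h⟩
  | nset x e => exact ⟨_, _, .nset s x e h.1, le_rfl, h.2⟩
  | rset x e => exact ⟨_, _, .rset s x e h.1, le_rfl, h.2⟩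
  | nstore a e => exact ⟨_, _, .nstore s a e h.1 h.2.1, le_rfl, h.2.2⟩
  | rstore a e => exact ⟨_, _, .rstore s a e h.1 h.2.1, le_rfl, h.2.2⟩
  | seq p q ihp ihq => exact seq ((ihp h).mono le_rfl fun _ => ihq)
  | ite b p q ihp ihq =>
    exact ite h.1 (fun hb => (ihp (h.2.1 hb)).mono (le_max_left _ _) fun _ => id)
      fun hb => (ihq (h.2.2 hb)).mono (le_max_right _ _) fun _ => id
  | loop => exact h.elim

theorem of_wp_le (h : p.wp W Q s) (hτ : p.maxCost ≤ τ) : Run W p s τ Q :=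
  (of_wp h).mono hτ fun _ => id

/-- The loop rule with time credits: `Inv s k` says that the invariant holds in the state `s` and
that the time `k` suffices for what remains to be done. -/
theorem loop_credit (Inv : State → ℕ → Prop)
    (h : ∀ s k, Inv s k → b.Fits W s ∧ (b.Holds s → ∃ τ, Run W p s τ
      (fun s' => ∃ k', k' + τ + b.cost ≤ k ∧ Inv s' k')) ∧ (¬ b.Holds s → Q s)) :
    ∀ k s, Inv s k → Run W (.loop b p) s (k + b.cost) Q := by
  -- Evaluating the test costs at least one unit, so the credit drops strictly in each round and
  -- bounds the number of rounds.
  have hc : 0 < b.cost := by cases b <;> simp [Test.cost]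
  intro k
  induction k using Nat.strong_induction_on with
  | _ k ih =>
    intro s hs
    obtain ⟨hf, ht, hn⟩ := h s k hs
    by_cases hb : b.Holds s
    · obtain ⟨τ, t, s', h1, h2, k', h3, h4⟩ := ht hb
      obtain ⟨t', s'', h5, h6, h7⟩ := ih k' (by omega) s' h4
      exact ⟨_, s'', .loop_true hf hb h1 h5, by omega, h7⟩
    · exact ⟨_, s, .loop_false hf hb, by omega, hn hb⟩

/-- The loop rule for at most `k` iterations of time at most `c` each, with a frame. -/
theorem loop_count (V F R : List ℕ) (hp : p.writes V F R = true) (h3 : 3 ∉ V) (h4 : 4 ∉ V)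
    (c : ℕ) (Inv : State → ℕ → Prop) {s₀ : State} {k₀ : ℕ} (h₀ : Inv s₀ k₀)
    (h : ∀ s k, Frame V F R s₀ s → Inv s k → b.Fits W s ∧
      (b.Holds s → Run W p s c (fun s' => ∃ k' < k, Inv s' k')) ∧ (¬ b.Holds s → Q s)) :
    Run W (.loop b p) s₀ ((c + b.cost) * k₀ + b.cost) Q := by
  refine loop_credit (fun s k => ∃ i, Frame V F R s₀ s ∧ Inv s i ∧ (c + b.cost) * i ≤ k) ?_ _ _
    ⟨k₀, Frame.refl .., h₀, le_rfl⟩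
  rintro s k ⟨i, hfr, hi, hk⟩
  obtain ⟨hf, ht, hn⟩ := h s i hfr hi
  refine ⟨hf, fun hb => ⟨c, ((ht hb).frame V F R hp h3 h4).mono le_rfl ?_⟩, hn⟩
  rintro s' ⟨⟨k', hk', hI⟩, hfr'⟩
  refine ⟨(c + b.cost) * k', ?_, k', hfr.trans h3 h4 hfr', hI, le_rfl⟩
  have : (c + b.cost) * (k' + 1) ≤ (c + b.cost) * i := Nat.mul_le_mul_left _ hk'
  rw [Nat.mul_add, Nat.mul_one] at this
  omega

/-- The loop rule with time credits and a frame. -/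
theorem loop_frame (V F R : List ℕ) (hp : p.writes V F R = true) (h3 : 3 ∉ V) (h4 : 4 ∉ V)
    (Inv : State → ℕ → Prop) {s₀ : State} {k₀ : ℕ} (h₀ : Inv s₀ k₀)
    (h : ∀ s k, Frame V F R s₀ s → Inv s k → b.Fits W s ∧ (b.Holds s → ∃ τ, Run W p s τ
      (fun s' => ∃ k', k' + τ + b.cost ≤ k ∧ Inv s' k')) ∧ (¬ b.Holds s → Q s)) :
    Run W (.loop b p) s₀ (k₀ + b.cost) Q := by
  refine loop_credit (fun s k => Frame V F R s₀ s ∧ Inv s k) ?_ _ _ ⟨Frame.refl .., h₀⟩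
  rintro s k ⟨hfr, hI⟩
  obtain ⟨hf, ht, hn⟩ := h s k hfr hI
  refine ⟨hf, fun hb => ?_, hn⟩
  obtain ⟨τ, hr⟩ := ht hb
  refine ⟨τ, (hr.frame V F R hp h3 h4).mono le_rfl ?_⟩
  rintro s' ⟨⟨k', hk', hI'⟩, hfr'⟩
  exact ⟨k', hk', hfr.trans h3 h4 hfr', hI'⟩

end Run

end RAM

/-! ### Minima of totally monotone matrices -/

namespace RAM

prefix:max "↟" => NExp.var

prefix:max "♯" => NExp.lit

notation "xE" => (30 : ℕ)
notation "xP" => (31 : ℕ)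
notation "xQ" => (32 : ℕ)
notation "xD" => (33 : ℕ)
notation "xLo" => (34 : ℕ)
notation "xHi" => (35 : ℕ)
notation "xL" => (36 : ℕ)
notation "xA" => (37 : ℕ)
notation "xB" => (38 : ℕ)
notation "xS" => (39 : ℕ)
notation "xT" => (40 : ℕ)
notation "xSrc" => (41 : ℕ)
notation "xLen" => (42 : ℕ)
notation "xDst" => (43 : ℕ)
notation "xSz" => (44 : ℕ)
notation "xRow" => (45 : ℕ)
notation "xI" => (46 : ℕ)
notation "xC" => (47 : ℕ)
notation "xTop" => (48 : ℕ)
notation "xFl" => (49 : ℕ)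
notation "xPos" => (50 : ℕ)
notation "xJ" => (51 : ℕ)
notation "xBest" => (52 : ℕ)
notation "xEnd" => (53 : ℕ)
notation "xLx" => (24 : ℕ)
notation "aCol" => (10 : ℕ)
notation "aLen" => (11 : ℕ)
notation "aRes" => (12 : ℕ)
notation "bDist" => (0 : ℕ)
notation "bVec" => (1 : ℕ)
notation "bTmp" => (2 : ℕ)

notation:60 p:61 ";;" q:60 => Prog.seq p q

/-- The candidate value at the output `j` for the input `i`: the entry of the vector plus the entry
of the current distance table. -/
def candExp (i j : NExp) : RExp :=
  RExp.ld bVec (↟xE + i) + RExp.ld bDist (↟xD + i * ↟xLx + j)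

/-- The input `i'` is better than the input `i < i'` for the output `j`. -/
def beatsTest (i i' j : NExp) : Test :=
  .neg (.conj (.neg (.nlt (i + ↟xQ) j))
    (.neg (.conj (.neg (.nlt (j + ↟xP) i')) (.neg (.rle (candExp i j) (candExp i' j))))))

/-- The list under construction serves as a stack of `xSz` columns, and `xRow = xSz * xS` is the
first row without a column. One round pops the top, pushes the current column, or discards it. The
flag `xFl` guards against reading the top of an empty stack. The position `xI` advances only if
nothing is popped. -/
def reduceBody : Prog :=
  .nset xC (.ld aCol (↟xSrc + ↟xI)) ;; .nset xFl ♯0 ;;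
  .ite (.nlt ♯0 ↟xSz)
    (.nset xTop (.ld aCol (↟xDst + ↟xSz - ♯1)) ;;
      .ite (beatsTest ↟xTop ↟xC (↟xRow - ↟xS)) (.nset xFl ♯1) .skip)
    .skip ;;
  .ite (.neq ↟xFl ♯1)
    (.nset xSz (↟xSz - ♯1) ;; .nset xRow (↟xRow - ↟xS))
    (.ite (.nlt ↟xL ↟xRow) .skip
      (.sta aCol (↟xDst + ↟xSz) ↟xC ;; .nset xSz (↟xSz + ♯1) ;; .nset xRow (↟xRow + ↟xS)) ;;
      .nset xI (↟xI + ♯1))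

def reduceInit : Prog :=
  .nset xSrc (↟xT * (↟xL + ♯1)) ;; .nset xDst (↟xSrc + (↟xL + ♯1)) ;;
  .nset xLen (.ld aLen ↟xT) ;; .nset xSz ♯0 ;; .nset xRow ♯0 ;; .nset xI ♯0

/-- From the list of candidate columns at level `xT` select at most one for each of the rows
`0, xS, 2 * xS, …`, without losing the minima of these rows. -/
def reduceProg : Prog :=
  reduceInit ;; .loop (.nlt ↟xI ↟xLen) reduceBody ;; .sta aLen (↟xT + ♯1) ↟xSz

/-- The candidate value as read from the state. -/
noncomputable def State.cand (s : State) (i j : ℕ) : ℝ :=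
  s.B bVec (s.nvar xE + i) + s.B bDist (s.nvar xD + i * s.nvar xLx + j)

/-- The input `i'` is better than the input `i < i'` for the output `j`. -/
def State.Beats (s : State) (i i' j : ℕ) : Prop :=
  s.nvar xQ + i < j ∨ (i' ≤ j + s.nvar xP ∧ s.cand i' j < s.cand i j)

/-- The comparison of the inputs `i` and `i'` for the output `j` causes no overflow. -/
def State.BeatsFits (W : ℕ) (s : State) (i i' j : ℕ) : Prop :=
  64 < W ∧ i + s.nvar xQ < W ∧ j + s.nvar xP < W ∧ s.nvar 4 + 4 * (s.nvar xE + i) + 4 ≤ W ∧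
    s.nvar 4 + 4 * (s.nvar xE + i') + 4 ≤ W ∧ s.nvar xLx < W ∧
    s.nvar 4 + 4 * (s.nvar xD + i * s.nvar xLx + j) + 4 ≤ W ∧
    s.nvar 4 + 4 * (s.nvar xD + i' * s.nvar xLx + j) + 4 ≤ W

theorem State.cand_setN (s : State) (x v i j : ℕ) (hx : x ∉ [4, xE, xD, xLx]) :
    (s.setN x v).cand i j = s.cand i j := by
  simp only [List.mem_cons, List.not_mem_nil, or_false, not_or] at hx
  have h4 : (4 : ℕ) ≠ x := fun h => hx.1 h.symm
  have hE : xE ≠ x := fun h => hx.2.1 h.symm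
  have hD : xD ≠ x := fun h => hx.2.2.1 h.symm
  have hL : xLx ≠ x := fun h => hx.2.2.2 h.symm
  simp [State.cand, hE, hD, hL, hx.1]

@[simp] theorem State.beats_setN (s : State) (x v i i' j : ℕ)
    (hx : x ∉ [4, xE, xD, xLx, xP, xQ]) : (s.setN x v).Beats i i' j ↔ s.Beats i i' j := by
  simp only [List.mem_cons, List.not_mem_nil, or_false, not_or] at hx
  have hP : xP ≠ x := fun h => hx.2.2.2.2.1 h.symm
  have hQ : xQ ≠ x := fun h => hx.2.2.2.2.2 h.symm
  simp [State.Beats, hP, hQ, State.cand_setN, hx]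

@[simp] theorem State.beatsFits_setN (W : ℕ) (s : State) (x v i i' j : ℕ)
    (hx : x ∉ [4, xE, xD, xLx, xP, xQ]) :
    (s.setN x v).BeatsFits W i i' j ↔ s.BeatsFits W i i' j := by
  simp only [List.mem_cons, List.not_mem_nil, or_false, not_or] at hx
  have h4 : (4 : ℕ) ≠ x := fun h => hx.1 h.symm
  have hE : xE ≠ x := fun h => hx.2.1 h.symm
  have hD : xD ≠ x := fun h => hx.2.2.1 h.symm
  have hL : xLx ≠ x := fun h => hx.2.2.2.1 h.symm
  have hP : xP ≠ x := fun h => hx.2.2.2.2.1 h.symm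
  have hQ : xQ ≠ x := fun h => hx.2.2.2.2.2 h.symm
  simp [State.BeatsFits, hP, hQ, hE, hD, hL, h4]

@[simp] theorem holds_beatsTest (s : State) (i i' j : NExp) :
    (beatsTest i i' j).Holds s ↔ s.Beats (i.eval s) (i'.eval s) (j.eval s) := by
  simp only [beatsTest, candExp, State.cand, State.Beats, Test.holds_neg, Test.holds_conj,
    Test.holds_nlt, Test.holds_rle, NExp.eval_add, NExp.eval_mul, NExp.eval_var, RExp.eval_add,
    RExp.eval_ld, not_and_or, not_or, not_lt, not_le, add_comm (s.nvar xQ)]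

theorem fits_beatsTest {W : ℕ} {s : State} {i i' j : NExp}
    (hi : i.Fits W s) (hi' : i'.Fits W s) (hj : j.Fits W s)
    (h : s.BeatsFits W (i.eval s) (i'.eval s) (j.eval s)) : (beatsTest i i' j).Fits W s := by
  unfold State.BeatsFits at h
  simp [beatsTest, candExp, hi, hi', hj]
  omega

/-- The order in which the inputs compete for an output, in terms of a matrix of keys. -/
structure KeyContext {K : Type*} [LinearOrder K] (W Z : ℕ) (key : ℕ → ℕ → K) (s : State) :
    Prop where
  base : s.nvar 3 + 64 * Z ≤ W
  rbase : s.nvar 4 + 4 * Z ≤ W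
  large : 64 < W
  sumE : s.nvar xE + s.nvar xL < Z
  sumP : s.nvar xL + s.nvar xP < Z
  sumQ : s.nvar xL + s.nvar xQ < Z
  sumD : ∀ i j, i ≤ s.nvar xL → j ≤ s.nvar xL → s.nvar xD + i * s.nvar xLx + j < Z
  ltLx : s.nvar xLx < Z
  room : (s.nvar xL + 3) * (s.nvar xL + 1) < Z
  beats : ∀ i i' j, i < i' → i' ≤ s.nvar xL → j ≤ s.nvar xL →
    (s.Beats i i' j ↔ key j i' < key j i)

theorem KeyContext.frame {K : Type*} [LinearOrder K] {W Z : ℕ} {key : ℕ → ℕ → K} {s s' : State}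
    (h : KeyContext W Z key s) {V F R : List ℕ} (hf : Frame V F R s s')
    (hV : ∀ x ∈ [3, 4, xE, xP, xQ, xD, xL, xLx], x ∉ V) (hR : bDist ∉ R ∧ bVec ∉ R) : KeyContext W Z key s' := by
  have e3 := hf.nvar 3 (hV _ (by simp))
  have e4 := hf.nvar 4 (hV _ (by simp))
  have eE := hf.nvar xE (hV _ (by simp))
  have eP := hf.nvar xP (hV _ (by simp))
  have eQ := hf.nvar xQ (hV _ (by simp))
  have eD := hf.nvar xD (hV _ (by simp))
  have eL := hf.nvar xL (hV _ (by simp))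
  have ex := hf.nvar xLx (hV _ (by simp))
  have b0 := hf.B bDist hR.1 (by simp)
  have b1 := hf.B bVec hR.2 (by simp)
  obtain ⟨h1, h2, h3, h4, h5, h6, h7, h8, h9, h10⟩ := h
  simp only [State.Beats, State.cand] at h10
  constructor <;> try simp only [State.Beats, State.cand, e3, e4, eE, eP, eQ, eD, eL, ex, b0, b1]
  all_goals assumption

/-- `am` picks the leftmost minimum in `[a, b]` of each of the rows `0, …, l`. -/
structure IsLeftmostMin {K : Type*} [LinearOrder K] (key : ℕ → ℕ → K) (l a b : ℕ) (am : ℕ → ℕ) :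
    Prop where
  mem : ∀ j ≤ l, a ≤ am j ∧ am j ≤ b
  left : ∀ j ≤ l, ∀ c, a ≤ c → c < am j → key j (am j) < key j c
  min : ∀ j ≤ l, ∀ c, a ≤ c → c ≤ b → key j (am j) ≤ key j c

/-- Total monotonicity. -/
def TotallyMonotone {K : Type*} [LinearOrder K] (key : ℕ → ℕ → K) (l : ℕ) : Prop :=
  ∀ i i' j j', i < i' → i' ≤ l → j ≤ j' → j' ≤ l → key j i' < key j i → key j' i' < key j' i

/-- If the minimum moved left from row `j` to row `j'`, leftmostness in row `j` would make the right
column strictly better there, hence also in row `j'` by total monotonicity, against minimality. -/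
theorem IsLeftmostMin.mono {K : Type*} [LinearOrder K] {key : ℕ → ℕ → K} {l a b : ℕ} {am : ℕ → ℕ}
    (h : IsLeftmostMin key l a b am) (hb : b ≤ l) (ht : TotallyMonotone key l) {j j' : ℕ}
    (hj : j ≤ j') (hj' : j' ≤ l) : am j ≤ am j' := by
  by_contra hlt
  push Not at hlt
  have h1 := h.mem j (hj.trans hj')
  have h2 := h.mem j' hj'
  have := h.left j (hj.trans hj') (am j') h2.1 hlt
  exact absurd (ht _ _ _ _ hlt (h1.2.trans hb) hj hj' this)
    (not_lt.2 (h.min j' hj' _ h1.1 h1.2))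

/-- The list at level `t` is increasing and contains the leftmost minima of all rows divisible
by `d`. -/
structure Level (l a b : ℕ) (am : ℕ → ℕ) (s : State) (t d : ℕ) : Prop where
  len : s.A aLen t ≤ l + 1
  mono : ∀ i i', i < i' → i' < s.A aLen t →
    s.A aCol (t * (l + 1) + i) < s.A aCol (t * (l + 1) + i')
  ge : ∀ i < s.A aLen t, a ≤ s.A aCol (t * (l + 1) + i)
  le : ∀ i < s.A aLen t, s.A aCol (t * (l + 1) + i) ≤ b
  mem : ∀ j ≤ l, d ∣ j → ∃ i < s.A aLen t, s.A aCol (t * (l + 1) + i) = am j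

theorem Level.congr {l a b : ℕ} {am : ℕ → ℕ} {s s' : State} {t d : ℕ} (h : Level l a b am s t d)
    (h1 : s'.A aLen t = s.A aLen t)
    (h2 : ∀ i < (t + 1) * (l + 1), s'.A aCol i = s.A aCol i) : Level l a b am s' t d := by
  have hl := h.len
  have h3 : ∀ i, i < s.A aLen t → s'.A aCol (t * (l + 1) + i) = s.A aCol (t * (l + 1) + i) := by
    intro i hi
    apply h2
    rw [Nat.succ_mul]
    omega
  refine ⟨by rw [h1]; exact h.len, ?_, ?_, ?_, ?_⟩
  · intro i i' hi hi'
    rw [h1] at hi'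
    rw [h3 i (by omega), h3 i' (by omega)]
    exact h.mono i i' hi hi'
  · intro i hi
    rw [h1] at hi
    rw [h3 i hi]
    exact h.ge i hi
  · intro i hi
    rw [h1] at hi
    rw [h3 i hi]
    exact h.le i hi
  · intro j hj hd
    obtain ⟨i, hi, he⟩ := h.mem j hj hd
    exact ⟨i, by rw [h1]; exact hi, by rw [h3 i hi]; exact he⟩

/-- The invariant of the reduction. -/
structure ReduceInv {K : Type*} [LinearOrder K] (key : ℕ → ℕ → K) (l b t d len : ℕ) (am : ℕ → ℕ)
    (C : ℕ → ℕ) (s : State) (k : ℕ) : Prop where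
  i_le : s.nvar xI ≤ len
  sz_le : s.nvar xSz ≤ s.nvar xI
  credit : 2 * (len - s.nvar xI) + s.nvar xSz = k
  row : s.nvar xRow = s.nvar xSz * d
  row_le : s.nvar xSz * d ≤ l + d
  src : ∀ i < (t + 1) * (l + 1), s.A aCol i = C i
  mono : ∀ i i', i < i' → i' < s.nvar xSz →
    s.A aCol ((t + 1) * (l + 1) + i) < s.A aCol ((t + 1) * (l + 1) + i')
  lt : ∀ i < s.nvar xSz, ∀ i', s.nvar xI ≤ i' → i' < len →
    s.A aCol ((t + 1) * (l + 1) + i) < C (t * (l + 1) + i')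
  from_src : ∀ i < s.nvar xSz, ∃ i' < len,
    s.A aCol ((t + 1) * (l + 1) + i) = C (t * (l + 1) + i')
  stack : ∀ r, r + 1 < s.nvar xSz → key (r * d) (s.A aCol ((t + 1) * (l + 1) + r)) ≤
    key (r * d) (s.A aCol ((t + 1) * (l + 1) + (r + 1)))
  mem : ∀ j ≤ l, d ∣ j → (∃ i < s.nvar xSz, s.A aCol ((t + 1) * (l + 1) + i) = am j) ∨
    ∃ i, s.nvar xI ≤ i ∧ i < len ∧ C (t * (l + 1) + i) = am j

theorem KeyContext.beatsFits {K : Type*} [LinearOrder K] {W Z : ℕ} {key : ℕ → ℕ → K} {s : State}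
    (h : KeyContext W Z key s) {i i' j : ℕ} (li : i ≤ s.nvar xL) (li' : i' ≤ s.nvar xL)
    (lj : j ≤ s.nvar xL) : s.BeatsFits W i i' j := by
  obtain ⟨h1, h2, h3, h4, h5, h6, h7, h8, -, -⟩ := h
  have := h7 _ _ li lj
  have := h7 _ _ li' lj
  unfold State.BeatsFits
  omega

/-- The push on an empty and on a non-empty stack in one statement: `hnb` demands something of the
old top only if there is one. -/
theorem ReduceInv.push {K : Type*} [LinearOrder K] {key : ℕ → ℕ → K} {l b t d len k k' : ℕ}
    {am C : ℕ → ℕ} {s s' : State} (h : ReduceInv key l b t d len am C s k)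
    (hmono : ∀ i i', i < i' → i' < len → C (t * (l + 1) + i) < C (t * (l + 1) + i'))
    (hi : s.nvar xI < len) (hrow : s.nvar xSz * d ≤ l)
    (hnb : ∀ z, s.nvar xSz = z + 1 → key (z * d) (s.A aCol ((t + 1) * (l + 1) + z)) ≤
      key (z * d) (C (t * (l + 1) + s.nvar xI)))
    (hI : s'.nvar xI = s.nvar xI + 1) (hSz : s'.nvar xSz = s.nvar xSz + 1)
    (hRow : s'.nvar xRow = s.nvar xSz * d + d)
    (hA : ∀ i, s'.A aCol i = if i = (t + 1) * (l + 1) + s.nvar xSz then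
      C (t * (l + 1) + s.nvar xI) else s.A aCol i)
    (hk : 2 * (len - (s.nvar xI + 1)) + (s.nvar xSz + 1) = k') :
    ReduceInv key l b t d len am C s' k' := by
  obtain ⟨i_le, sz_le, credit, row, row_le, src, mono, lt, from_src, stack, mem⟩ := h
  set dst := (t + 1) * (l + 1) with hdst
  set sz := s.nvar xSz with hsz
  set ii := s.nvar xI with hii
  have hold : ∀ i < sz, s'.A aCol (dst + i) = s.A aCol (dst + i) := fun i hi => by
    rw [hA, if_neg (by omega)]
  have hnew : s'.A aCol (dst + sz) = C (t * (l + 1) + ii) := by rw [hA, if_pos rfl]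
  constructor <;> simp only [hI, hSz, hRow, ← hdst]
  · omega
  · omega
  · omega
  · ring
  · rw [Nat.succ_mul]; omega
  · intro i hi'
    rw [hA, if_neg (by omega)]
    exact src i hi'
  · intro i i' h1 h2
    rcases Nat.lt_succ_iff_lt_or_eq.1 h2 with h2 | rfl
    · rw [hold i (by omega), hold i' h2]
      exact mono i i' h1 h2
    · rw [hold i h1, hnew]
      exact lt i h1 ii le_rfl hi
  · intro i h1 i' h2 h3
    rcases Nat.lt_succ_iff_lt_or_eq.1 h1 with h1 | rfl
    · rw [hold i h1]
      exact lt i h1 i' (by omega) h3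
    · rw [hnew]
      exact hmono _ _ (by omega) h3
  · intro i h1
    rcases Nat.lt_succ_iff_lt_or_eq.1 h1 with h1 | rfl
    · rw [hold i h1]
      exact from_src i h1
    · exact ⟨ii, hi, hnew⟩
  · intro r h1
    rw [hold r (by omega)]
    rcases Nat.lt_succ_iff_lt_or_eq.1 h1 with h1 | h1
    · rw [hold (r + 1) h1]
      exact stack r h1
    · rw [h1, hnew]
      exact hnb r h1.symm
  · intro j hj hdj
    rcases mem j hj hdj with ⟨i, h1, h2⟩ | ⟨i, h1, h2, h3⟩
    · exact Or.inl ⟨i, by omega, by rw [hold i h1]; exact h2⟩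
    · rcases eq_or_lt_of_le h1 with rfl | h1
      · exact Or.inl ⟨sz, by omega, by rw [hnew]; exact h3⟩
      · exact Or.inr ⟨i, h1, h2, h3⟩

theorem reduceBody_writes :
    reduceBody.writes [xC, xFl, xTop, xSz, xRow, xI] [aCol] [] = true := by decide

theorem reduceBody_cost : reduceBody.maxCost ≤ 200 := by decide

/-- The reduction step of SMAWK. The top of a stack of size z+1 is compared with the new column at
row z·d. If the new column wins, it wins in all later rows, while in earlier rows the top already
loses or ties with its predecessor on the stack, so the top may go. If it does not win, it is not
the leftmost minimum of any row up to z·d, so it is pushed when the row (z+1)·d exists and dropped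
otherwise. The potential 2·(columns left) + (stack size) decreases in each case. -/
theorem reduceBody_run {K : Type*} [LinearOrder K] {W Z : ℕ} {key : ℕ → ℕ → K}
    {l a b t d len k : ℕ} {am C : ℕ → ℕ} {s : State} (ctx : KeyContext W Z key s)
    (hl : s.nvar xL = l) (hb : b ≤ l) (ht : TotallyMonotone key l)
    (ham : IsLeftmostMin key l a b am) (hd : 0 < d) (hS : s.nvar xS = d) (htl : t ≤ l)
    (hdl : l + d < W)
    (hsrc : s.nvar xSrc = t * (l + 1)) (hdst : s.nvar xDst = (t + 1) * (l + 1))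
    (hlen' : len ≤ l + 1)
    (hge : ∀ i < len, a ≤ C (t * (l + 1) + i))
    (hle : ∀ i < len, C (t * (l + 1) + i) ≤ b)
    (hmono : ∀ i i', i < i' → i' < len → C (t * (l + 1) + i) < C (t * (l + 1) + i'))
    (h : ReduceInv key l b t d len am C s k) (hi : s.nvar xI < len) :
    Run W reduceBody s 200 (fun s' => ∃ k' < k, ReduceInv key l b t d len am C s' k') := by
  refine Run.of_wp_le ?_ reduceBody_cost
  have hroom : (t + 1) * (l + 1) + (l + 1) < Z := by
    have := ctx.room
    rw [hl] at this
    nlinarith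
  have hsucc : (t + 1) * (l + 1) = t * (l + 1) + (l + 1) := by ring
  have h1 := ctx.base
  have h2 := ctx.large
  obtain ⟨ii, hii⟩ : ∃ ii, s.nvar xI = ii := ⟨_, rfl⟩
  obtain ⟨sz, hsz⟩ : ∃ sz, s.nvar xSz = sz := ⟨_, rfl⟩
  have hh := h
  obtain ⟨i_le, sz_le, credit, row, row_le, src, mono, lt, from_src, stack, mem⟩ := hh
  rw [hii] at i_le sz_le credit lt mem hi
  rw [hsz] at sz_le credit row row_le mono lt from_src stack mem
  set dst := (t + 1) * (l + 1) with hdstdef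
  have hc : s.A aCol (t * (l + 1) + ii) = C (t * (l + 1) + ii) := src _ (by omega)
  have hcle := hle ii hi
  have hcge := hge ii hi
  have hsumE := ctx.sumE
  have hSb : ∀ r < sz, s.A aCol (dst + r) ≤ b := by
    intro r hr
    obtain ⟨i', hi', he⟩ := from_src r hr
    rw [he]
    exact hle i' hi'
  have hSa : ∀ r < sz, a ≤ s.A aCol (dst + r) := by
    intro r hr
    obtain ⟨i', hi', he⟩ := from_src r hr
    rw [he]
    exact hge i' hi'
  have hroomW : 64 * (dst + (l + 1)) + 64 + s.nvar 3 ≤ W := by omega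
  have hZW : Z ≤ W := by omega
  -- Only multiples of `d` count, so a row before `(r + 1) * d` is at or before `r * d`, where the
  -- comparisons were made.
  have hdvd : ∀ j r, d ∣ j → j < (r + 1) * d → j ≤ r * d := by
    rintro _ r ⟨m, rfl⟩ hlt
    rw [mul_comm d m] at hlt ⊢
    exact Nat.mul_le_mul_right d (Nat.lt_succ_iff.1 (Nat.lt_of_mul_lt_mul_right hlt))
  by_cases hs0 : 0 < sz
  · obtain ⟨z, rfl⟩ : ∃ z, sz = z + 1 := ⟨sz - 1, by omega⟩
    have hrow : z * d ≤ l := by rw [Nat.succ_mul] at row_le; omega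
    have hrowe : (z + 1) * d = z * d + d := Nat.succ_mul z d
    have e1 : dst + (z + 1) - 1 = dst + z := by omega
    have hlt1 := lt z (by omega) ii le_rfl hi
    have hSz := hSb z (by omega)
    have hSz' := hSa z (by omega)
    have hbf := ctx.beatsFits (i := s.A aCol (dst + z)) (i' := C (t * (l + 1) + ii)) (j := z * d)
      (by omega) (by omega) (by omega)
    have hbk := ctx.beats (s.A aCol (dst + z)) (C (t * (l + 1) + ii)) (z * d) hlt1 (by omega)
      (by omega)
    simp only [reduceBody, Prog.wp_seq, Prog.wp_nset, NExp.eval_ld]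
    by_cases hbeat : s.Beats (s.A aCol (dst + z)) (C (t * (l + 1) + ii)) (z * d)
    · simp [hsrc, hdst, hii, hsz, hc, row, hS, hrowe, hbeat]
      refine ⟨by omega, by omega, by omega, by omega, fits_beatsTest ?_ ?_ ?_ ?_, by omega,
        by omega, by omega, 2 * (len - ii) + z, by omega, ?_⟩
      · simp; omega
      · simp; omega
      · simp [row, hS]; omega
      · simp [row, hS, hrowe, hbf]
      rw [hbk] at hbeat
      constructor <;> simp [hii, ← hdstdef]
      · exact i_le
      · omega
      · omega
      · exact src
      · exact fun i i' h1 h2 => mono i i' h1 (by omega)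
      · exact fun i h1 => lt i (by omega)
      · exact fun i h1 => from_src i (by omega)
      · exact fun r h1 => stack r (by omega)
      · intro j hj hdj
        rcases mem j hj hdj with ⟨i, h1, h2⟩ | h3
        · rcases Nat.lt_succ_iff_lt_or_eq.1 h1 with h1 | rfl
          · exact Or.inl ⟨i, h1, h2⟩
          · exfalso
            -- From the row of the comparison on, the new column beats the popped one.
            by_cases hji : i * d ≤ j
            · have h4 := ht _ _ _ _ hlt1 (by omega) hji hj hbeat
              have h5 := ham.min j hj (C (t * (l + 1) + ii)) hcge hcle
              rw [← h2] at h5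
              exact absurd h4 (not_lt.2 h5)
            · obtain ⟨y, rfl⟩ : ∃ y, i = y + 1 := by
                rcases i with _ | y
                · simp at hji
                · exact ⟨y, rfl⟩
              -- In earlier rows the predecessor on the stack is at least as good and lies further
              -- left, so the popped column is not a leftmost minimum.
              have h4 := stack y (by omega)
              have h5 := mono y (y + 1) (by omega) (by omega)
              have h6 := hdvd j y hdj (by omega)
              have h7 := ham.left j hj (s.A aCol (dst + y)) (hSa y (by omega))
                (by rw [← h2]; exact h5)
              rw [← h2] at h7
              have h8 := ht _ _ _ _ h5 (by omega) h6 (by rw [Nat.succ_mul] at hrow; omega) h7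
              exact absurd h8 (not_lt.2 h4)
        · exact Or.inr h3
    · simp [hsrc, hdst, hii, hsz, hc, row, hS, hrowe, hbeat, hl]
      refine ⟨by omega, by omega, by omega, by omega, fits_beatsTest ?_ ?_ ?_ ?_, by omega,
        by omega, ?_, ?_⟩
      · simp; omega
      · simp; omega
      · simp [row, hS]; omega
      · simp [row, hS, hrowe, hbf]
      · intro hlast
        refine ⟨by omega, 2 * (len - (ii + 1)) + (z + 1), by omega, ?_⟩
        rw [hbk] at hbeat
        constructor <;> simp [hsz, row, ← hdstdef]
        · omega
        · omega
        · exact row_le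
        · exact src
        · exact fun i i' h1 h2 => mono i i' h1 (by omega)
        · exact fun i h1 i' h2 => lt i (by omega) i' (by omega)
        · exact fun i h1 => from_src i (by omega)
        · exact fun r h1 => stack r (by omega)
        · intro j hj hdj
          rcases mem j hj hdj with ⟨i, h1, h2⟩ | ⟨i, h1, h2, h3⟩
          · exact Or.inl ⟨i, by omega, h2⟩
          · rcases eq_or_lt_of_le h1 with rfl | h1
            · exfalso
              have h4 := hdvd j z hdj (by omega)
              have h5 := ham.left j hj (s.A aCol (dst + z)) hSz' (by rw [← h3]; exact hlt1)
              rw [← h3] at h5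
              exact hbeat (ht _ _ _ _ hlt1 (by omega) h4 hrow h5)
            · exact Or.inr ⟨i, h1, h2, h3⟩
      · intro hlast
        refine ⟨by omega, by omega, by omega, by omega, by omega,
          2 * (len - (ii + 1)) + (z + 2), by omega, ?_⟩
        rw [hbk] at hbeat
        refine h.push hmono (by omega) (by rw [hsz]; omega) ?_ ?_ ?_ ?_ ?_ ?_
        · intro y hy
          obtain rfl : z = y := by omega
          rw [hii]
          exact not_lt.1 hbeat
        · simp [hii]
        · simp [hsz]
        · simp [hsz, hrowe]
        · simp [hsz, ← hdstdef, hii]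
        · omega
  · obtain rfl : sz = 0 := by omega
    simp [reduceBody, hsrc, hdst, hii, hsz, hc, row, hS]
    refine ⟨by omega, by omega, by omega, by omega, by omega, by omega, by omega, by omega,
      by omega, 2 * (len - (ii + 1)) + 1, by omega, ?_⟩
    refine h.push hmono (by omega) (by simp [hsz]) ?_ ?_ ?_ ?_ ?_ ?_
    · intro y hy
      omega
    · simp [hii]
    · simp [hsz]
    · simp [hsz]
    · simp [hsz, ← hdstdef, hii]
    · omega

end RAM

namespace RAM

/-- The potential starts at twice the length of the list, which makes the reduction linear. The
survivors have their own rows `0, d, 2d, …` within `0, …, l`, whence the bound on their number. The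
new list is stored behind all earlier ones, which are needed again on the way up. -/
theorem reduceProg_run {K : Type*} [LinearOrder K] {W Z : ℕ} {key : ℕ → ℕ → K}
    {l a b t d : ℕ} {am : ℕ → ℕ} {s : State} (ctx : KeyContext W Z key s)
    (hl : s.nvar xL = l) (hb : b ≤ l) (ht : TotallyMonotone key l)
    (ham : IsLeftmostMin key l a b am) (hd : 0 < d) (hS : s.nvar xS = d) (hT : s.nvar xT = t)
    (htl : t ≤ l) (hdl : l + d < W) (hlev : Level l a b am s t d) :
    Run W reduceProg s (500 * (s.A aLen t + 1)) (fun s' => Level l a b am s' (t + 1) d ∧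
      (∀ i < (t + 1) * (l + 1), s'.A aCol i = s.A aCol i) ∧
      (∀ i ≤ t, s'.A aLen i = s.A aLen i) ∧ s'.A aLen (t + 1) * d ≤ l + d) := by
  have hroom : (t + 1) * (l + 1) + (l + 1) < Z := by
    have := ctx.room
    rw [hl] at this
    nlinarith
  have hsucc : (t + 1) * (l + 1) = t * (l + 1) + (l + 1) := by ring
  have h1 := ctx.base
  have h2 := ctx.large
  have h3 := ctx.sumE
  obtain ⟨len, hlen⟩ : ∃ len, s.A aLen t = len := ⟨_, rfl⟩
  have hlen' := hlev.len
  have hmono := hlev.mono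
  have hge := hlev.ge
  have hle := hlev.le
  have hmem := hlev.mem
  rw [hlen] at hlen' hmono hge hle hmem
  have hroomW : 64 * ((t + 1) * (l + 1) + (l + 1)) + 64 + s.nvar 3 ≤ W := by omega
  refine Run.mono (τ := 40 + ((203 * (2 * len) + 3) + 20)) ?_ (by omega) fun _ => id
  refine Run.seq (Run.mono ((Run.of_wp_le (Q := fun s1 => s1.nvar xSrc = t * (l + 1) ∧
    s1.nvar xDst = (t + 1) * (l + 1) ∧ s1.nvar xLen = len ∧ s1.nvar xSz = 0 ∧ s1.nvar xRow = 0 ∧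
    s1.nvar xI = 0) ?_ (by decide)).frame [xSrc, xDst, xLen, xSz, xRow, xI] [] [] (by decide)
    (by decide) (by decide)) le_rfl ?_)
  · simp [reduceInit, hT, hl, hlen, hsucc]
    omega
  rintro s1 ⟨⟨e1, e2, e3, e4, e5, e6⟩, hf1⟩
  have ctx1 := ctx.frame hf1 (by decide) (by decide)
  have f1 := fun i => hf1.A aCol (by simp) (by simp) i
  have f2 := fun i => hf1.A aLen (by simp) (by simp) i
  refine Run.seq (Run.mono (Run.loop_count (c := 200)
    (Q := fun s2 => ReduceInv key l b t d len am (s.A aCol) s2 (s2.nvar xSz) ∧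
      Frame [xC, xFl, xTop, xSz, xRow, xI] [aCol] [] s1 s2 ∧ s2.nvar xI = len)
    [xC, xFl, xTop, xSz, xRow, xI] [aCol] [] reduceBody_writes (by decide) (by decide)
    (fun s' k => ReduceInv key l b t d len am (s.A aCol) s' k) (k₀ := 2 * len) ?_ ?_) ?_ ?_)
  · constructor <;> simp [e4, e5, e6, f1]
    intro j hj hdj
    exact hmem j hj hdj
  · intro s2 k hf2 hI
    have ctx2 := ctx1.frame hf2 (by decide) (by decide)
    have v3 := hf2.nvar xLen (by simp)
    have v4 := hf2.nvar 3 (by simp)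
    have := hI.i_le
    refine ⟨?_, ?_, ?_⟩
    · simp [v3, e3]
      omega
    · intro hlt
      simp [v3, e3] at hlt
      refine reduceBody_run ctx2 ?_ hb ht ham hd ?_ htl hdl ?_ ?_ hlen' hge hle
        hmono hI hlt
      · rw [hf2.nvar _ (by simp), hf1.nvar _ (by simp), hl]
      · rw [hf2.nvar _ (by simp), hf1.nvar _ (by simp), hS]
      · rw [hf2.nvar _ (by simp), e1]
      · rw [hf2.nvar _ (by simp), e2]
    · intro hlt
      simp [v3, e3] at hlt
      have hk := hI.credit
      obtain rfl : s2.nvar xSz = k := by omega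
      exact ⟨hI, hf2, by omega⟩
  · simp [Test.cost, NExp.cost]
  rintro s2 ⟨hI, hf2, hi2⟩
  have v3 : s2.nvar 3 = s.nvar 3 := by rw [hf2.nvar _ (by simp), hf1.nvar _ (by simp)]
  have vT : s2.nvar xT = t := by rw [hf2.nvar _ (by simp), hf1.nvar _ (by simp), hT]
  refine Run.of_wp_le ?_ (by decide)
  have hsz := hI.sz_le
  simp [vT, v3]
  refine ⟨by omega, by omega, ⟨by simp; omega, ?_, ?_, ?_, ?_⟩, ?_, ?_, hI.row_le⟩
  · simpa using hI.mono
  · simp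
    intro i hi
    obtain ⟨i', h1, h2⟩ := hI.from_src i hi
    exact h2 ▸ hge i' h1
  · simp
    intro i hi
    obtain ⟨i', h1, h2⟩ := hI.from_src i hi
    exact h2 ▸ hle i' h1
  · simp
    intro j hj hdj
    rcases hI.mem j hj hdj with h | ⟨i, h4, h5, h6⟩
    · exact h
    · omega
  · exact hI.src
  · intro i hi
    rw [if_neg (by omega), hf2.A _ (by simp) (by simp), f2]

/-! ### Interpolation of the rows between two known minima -/

def interpolateBody : Prog :=
  .ite (.nlt ↟xL (↟xJ + ↟xS)) (.nset xEnd (.ld aCol (↟xSrc + ↟xLen - ♯1)))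
    (.nset xEnd (.ld aRes (↟xJ + ↟xS))) ;;
  .ite (.nlt (.ld aCol (↟xSrc + ↟xPos)) ↟xEnd)
    (.nset xPos (↟xPos + ♯1) ;; .nset xC (.ld aCol (↟xSrc + ↟xPos)) ;;
      .ite (beatsTest ↟xBest ↟xC ↟xJ) (.nset xBest ↟xC) .skip)
    (.sta aRes ↟xJ ↟xBest ;; .nset xJ (↟xJ + ↟xS + ↟xS) ;; .nset xBest (.ld aCol (↟xSrc + ↟xPos)))

def interpolateInit : Prog :=
  .nset xSrc ((↟xT + ♯1) * (↟xL + ♯1)) ;; .nset xLen (.ld aLen (↟xT + ♯1)) ;; .nset xPos ♯0 ;;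
  .nset xJ ↟xS ;; .nset xBest (.ld aCol ↟xSrc)

/-- Find the minima of the rows that are odd multiples of `xS`, when those of the even multiples are
known. -/
def interpolateProg : Prog :=
  interpolateInit ;; .loop (.neg (.nlt ↟xL ↟xJ)) interpolateBody

/-- The invariant of the interpolation. -/
structure InterpolateInv (l a d len : ℕ) (am C : ℕ → ℕ) (s : State) (k : ℕ) : Prop where
  odd : ∃ m, s.nvar xJ = 2 * m * d + d
  j_le : s.nvar xJ ≤ l + 2 * d
  pos : s.nvar xPos < len
  credit : ∃ r, k = len - s.nvar xPos + r ∧ l < s.nvar xJ + r * (2 * d)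
  even : ∀ j ≤ l, 2 * d ∣ j → s.A aRes j = am j
  done : ∀ j ≤ l, j < s.nvar xJ → d ∣ j → s.A aRes j = am j
  best : s.nvar xBest ≤ C (s.nvar xPos)
  best_ge : a ≤ s.nvar xBest
  found : s.nvar xJ ≤ l → am (s.nvar xJ) = s.nvar xBest ∨
    ∃ i, s.nvar xPos < i ∧ i < len ∧ C i = am (s.nvar xJ)
  pos_le : s.nvar xJ + d ≤ l → C (s.nvar xPos) ≤ am (s.nvar xJ + d)

/-- Minima move right from row to row, so that of row `J` lies between those of `J - d` and `J + d`,
which are known. The pointer therefore never moves back: a round either advances it, updating the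
best column for row `J`, or closes row `J` and keeps the pointer as the start for row `J + 2 * d`.
The credit is the number of columns ahead plus the number of rows left. -/
theorem interpolateBody_run {K : Type*} [LinearOrder K] {W Z : ℕ} {key : ℕ → ℕ → K}
    {l a b src d len k : ℕ} {am C : ℕ → ℕ} {s : State} (ctx : KeyContext W Z key s)
    (hl : s.nvar xL = l) (hb : b ≤ l) (ht : TotallyMonotone key l)
    (ham : IsLeftmostMin key l a b am) (hd : 0 < d) (hS : s.nvar xS = d)
    (hdl : l + 3 * d < W) (hsrc : s.nvar xSrc = src) (hroom : src + (l + 1) < Z)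
    (hlen : s.nvar xLen = len) (hlen' : len ≤ l + 1)
    (hC : ∀ i < len, s.A aCol (src + i) = C i)
    (hle : ∀ i < len, C i ≤ b)
    (hmono : ∀ i i', i < i' → i' < len → C i < C i')
    (hmem : ∀ j ≤ l, d ∣ j → ∃ i < len, C i = am j)
    (h : InterpolateInv l a d len am C s k) (hi : s.nvar xJ ≤ l) :
    Run W interpolateBody s 200
      (fun s' => ∃ k' < k, InterpolateInv l a d len am C s' k') := by
  refine Run.of_wp_le ?_ (by decide)
  have h1 := ctx.base
  have h2 := ctx.large
  have h3 := ctx.sumE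
  have hroomW : 64 * (src + (l + 1)) + 64 + s.nvar 3 ≤ W := by omega
  have hZW : Z ≤ W := by omega
  obtain ⟨⟨m, odd⟩, j_le, hpos, ⟨r, hk, hr⟩, even, done, best, best_ge, found, pos_le⟩ := h
  obtain ⟨J, hJ⟩ : ∃ J, s.nvar xJ = J := ⟨_, rfl⟩
  obtain ⟨pos, hpo⟩ : ∃ pos, s.nvar xPos = pos := ⟨_, rfl⟩
  obtain ⟨bst, hbs⟩ : ∃ bst, s.nvar xBest = bst := ⟨_, rfl⟩
  rw [hpo] at hpos hk best found pos_le
  rw [hJ] at odd j_le hr done found pos_le hi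
  rw [hbs] at best found best_ge
  replace found := fun _ : Unit => found hi
  have hCp := hC pos hpos
  have hCle := hle pos hpos
  have hCl := hC (len - 1) (by omega)
  have hCll := hle (len - 1) (by omega)
  have hdvdJ : d ∣ J := ⟨2 * m + 1, by rw [odd]; ring⟩
  have heven : 2 * d ∣ J + d := ⟨m + 1, by rw [odd]; ring⟩
  have hmono' : ∀ i i', i ≤ i' → i' < len → C i ≤ C i' := by
    intro i i' h1 h2
    rcases eq_or_lt_of_le h1 with rfl | h1
    · exact le_rfl
    · exact (hmono i i' h1 h2).le
  have hmlt : ∀ i i', i < len → i' < len → C i < C i' → i < i' := by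
    intro i i' h1 h2 h3
    by_contra h4
    exact absurd (hmono' i' i (by omega) h1) (by omega)
  have e1 : src + len - 1 = src + (len - 1) := by omega
  -- The scan for row `J` stops at the minimum of the next row, or at the end of the list if there
  -- is no next row.
  obtain ⟨last, hlast, ⟨li, hli, hlie⟩, hlast1, hlast2⟩ : ∃ last, last = (if l < J + d then C (len - 1) else
      am (J + d)) ∧ (∃ i < len, C i = last) ∧ am J ≤ last ∧ C pos ≤ last := by
    refine ⟨_, rfl, ?_⟩
    split_ifs with hc
    · obtain ⟨i, hi1, hi2⟩ := hmem J hi hdvdJ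
      exact ⟨⟨len - 1, by omega, rfl⟩, hi2 ▸ hmono' i (len - 1) (by omega) (by omega),
        hmono' pos (len - 1) (by omega) (by omega)⟩
    · exact ⟨hmem _ (by omega) (Nat.dvd_add hdvdJ dvd_rfl),
        ham.mono hb ht (by omega) (by omega), pos_le (by omega)⟩
  have hlastb : last ≤ b := hlie ▸ hle li hli
  rw [interpolateBody, Prog.wp_seq]
  suffices hsuff : Prog.wp W (.ite (.nlt (.ld aCol (↟xSrc + ↟xPos)) ↟xEnd)
      (.nset xPos (↟xPos + ♯1) ;; .nset xC (.ld aCol (↟xSrc + ↟xPos)) ;;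
        .ite (beatsTest ↟xBest ↟xC ↟xJ) (.nset xBest ↟xC) .skip)
      (.sta aRes ↟xJ ↟xBest ;; .nset xJ (↟xJ + ↟xS + ↟xS) ;;
        .nset xBest (.ld aCol (↟xSrc + ↟xPos))))
      (fun s' => ∃ k' < k, InterpolateInv l a d len am C s' k') (s.setN xEnd last) by
    by_cases hc : l < J + d
    · rw [if_pos hc] at hlast
      simp only [Prog.wp_ite, Prog.wp_nset, Test.holds_nlt, NExp.eval_var, NExp.eval_add,
        NExp.eval_sub, NExp.eval_lit, NExp.eval_ld, hl, hJ, hS, hsrc, hlen, e1, hCl, ← hlast]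
      simp only [hc, not_true, forall_const, false_imp_iff, and_true]
      refine ⟨?_, ?_, hsuff⟩ <;> simp [hl, hJ, hS, hsrc, hlen, e1, hCl] <;> omega
    · rw [if_neg hc, ← even (J + d) (by omega) heven] at hlast
      simp only [Prog.wp_ite, Prog.wp_nset, Test.holds_nlt, NExp.eval_var, NExp.eval_add,
        NExp.eval_ld, hl, hJ, hS, ← hlast]
      simp only [hc, not_false_eq_true, forall_const, false_imp_iff, true_and]
      refine ⟨?_, ?_, hsuff⟩ <;> simp [hl, hJ, hS, ← hlast] <;> omega
  by_cases hc : C pos < last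
  · have hposli : pos < li := hmlt pos li hpos hli (by omega)
    have hpos' : pos + 1 < len := by omega
    have hCn := hC (pos + 1) hpos'
    have hCnb := hle (pos + 1) hpos'
    have hCn' : C (pos + 1) ≤ last := hlie ▸ hmono' _ _ (by omega) hli
    have hlt1 := hmono pos (pos + 1) (by omega) hpos'
    have hbf := ctx.beatsFits (i := bst) (i' := C (pos + 1)) (j := J) (by omega) (by omega)
      (by omega)
    have hbk := ctx.beats bst (C (pos + 1)) J (by omega) (by omega) (by omega)
    have hend : J + d ≤ l → C (pos + 1) ≤ am (J + d) := fun h => by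
      rw [if_neg (by omega)] at hlast
      omega
    by_cases hbeat : s.Beats bst (C (pos + 1)) J
    · simp [hsrc, hpo, hCp, hc, hbs, hJ, hCn, hbeat]
      refine ⟨by omega, by omega, by omega, fits_beatsTest ?_ ?_ ?_ ?_, by omega, k - 1, by omega,
        ?_⟩
      · simp; omega
      · simp; omega
      · simp; omega
      · simp [hbs, hJ, hbf]
      rw [hbk] at hbeat
      constructor <;> simp [hJ]
      · exact ⟨m, odd⟩
      · exact j_le
      · exact hpos'
      · exact ⟨r, by omega, hr⟩
      · exact even
      · exact done
      · omega
      · intro _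
        rcases found () with h4 | ⟨i, h4, h5, h6⟩
        · have := ham.min J hi (C (pos + 1)) (by omega) hCnb
          rw [h4] at this
          exact absurd hbeat (not_lt.2 this)
        · rcases Nat.lt_or_ge (pos + 1) i with h7 | h7
          · exact Or.inr ⟨i, h7, h5, h6⟩
          · obtain rfl : i = pos + 1 := by omega
            exact Or.inl h6.symm
      · exact hend
    · simp [hsrc, hpo, hCp, hc, hbs, hJ, hCn, hbeat]
      refine ⟨by omega, by omega, by omega, fits_beatsTest ?_ ?_ ?_ ?_, k - 1, by omega, ?_⟩
      · simp; omega
      · simp; omega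
      · simp; omega
      · simp [hbs, hJ, hbf]
      rw [hbk] at hbeat
      constructor <;> simp [hJ, hbs]
      · exact ⟨m, odd⟩
      · exact j_le
      · exact hpos'
      · exact ⟨r, by omega, hr⟩
      · exact even
      · exact done
      · omega
      · exact best_ge
      · intro _
        rcases found () with h4 | ⟨i, h4, h5, h6⟩
        · exact Or.inl h4
        · rcases Nat.lt_or_ge (pos + 1) i with h7 | h7
          · exact Or.inr ⟨i, h7, h5, h6⟩
          · obtain rfl : i = pos + 1 := by omega
            have := ham.left J hi bst best_ge (by omega)
            rw [← h6] at this
            exact absurd this hbeat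
      · exact hend
  · have hamJ : am J = bst := by
      rcases found () with h4 | ⟨i, h4, h5, h6⟩
      · exact h4
      · have := hmono pos i h4 h5
        omega
    have hr0 : 0 < r := by
      rcases Nat.eq_zero_or_pos r with rfl | h
      · omega
      · exact h
    have hrm : r * (2 * d) = (r - 1) * (2 * d) + 2 * d := by
      obtain ⟨r, rfl⟩ : ∃ r', r = r' + 1 := ⟨r - 1, by omega⟩
      rw [Nat.add_sub_cancel]; ring
    simp [hsrc, hpo, hCp, hc, hbs, hJ, hS]
    refine ⟨by omega, by omega, by omega, by omega, by omega, k - 1, by omega, ?_⟩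
    have hpe : ∀ j, J + d ≤ j → j ≤ l → C pos ≤ am j := fun j h4 h5 =>
      (pos_le (by omega)).trans (ham.mono hb ht h4 h5)
    have hCa : a ≤ C pos := by omega
    constructor <;> simp [hpo]
    · exact ⟨m + 1, by rw [odd]; ring⟩
    · omega
    · exact hpos
    · exact ⟨r - 1, by omega, by omega⟩
    · intro j h4 h5
      split_ifs with h6
      · rw [h6, hamJ]
      · exact even j h4 h5
    · intro j h4 h5 h6
      split_ifs with h7
      · rw [h7, hamJ]
      · rcases Nat.lt_or_ge j J with h8 | h8
        · exact done j h4 h8 h6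
        · apply even j h4
          obtain ⟨c, rfl⟩ := h6
          -- Between `J` and `J + 2 * d` the only multiple of `d` is `J + d`, an even multiple,
          -- which was known from the start.
          obtain rfl : c = 2 * m + 2 := by
            have h9 : 2 * m + 1 < c := by
              by_contra hcon
              have : d * c ≤ d * (2 * m + 1) := Nat.mul_le_mul_left d (by omega)
              have : d * (2 * m + 1) = J := by rw [odd]; ring
              omega
            have h10 : c < 2 * m + 3 := by
              by_contra hcon
              have : d * (2 * m + 3) ≤ d * c := Nat.mul_le_mul_left d (by omega)
              have : d * (2 * m + 3) = J + d + d := by rw [odd]; ring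
              omega
            omega
          exact ⟨m + 1, by ring⟩
    · exact hCa
    · intro h4
      obtain ⟨i, h5, h6⟩ := hmem (J + d + d) h4
        (Nat.dvd_add (Nat.dvd_add hdvdJ dvd_rfl) dvd_rfl)
      have h7 := hpe _ (by omega) h4
      rw [← h6] at h7
      rcases eq_or_lt_of_le h7 with h8 | h8
      · exact Or.inl (by rw [← h6, h8])
      · exact Or.inr ⟨i, hmlt pos i hpos h5 h8, h5, h6⟩
    · intro h4
      exact hpe _ (by omega) h4

end RAM

namespace RAM

/-- Consecutive odd rows share only the boundary column of their ranges, so the scans add up to the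
length of the list plus the number of rows, which is at most `l / d + 1`. -/
theorem interpolateProg_run {K : Type*} [LinearOrder K] {W Z : ℕ} {key : ℕ → ℕ → K}
    {l a b t d : ℕ} {am : ℕ → ℕ} {s : State} (ctx : KeyContext W Z key s)
    (hl : s.nvar xL = l) (hb : b ≤ l) (ht : TotallyMonotone key l)
    (ham : IsLeftmostMin key l a b am) (hd : 0 < d) (hS : s.nvar xS = d) (hT : s.nvar xT = t)
    (htl : t ≤ l) (hdl : d ≤ l) (hlev : Level l a b am s (t + 1) d)
    (heven : ∀ j ≤ l, 2 * d ∣ j → s.A aRes j = am j) :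
    Run W interpolateProg s (250 * (s.A aLen (t + 1) + l / d + 1))
      (fun s' => ∀ j ≤ l, d ∣ j → s'.A aRes j = am j) := by
  have hroom : (t + 1) * (l + 1) + (l + 1) < Z := by
    have := ctx.room
    rw [hl] at this
    nlinarith
  have hroom' : 4 * l + 3 < Z := by
    have := ctx.room
    rw [hl] at this
    nlinarith
  have h1 := ctx.base
  have h2 := ctx.large
  have h3 := ctx.sumE
  obtain ⟨len, hlen⟩ : ∃ len, s.A aLen (t + 1) = len := ⟨_, rfl⟩
  have hlen' := hlev.len
  have hmono := hlev.mono
  have hge := hlev.ge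
  have hle := hlev.le
  have hmem := hlev.mem
  rw [hlen] at hlen' hmono hge hle hmem
  set src := (t + 1) * (l + 1) with hsrc
  have hroomW : 64 * (src + (l + 1)) + 64 + s.nvar 3 ≤ W := by omega
  obtain ⟨i0, hi0, -⟩ := hmem 0 (by omega) (dvd_zero d)
  have hb0 := hle 0 (by omega)
  have hge0 := hge 0 (by omega)
  have hsrcl : l + 1 ≤ src := by rw [hsrc]; nlinarith
  have hsrct : t + 1 ≤ src := by rw [hsrc]; nlinarith
  obtain ⟨r, hr⟩ : ∃ r, l / d = r := ⟨_, rfl⟩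
  rw [hlen, hr]
  refine Run.mono (τ := 50 + (204 * (len + (r + 1)) + 4)) ?_ (by omega) fun _ => id
  refine Run.seq (Run.mono ((Run.of_wp_le (Q := fun s1 => s1.nvar xSrc = src ∧
    s1.nvar xLen = len ∧ s1.nvar xPos = 0 ∧ s1.nvar xJ = d ∧
    s1.nvar xBest = s.A aCol (src + 0)) ?_ (by decide)).frame [xSrc, xLen, xPos, xJ, xBest] [] []
    (by decide) (by decide) (by decide)) le_rfl ?_)
  · simp [interpolateInit, hT, hl, hlen, hS, ← hsrc]
    rw [add_zero] at hb0
    omega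
  rintro s1 ⟨⟨e1, e2, e3, e4, e5⟩, hf1⟩
  have ctx1 := ctx.frame hf1 (by decide) (by decide)
  have f1 := fun i => hf1.A aCol (by simp) (by simp) i
  have f2 := fun i => hf1.A aRes (by simp) (by simp) i
  have hmono' : ∀ i < len, s.A aCol (src + 0) ≤ s.A aCol (src + i) := by
    intro i hi
    rcases Nat.eq_zero_or_pos i with rfl | h
    · exact le_rfl
    · exact (hmono 0 i h hi).le
  refine Run.mono (Run.loop_count (c := 200) [xPos, xEnd, xJ, xBest, xC] [aRes] [] (by decide)
    (by decide) (by decide)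
    (fun s' k => InterpolateInv l a d len am (fun i => s.A aCol (src + i)) s' k)
    (k₀ := len + (r + 1)) ?_ ?_) le_rfl fun _ => id
  · constructor <;> simp only [e3, e4, e5, f2]
    · exact ⟨0, by simp⟩
    · omega
    · omega
    · refine ⟨r + 1, by omega, ?_⟩
      have := Nat.lt_div_mul_add (a := l) hd
      rw [hr] at this
      nlinarith
    · exact heven
    · intro j hj hj' hdj
      obtain rfl : j = 0 := Nat.eq_zero_of_dvd_of_lt hdj hj'
      exact heven 0 hj (dvd_zero _)
    · exact le_rfl
    · exact hge0
    · intro hj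
      obtain ⟨i, hi1, hi2⟩ := hmem d hj dvd_rfl
      rcases Nat.eq_zero_or_pos i with rfl | h
      · exact Or.inl hi2.symm
      · exact Or.inr ⟨i, h, hi1, hi2⟩
    · intro hj
      obtain ⟨i, hi1, hi2⟩ := hmem (d + d) hj (Nat.dvd_add dvd_rfl dvd_rfl)
      exact hi2 ▸ hmono' i hi1
  · intro s2 k hf2 hI
    have ctx2 := ctx1.frame hf2 (by decide) (by decide)
    have vL : s2.nvar xL = l := by rw [hf2.nvar _ (by simp), hf1.nvar _ (by simp), hl]
    have := hI.j_le
    refine ⟨?_, ?_, ?_⟩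
    · simp [vL]
      omega
    · intro hlt
      simp [vL] at hlt
      refine interpolateBody_run ctx2 vL hb ht ham hd ?_ (by omega) ?_ hroom ?_ hlen' ?_ hle
        hmono hmem hI hlt
      · rw [hf2.nvar _ (by simp), hf1.nvar _ (by simp), hS]
      · rw [hf2.nvar _ (by simp), e1]
      · rw [hf2.nvar _ (by simp), e2]
      · intro i _
        rw [hf2.A _ (by simp) (by simp), f1]
    · intro hlt j hj hdj
      simp [vL] at hlt
      exact hI.done j hj (by omega) hdj

/-! ### Descent and ascent through the strides -/

/-- The columns `xA, …, xB` are the candidates of level `0`. -/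
def candidatesProg : Prog :=
  .nset xI ↟xA ;;
  .loop (.neg (.nlt ↟xB ↟xI)) (.sta aCol (↟xI - ↟xA) ↟xI ;; .nset xI (↟xI + ♯1)) ;;
  .sta aLen ♯0 (↟xB + ♯1 - ↟xA) ;; .nset xS ♯1 ;; .nset xT ♯0

/-- SMAWK without recursion: the level `xT` and the stride `xS = 2 ^ xT` replace the recursion
stack. Each round reduces the columns for the current stride and then halves the set of rows. -/
def descendProg : Prog :=
  .loop (.neg (.nlt ↟xL ↟xS)) (reduceProg ;; .nset xS (↟xS + ↟xS) ;; .nset xT (↟xT + ♯1))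

/-- At the coarsest stride only row 0 remains, and after one more reduction only its minimum is in
the list. -/
def topProg : Prog :=
  reduceProg ;; .sta aRes ♯0 (.ld aCol ((↟xT + ♯1) * (↟xL + ♯1)))

/-- The return from the recursion: halving the stride doubles the set of rows, and the new ones are
interpolated from the list that was reduced for this stride. -/
def ascendProg : Prog :=
  .loop (.nlt ♯0 ↟xT) ((.nset xT (↟xT - ♯1) ;; .nset xS (↟xS / ♯2)) ;; interpolateProg)

/-- Find the leftmost minimum among the columns `xA, …, xB` of each of the rows `0, …, xL`. -/
def minimaProg : Prog :=
  candidatesProg ;; descendProg ;; topProg ;; ascendProg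

theorem Level.weaken {l a b : ℕ} {am : ℕ → ℕ} {s : State} {t d d' : ℕ} (h : Level l a b am s t d)
    (hd : d ∣ d') : Level l a b am s t d' :=
  ⟨h.len, h.mono, h.ge, h.le, fun j hj hdj => h.mem j hj (hd.trans hdj)⟩

theorem candidatesProg_run {K : Type*} [LinearOrder K] {W Z : ℕ} {key : ℕ → ℕ → K}
    {l a b : ℕ} {am : ℕ → ℕ} {s : State} (ctx : KeyContext W Z key s)
    (hl : s.nvar xL = l) (hb : b ≤ l) (hab : a ≤ b) (hA : s.nvar xA = a) (hB : s.nvar xB = b)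
    (ham : IsLeftmostMin key l a b am) :
    Run W candidatesProg s (50 * (l + 2)) (fun s' => Level l a b am s' 0 1 ∧
      s'.nvar xS = 1 ∧ s'.nvar xT = 0) := by
  have hroom' : 4 * l + 3 < Z := by
    have := ctx.room
    rw [hl] at this
    nlinarith
  have h1 := ctx.base
  have h2 := ctx.large
  refine Run.mono (τ := 2 + ((24 * (b + 1 - a) + 4) + 30)) ?_ (by omega) fun _ => id
  refine Run.seq (Run.mono ((Run.of_wp_le (Q := fun s1 => s1.nvar xI = a) ?_ (by decide)).frame
    [xI] [] [] (by decide) (by decide) (by decide)) le_rfl ?_)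
  · simp [hA]
    omega
  rintro s1 ⟨e1, hf1⟩
  have vA : s1.nvar xA = a := by rw [hf1.nvar _ (by simp), hA]
  have vB : s1.nvar xB = b := by rw [hf1.nvar _ (by simp), hB]
  have v3 : s1.nvar 3 = s.nvar 3 := by rw [hf1.nvar _ (by simp)]
  refine Run.seq (Run.mono (Run.loop_count (c := 20)
    (Q := fun s2 => Frame [xI] [aCol] [] s1 s2 ∧ ∀ i ≤ b - a, s2.A aCol i = a + i)
    [xI] [aCol] [] (by decide) (by decide) (by decide)
    (fun s' k => a ≤ s'.nvar xI ∧ s'.nvar xI + k = b + 1 ∧ ∀ i < s'.nvar xI - a,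
      s'.A aCol i = a + i) (k₀ := b + 1 - a) ?_ ?_) le_rfl ?_)
  · simp [e1]
    omega
  · rintro s2 k hf2 ⟨hi1, hi2, hi3⟩
    have vA2 : s2.nvar xA = a := by rw [hf2.nvar _ (by simp), vA]
    have vB2 : s2.nvar xB = b := by rw [hf2.nvar _ (by simp), vB]
    have v32 : s2.nvar 3 = s.nvar 3 := by rw [hf2.nvar _ (by simp), v3]
    refine ⟨?_, ?_, ?_⟩
    · simp [vB2]
      omega
    · intro hlt
      simp [vB2] at hlt
      refine Run.of_wp_le ?_ (by decide)
      simp [vA2, v32]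
      refine ⟨by omega, by omega, by omega, k - 1, by omega, by omega, by omega, fun i hi => ?_⟩
      split_ifs with hc
      · omega
      · exact hi3 i (by omega)
    · intro hlt
      simp [vB2] at hlt
      exact ⟨hf2, fun i hi => hi3 i (by omega)⟩
  rintro s2 ⟨hf2, hcol⟩
  have vA2 : s2.nvar xA = a := by rw [hf2.nvar _ (by simp), vA]
  have vB2 : s2.nvar xB = b := by rw [hf2.nvar _ (by simp), vB]
  have v32 : s2.nvar 3 = s.nvar 3 := by rw [hf2.nvar _ (by simp), v3]
  refine Run.of_wp_le ?_ (by decide)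
  simp [vA2, vB2, v32]
  refine ⟨by omega, by omega, by omega, by omega, ?_⟩
  constructor <;> simp
  · omega
  · intro i i' h1 h2
    rw [hcol i (by omega), hcol i' (by omega)]
    omega
  · intro i h1
    rw [hcol i (by omega)]
    omega
  · intro i h1
    rw [hcol i (by omega)]
    omega
  · intro j hj
    have := ham.mem j hj
    exact ⟨am j - a, by omega, by rw [hcol _ (by omega)]; omega⟩

/-- The lists of the levels `1, …, t` are ready. -/
structure Levels (l a b : ℕ) (am : ℕ → ℕ) (t : ℕ) (s : State) : Prop where
  stride : s.nvar xS = 2 ^ t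
  level : s.nvar xT = t
  bottom : Level l a b am s 0 1
  lists : ∀ u < t, Level l a b am s (u + 1) (2 ^ u)
  lens : ∀ u < t, s.A aLen (u + 1) * 2 ^ u ≤ l + 2 ^ u
  pow_le : ∀ u < t, 2 ^ u ≤ l

theorem Levels.le {l a b t : ℕ} {am : ℕ → ℕ} {s : State} (h : Levels l a b am t s) : t ≤ l := by
  rcases t with _ | t
  · exact Nat.zero_le l
  · exact Nat.lt_of_lt_of_le Nat.lt_two_pow_self (h.pow_le t (Nat.lt_succ_self t))

/-- The loop goes on only while the stride is at most `l`, so the stride overshoots by a factor of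
two at most and still fits into a word. -/
theorem Levels.two_pow_le {l a b t : ℕ} {am : ℕ → ℕ} {s : State} (h : Levels l a b am t s) :
    2 ^ t ≤ 2 * l + 1 := by
  rcases t with _ | t
  · simp
  · have := h.pow_le t (Nat.lt_succ_self t)
    rw [pow_succ]
    omega

/-- The list at level `t` was reduced for the stride `2 ^ (t - 1)` and in particular serves the
multiples of `2 ^ t`. -/
theorem Levels.current {l a b t : ℕ} {am : ℕ → ℕ} {s : State} (h : Levels l a b am t s) :
    Level l a b am s t (2 ^ t) := by
  rcases t with _ | t
  · exact h.bottom
  · exact (h.lists t (Nat.lt_succ_self t)).weaken (pow_dvd_pow 2 (Nat.le_succ t))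

theorem Levels.len_le {l a b t : ℕ} {am : ℕ → ℕ} {s : State} (h : Levels l a b am t s) :
    ∀ u < t, s.A aLen (u + 1) ≤ l / 2 ^ u + 1 := by
  intro u hu
  have h1 := h.lens u hu
  have h2 : 0 < 2 ^ u := Nat.two_pow_pos u
  have h3 := Nat.div_le_div_right (c := 2 ^ u) h1
  rwa [Nat.mul_div_cancel _ h2, Nat.add_div_right _ h2] at h3

/-- A list reduced for twice as many rows is about twice as long as needed. This factor is why each
stride is reduced anew, and it keeps the total linear. -/
theorem Levels.current_len {l a b t : ℕ} {am : ℕ → ℕ} {s : State} (h : Levels l a b am t s) :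
    s.A aLen t ≤ 2 * (l / 2 ^ t) + 2 := by
  rcases t with _ | t
  · have := h.bottom.len
    simp
    omega
  · have h1 := h.len_le t (Nat.lt_succ_self t)
    rw [pow_succ, ← Nat.div_div_eq_div_mul]
    omega

theorem Levels.after_reduce {l a b t : ℕ} {am : ℕ → ℕ} {s s' : State} (h : Levels l a b am t s)
    (h1 : Level l a b am s' (t + 1) (2 ^ t))
    (h2 : ∀ i < (t + 1) * (l + 1), s'.A aCol i = s.A aCol i)
    (h3 : ∀ i ≤ t, s'.A aLen i = s.A aLen i) (h4 : s'.A aLen (t + 1) * 2 ^ t ≤ l + 2 ^ t) :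
    Level l a b am s' 0 1 ∧ (∀ u < t + 1, Level l a b am s' (u + 1) (2 ^ u)) ∧
      ∀ u < t + 1, s'.A aLen (u + 1) * 2 ^ u ≤ l + 2 ^ u := by
  refine ⟨h.bottom.congr (h3 0 (Nat.zero_le t)) fun i hi => h2 i ?_, fun u hu => ?_,
    fun u hu => ?_⟩
  · exact hi.trans_le (Nat.mul_le_mul_right _ (by omega))
  · rcases Nat.lt_succ_iff_lt_or_eq.1 hu with hu | rfl
    · exact (h.lists u hu).congr (h3 _ hu) fun i hi => h2 i
        (hi.trans_le (Nat.mul_le_mul_right _ (by omega)))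
    · exact h1
  · rcases Nat.lt_succ_iff_lt_or_eq.1 hu with hu | rfl
    · rw [h3 _ hu]
      exact h.lens u hu
    · exact h4

/-- The word variables that the computation of the minima changes. -/
def minimaVars : List ℕ :=
  [xI, xS, xT, xSrc, xDst, xLen, xSz, xRow, xC, xTop, xFl, xPos, xJ, xBest, xEnd]

/-- With m = `l / 2 ^ t`, one round costs about 1000·m plus a constant, while the credit 6000·m
drops by at least half because m is halved; m ≥ 1 absorbs the constants. Thus the geometric series
is summed by the credit. -/
theorem descendProg_run {K : Type*} [LinearOrder K] {W Z : ℕ} {key : ℕ → ℕ → K}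
    {l a b : ℕ} {am : ℕ → ℕ} {s : State} (ctx : KeyContext W Z key s)
    (hl : s.nvar xL = l) (hb : b ≤ l) (ht : TotallyMonotone key l)
    (ham : IsLeftmostMin key l a b am) (h : Levels l a b am 0 s) :
    Run W descendProg s (6000 * l + 4) (fun s' => ∃ t, Levels l a b am t s' ∧ l < 2 ^ t) := by
  have hroom' : 4 * l + 3 < Z := by
    have := ctx.room
    rw [hl] at this
    nlinarith
  have h1 := ctx.base
  have h2 := ctx.large
  refine Run.loop_frame (k₀ := 6000 * l) minimaVars [aCol, aLen, aRes] [] (by decide) (by decide)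
    (by decide) (fun s' k => ∃ t, Levels l a b am t s' ∧ 6000 * (l / 2 ^ t) ≤ k) ⟨0, h, by simp⟩ ?_
  rintro s1 k hf ⟨t, hI, hk⟩
  have ctx1 := ctx.frame hf (by decide) (by decide)
  have vL : s1.nvar xL = l := by rw [hf.nvar _ (by decide), hl]
  have hpow := hI.two_pow_le
  have hcur := hI.current_len
  refine ⟨?_, ?_, ?_⟩
  · simp [vL, hI.stride]
    omega
  · intro hlt
    simp [vL, hI.stride] at hlt
    have hm : 0 < l / 2 ^ t := Nat.div_pos hlt (Nat.two_pow_pos t)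
    have hm2 : l / 2 ^ (t + 1) = l / 2 ^ t / 2 := by rw [pow_succ, Nat.div_div_eq_div_mul]
    obtain ⟨m, hmm⟩ : ∃ m, l / 2 ^ t = m := ⟨_, rfl⟩
    rw [hmm] at hm hm2 hcur hk
    refine ⟨500 * (s1.A aLen t + 1) + 20, Run.seq (Run.mono ((reduceProg_run ctx1 vL hb ht ham
      (Nat.two_pow_pos t) hI.stride hI.level hI.le (by omega) hI.current).frame
      [xC, xFl, xTop, xSz, xRow, xI, xSrc, xDst, xLen] [aCol, aLen] [] (by decide) (by decide)
      (by decide)) le_rfl ?_)⟩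
    rintro s2 ⟨⟨e1, e2, e3, e4⟩, hf2⟩
    have vS : s2.nvar xS = 2 ^ t := by rw [hf2.nvar _ (by decide), hI.stride]
    have vT : s2.nvar xT = t := by rw [hf2.nvar _ (by decide), hI.level]
    obtain ⟨g1, g2, g3⟩ := hI.after_reduce e1 e2 e3 e4
    have := hI.le
    refine Run.of_wp_le ?_ (by decide)
    simp [vS, vT]
    refine ⟨by omega, by omega, k - (500 * (s1.A aLen t + 1) + 20 + 4), ?_, t + 1, ?_, ?_⟩
    · simp only [Test.cost, NExp.cost]
      omega
    · refine ⟨?_, ?_, g1.congr ?_ ?_, fun u hu => (g2 u hu).congr ?_ ?_, ?_, ?_⟩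
      · simp [pow_succ]
        omega
      · simp
      · simp
      · simp
      · simp
      · simp
      · simpa using g3
      · intro u hu
        rcases Nat.lt_succ_iff_lt_or_eq.1 hu with hu | rfl
        · exact hI.pow_le u hu
        · exact hlt
    · rw [hm2]
      omega
  · intro hlt
    simp [vL, hI.stride] at hlt
    exact ⟨t, hI, hlt⟩

/-- Since `l < 2 ^ t`, the bound on the reduced list leaves room for a single column, which must be
the minimum of row 0. -/
theorem topProg_run {K : Type*} [LinearOrder K] {W Z : ℕ} {key : ℕ → ℕ → K}
    {l a b t : ℕ} {am : ℕ → ℕ} {s : State} (ctx : KeyContext W Z key s)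
    (hl : s.nvar xL = l) (hb : b ≤ l) (ht : TotallyMonotone key l)
    (ham : IsLeftmostMin key l a b am) (hI : Levels l a b am t s) (hlt : l < 2 ^ t) :
    Run W topProg s 1600 (fun s' => Levels l a b am t s' ∧ s'.A aRes 0 = am 0) := by
  have hroom : (t + 1) * (l + 1) + (l + 1) < Z := by
    have := ctx.room
    have := hI.le
    rw [hl] at *
    nlinarith
  have hroom' : 4 * l + 3 < Z := by
    have := ctx.room
    rw [hl] at this
    nlinarith
  have h1 := ctx.base
  have h2 := ctx.large
  have hpow := hI.two_pow_le
  have hcur := hI.current_len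
  rw [Nat.div_eq_of_lt hlt] at hcur
  refine Run.mono (τ := 500 * (s.A aLen t + 1) + 50) (Run.seq (Run.mono ((reduceProg_run ctx hl hb
    ht ham (Nat.two_pow_pos t) hI.stride hI.level hI.le (by omega) hI.current).frame
    [xC, xFl, xTop, xSz, xRow, xI, xSrc, xDst, xLen] [aCol, aLen] [] (by decide) (by decide)
    (by decide)) le_rfl ?_)) (by omega) fun _ => id
  rintro s2 ⟨⟨e1, e2, e3, e4⟩, hf2⟩
  have vS : s2.nvar xS = 2 ^ t := by rw [hf2.nvar _ (by decide), hI.stride]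
  have vT : s2.nvar xT = t := by rw [hf2.nvar _ (by decide), hI.level]
  have vL : s2.nvar xL = l := by rw [hf2.nvar _ (by decide), hl]
  have v3 : s2.nvar 3 = s.nvar 3 := by rw [hf2.nvar _ (by decide)]
  obtain ⟨g1, g2, g3⟩ := hI.after_reduce e1 e2 e3 e4
  have hlen : s2.A aLen (t + 1) ≤ 1 := by
    by_contra hcon
    have : 2 * 2 ^ t ≤ s2.A aLen (t + 1) * 2 ^ t := Nat.mul_le_mul_right _ (by omega)
    omega
  obtain ⟨i, hi1, hi2⟩ := e1.mem 0 (Nat.zero_le l) (dvd_zero _)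
  obtain rfl : i = 0 := by omega
  have hamb := (ham.mem 0 (Nat.zero_le l)).2
  rw [add_zero] at hi2
  refine Run.of_wp_le ?_ (by decide)
  have hprod : (t + 1) * (l + 1) = t * (l + 1) + (l + 1) := by ring
  have hle := hI.le
  simp [vT, vL, v3, hi2]
  refine ⟨by omega, by omega, ?_⟩
  refine ⟨by simpa using vS, by simpa using vT, g1.congr ?_ ?_, fun u hu =>
    (g2 u (by omega)).congr ?_ ?_, ?_, hI.pow_le⟩
  · simp
  · simp
  · simp
  · simp
  · intro u hu
    simpa using g3 u (by omega)

/-- The credit is 2200 times the increase of `l / 2 ^ u` that is still to come. Each halving of the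
stride at least doubles this quotient, and its increase pays for the interpolation. Initially the
stride exceeds `l`, so row 0 is the only multiple. -/
theorem ascendProg_run {K : Type*} [LinearOrder K] {W Z : ℕ} {key : ℕ → ℕ → K}
    {l a b t : ℕ} {am : ℕ → ℕ} {s : State} (ctx : KeyContext W Z key s)
    (hl : s.nvar xL = l) (hb : b ≤ l) (ht : TotallyMonotone key l)
    (ham : IsLeftmostMin key l a b am) (hI : Levels l a b am t s) (hlt : l < 2 ^ t)
    (h0 : s.A aRes 0 = am 0) :
    Run W ascendProg s (2200 * l + 3) (fun s' => ∀ j ≤ l, s'.A aRes j = am j) := by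
  have hroom' : 4 * l + 3 < Z := by
    have := ctx.room
    rw [hl] at this
    nlinarith
  have h1 := ctx.base
  have h2 := ctx.large
  refine Run.loop_frame (k₀ := 2200 * l) minimaVars [aRes] [] (by decide) (by decide)
    (by decide) (fun s' k => ∃ u, Levels l a b am u s' ∧ (∀ j ≤ l, 2 ^ u ∣ j → s'.A aRes j = am j) ∧
      2200 * (l - l / 2 ^ u) ≤ k) ⟨t, hI, ?_,
      Nat.mul_le_mul_left _ (Nat.sub_le _ _)⟩ ?_
  · intro j hj hdj
    rw [Nat.eq_zero_of_dvd_of_lt hdj (by omega), h0]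
  rintro s1 k hf ⟨u, hI, hres, hk⟩
  have ctx1 := ctx.frame hf (by decide) (by decide)
  have vL : s1.nvar xL = l := by rw [hf.nvar _ (by decide), hl]
  have hpow := hI.two_pow_le
  refine ⟨?_, ?_, ?_⟩
  · simp [hI.level]
    have := hI.le
    omega
  · intro hlt
    simp [hI.level] at hlt
    obtain ⟨w, rfl⟩ : ∃ w, u = w + 1 := ⟨u - 1, by omega⟩
    have hm2 : l / 2 ^ (w + 1) = l / 2 ^ w / 2 := by rw [pow_succ, Nat.div_div_eq_div_mul]
    have hm0 : 0 < l / 2 ^ w := Nat.div_pos (hI.pow_le w (by omega)) (Nat.two_pow_pos w)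
    have hml : l / 2 ^ w ≤ l := Nat.div_le_self _ _
    have hlen := hI.len_le w (by omega)
    obtain ⟨m, hmm⟩ : ∃ m, l / 2 ^ w = m := ⟨_, rfl⟩
    rw [hm2] at hk
    rw [hmm] at hm0 hk hlen hml
    have hul := hI.le
    have hpw := hI.pow_le w (by omega)
    refine ⟨10 + 250 * (s1.A aLen (w + 1) + m + 1), Run.seq (Run.mono ((Run.of_wp_le
      (Q := fun s2 => s2.nvar xT = w ∧ s2.nvar xS = 2 ^ w) ?_ (by decide)).frame [xT, xS] [] []
      (by decide) (by decide) (by decide)) le_rfl ?_)⟩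
    · simp [hI.stride, hI.level, pow_succ]
      rw [pow_succ] at hpow
      omega
    rintro s2 ⟨⟨e1, e2⟩, hf2⟩
    have ctx2 := ctx1.frame hf2 (by decide) (by decide)
    have f1 := fun i => hf2.A aCol (by simp) (by simp) i
    have f2 := fun i => hf2.A aLen (by simp) (by simp) i
    have f3 := fun i => hf2.A aRes (by simp) (by simp) i
    have hrun := interpolateProg_run ctx2 (d := 2 ^ w) (t := w)
      (by rw [hf2.nvar _ (by decide), vL]) hb ht ham (Nat.two_pow_pos w) e2 e1 (by omega) hpw
      ((hI.lists w (by omega)).congr (f2 _) fun i _ => f1 i) (fun j hj hdj => by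
        rw [f3]
        refine hres j hj ?_
        rwa [pow_succ, mul_comm])
    rw [f2, hmm] at hrun
    refine (hrun.frame [xSrc, xLen, xPos, xJ, xBest, xEnd, xC] [aRes] [] (by decide) (by decide)
      (by decide)).mono le_rfl ?_
    rintro s3 ⟨hres', hf3⟩
    have g1 := fun i => (hf3.A aCol (by simp) (by simp) i).trans (f1 i)
    have g2 := fun i => (hf3.A aLen (by simp) (by simp) i).trans (f2 i)
    refine ⟨k - (10 + 250 * (s1.A aLen (w + 1) + m + 1) + 3), ?_, w, ?_, hres', ?_⟩
    · simp only [Test.cost, NExp.cost]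
      omega
    · refine ⟨?_, ?_, hI.bottom.congr (g2 _) fun i _ => g1 i, fun v hv =>
        (hI.lists v (by omega)).congr (g2 _) fun i _ => g1 i, fun v hv => ?_, fun v hv =>
        hI.pow_le v (by omega)⟩
      · rw [hf3.nvar _ (by decide), e2]
      · rw [hf3.nvar _ (by decide), e1]
      · rw [g2]
        exact hI.lens v (by omega)
    · rw [hmm]
      omega
  · intro hlt j hj
    simp [hI.level] at hlt
    subst hlt
    exact hres j hj (by simp)

theorem minimaProg_run {K : Type*} [LinearOrder K] {W Z : ℕ} {key : ℕ → ℕ → K}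
    {l a b : ℕ} {am : ℕ → ℕ} {s : State} (ctx : KeyContext W Z key s)
    (hl : s.nvar xL = l) (hb : b ≤ l) (hab : a ≤ b) (hA : s.nvar xA = a) (hB : s.nvar xB = b)
    (ht : TotallyMonotone key l) (ham : IsLeftmostMin key l a b am) :
    Run W minimaProg s (10000 * (l + 1)) (fun s' => ∀ j ≤ l, s'.A aRes j = am j) := by
  have nL : ∀ {s s' : State}, Frame minimaVars [aCol, aLen, aRes] [] s s' →
      s'.nvar xL = s.nvar xL := fun h => h.nvar _ (by decide)
  refine Run.mono (τ := 50 * (l + 2) + ((6000 * l + 4) + (1600 + (2200 * l + 3)))) ?_ (by omega)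
    fun _ => id
  refine Run.seq (((candidatesProg_run ctx hl hb hab hA hB ham).frame minimaVars
    [aCol, aLen, aRes] [] (by decide) (by decide) (by decide)).mono le_rfl ?_)
  rintro s1 ⟨⟨h1, h2, h3⟩, hf1⟩
  have ctx1 := ctx.frame hf1 (by decide) (by decide)
  have hl1 := (nL hf1).trans hl
  refine Run.seq (((descendProg_run ctx1 hl1 hb ht ham ⟨h2, h3, h1, fun u hu => by omega,
    fun u hu => by omega, fun u hu => by omega⟩).frame minimaVars
    [aCol, aLen, aRes] [] (by decide) (by decide) (by decide)).mono le_rfl ?_)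
  rintro s2 ⟨⟨t, h4, h5⟩, hf2⟩
  have ctx2 := ctx1.frame hf2 (by decide) (by decide)
  have hl2 := (nL hf2).trans hl1
  refine Run.seq (((topProg_run ctx2 hl2 hb ht ham h4 h5).frame minimaVars
    [aCol, aLen, aRes] [] (by decide) (by decide) (by decide)).mono le_rfl ?_)
  rintro s3 ⟨⟨h6, h7⟩, hf3⟩
  exact ascendProg_run (ctx2.frame hf3 (by decide) (by decide)) ((nL hf3).trans hl2) hb ht ham h6
    h5 h7

end RAM

/-! ### Distances in the dynamic programming grid -/

/-- The weights of the edges of a grid: vertical edges by row, horizontal edges by column, and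
diagonal edges. -/
structure GridCosts where
  del : ℕ → ℝ
  ins : ℕ → ℝ
  rep : ℕ → ℕ → ℝ

namespace GridCosts

variable (G : GridCosts)

/-- The weight of a lightest path from the vertex `(a, b)` to the vertex `(i, j)`. -/
noncomputable def dist (a b : ℕ) : ℕ → ℕ → WithTop ℝ
  | 0, 0 => if a = 0 ∧ b = 0 then 0 else ⊤
  | i + 1, 0 => if a = i + 1 ∧ b = 0 then 0 else dist a b i 0 + G.del i
  | 0, j + 1 => if a = 0 ∧ b = j + 1 then 0 else dist a b 0 j + G.ins j
  | i + 1, j + 1 => if a = i + 1 ∧ b = j + 1 then 0 else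
      min (dist a b i (j + 1) + G.del i)
        (min (dist a b (i + 1) j + G.ins j) (dist a b i j + G.rep i j))

theorem dist_eq_top {a b : ℕ} : ∀ {i j : ℕ}, ¬ (a ≤ i ∧ b ≤ j) → G.dist a b i j = ⊤
  | 0, 0, h => by rw [dist, if_neg (by omega)]
  | i + 1, 0, h => by rw [dist, if_neg (by omega), dist_eq_top (by omega), top_add]
  | 0, j + 1, h => by rw [dist, if_neg (by omega), dist_eq_top (by omega), top_add]
  | i + 1, j + 1, h => by
    rw [dist, if_neg (by omega), dist_eq_top (i := i) (j := j + 1) (by omega),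
      dist_eq_top (i := i + 1) (j := j) (by omega), dist_eq_top (i := i) (j := j) (by omega)]
    simp

@[simp] theorem dist_self (i j : ℕ) : G.dist i j i j = 0 := by
  rcases i with _ | i <;> rcases j with _ | j <;> simp [dist]

theorem dist_del_le (a b i j : ℕ) : G.dist a b (i + 1) j ≤ G.dist a b i j + G.del i := by
  by_cases h : a = i + 1 ∧ b = j
  · rw [G.dist_eq_top (i := i) (by omega), top_add]
    exact le_top
  · rcases j with _ | j
    · rw [dist, if_neg h]
    · rw [dist, if_neg h]
      exact min_le_left _ _

theorem dist_ins_le (a b i j : ℕ) : G.dist a b i (j + 1) ≤ G.dist a b i j + G.ins j := by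
  by_cases h : a = i ∧ b = j + 1
  · rw [G.dist_eq_top (j := j) (by omega), top_add]
    exact le_top
  · rcases i with _ | i
    · rw [dist, if_neg h]
    · rw [dist, if_neg h]
      exact (min_le_right _ _).trans (min_le_left _ _)

theorem dist_rep_le (a b i j : ℕ) :
    G.dist a b (i + 1) (j + 1) ≤ G.dist a b i j + G.rep i j := by
  by_cases h : a = i + 1 ∧ b = j + 1
  · rw [G.dist_eq_top (j := j) (by omega), top_add]
    exact le_top
  · rw [dist, if_neg h]
    exact (min_le_right _ _).trans (min_le_right _ _)

/-- The last edge of a lightest path. -/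
theorem dist_cases {a b i j : ℕ} (hne : ¬ (a = i ∧ b = j)) (h : G.dist a b i j ≠ ⊤) :
    (∃ i', i = i' + 1 ∧ G.dist a b i j = G.dist a b i' j + G.del i') ∨
    (∃ j', j = j' + 1 ∧ G.dist a b i j = G.dist a b i j' + G.ins j') ∨
    ∃ i' j', i = i' + 1 ∧ j = j' + 1 ∧ G.dist a b i j = G.dist a b i' j' + G.rep i' j' := by
  rcases i with _ | i <;> rcases j with _ | j
  · rw [dist, if_neg hne] at h
    exact absurd rfl h
  · exact Or.inr (Or.inl ⟨j, rfl, by rw [dist, if_neg hne]⟩)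
  · exact Or.inl ⟨i, rfl, by rw [dist, if_neg hne]⟩
  · have he : G.dist a b (i + 1) (j + 1) = min (G.dist a b i (j + 1) + G.del i)
        (min (G.dist a b (i + 1) j + G.ins j) (G.dist a b i j + G.rep i j)) := by
      rw [dist, if_neg hne]
    rcases min_choice (G.dist a b i (j + 1) + G.del i)
      (min (G.dist a b (i + 1) j + G.ins j) (G.dist a b i j + G.rep i j)) with h1 | h1
    · exact Or.inl ⟨i, rfl, he.trans h1⟩
    · rcases min_choice (G.dist a b (i + 1) j + G.ins j) (G.dist a b i j + G.rep i j) with h2 | h2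
      · exact Or.inr (Or.inl ⟨j, rfl, he.trans (h1.trans h2)⟩)
      · exact Or.inr (Or.inr ⟨i, j, rfl, rfl, he.trans (h1.trans h2)⟩)

theorem dist_ne_top {a b i j : ℕ} (hi : a ≤ i) (hj : b ≤ j) : G.dist a b i j ≠ ⊤ := by
  induction i with
  | zero =>
    induction j with
    | zero =>
      obtain rfl : a = 0 := by omega
      obtain rfl : b = 0 := by omega
      simp
    | succ j ih =>
      by_cases h : b = j + 1
      · subst h
        obtain rfl : a = 0 := by omega
        simp
      · exact ne_top_of_le_ne_top (WithTop.add_ne_top.2 ⟨ih (by omega), WithTop.coe_ne_top⟩)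
          (G.dist_ins_le a b 0 j)
  | succ i ih =>
    by_cases h : a = i + 1
    · subst h
      clear ih
      induction j with
      | zero =>
        obtain rfl : b = 0 := by omega
        simp
      | succ j ih =>
        by_cases h : b = j + 1
        · subst h
          simp
        · exact ne_top_of_le_ne_top (WithTop.add_ne_top.2 ⟨ih (by omega), WithTop.coe_ne_top⟩)
            (G.dist_ins_le (i + 1) b (i + 1) j)
    · exact ne_top_of_le_ne_top (WithTop.add_ne_top.2 ⟨ih (by omega), WithTop.coe_ne_top⟩)
        (G.dist_del_le a b i j)

theorem dist_ne_top_iff {a b i j : ℕ} : G.dist a b i j ≠ ⊤ ↔ a ≤ i ∧ b ≤ j :=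
  ⟨fun h => by_contra fun h' => h (G.dist_eq_top h'), fun h => G.dist_ne_top h.1 h.2⟩

/-- Induction along the second path, removing its last edge. The sign of the weights plays no role.
-/
theorem dist_triangle (a b u v i j : ℕ) :
    G.dist a b i j ≤ G.dist a b u v + G.dist u v i j := by
  by_cases htop : G.dist u v i j = ⊤
  · rw [htop, add_top]
    exact le_top
  induction hn : i + j using Nat.strong_induction_on generalizing i j with
  | _ n ih =>
    by_cases hne : u = i ∧ v = j
    · obtain ⟨rfl, rfl⟩ := hne
      simp
    · rcases G.dist_cases hne htop with ⟨i, rfl, he⟩ | ⟨j, rfl, he⟩ | ⟨i, j, rfl, rfl, he⟩ <;>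
        rw [he] at htop ⊢ <;> have ht := (WithTop.add_ne_top.1 htop).1 <;> rw [← add_assoc]
      · exact (G.dist_del_le a b i j).trans (add_le_add_left (ih _ (by omega) i j ht rfl) _)
      · exact (G.dist_ins_le a b i j).trans (add_le_add_left (ih _ (by omega) i j ht rfl) _)
      · exact (G.dist_rep_le a b i j).trans (add_le_add_left (ih _ (by omega) i j ht rfl) _)

/-- A path that ends in the quadrant below and to the right of `(r, c)` and does not start in its
interior passes through its boundary. -/
theorem exists_boundary {a b r c : ℕ} (hs : a ≤ r ∨ b ≤ c) {i j : ℕ} (hi : r ≤ i) (hj : c ≤ j)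
    (htop : G.dist a b i j ≠ ⊤) : ∃ u v, ((u = r ∧ c ≤ v) ∨ (r ≤ u ∧ v = c)) ∧ u ≤ i ∧ v ≤ j ∧
      G.dist a b i j = G.dist a b u v + G.dist u v i j := by
  induction hn : i + j using Nat.strong_induction_on generalizing i j with
  | _ n ih =>
    by_cases hb : i = r ∨ j = c
    · exact ⟨i, j, by omega, le_rfl, le_rfl, by simp⟩
    -- Remove the last edge, find the boundary vertex of the shorter path by induction, and append
    -- the edge again. The triangle inequality gives the other direction, so no path is ever
    -- constructed.
    have key : ∀ i' j' (w : ℝ), r ≤ i' → c ≤ j' → i' ≤ i → j' ≤ j → i' + j' < n →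
        G.dist a b i j = G.dist a b i' j' + w →
        (∀ u v, G.dist u v i j ≤ G.dist u v i' j' + w) →
        ∃ u v, ((u = r ∧ c ≤ v) ∨ (r ≤ u ∧ v = c)) ∧ u ≤ i ∧ v ≤ j ∧
          G.dist a b i j = G.dist a b u v + G.dist u v i j := by
      intro i' j' w h1 h2 h3 h4 h5 he hle
      rw [he] at htop
      obtain ⟨u, v, g1, g2, g3, g4⟩ := ih _ h5 h1 h2 (WithTop.add_ne_top.1 htop).1 rfl
      refine ⟨u, v, g1, g2.trans h3, g3.trans h4, le_antisymm (G.dist_triangle a b u v i j) ?_⟩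
      rw [he, g4, add_assoc]
      exact add_le_add_right (hle u v) _
    rcases G.dist_cases (by omega) htop with ⟨i, rfl, he⟩ | ⟨j, rfl, he⟩ | ⟨i, j, rfl, rfl, he⟩
    · exact key i j _ (by omega) (by omega) (by omega) (by omega) (by omega) he
        fun u v => G.dist_del_le u v i j
    · exact key i j _ (by omega) (by omega) (by omega) (by omega) (by omega) he
        fun u v => G.dist_ins_le u v i j
    · exact key i j _ (by omega) (by omega) (by omega) (by omega) (by omega) he
        fun u v => G.dist_rep_le u v i j

/-- Crossing paths can be exchanged: the distances between two monotone staircases form a Monge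
matrix. -/
theorem dist_monge {a b a' b' i j i' j' : ℕ} (ha : a' ≤ a) (hb : b ≤ b') (hi : i' ≤ i)
    (hj : j ≤ j') : G.dist a b i j + G.dist a' b' i' j' ≤
      G.dist a b i' j' + G.dist a' b' i j := by
  by_cases ht : G.dist a b i' j' = ⊤
  · rw [ht, top_add]
    exact le_top
  by_cases ht' : G.dist a' b' i j = ⊤
  · rw [ht', add_top]
    exact le_top
  induction hn : i + j + i' + j' using Nat.strong_induction_on generalizing i j i' j' with
  | _ n ih =>
    have h1 := G.dist_ne_top_iff.1 ht
    have h2 := G.dist_ne_top_iff.1 ht'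
    -- Instead of intersecting two paths, the last edge of one of the crossing paths is removed. If
    -- the targets differ in their column, the target at the upper right is moved back, otherwise
    -- the one at the lower left. Neither move takes a target past the other, and when the targets
    -- coincide the two sides agree.
    by_cases hjj : j = j'
    · by_cases hii : i = i'
      · subst hjj hii
        rfl
      have key : ∀ k l (w : ℝ), i' ≤ k → l ≤ j' → k + l + i' + j' < n →
          G.dist a' b' i j = G.dist a' b' k l + w → G.dist a b i j ≤ G.dist a b k l + w →
          G.dist a b i j + G.dist a' b' i' j' ≤ G.dist a b i' j' + G.dist a' b' i j := by
        intro k l w g1 g2 g3 he hle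
        rw [he] at ht' ⊢
        have := ih _ g3 g1 g2 ht (WithTop.add_ne_top.1 ht').1 rfl
        calc G.dist a b i j + G.dist a' b' i' j' ≤
            G.dist a b k l + w + G.dist a' b' i' j' := add_le_add_left hle _
          _ = G.dist a b k l + G.dist a' b' i' j' + w := add_right_comm _ _ _
          _ ≤ G.dist a b i' j' + G.dist a' b' k l + w := add_le_add_left this _
          _ = _ := add_assoc _ _ _
      rcases G.dist_cases (by omega) ht' with ⟨k, rfl, he⟩ | ⟨l, rfl, he⟩ | ⟨k, l, rfl, rfl, he⟩
      · exact key k j _ (by omega) (by omega) (by omega) he (G.dist_del_le _ _ _ _)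
      · exact key i l _ (by omega) (by omega) (by omega) he (G.dist_ins_le _ _ _ _)
      · exact key k l _ (by omega) (by omega) (by omega) he (G.dist_rep_le _ _ _ _)
    · have key : ∀ k l (w : ℝ), k ≤ i → j ≤ l → i + j + k + l < n →
          G.dist a b i' j' = G.dist a b k l + w → G.dist a' b' i' j' ≤ G.dist a' b' k l + w →
          G.dist a b i j + G.dist a' b' i' j' ≤ G.dist a b i' j' + G.dist a' b' i j := by
        intro k l w g1 g2 g3 he hle
        rw [he] at ht ⊢
        have := ih _ g3 g1 g2 (WithTop.add_ne_top.1 ht).1 ht' rfl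
        calc G.dist a b i j + G.dist a' b' i' j' ≤
            G.dist a b i j + (G.dist a' b' k l + w) := add_le_add_right hle _
          _ = G.dist a b i j + G.dist a' b' k l + w := (add_assoc _ _ _).symm
          _ ≤ G.dist a b k l + G.dist a' b' i j + w := add_le_add_left this _
          _ = _ := add_right_comm _ _ _
      rcases G.dist_cases (by omega) ht with ⟨k, rfl, he⟩ | ⟨l, rfl, he⟩ | ⟨k, l, rfl, rfl, he⟩
      · exact key k j' _ (by omega) (by omega) (by omega) he (G.dist_del_le _ _ _ _)
      · exact key i' l _ (by omega) (by omega) (by omega) he (G.dist_ins_le _ _ _ _)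
      · exact key k l _ (by omega) (by omega) (by omega) he (G.dist_rep_le _ _ _ _)

/-- The part of the grid `G` with `p` rows and `q` columns below and to the right of `(r, c)` looks
like `H`. -/
structure Looks (G H : GridCosts) (r c p q : ℕ) : Prop where
  del : ∀ i < p, G.del (r + i) = H.del i
  ins : ∀ j < q, G.ins (c + j) = H.ins j
  rep : ∀ i < p, ∀ j < q, G.rep (r + i) (c + j) = H.rep i j

/-- Both distances obey the same recursion inside the window. A path between two vertices of the
window cannot leave it, because paths only go down and to the right. -/
theorem Looks.dist_eq {G H : GridCosts} {r c p q : ℕ} (h : Looks G H r c p q) (a b : ℕ) :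
    ∀ i ≤ p, ∀ j ≤ q, G.dist (r + a) (c + b) (r + i) (c + j) = H.dist a b i j := by
  have htop : ∀ i j, ¬ (a ≤ i ∧ b ≤ j) →
      G.dist (r + a) (c + b) (r + i) (c + j) = H.dist a b i j := by
    intro i j hij
    rw [H.dist_eq_top hij, G.dist_eq_top (by omega)]
  have hle : ∀ n i j, i + j = n → i ≤ p → j ≤ q →
      G.dist (r + a) (c + b) (r + i) (c + j) = H.dist a b i j := by
    intro n
    induction n using Nat.strong_induction_on with
    | _ n ih =>
      intro i j hn hi hj
      by_cases hab : a ≤ i ∧ b ≤ j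
      · by_cases hne : a = i ∧ b = j
        · obtain ⟨rfl, rfl⟩ := hne
          simp
        apply le_antisymm
        · rcases H.dist_cases hne (H.dist_ne_top hab.1 hab.2) with
            ⟨i, rfl, he⟩ | ⟨j, rfl, he⟩ | ⟨i, j, rfl, rfl, he⟩ <;> rw [he]
          · rw [← ih _ (by omega) i j rfl (by omega) hj, ← h.del i (by omega)]
            exact G.dist_del_le _ _ _ _
          · rw [← ih _ (by omega) i j rfl hi (by omega), ← h.ins j (by omega)]
            exact G.dist_ins_le _ _ _ _
          · rw [← ih _ (by omega) i j rfl (by omega) (by omega), ← h.rep i (by omega) j (by omega)]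
            exact G.dist_rep_le _ _ _ _
        · have hnt : G.dist (r + a) (c + b) (r + i) (c + j) ≠ ⊤ :=
            G.dist_ne_top (by omega) (by omega)
          rcases G.dist_cases (by omega) hnt with
            ⟨i', hi', he⟩ | ⟨j', hj', he⟩ | ⟨i', j', hi', hj', he⟩ <;> rw [he] at hnt ⊢ <;>
            have hnt' := G.dist_ne_top_iff.1 (WithTop.add_ne_top.1 hnt).1
          · obtain ⟨i, rfl⟩ : ∃ k, i = k + 1 := ⟨i - 1, by omega⟩
            obtain rfl : i' = r + i := by omega
            rw [ih _ (by omega) i j rfl (by omega) hj, h.del i (by omega)]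
            exact H.dist_del_le _ _ _ _
          · obtain ⟨j, rfl⟩ : ∃ k, j = k + 1 := ⟨j - 1, by omega⟩
            obtain rfl : j' = c + j := by omega
            rw [ih _ (by omega) i j rfl hi (by omega), h.ins j (by omega)]
            exact H.dist_ins_le _ _ _ _
          · obtain ⟨i, rfl⟩ : ∃ k, i = k + 1 := ⟨i - 1, by omega⟩
            obtain ⟨j, rfl⟩ : ∃ k, j = k + 1 := ⟨j - 1, by omega⟩
            obtain rfl : i' = r + i := by omega
            obtain rfl : j' = c + j := by omega
            rw [ih _ (by omega) i j rfl (by omega) (by omega), h.rep i (by omega) j (by omega)]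
            exact H.dist_rep_le _ _ _ _
      · exact htop i j hab
  exact fun i hi j hj => hle _ i j rfl hi hj

end GridCosts

/-! ### The grid of two strings -/

namespace Scoring

/-- The grid of the dynamic program for two strings. -/
noncomputable def grid {α : Type} (C : Scoring α) (A B : List α) : GridCosts where
  del := C.deleteAt A
  ins := C.insertAt B
  rep := C.replaceAt A B

/-- From the origin the recursion for the distance is literally that of the dynamic program, and
every entry is finite. -/
theorem grid_dist_zero {α : Type} (C : Scoring α) (A B : List α) :
    ∀ i j, (C.grid A B).dist 0 0 i j = (C.table A B i j : WithTop ℝ)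
  | 0, 0 => by simp [table]
  | i + 1, 0 => by
    rw [GridCosts.dist, if_neg (by omega), grid_dist_zero C A B i 0, table]
    rfl
  | 0, j + 1 => by
    rw [GridCosts.dist, if_neg (by omega), grid_dist_zero C A B 0 j, table]
    rfl
  | i + 1, j + 1 => by
    rw [GridCosts.dist, if_neg (by omega), grid_dist_zero C A B i (j + 1),
      grid_dist_zero C A B (i + 1) j, grid_dist_zero C A B i j, table]
    rfl

/-- The weights inside a block depend only on the two factors that meet there, so one table serves
all occurrences of a pair of blocks. -/
theorem grid_looks {α : Type} (C : Scoring α) (A₁ X A₂ B₁ Y B₂ : List α) :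
    (C.grid (A₁ ++ X ++ A₂) (B₁ ++ Y ++ B₂)).Looks (C.grid X Y) A₁.length B₁.length X.length
      Y.length where
  del i hi := by
    have : A₁.length + i < (A₁ ++ X ++ A₂).length := by simp; omega
    simp only [grid, deleteAt, this, hi, dif_pos]
    congr 1
    rw [List.getElem_append_left (by simp; omega), List.getElem_append_right (by omega)]
    simp
  ins j hj := by
    have : B₁.length + j < (B₁ ++ Y ++ B₂).length := by simp; omega
    simp only [grid, insertAt, this, hj, dif_pos]
    congr 1
    rw [List.getElem_append_left (by simp; omega), List.getElem_append_right (by omega)]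
    simp
  rep i hi j hj := by
    have h1 : A₁.length + i < (A₁ ++ X ++ A₂).length := by simp; omega
    have h2 : B₁.length + j < (B₁ ++ Y ++ B₂).length := by simp; omega
    simp only [grid, replaceAt, h1, h2, hi, hj, and_self, dif_pos]
    congr 1
    · rw [List.getElem_append_left (by simp; omega), List.getElem_append_right (by omega)]
      simp
    · rw [List.getElem_append_left (by simp; omega), List.getElem_append_right (by omega)]
      simp

end Scoring

/-! ### Distances across a block -/

namespace RAM

theorem exists_isLeftmostMin {K : Type*} [LinearOrder K] (key : ℕ → ℕ → K) (l : ℕ) {a b : ℕ}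
    (hab : a ≤ b) : ∃ am, IsLeftmostMin key l a b am := by
  have h : ∀ j, ∃ c, (a ≤ c ∧ c ≤ b) ∧ ∀ c', a ≤ c' → c' ≤ b → key j c ≤ key j c' := by
    intro j
    obtain ⟨c, hc, hmin⟩ := Finset.exists_min_image (Finset.Icc a b) (key j) ⟨a, by simp [hab]⟩
    exact ⟨c, Finset.mem_Icc.1 hc, fun c' h1 h2 => hmin c' (Finset.mem_Icc.2 ⟨h1, h2⟩)⟩
  classical
  refine ⟨fun j => Nat.find (h j), fun j _ => (Nat.find_spec (h j)).1, fun j _ c hc hlt => ?_,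
    fun j _ c h1 h2 => (Nat.find_spec (h j)).2 c h1 h2⟩
  have hspec := Nat.find_spec (h j)
  by_contra hcon
  exact Nat.find_min (h j) hlt ⟨⟨hc, by omega⟩, fun c' h1 h2 =>
    (not_lt.1 hcon).trans (hspec.2 c' h1 h2)⟩

/-- The candidates for an output, ordered first by how far they are from reaching it, then by
value. -/
noncomputable def bandKey (p q : ℕ) (w : ℕ → ℝ) (D : ℕ → ℕ → ℝ) (j i : ℕ) : ℕ ×ₗ ℝ :=
  toLex ((j - (i + q)) + (i - (j + p)), if j ≤ i + q ∧ i ≤ j + p then w i + D i j else 0)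

/-- If `i` is too small to reach `j`, then the larger `i'` is closer to the band or inside it; it
cannot be beyond the band, as `i` and `i'` would then be more than `p + q` apart. Otherwise `i'`
wins only inside the band, where `i` lies too and the values decide. The right-hand side is the test
made by the machine. -/
theorem bandKey_lt_iff {p q : ℕ} {w : ℕ → ℝ} {D : ℕ → ℕ → ℝ} {i i' j : ℕ} (hi : i < i')
    (hi' : i' ≤ p + q) : bandKey p q w D j i' < bandKey p q w D j i ↔
      q + i < j ∨ (i' ≤ j + p ∧ w i' + D i' j < w i + D i j) := by
  rw [bandKey, bandKey, Prod.Lex.toLex_lt_toLex]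
  by_cases h1 : q + i < j
  · simp only [h1, true_or, iff_true]
    left
    omega
  · by_cases h2 : i' ≤ j + p
    · have h3 : j ≤ i' + q ∧ i' ≤ j + p := by omega
      have h4 : j ≤ i + q ∧ i ≤ j + p := by omega
      rw [if_pos h3, if_pos h4]
      simp only [h1, h2, false_or, true_and]
      constructor
      · rintro (h | h)
        · omega
        · exact h.2
      · exact fun h => Or.inr ⟨by omega, h⟩
    · simp only [h1, h2, false_or, false_and, iff_false, not_or, not_and]
      constructor <;> omega

/-- The Monge inequality is available only where all four distances are finite. When the later
output is out of reach for `i`, then `i'` wins by the first component of the key. In the remaining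
case all four pairs lie in the band. -/
theorem bandKey_totallyMonotone {p q : ℕ} {w : ℕ → ℝ} {D : ℕ → ℕ → ℝ}
    (hD : ∀ i i' j j', i < i' → j < j' → i' ≤ p + q → j' ≤ p + q → i' ≤ j + p → j' ≤ i + q →
      D i j + D i' j' ≤ D i j' + D i' j) : TotallyMonotone (bandKey p q w D) (p + q) := by
  intro i i' j j' hi hi' hj hj' h
  rcases eq_or_lt_of_le hj with rfl | hj
  · exact h
  rw [bandKey_lt_iff hi hi'] at h ⊢
  by_cases h1 : q + i < j'
  · exact Or.inl h1
  · rcases h with h | ⟨h2, h3⟩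
    · omega
    · have := hD i i' j j' hi hj hi' hj' h2 (by omega)
      exact Or.inr ⟨by omega, by linarith⟩

end RAM

/-! ### The boundary of a block and the distances across it -/

/-- The row of the `i`-th vertex on the left and upper side of a block, from the lower left to the
upper right corner; the block has `p` rows below row `r`. -/
def inRow (r p i : ℕ) : ℕ := r + (p - i)

/-- The column of the `i`-th vertex on the left and upper side of a block. -/
def inCol (c p i : ℕ) : ℕ := c + (i - p)

/-- The row of the `j`-th vertex on the lower and right side of a block. -/
def outRow (r p q j : ℕ) : ℕ := r + min p (p + q - j)

/-- The column of the `j`-th vertex on the lower and right side of a block. -/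
def outCol (c q j : ℕ) : ℕ := c + min j q

/-- The vector `w` and the table `D` hold lengths of paths from the source `(x, y)` to the upper left
side of a block, among them sufficiently many shortest ones, and the distances across the block. -/
structure BlockData (G : GridCosts) (x y r c p q : ℕ) (w : ℕ → ℝ) (D : ℕ → ℕ → ℝ) (a b : ℕ) :
    Prop where
  src : x ≤ r ∨ y ≤ c
  vec : ∀ i ≤ p + q, a ≤ i → i ≤ b → G.dist x y (inRow r p i) (inCol c p i) ≤ (w i : WithTop ℝ)
  base : ∀ i ≤ p + q, G.dist x y (inRow r p i) (inCol c p i) ≠ ⊤ → ∃ i' ≤ p + q, a ≤ i' ∧ i' ≤ b ∧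
    G.dist x y (inRow r p i) (inCol c p i) = (w i' : WithTop ℝ) +
      G.dist (inRow r p i') (inCol c p i') (inRow r p i) (inCol c p i)
  tab : ∀ i ≤ p + q, ∀ j ≤ p + q, j ≤ i + q → i ≤ j + p → (D i j : WithTop ℝ) =
    G.dist (inRow r p i) (inCol c p i) (outRow r p q j) (outCol c q j)

namespace BlockData

variable {G : GridCosts} {x y r c p q : ℕ} {w : ℕ → ℝ} {D : ℕ → ℕ → ℝ} {a b : ℕ}

/-- Inputs and outputs are numbered along the diagonals, so input `k` and output `k` lie on the same
diagonal and reachability becomes a band condition. -/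
theorem in_le_out {i j : ℕ} (hi : i ≤ p + q) (hj : j ≤ p + q) :
    (inRow r p i ≤ outRow r p q j ∧ inCol c p i ≤ outCol c q j) ↔ j ≤ i + q ∧ i ≤ j + p := by
  unfold inRow inCol outRow outCol
  omega

/-- A shortest path to an output passes through some input, and by `base` the distance of that input
is realised through an input of the window. The triangle inequality moves the remainder of the path
to the latter, while `vec` shows that no candidate is too small. -/
theorem exists_in (h : BlockData G x y r c p q w D a b) {j : ℕ} (hj : j ≤ p + q)
    (hne : G.dist x y (outRow r p q j) (outCol c q j) ≠ ⊤) :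
    ∃ i ≤ p + q, a ≤ i ∧ i ≤ b ∧ j ≤ i + q ∧ i ≤ j + p ∧
      G.dist x y (outRow r p q j) (outCol c q j) = ((w i + D i j : ℝ) : WithTop ℝ) := by
  have hr : r ≤ outRow r p q j := Nat.le_add_right r _
  have hc : c ≤ outCol c q j := Nat.le_add_right c _
  obtain ⟨u, v, h1, h2, h3, h4⟩ := G.exists_boundary h.src hr hc hne
  obtain ⟨i, hi, rfl, rfl⟩ : ∃ i ≤ p + q, u = inRow r p i ∧ v = inCol c p i := by
    unfold outRow at h2
    unfold outCol at h3
    clear h4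
    rcases h1 with ⟨rfl, h1⟩ | ⟨h1, rfl⟩
    · exact ⟨p + (v - c), by omega, by unfold inRow; omega, by unfold inCol; omega⟩
    · exact ⟨p - (u - r), by omega, by unfold inRow; omega, by unfold inCol; omega⟩
  have h5 : G.dist x y (inRow r p i) (inCol c p i) ≠ ⊤ := fun h5 => by
    rw [h5, top_add] at h4
    exact hne h4
  obtain ⟨i', hi', ha, hb, h6⟩ := h.base i hi h5
  have h7 : (w i' : WithTop ℝ) + G.dist (inRow r p i') (inCol c p i') (outRow r p q j)
      (outCol c q j) ≤ G.dist x y (outRow r p q j) (outCol c q j) := by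
    rw [h4, h6, add_assoc]
    gcongr
    exact G.dist_triangle ..
  have h8 : G.dist (inRow r p i') (inCol c p i') (outRow r p q j) (outCol c q j) ≠ ⊤ := fun h8 => by
    rw [h8, add_top, top_le_iff] at h7
    exact hne h7
  have hband := (in_le_out hi' hj).1 (G.dist_ne_top_iff.1 h8)
  rw [← h.tab i' hi' j hj hband.1 hband.2] at h7
  refine ⟨i', hi', ha, hb, hband.1, hband.2, le_antisymm ?_ h7⟩
  refine (G.dist_triangle x y (inRow r p i') (inCol c p i') _ _).trans ?_
  rw [← h.tab i' hi' j hj hband.1 hband.2]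
  push_cast
  gcongr
  exact h.vec i' hi' ha hb

/-- The band is an interval for each output, so the outputs reached from an interval of inputs form
an interval again. This is what allows the support of the vector to be described by two numbers. -/
theorem out_ne_top_iff (h : BlockData G x y r c p q w D a b) (hab : a ≤ b) (hb : b ≤ p + q) {j : ℕ}
    (hj : j ≤ p + q) :
    G.dist x y (outRow r p q j) (outCol c q j) ≠ ⊤ ↔ a ≤ j + p ∧ j ≤ b + q := by
  constructor
  · intro hne
    obtain ⟨i, hi, h1, h2, h3, h4, -⟩ := h.exists_in hj hne
    omega
  · rintro ⟨h1, h2⟩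
    -- The input closest to the diagonal of the output: `j` clamped to the interval from `a` to `b`.
    obtain ⟨i, hi1, hi2, hi3, hi4⟩ : ∃ i, a ≤ i ∧ i ≤ b ∧ j ≤ i + q ∧ i ≤ j + p :=
      ⟨max a (min b j), by omega, by omega, by omega, by omega⟩
    have h3 := (in_le_out (r := r) (c := c) (by omega) hj).2 ⟨hi3, hi4⟩
    have h4 : G.dist x y (inRow r p i) (inCol c p i) ≠ ⊤ := fun h4 => by
      have := h.vec i (by omega) hi1 hi2
      rw [h4, top_le_iff] at this
      exact WithTop.coe_ne_top this
    rw [GridCosts.dist_ne_top_iff] at h4 ⊢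
    exact ⟨h4.1.trans h3.1, h4.2.trans h3.2⟩

/-- If the output is reachable, some candidate has first component 0, so the chosen one is in the
band too, and then the second component is minimised. An output without a chosen input in its band
is unreachable, and the machine leaves its value alone. -/
theorem minimum (h : BlockData G x y r c p q w D a b) (hab : a ≤ b) (hb : b ≤ p + q)
    {am : ℕ → ℕ} (ham : RAM.IsLeftmostMin (RAM.bandKey p q w D) (p + q) a b am) {j : ℕ}
    (hj : j ≤ p + q) :
    ((j ≤ am j + q ∧ am j ≤ j + p) ↔ a ≤ j + p ∧ j ≤ b + q) ∧
    (j ≤ am j + q → am j ≤ j + p → ((w (am j) + D (am j) j : ℝ) : WithTop ℝ) =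
      G.dist x y (outRow r p q j) (outCol c q j)) := by
  have hm := ham.mem j hj
  have hle : a ≤ j + p ∧ j ≤ b + q → (j ≤ am j + q ∧ am j ≤ j + p) ∧
      ((w (am j) + D (am j) j : ℝ) : WithTop ℝ) ≤
        G.dist x y (outRow r p q j) (outCol c q j) := by
    intro hr
    obtain ⟨i, hi, h1, h2, h3, h4, h5⟩ := h.exists_in hj ((h.out_ne_top_iff hab hb hj).2 hr)
    have h6 := ham.min j hj i h1 h2
    rw [RAM.bandKey, RAM.bandKey, Prod.Lex.toLex_le_toLex] at h6
    have h7 : j ≤ am j + q ∧ am j ≤ j + p := by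
      rcases h6 with h6 | h6
      · simp only at h6
        omega
      · have := h6.1
        simp only at this
        omega
    rw [if_pos h7, if_pos ⟨h3, h4⟩] at h6
    refine ⟨h7, ?_⟩
    rcases h6 with h6 | h6
    · simp only at h6
      omega
    · rw [h5]
      exact WithTop.coe_le_coe.2 h6.2
  refine ⟨⟨fun h' => by omega, fun hr => (hle hr).1⟩, fun h1 h2 => ?_⟩
  refine le_antisymm (hle (by omega)).2 ?_
  have hmem := ham.mem j hj
  refine (G.dist_triangle x y (inRow r p (am j)) (inCol c p (am j)) _ _).trans ?_
  rw [← h.tab _ (by omega) j hj h1 h2]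
  push_cast
  gcongr
  exact h.vec _ (by omega) hmem.1 hmem.2

/-- A larger index means further up and to the right, both for inputs and for outputs, so this is
the exchange inequality for pairs in the band. -/
theorem totallyMonotone (h : BlockData G x y r c p q w D a b) :
    RAM.TotallyMonotone (RAM.bandKey p q w D) (p + q) := by
  refine RAM.bandKey_totallyMonotone fun i i' j j' h1 h2 h3 h4 h5 h6 => ?_
  have := G.dist_monge (a := inRow r p i) (b := inCol c p i) (a' := inRow r p i')
    (b' := inCol c p i') (i := outRow r p q j) (j := outCol c q j) (i' := outRow r p q j')
    (j' := outCol c q j') (by unfold inRow; omega) (by unfold inCol; omega)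
    (by unfold outRow; omega) (by unfold outCol; omega)
  rw [← h.tab i (by omega) j (by omega) (by omega) (by omega),
    ← h.tab i' (by omega) j' (by omega) (by omega) (by omega),
    ← h.tab i (by omega) j' (by omega) (by omega) (by omega),
    ← h.tab i' (by omega) j (by omega) (by omega) (by omega)] at this
  exact_mod_cast this

end BlockData

/-! ### Propagation of a vector across a block -/

namespace RAM

/-- The part of the support of the vector inside the block. -/
def windowProg : Prog :=
  .ite (.nlt ↟xLo ↟xE) (.nset xA ♯0) (.nset xA (↟xLo - ↟xE)) ;;
  .ite (.nlt (↟xE + ↟xL) ↟xHi) (.nset xB ↟xL) (.nset xB (↟xHi - ↟xE)) ;; .nset xJ ♯0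

/-- The chosen input `xC` reaches the output `xJ`. -/
def bandTest : Test :=
  .conj (.neg (.nlt (↟xJ + ↟xP) ↟xC)) (.neg (.nlt (↟xC + ↟xQ) ↟xJ))

/-- The new values go to a separate array, because an entry of the vector may still be needed as an
input of later outputs; a second loop copies them back. -/
def valuesBody : Prog :=
  .nset xC (.ld aRes ↟xJ) ;; .ite bandTest (.stb bTmp ↟xJ (candExp ↟xC ↟xJ)) .skip ;;
  .nset xJ (↟xJ + ♯1)

def writeBackBody : Prog :=
  .nset xC (.ld aRes ↟xJ) ;; .ite bandTest (.stb bVec (↟xE + ↟xJ) (.ld bTmp ↟xJ)) .skip ;;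
  .nset xJ (↟xJ + ♯1)

/-- The new support of the vector. -/
def supportProg : Prog :=
  .ite (.nlt (↟xE + (↟xA - ↟xP)) ↟xLo) (.nset xLo (↟xE + (↟xA - ↟xP))) .skip ;;
  .ite (.nlt ↟xL (↟xB + ↟xQ)) (.nset xC ↟xL) (.nset xC (↟xB + ↟xQ)) ;;
  .ite (.nlt ↟xHi (↟xE + ↟xC)) (.nset xHi (↟xE + ↟xC)) .skip

def applyBody : Prog :=
  windowProg ;; minimaProg ;; .nset xJ ♯0 ;; .loop (.neg (.nlt ↟xL ↟xJ)) valuesBody ;;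
  .nset xJ ♯0 ;; .loop (.neg (.nlt ↟xL ↟xJ)) writeBackBody ;; supportProg

/-- Propagate the distances in the vector across a block with `xP` rows and `xQ` columns whose
distance table starts at `xD`, at the offset `xE` of the vector. -/
def applyProg : Prog :=
  .nset xL (↟xP + ↟xQ) ;;
  .ite (.conj (.neg (.nlt ↟xHi ↟xE)) (.neg (.nlt (↟xE + ↟xL) ↟xLo))) applyBody .skip

/-- The word variables that `applyProg` changes. -/
def applyVars : List ℕ := minimaVars ++ [xL, xA, xB, xLo, xHi]

/-- The vector in the memory holds the finite values among `val 0, …, val n`, which are those with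
indices from `xLo` to `xHi`. -/
structure Frontier (s : State) (val : ℕ → WithTop ℝ) (n : ℕ) : Prop where
  le : s.nvar xLo ≤ s.nvar xHi
  hi_le : s.nvar xHi ≤ n
  coe : ∀ k, s.nvar xLo ≤ k → k ≤ s.nvar xHi → (s.B bVec k : WithTop ℝ) = val k
  top : ∀ k ≤ n, ¬ (s.nvar xLo ≤ k ∧ k ≤ s.nvar xHi) → val k = ⊤

/-- The words are large enough for the propagation across a block. -/
structure Room (W Z n : ℕ) (s : State) : Prop where
  base : s.nvar 3 + 64 * Z ≤ W
  rbase : s.nvar 4 + 4 * Z ≤ W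
  large : 64 < W
  size : n < Z
  window : s.nvar xE + (s.nvar xP + s.nvar xQ) ≤ n
  sumD : ∀ i j, i ≤ s.nvar xP + s.nvar xQ → j ≤ s.nvar xP + s.nvar xQ →
    s.nvar xD + i * s.nvar xLx + j < Z
  ltLx : s.nvar xLx < Z
  square : (s.nvar xP + s.nvar xQ + 3) * (s.nvar xP + s.nvar xQ + 1) < Z

/-- The variables `xA` and `xB` delimit the support of the vector inside the block. -/
structure Window (s : State) : Prop where
  l_eq : s.nvar xL = s.nvar xP + s.nvar xQ
  a_eq : s.nvar xA = s.nvar xLo - s.nvar xE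
  b_eq : s.nvar xB = min (s.nvar xL) (s.nvar xHi - s.nvar xE)
  lo_hi : s.nvar xLo ≤ s.nvar xHi
  hi_ge : s.nvar xE ≤ s.nvar xHi
  lo_le : s.nvar xLo ≤ s.nvar xE + s.nvar xL

theorem windowProg_run {W Z n : ℕ} {s : State} (room : Room W Z n s)
    (hl : s.nvar xL = s.nvar xP + s.nvar xQ) (hlohi : s.nvar xLo ≤ s.nvar xHi)
    (hhin : s.nvar xHi ≤ n) (hhi : s.nvar xE ≤ s.nvar xHi)
    (hlo : s.nvar xLo ≤ s.nvar xE + s.nvar xL) :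
    Run W windowProg s 50 Window := by
  obtain ⟨h1, h2, h3, h4, h5, h6, h7, h8⟩ := room
  refine Run.of_wp_le ?_ (by decide)
  have key : ∀ s', s'.nvar xL = s.nvar xL → s'.nvar xP = s.nvar xP → s'.nvar xQ = s.nvar xQ →
      s'.nvar xE = s.nvar xE → s'.nvar xLo = s.nvar xLo → s'.nvar xHi = s.nvar xHi →
      s'.nvar xA = s.nvar xLo - s.nvar xE →
      s'.nvar xB = min (s.nvar xL) (s.nvar xHi - s.nvar xE) → Window s' := by
    intro s' g1 g2 g3 g4 g5 g6 g7 g8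
    constructor <;> simp only [g1, g2, g3, g4, g5, g6, g7, g8] <;> omega
  by_cases c1 : s.nvar xLo < s.nvar xE <;> by_cases c2 : s.nvar xE + s.nvar xL < s.nvar xHi <;>
    simp [windowProg, c1, c2] <;>
    (try refine ⟨by omega, ?_⟩) <;> (try refine ⟨by omega, ?_⟩) <;> (try refine ⟨by omega, ?_⟩) <;>
    (try refine ⟨by omega, ?_⟩) <;> (try refine ⟨by omega, ?_⟩) <;>
    apply key <;> simp <;> omega

/-- Inputs from `a` to `b` reach the outputs from `a - p` to `b + q`. This range contains the part
of the old support inside the window, so the union with the old support is an interval. -/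
theorem supportProg_run {W Z n : ℕ} {s : State} (room : Room W Z n s) (hw : Window s)
    (hhin : s.nvar xHi ≤ n) :
    Run W supportProg s 60 (fun s' =>
      s'.nvar xLo = min (s.nvar xLo) (s.nvar xE + (s.nvar xA - s.nvar xP)) ∧
      s'.nvar xHi = max (s.nvar xHi) (s.nvar xE + min (s.nvar xL) (s.nvar xB + s.nvar xQ))) := by
  obtain ⟨h1, h2, h3, h4, h5, h6, h7, h8⟩ := room
  obtain ⟨g1, g2, g3, g4, g5, g6⟩ := hw
  have h9 : 2 * (s.nvar xP + s.nvar xQ) + 3 < Z := by nlinarith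
  refine Run.of_wp_le ?_ (by decide)
  by_cases c1 : s.nvar xE + (s.nvar xA - s.nvar xP) < s.nvar xLo <;>
    by_cases c2 : s.nvar xL < s.nvar xB + s.nvar xQ
  · by_cases c3 : s.nvar xHi < s.nvar xE + s.nvar xL <;> simp [supportProg, c1, c2, c3] <;> omega
  · by_cases c3 : s.nvar xHi < s.nvar xE + (s.nvar xB + s.nvar xQ) <;>
      simp [supportProg, c1, c2, c3] <;> omega
  · by_cases c3 : s.nvar xHi < s.nvar xE + s.nvar xL <;> simp [supportProg, c1, c2, c3] <;> omega
  · by_cases c3 : s.nvar xHi < s.nvar xE + (s.nvar xB + s.nvar xQ) <;>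
      simp [supportProg, c1, c2, c3] <;> omega

theorem Room.frame {W Z n : ℕ} {s s' : State} (h : Room W Z n s) {V F R : List ℕ}
    (hf : Frame V F R s s') (hV : ∀ x ∈ [3, 4, xE, xP, xQ, xD, xLx], x ∉ V) : Room W Z n s' := by
  have e3 := hf.nvar 3 (hV _ (by simp))
  have e4 := hf.nvar 4 (hV _ (by simp))
  have eE := hf.nvar xE (hV _ (by simp))
  have eP := hf.nvar xP (hV _ (by simp))
  have eQ := hf.nvar xQ (hV _ (by simp))
  have eD := hf.nvar xD (hV _ (by simp))
  have ex := hf.nvar xLx (hV _ (by simp))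
  obtain ⟨h1, h2, h3, h4, h5, h6, h7, h8⟩ := h
  constructor <;> try simp only [e3, e4, eE, eP, eQ, eD, ex]
  all_goals assumption

theorem Frontier.frame {s s' : State} {val : ℕ → WithTop ℝ} {n : ℕ} (h : Frontier s val n)
    {V F R : List ℕ} (hf : Frame V F R s s') (hV : ∀ x ∈ [xLo, xHi], x ∉ V) (hR : bVec ∉ R) :
    Frontier s' val n := by
  have e1 := hf.nvar xLo (hV _ (by simp))
  have e2 := hf.nvar xHi (hV _ (by simp))
  have b1 := hf.B bVec hR (by simp)
  obtain ⟨f1, f2, f3, f4⟩ := h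
  refine ⟨?_, ?_, ?_, ?_⟩ <;> simp only [e1, e2, b1] <;> assumption

theorem Window.frame {s s' : State} (h : Window s) {V F R : List ℕ}
    (hf : Frame V F R s s') (hV : ∀ x ∈ [xE, xP, xQ, xL, xA, xB, xLo, xHi], x ∉ V) :
    Window s' := by
  have eE := hf.nvar xE (hV _ (by simp))
  have eP := hf.nvar xP (hV _ (by simp))
  have eQ := hf.nvar xQ (hV _ (by simp))
  have eL := hf.nvar xL (hV _ (by simp))
  have eA := hf.nvar xA (hV _ (by simp))
  have eB := hf.nvar xB (hV _ (by simp))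
  have eo := hf.nvar xLo (hV _ (by simp))
  have ei := hf.nvar xHi (hV _ (by simp))
  obtain ⟨h1, h2, h3, h4, h5, h6⟩ := h
  constructor <;> simp only [eE, eP, eQ, eL, eA, eB, eo, ei] <;> assumption

theorem valuesLoop_run {W Z n l : ℕ} {s : State} {am : ℕ → ℕ} (room : Room W Z n s)
    (hl : s.nvar xL = l) (hlp : l = s.nvar xP + s.nvar xQ) (hJ : s.nvar xJ = 0)
    (ham : ∀ j ≤ l, s.A aRes j = am j) (hal : ∀ j ≤ l, am j ≤ l) :
    Run W (.loop (.neg (.nlt ↟xL ↟xJ)) valuesBody) s (104 * (l + 1) + 4) (fun s' =>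
      ∀ j ≤ l, j ≤ am j + s.nvar xQ → am j ≤ j + s.nvar xP → s'.B bTmp j = s.cand (am j) j) := by
  obtain ⟨h1, h2, h3, h4, h5, h6, h7, h8⟩ := room
  have h9 : 2 * (s.nvar xP + s.nvar xQ) + 3 < Z := by nlinarith
  refine Run.mono (Run.loop_count (c := 100) [xC, xJ] [] [bTmp] (by decide) (by decide) (by decide)
    (fun s' k => s'.nvar xJ + k = l + 1 ∧ ∀ j < s'.nvar xJ, j ≤ am j + s.nvar xQ →
      am j ≤ j + s.nvar xP → s'.B bTmp j = s.cand (am j) j) (k₀ := l + 1) ?_ ?_) le_rfl fun _ => id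
  · simp [hJ]
  rintro s1 k hf ⟨hk, hI⟩
  have vL : s1.nvar xL = l := by rw [hf.nvar _ (by simp), hl]
  have vP : s1.nvar xP = s.nvar xP := hf.nvar _ (by simp)
  have vQ : s1.nvar xQ = s.nvar xQ := hf.nvar _ (by simp)
  have vE : s1.nvar xE = s.nvar xE := hf.nvar _ (by simp)
  have vD : s1.nvar xD = s.nvar xD := hf.nvar _ (by simp)
  have vx : s1.nvar xLx = s.nvar xLx := hf.nvar _ (by simp)
  have v3 : s1.nvar 3 = s.nvar 3 := hf.nvar _ (by simp)
  have v4 : s1.nvar 4 = s.nvar 4 := hf.nvar _ (by simp)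
  have hR : ∀ j, s1.A aRes j = s.A aRes j := fun j => hf.A _ (by simp) (by simp) j
  have b0 : ∀ j, s1.B bDist j = s.B bDist j := fun j => hf.B _ (by simp) (by simp) j
  have b1 : ∀ j, s1.B bVec j = s.B bVec j := fun j => hf.B _ (by simp) (by simp) j
  refine ⟨by simp [vL]; omega, fun hlt => ?_, fun hlt => ?_⟩
  · simp [vL] at hlt
    obtain ⟨J, hJe⟩ : ∃ J, s1.nvar xJ = J := ⟨_, rfl⟩
    rw [hJe] at hlt hk hI
    have hamJ := ham J hlt
    have hamle := hal J hlt
    have hD := h6 (am J) J (by omega) (by omega)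
    refine Run.of_wp_le ?_ (by decide)
    by_cases hc : am J ≤ J + s.nvar xP ∧ J ≤ am J + s.nvar xQ
    · simp [valuesBody, bandTest, candExp, hJe, hR, hamJ, vP, vQ, vE, vD, vx, v3, v4, b0, b1, hc]
      refine ⟨by omega, by omega, by omega, by omega, by omega, k - 1, by omega, by omega, ?_⟩
      intro j hj g1 g2
      split_ifs with hjj
      · rw [hjj]
        rfl
      · exact hI j (by omega) g1 g2
    · have hc' : am J ≤ J + s.nvar xP → ¬ (J ≤ am J + s.nvar xQ) := fun g1 g2 => hc ⟨g1, g2⟩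
      simp [valuesBody, bandTest, hJe, hR, hamJ, vP, vQ, v3, hc]
      refine ⟨by omega, by omega, by omega, k - 1, by omega, by omega, ?_⟩
      intro j hj g1 g2
      rcases Nat.lt_or_ge j J with hjj | hjj
      · exact hI j hjj g1 g2
      · obtain rfl : j = J := by omega
        exact absurd g1 (hc' g2)
  · simp [vL] at hlt
    exact fun j hj => hI j (by omega)

theorem writeBackLoop_run {W Z n l : ℕ} {s : State} {am : ℕ → ℕ} (room : Room W Z n s)
    (hl : s.nvar xL = l) (hlp : l = s.nvar xP + s.nvar xQ) (hJ : s.nvar xJ = 0)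
    (ham : ∀ j ≤ l, s.A aRes j = am j) (hal : ∀ j ≤ l, am j ≤ l)
    (T : ℕ → Prop) (hT : ∀ j ≤ l, (T j ↔ am j ≤ j + s.nvar xP ∧ j ≤ am j + s.nvar xQ)) :
    Run W (.loop (.neg (.nlt ↟xL ↟xJ)) writeBackBody) s (104 * (l + 1) + 4) (fun s' =>
      (∀ j ≤ l, T j → s'.B bVec (s.nvar xE + j) = s.B bTmp j) ∧
      ∀ k, ¬ (s.nvar xE ≤ k ∧ k ≤ s.nvar xE + l) → s'.B bVec k = s.B bVec k) := by
  obtain ⟨h1, h2, h3, h4, h5, h6, h7, h8⟩ := room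
  have h9 : 2 * (s.nvar xP + s.nvar xQ) + 3 < Z := by nlinarith
  obtain ⟨e, he⟩ : ∃ e, s.nvar xE = e := ⟨_, rfl⟩
  simp only [he]
  refine Run.mono (Run.loop_count (c := 100) [xC, xJ] [] [bVec] (by decide) (by decide) (by decide)
    (fun s' k => s'.nvar xJ + k = l + 1 ∧
      (∀ j < s'.nvar xJ, T j → s'.B bVec (e + j) = s.B bTmp j) ∧
      ∀ k, ¬ (e ≤ k ∧ k ≤ e + l) → s'.B bVec k = s.B bVec k) (k₀ := l + 1) ?_ ?_) le_rfl fun _ => id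
  · simp [hJ]
  rintro s1 k hf ⟨hk, hI, hO⟩
  have vL : s1.nvar xL = l := by rw [hf.nvar _ (by simp), hl]
  have vP : s1.nvar xP = s.nvar xP := hf.nvar _ (by simp)
  have vQ : s1.nvar xQ = s.nvar xQ := hf.nvar _ (by simp)
  have vE : s1.nvar xE = e := by rw [hf.nvar _ (by simp), he]
  have v3 : s1.nvar 3 = s.nvar 3 := hf.nvar _ (by simp)
  have v4 : s1.nvar 4 = s.nvar 4 := hf.nvar _ (by simp)
  have hR : ∀ j, s1.A aRes j = s.A aRes j := fun j => hf.A _ (by simp) (by simp) j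
  have b2 : ∀ j, s1.B bTmp j = s.B bTmp j := fun j => hf.B _ (by simp) (by simp) j
  refine ⟨by simp [vL]; omega, fun hlt => ?_, fun hlt => ?_⟩
  · simp [vL] at hlt
    obtain ⟨J, hJe⟩ : ∃ J, s1.nvar xJ = J := ⟨_, rfl⟩
    rw [hJe] at hlt hk
    simp only [hJe] at hI
    have hamJ := ham J hlt
    have hamle := hal J hlt
    have hTJ := hT J hlt
    refine Run.of_wp_le ?_ (by decide)
    by_cases hc : am J ≤ J + s.nvar xP ∧ J ≤ am J + s.nvar xQ
    · simp [writeBackBody, bandTest, hJe, hR, hamJ, vP, vQ, vE, v3, v4, b2, hc]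
      refine ⟨by omega, by omega, by omega, by omega, by omega, k - 1, by omega, by omega, ?_, ?_⟩
      · intro j hj hTj
        split_ifs with hjj
        · rw [hjj]
        · exact hI j (by omega) hTj
      · intro j hj
        rw [if_neg (by omega), hO j (by omega)]
    · simp [writeBackBody, bandTest, hJe, hR, hamJ, vP, vQ, v3, hc]
      refine ⟨by omega, by omega, by omega, k - 1, by omega, by omega, ?_, ?_⟩
      · intro j hj hTj
        rcases Nat.lt_or_ge j J with hjj | hjj
        · exact hI j hjj hTj
        · obtain rfl : j = J := by omega
          exact absurd (hTJ.1 hTj) hc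
      · intro j hj
        rw [hO j (by omega)]
  · simp [vL] at hlt
    exact ⟨fun j hj => hI j (by omega), hO⟩

/-- The values before and after the propagation across a block: `val` and `val'` hold lengths of
paths from the source `(x, y)`, the block has its upper left corner at `(r, c)`, and `D` is the
table of distances across the block. -/
structure Propagates (G : GridCosts) (x y r c p q e : ℕ) (D : ℕ → ℕ → ℝ)
    (val val' : ℕ → WithTop ℝ) : Prop where
  src : x ≤ r ∨ y ≤ c
  before : ∀ i ≤ p + q, G.dist x y (inRow r p i) (inCol c p i) ≤ val (e + i)
  base : ∀ i ≤ p + q, G.dist x y (inRow r p i) (inCol c p i) ≠ ⊤ → ∃ i' ≤ p + q,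
    G.dist x y (inRow r p i) (inCol c p i) = val (e + i') +
      G.dist (inRow r p i') (inCol c p i') (inRow r p i) (inCol c p i)
  after : ∀ j ≤ p + q, val' (e + j) = G.dist x y (outRow r p q j) (outCol c q j)
  outside : ∀ k, ¬ (e ≤ k ∧ k ≤ e + (p + q)) → val' k = val k
  tab : ∀ i ≤ p + q, ∀ j ≤ p + q, j ≤ i + q → i ≤ j + p → (D i j : WithTop ℝ) =
    G.dist (inRow r p i) (inCol c p i) (outRow r p q j) (outCol c q j)

/-- The totally monotone minimisation is applied to the keys of the block. Inside the window the
chosen candidates are the distances of the outputs; outside the window nothing changes; and the new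
support consists of the indices with finite values. -/
theorem applyBody_run {W Z n p q e x y r c : ℕ} {G : GridCosts} {s : State}
    {val val' : ℕ → WithTop ℝ} (room : Room W Z n s) (hfr : Frontier s val n)
    (hp : s.nvar xP = p) (hq : s.nvar xQ = q) (he : s.nvar xE = e) (hl : s.nvar xL = p + q)
    (hhi : e ≤ s.nvar xHi) (hlo : s.nvar xLo ≤ e + (p + q))
    (hpr : Propagates G x y r c p q e
      (fun i j => s.B bDist (s.nvar xD + i * s.nvar xLx + j)) val val') :
    Run W applyBody s (11000 * (p + q + 1)) (fun s' => Frontier s' val' n) := by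
  obtain ⟨w, hw⟩ : ∃ w : ℕ → ℝ, w = fun i => s.B bVec (e + i) := ⟨_, rfl⟩
  obtain ⟨D, hD⟩ : ∃ D : ℕ → ℕ → ℝ, D = fun i j => s.B bDist (s.nvar xD + i * s.nvar xLx + j) :=
    ⟨_, rfl⟩
  rw [← hD] at hpr
  obtain ⟨f1, f2, f3, f4⟩ := hfr
  obtain ⟨lo, elo⟩ : ∃ lo, s.nvar xLo = lo := ⟨_, rfl⟩
  obtain ⟨hi, ehi⟩ : ∃ hi, s.nvar xHi = hi := ⟨_, rfl⟩
  rw [elo] at f1 f3 f4 hlo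
  rw [ehi] at f1 f2 f3 f4 hhi
  have hroomw := room.window
  rw [he, hp, hq] at hroomw
  obtain ⟨a, ha⟩ : ∃ a, a = lo - e := ⟨_, rfl⟩
  obtain ⟨b, hb⟩ : ∃ b, b = min (p + q) (hi - e) := ⟨_, rfl⟩
  have hab : a ≤ b := by omega
  have hbl : b ≤ p + q := by omega
  -- Only inputs with finite values can realise a distance, and these are the ones in the support,
  -- so restricting the minimisation to the window loses nothing.
  have data : BlockData G x y r c p q w D a b := by
    refine ⟨hpr.src, fun i hi h1 h2 => ?_, fun i _ h1 => ?_, hpr.tab⟩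
    · rw [hw, f3 (e + i) (by omega) (by omega)]
      exact hpr.before i hi
    · rename_i hil
      obtain ⟨i', hi', h2⟩ := hpr.base i hil h1
      have h3 : lo ≤ e + i' ∧ e + i' ≤ hi := by
        by_contra h3
        rw [f4 (e + i') (by omega) h3, top_add] at h2
        exact h1 h2
      refine ⟨i', hi', by omega, by omega, ?_⟩
      rw [hw, f3 (e + i') (by omega) (by omega), ← h2]
  obtain ⟨am, ham⟩ := exists_isLeftmostMin (bandKey p q w D) (p + q) hab
  have hmin := fun j hj => data.minimum hab hbl ham (j := j) hj
  have hal : ∀ j ≤ p + q, am j ≤ p + q := fun j hj => (ham.mem j hj).2.trans hbl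
  refine Run.mono (τ := 50 + (10000 * (p + q + 1) + (2 + ((104 * (p + q + 1) + 4) +
    (2 + ((104 * (p + q + 1) + 4) + 60)))))) ?_ (by omega) fun _ => id
  refine Run.seq (((windowProg_run room (by omega) (by omega) (by omega) (by omega)
    (by omega)).frame [xA, xB, xJ] [] [] (by decide) (by decide) (by decide)).mono le_rfl ?_)
  rintro s1 ⟨win1, hf1⟩
  have room1 := room.frame hf1 (by decide)
  have ctx1 : KeyContext W Z (bandKey p q w D) s1 := by
    have b0 := hf1.B bDist (by decide) (by decide)
    have b1 := hf1.B bVec (by decide) (by decide)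
    have eL : s1.nvar xL = p + q := by rw [hf1.nvar _ (by decide), hl]
    have eP : s1.nvar xP = p := by rw [hf1.nvar _ (by decide), hp]
    have eQ : s1.nvar xQ = q := by rw [hf1.nvar _ (by decide), hq]
    have eE : s1.nvar xE = e := by rw [hf1.nvar _ (by decide), he]
    have eD : s1.nvar xD = s.nvar xD := hf1.nvar _ (by decide)
    have ex : s1.nvar xLx = s.nvar xLx := hf1.nvar _ (by decide)
    obtain ⟨h1, h2, h3, h4, h5, h6, h7, h8⟩ := room1
    rw [eP, eQ] at h5 h6 h8
    rw [eE] at h5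
    have h9 : 2 * (p + q) + 3 < Z := by nlinarith
    refine ⟨h1, h2, h3, by omega, by omega, by omega, ?_, h7, ?_, ?_⟩
    · rw [eL]; exact h6
    · rw [eL]; exact h8
    · rw [eL]
      intro i i' j hi hi' hj
      rw [bandKey_lt_iff hi hi']
      simp only [State.Beats, State.cand, eE, eD, ex, eP, eQ, b0, b1, hw, hD]
  have wa : s1.nvar xA = a := by
    rw [win1.a_eq, hf1.nvar xLo (by decide), hf1.nvar xE (by decide), elo, he, ha]
  have wb : s1.nvar xB = b := by
    rw [win1.b_eq, hf1.nvar xHi (by decide), hf1.nvar xE (by decide), hf1.nvar xL (by decide),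
      ehi, he, hl, hb]
  have wl : s1.nvar xL = p + q := by rw [hf1.nvar _ (by decide), hl]
  refine Run.seq (((minimaProg_run ctx1 wl hbl hab wa wb data.totallyMonotone ham).frame minimaVars
    [aCol, aLen, aRes] [] (by decide) (by decide) (by decide)).mono le_rfl ?_)
  rintro s2 ⟨hres2, hf2⟩
  have hf12 := (hf1.mono (V' := minimaVars ++ [xA, xB]) (F' := [aCol, aLen, aRes]) (R' := [])
    (by decide) (by decide) (by decide)).trans (by decide) (by decide)
    (hf2.mono (by decide) (by decide) (by decide))
  have room2 := room.frame hf12 (by decide)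
  have win2 := win1.frame hf2 (by decide)
  refine Run.seq (((Run.of_wp_le (p := .nset xJ ♯0) (W := W) (s := s2) (τ := 2)
    (Q := fun s' => s'.nvar xJ = 0) (by have := room.large; simp; omega) (by decide)).frame [xJ] [] []
    (by decide) (by decide) (by decide)).mono le_rfl ?_)
  rintro s3 ⟨hJ3, hf3⟩
  have room3 := room2.frame hf3 (by decide)
  have win3 := win2.frame hf3 (by decide)
  have hf13 := hf12.trans (by decide) (by decide) (hf3.mono (by decide) (by decide) (by decide))
  have e3 : ∀ z, z ∉ minimaVars ++ [xA, xB] → s3.nvar z = s.nvar z := hf13.nvar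
  have hres3 : ∀ j ≤ p + q, s3.A aRes j = am j := fun j hj => by
    rw [hf3.A _ (by decide) (by decide), hres2 j hj]
  refine Run.seq (((valuesLoop_run room3 ((e3 _ (by decide)).trans hl)
    (by rw [e3 _ (by decide), e3 _ (by decide), hp, hq]) hJ3 hres3 hal).frame [xC, xJ] [] [bTmp]
    (by decide) (by decide) (by decide)).mono le_rfl ?_)
  rintro s4 ⟨hval4, hf4⟩
  refine Run.seq (((Run.of_wp_le (p := .nset xJ ♯0) (W := W) (s := s4) (τ := 2)
    (Q := fun s' => s'.nvar xJ = 0) (by have := room.large; simp; omega) (by decide)).frame [xJ] [] []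
    (by decide) (by decide) (by decide)).mono le_rfl ?_)
  rintro s5 ⟨hJ5, hf5⟩
  have hf35 := hf4.trans (by decide) (by decide) (hf5.mono (by decide) (by decide) (by decide))
  have hf15 := (hf13.mono (R' := [bTmp]) (List.Subset.refl _) (List.Subset.refl _)
    (by decide)).trans (by decide) (by decide) (hf35.mono (by decide) (by decide) (by decide))
  have e5 : ∀ z, z ∉ minimaVars ++ [xA, xB] → s5.nvar z = s.nvar z := hf15.nvar
  have room5 := room3.frame hf35 (by decide)
  have win5 := win3.frame hf35 (by decide)
  have hres5 : ∀ j ≤ p + q, s5.A aRes j = am j := fun j hj => by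
    rw [hf35.A _ (by decide) (by decide), hres3 j hj]
  refine Run.seq (((writeBackLoop_run room5 ((e5 _ (by decide)).trans hl)
    (by rw [e5 _ (by decide), e5 _ (by decide), hp, hq]) hJ5 hres5 hal
    (fun j => a ≤ j + p ∧ j ≤ b + q) (fun j hj => by
      rw [e5 _ (by decide), e5 _ (by decide), hp, hq, ← (hmin j hj).1, and_comm])).frame
    [xC, xJ] [] [bVec] (by decide) (by decide) (by decide)).mono le_rfl ?_)
  rintro s6 ⟨⟨hin6, hout6⟩, hf6⟩
  have room6 := room5.frame hf6 (by decide)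
  have win6 := win5.frame hf6 (by decide)
  have e6 : ∀ z, z ∉ minimaVars ++ [xA, xB] → s6.nvar z = s.nvar z := fun z hz => by
    rw [hf6.nvar z fun h => hz ((show [xC, xJ] ⊆ minimaVars ++ [xA, xB] by decide) h), e5 z hz]
  rw [e5 _ (by decide), he] at hin6 hout6
  refine ((supportProg_run room6 win6 (by rw [e6 _ (by decide), ehi]; exact f2)).frame
    [xLo, xHi, xC] [] [] (by decide) (by decide) (by decide)).mono le_rfl ?_
  rintro s7 ⟨⟨hlo7, hhi7⟩, hf7⟩
  have b7 := hf7.B bVec (by decide) (by decide)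
  have a6 : s6.nvar xA = a := by rw [win6.a_eq, e6 _ (by decide), e6 _ (by decide), elo, he, ha]
  have b6 : s6.nvar xB = b := by
    rw [win6.b_eq, e6 _ (by decide), e6 _ (by decide), e6 _ (by decide), ehi, he, hl, hb]
  rw [a6, e6 xLo (by decide), e6 xE (by decide), e6 xP (by decide), elo, he, hp] at hlo7
  rw [b6, e6 xHi (by decide), e6 xE (by decide), e6 xL (by decide), e6 xQ (by decide), ehi, he, hq,
    hl] at hhi7
  -- The condition is that output `j` is reachable; the minimum then lies in the band, and the two
  -- loops have moved its value into the vector.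
  have hnew : ∀ j ≤ p + q, a ≤ j + p ∧ j ≤ b + q → (s7.B bVec (e + j) : WithTop ℝ) =
      val' (e + j) := by
    intro j hj hT
    have hT' := (hmin j hj).1.2 hT
    rw [b7, hin6 j hj hT, hf5.B _ (by decide) (by decide), hval4 j hj
      (by rw [e3 _ (by decide), hq]; exact hT'.1) (by rw [e3 _ (by decide), hp]; exact hT'.2),
      hpr.after j hj, ← (hmin j hj).2 hT'.1 hT'.2, State.cand, e3 _ (by decide), e3 _ (by decide),
      e3 _ (by decide), hf13.B _ (by decide) (by decide), hf13.B _ (by decide) (by decide), hw, hD,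
      he]
  refine ⟨by omega, by omega, fun k h1 h2 => ?_, fun k hk h1 => ?_⟩
  · rw [hlo7] at h1
    rw [hhi7] at h2
    by_cases hk : e ≤ k ∧ k ≤ e + (p + q)
    · obtain ⟨j, rfl⟩ : ∃ j, k = e + j := ⟨k - e, by omega⟩
      exact hnew j (by omega) (by omega)
    · rw [hpr.outside k hk, b7, hout6 k hk, hf15.B _ (by decide) (by decide)]
      exact f3 k (by omega) (by omega)
  · rw [hlo7, hhi7] at h1
    by_cases hk' : e ≤ k ∧ k ≤ e + (p + q)
    · obtain ⟨j, rfl⟩ : ∃ j, k = e + j := ⟨k - e, by omega⟩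
      rw [hpr.after j (by omega)]
      by_contra hcon
      have := (data.out_ne_top_iff hab hbl (j := j) (by omega)).1 hcon
      omega
    · rw [hpr.outside k hk']
      exact f4 k hk (by omega)

/-- If the support misses the block, all its inputs are infinite, hence so are its outputs, and the
vector is correct as it stands. -/
theorem applyProg_run {W Z n p q e x y r c : ℕ} {G : GridCosts} {s : State}
    {val val' : ℕ → WithTop ℝ} (room : Room W Z n s) (hfr : Frontier s val n)
    (hp : s.nvar xP = p) (hq : s.nvar xQ = q) (he : s.nvar xE = e)
    (hpr : Propagates G x y r c p q e
      (fun i j => s.B bDist (s.nvar xD + i * s.nvar xLx + j)) val val') :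
    Run W applyProg s (11100 * (p + q + 1)) (fun s' => Frontier s' val' n) := by
  have hr := room
  obtain ⟨h1, h2, h3, h4, h5, h6, h7, h8⟩ := hr
  have hh := hfr.hi_le
  have hlh := hfr.le
  have h9 : 2 * (p + q) + 3 < Z := by rw [hp, hq] at h8; nlinarith
  refine Run.mono (τ := 4 + (11 + 11000 * (p + q + 1))) ?_ (by omega) fun _ => id
  refine Run.seq (((Run.of_wp_le (p := .nset xL (↟xP + ↟xQ)) (W := W) (s := s) (τ := 4)
    (Q := fun s' => s'.nvar xL = p + q) (by simp [hp, hq]; omega) (by decide)).frame [xL] [] []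
    (by decide) (by decide) (by decide)).mono le_rfl ?_)
  rintro s1 ⟨hL, hf⟩
  have e1 : ∀ z, z ≠ xL → s1.nvar z = s.nvar z := fun z hz => hf.nvar z (by simpa using hz)
  have b0 := hf.B bDist (by decide) (by decide)
  have b1 := hf.B bVec (by decide) (by decide)
  have elo := e1 xLo (by decide)
  have ehi := e1 xHi (by decide)
  have hfr1 : Frontier s1 val n := hfr.frame hf (by decide) (by decide)
  refine Run.ite (b := .conj (.neg (.nlt ↟xHi ↟xE)) (.neg (.nlt (↟xE + ↟xL) ↟xLo))) ?_
    (fun hb => ?_) fun hb => ?_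
  · simp [hL, elo, ehi, e1]
    omega
  · simp [hL, elo, ehi, e1, he] at hb
    refine applyBody_run (G := G) (x := x) (y := y) (r := r) (c := c) (room.frame hf (by decide)) hfr1
      ((e1 _ (by decide)).trans hp) ((e1 _ (by decide)).trans hq) ((e1 _ (by decide)).trans he) hL
      (by omega) (by omega) ?_
    simp only [b0, e1 xD (by decide), e1 xLx (by decide)]
    exact hpr
  · simp [hL, elo, ehi, e1, he] at hb
    refine Run.of_wp_le ?_ (by simp [Prog.maxCost]; omega)
    rw [Prog.wp_skip]
    have hin : ∀ i ≤ p + q, val (e + i) = ⊤ := fun i hi => hfr.top (e + i) (by omega) (by omega)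
    -- The window from 1 to 0 is empty, so an output with a finite distance would yield an input
    -- that does not exist.
    have data : BlockData G x y r c p q (fun _ => 0)
        (fun i j => s.B bDist (s.nvar xD + i * s.nvar xLx + j)) 1 0 :=
      ⟨hpr.src, fun i hi h1 h2 => by omega, fun i hi h1 => by
        obtain ⟨i', hi', h2⟩ := hpr.base i hi h1
        rw [hin i' hi', top_add] at h2
        exact absurd h2 h1, hpr.tab⟩
    have hout : val' = val := by
      funext k
      by_cases hk : e ≤ k ∧ k ≤ e + (p + q)
      · obtain ⟨j, rfl⟩ : ∃ j, k = e + j := ⟨k - e, by omega⟩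
        rw [hin j (by omega), hpr.after j (by omega)]
        by_contra hcon
        obtain ⟨i, -, g1, g2, -⟩ := data.exists_in (by omega) hcon
        omega
      · exact hpr.outside k hk
    rw [hout]
    exact hfr1

end RAM

/-! ### Derivation trees and blocks -/

/-- Binary trees with labelled nodes and with letters at the leaves. -/
inductive SLPTree (α : Type) : Type
  | leaf (i : ℕ) (a : α) : SLPTree α
  | node (i : ℕ) (l r : SLPTree α) : SLPTree α

namespace SLPTree

variable {α : Type}

/-- The label of the root. -/
def label : SLPTree α → ℕ
  | leaf i _ => i
  | node i _ _ => i

def word : SLPTree α → List α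
  | leaf _ a => [a]
  | node _ l r => l.word ++ r.word

/-- The number of leaves. -/
def size : SLPTree α → ℕ
  | leaf _ _ => 1
  | node _ l r => l.size + r.size

theorem size_pos (t : SLPTree α) : 0 < t.size := by
  induction t with
  | leaf => exact Nat.one_pos
  | node i l r hl hr => exact Nat.add_pos_left hl _

@[simp] theorem length_word (t : SLPTree α) : t.word.length = t.size := by
  induction t with
  | leaf => rfl
  | node i l r hl hr => simp [word, size, hl, hr]

/-- Concatenate two lists of blocks, where the two blocks at the seam are merged if their total size
is at most `x`. -/
def joinBlocks (x i : ℕ) (P Q : List (SLPTree α)) : List (SLPTree α) :=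
  match P.getLast?, Q.head? with
  | some u, some v =>
      if u.size + v.size ≤ x then P.dropLast ++ node i u v :: Q.tail else P ++ Q
  | _, _ => P ++ Q

theorem joinBlocks_eq (x i : ℕ) (P Q : List (SLPTree α)) (u v : SLPTree α) :
    joinBlocks x i (P ++ [u]) (v :: Q) =
      if u.size + v.size ≤ x then P ++ node i u v :: Q else P ++ [u] ++ v :: Q := by
  simp [joinBlocks]

/-- The partition of the tree into blocks of size at most `x`. -/
def blocks (x : ℕ) : SLPTree α → List (SLPTree α)
  | leaf i a => [leaf i a]
  | node i l r => joinBlocks x i (l.blocks x) (r.blocks x)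

theorem blocks_ne_nil (x : ℕ) (t : SLPTree α) : t.blocks x ≠ [] := by
  induction t with
  | leaf => simp [blocks]
  | node i l r hl hr =>
    obtain ⟨P, u, hP⟩ := List.eq_nil_or_concat'.{0} (l.blocks x) |>.resolve_left hl
    obtain ⟨v, Q, hQ⟩ := List.exists_cons_of_ne_nil hr
    rw [blocks, hP, hQ, joinBlocks_eq]
    split_ifs <;> simp

theorem exists_blocks_last (x : ℕ) (t : SLPTree α) : ∃ P u, t.blocks x = P ++ [u] :=
  (List.eq_nil_or_concat'.{0} (t.blocks x)).resolve_left (t.blocks_ne_nil x)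

theorem exists_blocks_head (x : ℕ) (t : SLPTree α) : ∃ v Q, t.blocks x = v :: Q :=
  List.exists_cons_of_ne_nil (t.blocks_ne_nil x)

theorem flatMap_word_blocks (x : ℕ) (t : SLPTree α) : (t.blocks x).flatMap word = t.word := by
  induction t with
  | leaf => simp [blocks]
  | node i l r hl hr =>
    obtain ⟨P, u, hP⟩ := l.exists_blocks_last x
    obtain ⟨v, Q, hQ⟩ := r.exists_blocks_head x
    rw [hP] at hl
    rw [hQ] at hr
    rw [blocks, hP, hQ, joinBlocks_eq, word, ← hl, ← hr]
    split_ifs <;> simp [word]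

theorem length_blocks_le (x : ℕ) (t : SLPTree α) : (t.blocks x).length ≤ t.size := by
  induction t with
  | leaf => simp [blocks, size]
  | node i l r hl hr =>
    obtain ⟨P, u, hP⟩ := l.exists_blocks_last x
    obtain ⟨v, Q, hQ⟩ := r.exists_blocks_head x
    rw [hP] at hl
    rw [hQ] at hr
    rw [blocks, hP, hQ, joinBlocks_eq, size]
    simp only [List.length_append, List.length_cons, List.length_nil] at hl hr
    split_ifs <;> simp <;> omega

theorem size_le_of_mem_blocks {x : ℕ} (hx : 1 ≤ x) (t : SLPTree α) : ∀ b ∈ t.blocks x,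
    b.size ≤ x := by
  induction t with
  | leaf => simp [blocks, size, hx]
  | node i l r hl hr =>
    obtain ⟨P, u, hP⟩ := l.exists_blocks_last x
    obtain ⟨v, Q, hQ⟩ := r.exists_blocks_head x
    rw [hP] at hl
    rw [hQ] at hr
    rw [blocks, hP, hQ, joinBlocks_eq]
    intro b hb
    split_ifs at hb with h
    · simp only [List.mem_append, List.mem_cons] at hb
      rcases hb with hb | rfl | hb
      · exact hl b (by simp [hb])
      · exact h
      · exact hr b (by simp [hb])
    · rcases List.mem_append.1 hb with hb | hb
      · exact hl b hb
      · exact hr b hb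

/-- A merge only enlarges a block, so its sums with the outer neighbours grow. Without a merge the
sum at the seam exceeds `x`, for otherwise the two blocks would have been merged. -/
theorem isChain_blocks (x : ℕ) (t : SLPTree α) :
    (t.blocks x).IsChain fun u v => x < u.size + v.size := by
  induction t with
  | leaf => simp [blocks]
  | node i l r hl hr =>
    obtain ⟨P, u, hP⟩ := l.exists_blocks_last x
    obtain ⟨v, Q, hQ⟩ := r.exists_blocks_head x
    rw [hP] at hl
    rw [hQ] at hr
    rw [blocks, hP, hQ, joinBlocks_eq]
    have hu := u.size_pos
    have hv := v.size_pos
    split_ifs with h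
    · rw [List.isChain_append] at hl ⊢
      refine ⟨hl.1, ?_, ?_⟩
      · cases Q with
        | nil => simp
        | cons w Q =>
          simp only [List.isChain_cons_cons] at hr ⊢
          refine ⟨?_, hr.2⟩
          have := hr.1
          simp only [size]
          omega
      · intro a ha b hb
        have := hl.2.2 a ha u (by simp)
        simp only [List.head?_cons, Option.mem_def, Option.some.injEq] at hb
        subst hb
        simp only [size]
        omega
    · rw [List.isChain_append]
      refine ⟨hl, hr, ?_⟩
      intro a ha b hb
      simp only [List.getLast?_append, List.getLast?_singleton, Option.some_or, Option.mem_def,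
        Option.some.injEq, List.head?_cons] at ha hb
      subst ha hb
      omega

theorem sum_size_blocks (x : ℕ) (t : SLPTree α) : ((t.blocks x).map size).sum = t.size := by
  rw [← length_word, ← flatMap_word_blocks x t, List.length_flatMap]
  simp

/-- Summing the inequality over all neighbouring pairs counts each block at most twice. -/
theorem length_mul_le_of_isChain (x : ℕ) (P : List (SLPTree α))
    (h : P.IsChain fun u v => x < u.size + v.size) :
    P.length * x ≤ 2 * (P.map size).sum + x := by
  suffices H : ∀ P : List (SLPTree α), ∀ u, (u :: P).IsChain (fun u v => x < u.size + v.size) →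
      P.length * x + u.size ≤ 2 * ((u :: P).map size).sum by
    cases P with
    | nil => simp
    | cons u P =>
      have := H P u h
      rw [List.length_cons, Nat.add_mul, Nat.one_mul]
      omega
  intro P
  induction P with
  | nil => intro u _; simp; omega
  | cons v P ih =>
    intro u hu
    rw [List.isChain_cons_cons] at hu
    have := ih v hu.2
    simp only [List.length_cons, List.map_cons, List.sum_cons] at this ⊢
    rw [Nat.add_mul, Nat.one_mul]
    omega

theorem length_blocks_mul_le (x : ℕ) (t : SLPTree α) :
    (t.blocks x).length * x ≤ 2 * t.size + x := by
  have := length_mul_le_of_isChain x _ (t.isChain_blocks x)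
  rwa [sum_size_blocks] at this

/-- The time for the computation of the blocks, up to a constant factor. -/
def visitCost (x : ℕ) : SLPTree α → ℕ
  | leaf _ _ => 1
  | node i l r => l.visitCost x + r.visitCost x + 1 +
      if ((node i l r).blocks x).length < (l.blocks x).length + (r.blocks x).length then
        (r.blocks x).length else 0

/-- With bound 1 nothing is ever merged, so the cost is the number of nodes of a binary tree. -/
theorem visitCost_one (t : SLPTree α) : t.visitCost 1 + 1 ≤ 2 * t.size := by
  induction t with
  | leaf => simp [visitCost, size]
  | node i l r hl hr =>
    obtain ⟨P, u, hP⟩ := l.exists_blocks_last 1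
    obtain ⟨v, Q, hQ⟩ := r.exists_blocks_head 1
    have h : (node i l r).blocks 1 = l.blocks 1 ++ r.blocks 1 := by
      have hu := u.size_pos
      have hv := v.size_pos
      rw [blocks, hP, hQ, joinBlocks_eq, if_neg (by omega)]
    rw [visitCost, h, List.length_append, if_neg (lt_irrefl _), size]
    omega

/-- A node is charged one unit plus, after a merge, one for each block of its right part, that is at
most `2 * M / x + 1` in addition. Multiplied by `x` this is `2 * x + 2 * M`. The claim carries
precisely this amount as slack, and of the slacks of the two children one pays for the node and one
is kept. -/
theorem visitCost_mul_le (x M : ℕ) (t : SLPTree α) (hM : t.size ≤ M) :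
    t.visitCost x * x + (2 * x + 2 * M) ≤ t.size * (3 * x + 2 * M) := by
  induction t with
  | leaf => simp [visitCost, size]; omega
  | node i l r hl hr =>
    rw [size] at hM
    have h1 := hl (by omega)
    have h2 := hr (by omega)
    have h3 := r.length_blocks_mul_le x
    rw [visitCost, size]
    have h4 : (if ((node i l r).blocks x).length < (l.blocks x).length + (r.blocks x).length then
        (r.blocks x).length else 0) * x ≤ 2 * M + x := by
      split_ifs
      · omega
      · simp
    rw [Nat.add_mul, Nat.add_mul, Nat.add_mul, Nat.add_mul, Nat.one_mul]
    omega

theorem blocks_one_length (t : SLPTree α) : (t.blocks 1).length = t.size := by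
  refine le_antisymm (t.length_blocks_le 1) ?_
  rw [← t.sum_size_blocks 1]
  refine (List.sum_le_card_nsmul _ 1 fun k hk => ?_).trans (by simp)
  obtain ⟨b, hb, rfl⟩ := List.mem_map.1 hk
  exact size_le_of_mem_blocks le_rfl t b hb

/-- The two children of a block. -/
def children : SLPTree α → List (SLPTree α)
  | leaf _ _ => []
  | node _ l r => [l, r]

/-- The block with the same label as the tree, if there is one. -/
def top (x : ℕ) : SLPTree α → SLPTree α
  | leaf i a => leaf i a
  | node i l r => node i ((l.blocks x).getLastD l) ((r.blocks x).headD r)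

end SLPTree

namespace SLP

variable {α : Type}

/-- The derivation tree of a variable. -/
def tree (S : SLP α) (i : ℕ) (hi : i < S.size) : SLPTree α :=
  match S.rule ⟨i, hi⟩ with
  | .term a => .leaf i a
  | .pair p q => .node i (S.tree p.1 (lt_trans p.2 hi)) (S.tree q.1 (lt_trans q.2 hi))
termination_by i
decreasing_by
  · exact p.2
  · exact q.2

theorem label_tree (S : SLP α) (i : ℕ) (hi : i < S.size) : (S.tree i hi).label = i := by
  rw [tree]
  split <;> rfl

theorem word_tree (S : SLP α) (i : ℕ) (hi : i < S.size) : (S.tree i hi).word = S.derive i hi := by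
  induction i using Nat.strong_induction_on with
  | _ i ih =>
    rw [tree, derive]
    cases h : S.rule ⟨i, hi⟩ with
    | term a => rfl
    | pair p q =>
      simp only [SLPTree.word]
      rw [ih p.1 p.2, ih q.1 q.2]

end SLP

/-! ### A label determines its block -/

namespace SLPTree

variable {σ : ℕ}

theorem top_node {x i : ℕ} {l r u v : SLPTree α} {P Q : List (SLPTree α)}
    (hP : l.blocks x = P ++ [u]) (hQ : r.blocks x = v :: Q) :
    top x (node i l r) = node i u v := by
  simp [top, hP, hQ]

/-- The tree is described by the productions in `code`, and `β` maps the labels to blocks. -/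
def Coherent (x n : ℕ) (code : ℕ → ℕ) (β : ℕ → SLPTree (Fin σ)) : SLPTree (Fin σ) → Prop
  | leaf i a => i < n ∧ code (3 * i) = 0 ∧ code (3 * i + 1) = a ∧ β i = leaf i a
  | node i l r => i < n ∧ code (3 * i) = 1 ∧ code (3 * i + 1) = l.label ∧
      code (3 * i + 2) = r.label ∧ β i = top x (node i l r) ∧ l.Coherent x n code β ∧
      r.Coherent x n code β

theorem Coherent.label_lt {x n : ℕ} {code : ℕ → ℕ} {β : ℕ → SLPTree (Fin σ)}
    {t : SLPTree (Fin σ)} (h : t.Coherent x n code β) : t.label < n := by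
  cases t with
  | leaf i a => exact h.1
  | node i l r => exact h.1

/-- A block is created at a node from the last block of the left subtree and the first block of the
right one. These depend only on the variable at the node, so all blocks with that label are equal.
This is how the number of different blocks is bounded by the size of the grammar. -/
theorem Coherent.block {x n : ℕ} {code : ℕ → ℕ} {β : ℕ → SLPTree (Fin σ)}
    {t : SLPTree (Fin σ)} (h : t.Coherent x n code β) :
    ∀ b ∈ t.blocks x, b.label < n ∧ β b.label = b := by
  induction t with
  | leaf i a =>
    intro b hb
    rw [blocks, List.mem_singleton] at hb
    subst hb
    exact ⟨h.1, h.2.2.2⟩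
  | node i l r hl hr =>
    obtain ⟨h1, -, -, -, h2, h3, h4⟩ := h
    obtain ⟨P, u, hP⟩ := l.exists_blocks_last x
    obtain ⟨v, Q, hQ⟩ := r.exists_blocks_head x
    rw [top_node hP hQ] at h2
    have hl := hl h3
    have hr := hr h4
    rw [hP] at hl
    rw [hQ] at hr
    rw [blocks, hP, hQ, joinBlocks_eq]
    intro b hb
    split_ifs at hb with h
    · simp only [List.mem_append, List.mem_cons] at hb
      rcases hb with hb | rfl | hb
      · exact hl b (by simp [hb])
      · exact ⟨h1, h2⟩
      · exact hr b (by simp [hb])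
    · rcases List.mem_append.1 hb with hb | hb
      · exact hl b hb
      · exact hr b hb

end SLPTree

namespace SLP

variable {σ : ℕ}

/-- The block with a given label. -/
def block (S : SLP (Fin σ)) (x i : ℕ) : SLPTree (Fin σ) :=
  if h : i < S.size then (S.tree i h).top x
  else (S.tree 0 S.size_pos).top x

theorem coherent_tree (S : SLP (Fin σ)) (x i : ℕ) (hi : i < S.size) :
    (S.tree i hi).Coherent x S.size S.code (S.block x) := by
  induction i using Nat.strong_induction_on with
  | _ i ih =>
    have hb : S.block x i = (S.tree i hi).top x := dif_pos hi
    have c : ∀ k < 3, S.code (3 * i + k) = (S.rule ⟨i, hi⟩).code k := by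
      intro k hk
      have h1 : (3 * i + k) / 3 = i := by omega
      have h2 : (3 * i + k) % 3 = k := by omega
      have h3 : ∀ m (h : m = i) (hm : m < S.size),
          (S.rule ⟨m, hm⟩).code k = (S.rule ⟨i, hi⟩).code k := by
        rintro m rfl hm
        rfl
      simp only [code, h2]
      rw [dif_pos (by omega)]
      exact h3 _ h1 _
    have c0 := c 0 (by omega)
    have c1 := c 1 (by omega)
    have c2 := c 2 (by omega)
    rw [tree] at hb ⊢
    cases h : S.rule ⟨i, hi⟩ with
    | term a =>
      rw [h] at c0 c1 c2 hb
      exact ⟨hi, c0, c1, hb⟩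
    | pair p q =>
      rw [h] at c0 c1 c2 hb
      exact ⟨hi, c0, by rw [label_tree]; exact c1, by rw [label_tree]; exact c2, hb,
        ih p.1 p.2 _, ih q.1 q.2 _⟩

end SLP

/-! ### The computation of the blocks -/

namespace SLPTree

variable {σ : ℕ}

/-- `0` for a leaf, `1` for an inner node. -/
def kind : SLPTree (Fin σ) → ℕ
  | leaf _ _ => 0
  | node _ _ _ => 1

/-- The letter at a leaf, or the label of the left child. -/
def fst : SLPTree (Fin σ) → ℕ
  | leaf _ a => a
  | node _ l _ => l.label

/-- The label of the right child. -/
def snd : SLPTree (Fin σ) → ℕ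
  | leaf _ _ => 0
  | node _ _ r => r.label

end SLPTree

theorem List.getElem?_concat_eq_some {α : Type*} {L : List α} {x y : α} {j : ℕ} :
    (L ++ [x])[j]? = some y ↔ L[j]? = some y ∨ (j = L.length ∧ y = x) := by
  rcases Nat.lt_trichotomy j L.length with h | h | h
  · rw [List.getElem?_append_left h]
    simp [h.ne]
  · subst h
    simp [eq_comm]
  · rw [List.getElem?_eq_none (by simp; omega), List.getElem?_eq_none (by omega)]
    simp
    omega

namespace RAM

notation "vRoot" => 5
notation "vRul" => 6
notation "vCap" => 7
notation "vSp" => 8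
notation "vEnd" => 9
notation "vCnt" => 10
notation "vKd" => 11
notation "vX" => 12
notation "vM" => 13
notation "vU" => 14
notation "vV" => 15
notation "vI" => 16
notation "vSum" => 17

/-- Record the block with label `vX` unless it has been recorded. -/
def recordProg (g : ℕ) : Prog :=
  .ite (.neq (.ld (g + 4) ↟vX) ♯0)
    (.sta (g + 4) ↟vX ♯1 ;; .sta (g + 5) ↟vX ↟vSum ;; .sta (g + 8) ↟vX ↟vKd ;;
      .sta (g + 6) ↟vX ↟vU ;; .sta (g + 7) ↟vX ↟vV ;; .sta (g + 9) ↟vCnt ↟vX ;;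
      .nset vCnt (↟vCnt + ♯1))
    .skip

/-- Append a terminal to the list of blocks. -/
def appendProg (g : ℕ) : Prog :=
  .sta (g + 3) ↟vEnd ↟vX ;; .nset vEnd (↟vEnd + ♯1) ;; .nset vU (.load (↟vRul + ♯3 * ↟vX + ♯1)) ;;
  .nset vV ♯0 ;; .nset vSum ♯1

/-- Visit a terminal. -/
def termProg (g : ℕ) : Prog := appendProg g ;; recordProg g

/-- Start the visit of the first factor of a product. -/
def leftProg (g : ℕ) : Prog :=
  .sta g (↟vSp - ♯1) ♯1 ;; .sta g ↟vSp ♯0 ;;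
  .sta (g + 1) ↟vSp (.load (↟vRul + ♯3 * ↟vX + ♯1)) ;; .nset vSp (↟vSp + ♯1)

/-- Start the visit of the second factor of a product. -/
def rightProg (g : ℕ) : Prog :=
  .sta (g + 2) (↟vSp - ♯1) ↟vEnd ;; .sta g (↟vSp - ♯1) ♯2 ;; .sta g ↟vSp ♯0 ;;
  .sta (g + 1) ↟vSp (.load (↟vRul + ♯3 * ↟vX + ♯2)) ;; .nset vSp (↟vSp + ♯1)

def shiftBody (g : ℕ) : Prog :=
  .sta (g + 3) ↟vI (.ld (g + 3) (↟vI + ♯1)) ;; .nset vI (↟vI + ♯1)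

/-- Merge the two blocks at the seam. -/
def mergeProg (g : ℕ) : Prog :=
  (.sta (g + 3) (↟vM - ♯1) ↟vX ;; .nset vI ↟vM) ;;
  .loop (.nlt (↟vI + ♯1) ↟vEnd) (shiftBody g) ;; (.nset vEnd (↟vEnd - ♯1) ;; .nset vKd ♯1) ;;
  recordProg g

/-- Find the two blocks at the seam. -/
def seamInit (g : ℕ) : Prog :=
  .nset vM (.ld (g + 2) (↟vSp - ♯1)) ;; .nset vU (.ld (g + 3) (↟vM - ♯1)) ;;
  .nset vV (.ld (g + 3) ↟vM) ;; .nset vSum (.ld (g + 5) ↟vU + .ld (g + 5) ↟vV)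

/-- Complete the visit of a product. -/
def seamProg (g : ℕ) : Prog :=
  seamInit g ;; .ite (.nlt ↟vCap ↟vSum) .skip (mergeProg g)

/-- Inspect the top of the stack. -/
def peekProg (g : ℕ) : Prog :=
  .nset vX (.ld (g + 1) (↟vSp - ♯1)) ;; .nset vKd (.ld g (↟vSp - ♯1))

def visitBody (g : ℕ) : Prog :=
  peekProg g ;;
  .ite (.neq ↟vKd ♯0)
    (.ite (.neq (.load (↟vRul + ♯3 * ↟vX)) ♯0) (termProg g ;; .nset vSp (↟vSp - ♯1)) (leftProg g))
    (.ite (.neq ↟vKd ♯1) (rightProg g) (seamProg g ;; .nset vSp (↟vSp - ♯1)))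

/-- Put the root on the stack. -/
def visitInit (g : ℕ) : Prog :=
  .nset vSp ♯1 ;; .sta g ♯0 ♯0 ;; .sta (g + 1) ♯0 ↟vRoot ;; .nset vEnd ♯0 ;; .nset vCnt ♯0

/-- Compute the partition into blocks of the string derived from the variable `vRoot` of the
straight-line program at the address `vRul`, by a traversal of the derivation tree. -/
def visitProg (g : ℕ) : Prog :=
  visitInit g ;; .loop (.nlt ♯0 ↟vSp) (visitBody g)

def visitVars : List ℕ := [vSp, vEnd, vCnt, vKd, vX, vM, vU, vV, vI, vSum]

/-- In this order: state of a stack entry, its variable, the number of blocks before its second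
factor, the list of blocks; then, by label, a flag for recorded blocks, size, letter or left child,
right child, kind; finally the recorded labels in the order of their creation. The tags 0, 16, 32,
48 keep several traversals apart, and the arrays 10 to 12 used for the minima avoid all of them. -/
def visitArrays (g : ℕ) : List ℕ :=
  [g, g + 1, g + 2, g + 3, g + 4, g + 5, g + 6, g + 7, g + 8, g + 9]

/-- The straight-line program is in the memory, and the words are large enough. -/
structure VisitContext (W Z n x g : ℕ) (code : ℕ → ℕ) (s : State) : Prop where
  base : s.nvar 3 + 64 * Z ≤ W
  large : 64 < W
  size : n < Z
  rules : s.nvar vRul + 3 * n ≤ s.nvar 3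
  cap : s.nvar vCap = x
  cap_lt : 2 * x < W
  code_eq : ∀ m < 3 * n, s.nmem (s.nvar vRul + m) = code m
  code_lt : ∀ m < 3 * n, code m < W
  tag : g = 0 ∨ g = 16 ∨ g = 32 ∨ g = 48

theorem VisitContext.frame {W Z n x g : ℕ} {code : ℕ → ℕ} {s s' : State}
    (h : VisitContext W Z n x g code s) {V F R : List ℕ} (hf : Frame V F R s s')
    (hV : ∀ x ∈ [3, vRul, vCap], x ∉ V) : VisitContext W Z n x g code s' := by
  have e3 := hf.nvar 3 (hV _ (by simp))
  have er := hf.nvar vRul (hV _ (by simp))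
  have ec := hf.nvar vCap (hV _ (by simp))
  obtain ⟨h1, h2, h3, h4, h5, h6, h7, h8, h9⟩ := h
  refine ⟨by rw [e3]; exact h1, h2, h3, by rw [e3, er]; exact h4, by rw [ec]; exact h5, h6, ?_, h8,
    h9⟩
  intro m hm
  rw [er, hf.low _ (by omega), h7 m hm]

/-- The recorded blocks are those with labels in `L`, listed after their children. -/
structure Recorded {σ : ℕ} (g n x : ℕ) (β : ℕ → SLPTree (Fin σ)) (L : List ℕ) (s : State) :
    Prop where
  ord : ∀ j X : ℕ, L[j]? = some X → s.A (g + 9) j = X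
  done : ∀ X, s.A (g + 4) X = if X ∈ L then 1 else 0
  nodup : L.Nodup
  lt : ∀ X ∈ L, X < n
  label : ∀ X ∈ L, (β X).label = X
  len : ∀ X ∈ L, s.A (g + 5) X = (β X).size
  fst : ∀ X ∈ L, s.A (g + 6) X = (β X).fst
  snd : ∀ X ∈ L, s.A (g + 7) X = (β X).snd
  kind : ∀ X ∈ L, s.A (g + 8) X = (β X).kind
  child : ∀ j X : ℕ, L[j]? = some X → ∀ c ∈ (β X).children,
    β c.label = c ∧ ∃ i < j, L[i]? = some c.label
  size : ∀ X ∈ L, (β X).size ≤ x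

theorem Recorded.frame {σ g n x : ℕ} {β : ℕ → SLPTree (Fin σ)} {L : List ℕ} {s s' : State}
    (h : Recorded g n x β L s) {V F R : List ℕ} (hf : Frame V F R s s')
    (hF : ∀ x ∈ [g + 4, g + 5, g + 6, g + 7, g + 8, g + 9], x ∉ F) (hg : g + 9 < 64) :
    Recorded g n x β L s' := by
  have a4 := hf.A (g + 4) (hF _ (by simp)) (by omega)
  have a5 := hf.A (g + 5) (hF _ (by simp)) (by omega)
  have a6 := hf.A (g + 6) (hF _ (by simp)) (by omega)
  have a7 := hf.A (g + 7) (hF _ (by simp)) (by omega)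
  have a8 := hf.A (g + 8) (hF _ (by simp)) (by omega)
  have a9 := hf.A (g + 9) (hF _ (by simp)) (by omega)
  obtain ⟨h1, h2, h3, h4, h5, h6, h7, h8, h9, h10, h11⟩ := h
  constructor <;> try simp only [a4, a5, a6, a7, a8, a9]
  all_goals assumption

theorem Recorded.length_le {σ g n x : ℕ} {β : ℕ → SLPTree (Fin σ)} {L : List ℕ} {s : State}
    (h : Recorded g n x β L s) : L.length ≤ n := by
  have := (List.subperm_of_subset h.nodup (l₂ := List.range n) fun X hX =>
    List.mem_range.2 (h.lt X hX)).length_le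
  simpa using this

/-- A block is recorded after its children, so the order of creation is an order in which tables can
be computed. A repetition changes nothing, because the label determines the block. -/
theorem recordProg_run {σ W Z n x g X : ℕ} {code : ℕ → ℕ} {β : ℕ → SLPTree (Fin σ)} {L : List ℕ}
    {s : State} (ctx : VisitContext W Z n x g code s) (rec : Recorded g n x β L s)
    (hcnt : s.nvar vCnt = L.length) (hX : s.nvar vX = X) (hXn : X < n)
    (hlab : (β X).label = X) (hlen : s.nvar vSum = (β X).size) (hfst : s.nvar vU = (β X).fst)
    (hsnd : s.nvar vV = (β X).snd) (hkind : s.nvar vKd = (β X).kind)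
    (fsum : s.nvar vSum < W) (fu : s.nvar vU < W) (fv : s.nvar vV < W) (fk : s.nvar vKd < W)
    (hch : ∀ c ∈ (β X).children, β c.label = c ∧ c.label ∈ L) (hsz : (β X).size ≤ x) :
    Run W (recordProg g) s 200 (fun s' => ∃ L', Recorded g n x β L' s' ∧ s'.nvar vCnt = L'.length ∧
      L ⊆ L' ∧ X ∈ L' ∧ L'.length ≤ L.length + 1) := by
  have hlen' := rec.length_le
  obtain ⟨c1, c2, c3, c4, c5, c6, c7, c8, c9⟩ := ctx
  have hg : g + 16 ≤ 64 := by omega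
  have g4 : g + 4 < 64 := by omega
  have g5 : g + 5 < 64 := by omega
  have g6 : g + 6 < 64 := by omega
  have g7 : g + 7 < 64 := by omega
  have g8 : g + 8 < 64 := by omega
  have g9 : g + 9 < 64 := by omega
  refine Run.of_wp_le ?_ (Nat.le_of_ble_eq_true rfl)
  by_cases hd : X ∈ L
  · have hdone : s.A (g + 4) X = 1 := by rw [rec.done, if_pos hd]
    simp [recordProg, hX, hdone, g4]
    refine ⟨by omega, L, rec, hcnt, fun _ h => h, hd, by omega⟩
  · have hdone : s.A (g + 4) X = 0 := by rw [rec.done, if_neg hd]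
    simp [recordProg, hX, hdone, g4, g5, g6, g7, g8, g9, hcnt]
    repeat refine And.intro (by omega) ?_
    refine ⟨L ++ [X], ?_, by simp, by simp, by simp, by simp⟩
    obtain ⟨h1, h2, h3, h4, h5, h6, h7, h8, h9, h10, h11⟩ := rec
    have hne : ∀ Y ∈ L, Y ≠ X := fun Y hY h => hd (h ▸ hY)
    refine ⟨?_, ?_, ?_, ?_, ?_, ?_, ?_, ?_, ?_, ?_, ?_⟩
    · intro j Y hj
      rw [List.getElem?_concat_eq_some] at hj
      rcases hj with hj | ⟨rfl, rfl⟩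
      · have : j ≠ L.length := (List.getElem?_eq_some_iff.1 hj).1.ne
        simp [g4, g5, g6, g7, g8, g9, this, h1 j Y hj]
      · simp [g4, g5, g6, g7, g8, g9]
    · intro Y
      by_cases hY : Y = X
      · simp [g4, g5, g6, g7, g8, g9, hY]
      · simp [g4, g5, g6, g7, g8, g9, hY, h2 Y]
    · exact List.nodup_append.2 ⟨h3, by simp, by simpa using hne⟩
    · simp only [List.mem_append, List.mem_singleton]
      rintro Y (hY | rfl)
      · exact h4 Y hY
      · exact hXn
    · simp only [List.mem_append, List.mem_singleton]
      rintro Y (hY | rfl)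
      · exact h5 Y hY
      · exact hlab
    · simp only [List.mem_append, List.mem_singleton]
      rintro Y (hY | rfl)
      · simp [g4, g5, g6, g7, g8, g9, hne Y hY, h6 Y hY]
      · simp [g4, g5, g6, g7, g8, g9, hlen]
    · simp only [List.mem_append, List.mem_singleton]
      rintro Y (hY | rfl)
      · simp [g4, g5, g6, g7, g8, g9, hne Y hY, h7 Y hY]
      · simp [g4, g5, g6, g7, g8, g9, hfst]
    · simp only [List.mem_append, List.mem_singleton]
      rintro Y (hY | rfl)
      · simp [g4, g5, g6, g7, g8, g9, hne Y hY, h8 Y hY]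
      · simp [g4, g5, g6, g7, g8, g9, hsnd]
    · simp only [List.mem_append, List.mem_singleton]
      rintro Y (hY | rfl)
      · simp [g4, g5, g6, g7, g8, g9, hne Y hY, h9 Y hY]
      · simp [g4, g5, g6, g7, g8, g9, hkind]
    · intro j Y hj c hc
      rw [List.getElem?_concat_eq_some] at hj
      rcases hj with hj | ⟨rfl, rfl⟩
      · obtain ⟨e1, i, hi, e2⟩ := h10 j Y hj c hc
        exact ⟨e1, i, hi, List.getElem?_concat_eq_some.2 (Or.inl e2)⟩
      · obtain ⟨e1, e2⟩ := hch c hc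
        obtain ⟨i, hi, e3⟩ := List.mem_iff_getElem.1 e2
        exact ⟨e1, i, hi, List.getElem?_concat_eq_some.2
          (Or.inl (List.getElem?_eq_some_iff.2 ⟨hi, e3⟩))⟩
    · simp only [List.mem_append, List.mem_singleton]
      rintro Y (hY | rfl)
      · exact h11 Y hY
      · exact hsz

end RAM

namespace RAM

namespace Run

variable {W : ℕ} {p : Prog} {s : State} {τ τ' : ℕ} {Q : State → Prop} {b : Test}

theorem loop_step (hb : b.Fits W s) (h : b.Holds s)
    (hr : Run W p s τ (fun s' => Run W (.loop b p) s' τ' Q)) :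
    Run W (.loop b p) s (b.cost + τ + τ') Q := by
  obtain ⟨t, s', h1, h2, t', s'', h3, h4, h5⟩ := hr
  exact ⟨_, s'', .loop_true hb h h1 h3, by omega, h5⟩

theorem loop_exit (hb : b.Fits W s) (h : ¬ b.Holds s) (hQ : Q s) :
    Run W (.loop b p) s b.cost Q :=
  ⟨_, s, .loop_false hb h, le_rfl, hQ⟩

end Run

variable {σ W Z n x g : ℕ} {code : ℕ → ℕ} {β : ℕ → SLPTree (Fin σ)}

theorem VisitContext.tag_lt {s : State} (ctx : VisitContext W Z n x g code s) : g + 16 ≤ 64 := by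
  have := ctx.tag
  omega

theorem termProg_run {i m : ℕ} {a : Fin σ} {L : List ℕ} {s : State} (hx : 1 ≤ x)
    (ctx : VisitContext W Z n x g code s) (rec : Recorded g n x β L s)
    (hcnt : s.nvar vCnt = L.length) (hX : s.nvar vX = i) (hK : s.nvar vKd = 0) (hi : i < n)
    (hcode : code (3 * i + 1) = a) (hβ : β i = .leaf i a) (hm : s.nvar vEnd = m) (hmZ : m + 1 < Z) :
    Run W (termProg g) s 300 (fun s' => s'.nvar vEnd = m + 1 ∧ s'.A (g + 3) m = i ∧
      (∀ j < m, s'.A (g + 3) j = s.A (g + 3) j) ∧ ∃ L', Recorded g n x β L' s' ∧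
        s'.nvar vCnt = L'.length ∧ L ⊆ L' ∧ i ∈ L' ∧ L'.length ≤ L.length + 1) := by
  have htag := ctx.tag_lt
  have ha : (a : ℕ) < W := hcode ▸ ctx.code_lt (3 * i + 1) (by omega)
  have hload : s.nmem (s.nvar vRul + 3 * i + 1) = a := by
    rw [add_assoc, ctx.code_eq _ (by omega), hcode]
  refine Run.mono (τ := 100 + 200) ?_ le_rfl fun _ => id
  refine Run.seq (((Run.of_wp_le (p := appendProg g) (W := W) (s := s) (τ := 100)
    (Q := fun s' => s'.nvar vEnd = m + 1 ∧ s'.A (g + 3) m = i ∧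
      (∀ j < m, s'.A (g + 3) j = s.A (g + 3) j) ∧ s'.nvar vU = a ∧ s'.nvar vV = 0 ∧
      s'.nvar vSum = 1) ?_ (Nat.le_of_ble_eq_true rfl)).frame
      [vEnd, vU, vV, vSum] [g + 3] [] ?_ (by decide) (by decide)).mono le_rfl ?_)
  · obtain ⟨c1, c2, c3, c4, c5, c6, c7, c8, c9⟩ := ctx
    have g3 : g + 3 < 64 := by omega
    have hl2 : (s.stA (g + 3) m i).nmem (s.nvar vRul + 3 * i + 1) = a := by
      rw [State.stA_nmem_low _ _ _ _ _ (by omega), hload]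
    simp [appendProg, hX, hm, g3, hl2]
    repeat refine And.intro (by omega) ?_
    exact fun j hj h => by omega
  · rcases ctx.tag with rfl | rfl | rfl | rfl <;> decide
  rintro s1 ⟨⟨h1, h2, h3, h4, h5, h6⟩, hf⟩
  have rec1 := rec.frame hf (by simp) (by omega)
  -- The state 0 of the stack entry doubles as the kind of a leaf.
  have hK1 : s1.nvar vKd = 0 := by rw [hf.nvar _ (by decide), hK]
  have hfits := ctx.large
  refine ((recordProg_run (ctx.frame hf (by decide)) rec1 (by rw [hf.nvar _ (by decide), hcnt])
    (by rw [hf.nvar _ (by decide), hX]) hi (by rw [hβ]; rfl) (by rw [hβ, h6]; rfl)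
    (by rw [hβ, h4]; rfl) (by rw [hβ, h5]; rfl) (by rw [hβ, hK1]; rfl) (by omega) (by omega)
    (by omega) (by omega) (by rw [hβ]; simp [SLPTree.children]) (by rw [hβ]; exact hx)).frame
    [vCnt] [g + 4, g + 5, g + 6, g + 7, g + 8, g + 9] [] ?_ (by decide) (by decide)).mono le_rfl ?_
  · rcases ctx.tag with rfl | rfl | rfl | rfl <;> decide
  rintro s2 ⟨hL, hf2⟩
  have a3 := hf2.A (g + 3) (by simp) (by omega)
  refine ⟨by rw [hf2.nvar _ (by decide), h1], by rw [a3, h2], fun j hj => by rw [a3, h3 j hj], hL⟩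

theorem shiftLoop_run {m e : ℕ} {s : State} (ctx : VisitContext W Z n x g code s)
    (hI : s.nvar vI = m) (hE : s.nvar vEnd = e) (heZ : e < Z) (hme : m < e)
    (hfit : ∀ j, m ≤ j → j < e → s.A (g + 3) j < W) :
    Run W (.loop (.nlt (↟vI + ♯1) ↟vEnd) (shiftBody g)) s (45 * (e - 1 - m) + 5) (fun s' =>
      (∀ j < m, s'.A (g + 3) j = s.A (g + 3) j) ∧
      ∀ j, m ≤ j → j + 1 < e → s'.A (g + 3) j = s.A (g + 3) (j + 1)) := by
  have htag := ctx.tag_lt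
  have g3 : g + 3 < 64 := by omega
  refine Run.mono (Run.loop_count (c := 40) [vI] [g + 3] [] ?_ (by decide) (by decide)
    (fun s' k => m ≤ s'.nvar vI ∧ s'.nvar vI + k = e - 1 ∧
      (∀ j, s'.nvar vI ≤ j → s'.A (g + 3) j = s.A (g + 3) j) ∧
      (∀ j < m, s'.A (g + 3) j = s.A (g + 3) j) ∧
      ∀ j, m ≤ j → j < s'.nvar vI → s'.A (g + 3) j = s.A (g + 3) (j + 1)) (k₀ := e - 1 - m)
    ?_ ?_) le_rfl fun _ => id
  · rcases ctx.tag with rfl | rfl | rfl | rfl <;> decide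
  · refine ⟨by omega, by omega, fun _ _ => rfl, fun _ _ => rfl, fun j h1 h2 => by omega⟩
  rintro s1 k hf ⟨h0, h1, h2, h3, h4⟩
  have ctx1 := ctx.frame hf (by decide)
  have e1 : s1.nvar vEnd = e := by rw [hf.nvar _ (by decide), hE]
  obtain ⟨c1, c2, c3, c4, c5, c6, c7, c8, c9⟩ := ctx1
  obtain ⟨i, hi⟩ : ∃ i, s1.nvar vI = i := ⟨_, rfl⟩
  rw [hi] at h0 h1 h2 h4
  refine ⟨by simp [hi, e1]; omega, fun hlt => ?_, fun hlt => ?_⟩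
  · simp [hi, e1] at hlt
    have hv := h2 (i + 1) (by omega)
    have hw := hfit (i + 1) (by omega) (by omega)
    refine Run.of_wp_le ?_ (Nat.le_of_ble_eq_true rfl)
    simp [shiftBody, hi, hv, g3]
    repeat refine And.intro (by omega) ?_
    refine ⟨k - 1, by omega, by omega, by omega, ?_, ?_, ?_⟩
    · intro j hj
      rw [if_neg (by omega), h2 j (by omega)]
    · intro j hj
      rw [if_neg (by omega), h3 j (by omega)]
    · intro j hj hj'
      by_cases h : j = i
      · rw [if_pos h, h]
      · rw [if_neg h, h4 j hj (by omega)]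
  · simp [hi, e1] at hlt
    exact ⟨h3, fun j hj hj' => h4 j hj (by omega)⟩

theorem mergeProg_run {i m e : ℕ} {u v : SLPTree (Fin σ)} {L : List ℕ} {s : State}
    (ctx : VisitContext W Z n x g code s) (rec : Recorded g n x β L s)
    (hcnt : s.nvar vCnt = L.length) (hX : s.nvar vX = i) (hi : i < n)
    (hβ : β i = .node i u v) (hM : s.nvar vM = m) (hm : 0 < m) (hE : s.nvar vEnd = e)
    (heZ : e < Z) (hme : m < e) (hfit : ∀ j, m ≤ j → j < e → s.A (g + 3) j < W)
    (hU : s.nvar vU = u.label) (hV : s.nvar vV = v.label) (hS : s.nvar vSum = u.size + v.size)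
    (hu : β u.label = u) (hv : β v.label = v) (huL : u.label ∈ L) (hvL : v.label ∈ L)
    (hsum : u.size + v.size ≤ x) :
    Run W (mergeProg g) s (300 + 45 * (e - m)) (fun s' => s'.nvar vEnd = e - 1 ∧
      s'.A (g + 3) (m - 1) = i ∧ (∀ j < m - 1, s'.A (g + 3) j = s.A (g + 3) j) ∧
      (∀ j, m ≤ j → j + 1 < e → s'.A (g + 3) j = s.A (g + 3) (j + 1)) ∧
      ∃ L', Recorded g n x β L' s' ∧ s'.nvar vCnt = L'.length ∧ L ⊆ L' ∧ i ∈ L' ∧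
        L'.length ≤ L.length + 1) := by
  have htag := ctx.tag_lt
  have g3 : g + 3 < 64 := by omega
  have hlt1 := rec.lt _ huL
  have hlt2 := rec.lt _ hvL
  refine Run.mono (τ := 50 + ((45 * (e - 1 - m) + 5) + (20 + 200))) ?_ (by omega) fun _ => id
  refine Run.seq (((Run.of_wp_le (p := .sta (g + 3) (↟vM - ♯1) ↟vX ;; .nset vI ↟vM) (W := W) (s := s)
    (τ := 50) (Q := fun s' => s'.nvar vI = m ∧ ∀ j, s'.A (g + 3) j = if j = m - 1 then i else
      s.A (g + 3) j) ?_ (Nat.le_of_ble_eq_true rfl)).frame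
    [vI] [g + 3] [] ?_ (by decide) (by decide)).mono le_rfl ?_)
  · obtain ⟨c1, c2, c3, c4, c5, c6, c7, c8, c9⟩ := ctx
    simp [hX, hM, g3]
    omega
  · rcases ctx.tag with rfl | rfl | rfl | rfl <;> decide
  rintro s1 ⟨⟨h1, h2⟩, hf1⟩
  have ctx1 := ctx.frame hf1 (by decide)
  have rec1 := rec.frame hf1 (by simp) (by omega)
  refine Run.seq (((shiftLoop_run (e := e) ctx1 h1 (by rw [hf1.nvar _ (by decide), hE]) heZ hme
    (fun j hj hj' => by rw [h2, if_neg (by omega)]; exact hfit j hj hj')).frame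
    [vI] [g + 3] [] ?_ (by decide) (by decide)).mono le_rfl ?_)
  · rcases ctx.tag with rfl | rfl | rfl | rfl <;> decide
  rintro s2 ⟨⟨h3, h4⟩, hf2⟩
  have ctx2 := ctx1.frame hf2 (by decide)
  have rec2 := rec1.frame hf2 (by simp) (by omega)
  have hf12 := hf1.trans (by decide) (by decide) hf2
  have n2 : ∀ y, y ≠ vI → s2.nvar y = s.nvar y := fun y hy => hf12.nvar y (by simpa using hy)
  refine Run.seq (((Run.of_wp_le (p := .nset vEnd (↟vEnd - ♯1) ;; .nset vKd ♯1) (W := W) (s := s2)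
    (τ := 20) (Q := fun s' => s'.nvar vEnd = e - 1 ∧ s'.nvar vKd = 1) ?_ (by decide)).frame
    [vEnd, vKd] [] [] (by decide) (by decide) (by decide)).mono le_rfl ?_)
  · have := ctx.large
    have := ctx.base
    simp [n2, hE]
    omega
  rintro s3 ⟨⟨h5, h6⟩, hf3⟩
  have n3 : ∀ y, y ≠ vI → y ∉ [vEnd, vKd] → s3.nvar y = s.nvar y := fun y hy hy' => by
    rw [hf3.nvar y hy', n2 y hy]
  have hfits := ctx.large
  have hbase := ctx.base
  have hnZ := ctx.size
  have hcap := ctx.cap_lt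
  have eS := n3 vSum (by decide) (by decide)
  have eU := n3 vU (by decide) (by decide)
  have eV := n3 vV (by decide) (by decide)
  refine ((recordProg_run (X := i) (ctx2.frame hf3 (by decide)) (rec2.frame hf3 (by simp) (by omega))
    (by rw [n3 _ (by decide) (by decide), hcnt])
    (by rw [n3 _ (by decide) (by decide), hX]) hi (by rw [hβ]; rfl)
    (by rw [hβ, eS, hS]; rfl) (by rw [hβ, eU, hU]; rfl) (by rw [hβ, eV, hV]; rfl)
    (by rw [hβ, h6]; rfl) (by omega) (by omega)
    (by omega) (by omega) ?_ (by rw [hβ]; exact hsum)).frame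
    [vCnt] [g + 4, g + 5, g + 6, g + 7, g + 8, g + 9] [] ?_ (by decide) (by decide)).mono le_rfl ?_
  · rw [hβ]
    simp [SLPTree.children, hu, hv, huL, hvL]
  · rcases ctx.tag with rfl | rfl | rfl | rfl <;> decide
  rintro s4 ⟨hL, hf4⟩
  have a3 : ∀ j, s4.A (g + 3) j = s2.A (g + 3) j := fun j => by
    rw [hf4.A (g + 3) (by simp) g3, hf3.A (g + 3) (by simp) g3]
  refine ⟨by rw [hf4.nvar _ (by decide), h5], ?_, fun j hj => ?_, fun j hj hj' => ?_, hL⟩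
  · rw [a3, h3 _ (by omega), h2, if_pos rfl]
  · rw [a3, h3 _ (by omega), h2, if_neg (by omega)]
  · rw [a3, h4 j hj hj', h2, if_neg (by omega)]

end RAM

namespace RAM

variable {σ W Z n x g : ℕ} {code : ℕ → ℕ} {β : ℕ → SLPTree (Fin σ)}

-- The blocks of the two factors lie next to each other in one array, the seam being at the stored
-- position `m`. Only a merge moves anything, and then the blocks of the second factor by one cell;
-- this shift is the extra term in the time.
open SLPTree in
theorem seamProg_run {i k m₀ m : ℕ} {P Q : List (SLPTree (Fin σ))} {u v : SLPTree (Fin σ)}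
    {L : List ℕ} {s : State}
    (ctx : VisitContext W Z n x g code s) (rec : Recorded g n x β L s)
    (hcnt : s.nvar vCnt = L.length) (hX : s.nvar vX = i) (hi : i < n) (hβ : β i = .node i u v)
    (hsp : s.nvar vSp = k + 1) (hk : k + 1 < Z) (hsplit : s.A (g + 2) k = m)
    (hm : m = m₀ + P.length + 1) (hE : s.nvar vEnd = m + Q.length + 1)
    (heZ : m + Q.length + 1 < Z)
    (hl : ∀ (j : ℕ) b, (P ++ [u])[j]? = some b → s.A (g + 3) (m₀ + j) = b.label)
    (hr : ∀ (j : ℕ) b, (v :: Q)[j]? = some b → s.A (g + 3) (m + j) = b.label)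
    (hbl : ∀ b ∈ (P ++ [u]) ++ v :: Q, β b.label = b ∧ b.label ∈ L ∧ b.size ≤ x) :
    Run W (seamProg g) s (500 + 45 * (if u.size + v.size ≤ x then Q.length + 1 else 0))
      (fun s' => s'.nvar vEnd = m₀ + (joinBlocks x i (P ++ [u]) (v :: Q)).length ∧
        (∀ (j : ℕ) b, (joinBlocks x i (P ++ [u]) (v :: Q))[j]? = some b →
          s'.A (g + 3) (m₀ + j) = b.label) ∧
        (∀ j < m₀, s'.A (g + 3) j = s.A (g + 3) j) ∧
        ∃ L', Recorded g n x β L' s' ∧ s'.nvar vCnt = L'.length ∧ L ⊆ L' ∧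
          (∀ b ∈ joinBlocks x i (P ++ [u]) (v :: Q), b.label ∈ L') ∧
          L'.length ≤ L.length + 1) := by
  have htag := ctx.tag_lt
  have g2 : g + 2 < 64 := by omega
  have g3 : g + 3 < 64 := by omega
  have g5 : g + 5 < 64 := by omega
  obtain ⟨hu1, hu2, hu3⟩ := hbl u (by simp)
  obtain ⟨hv1, hv2, hv3⟩ := hbl v (by simp)
  have hu4 := rec.lt _ hu2
  have hv4 := rec.lt _ hv2
  have ou : s.A (g + 3) (m - 1) = u.label := by
    rw [hm, Nat.add_sub_cancel]
    exact hl P.length u (by simp)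
  have ov : s.A (g + 3) m = v.label := hr 0 v (by simp)
  have lu := rec.len _ hu2
  have lv := rec.len _ hv2
  rw [hu1] at lu
  rw [hv1] at lv
  obtain ⟨c1, c2, c3, c4, c5, c6, c7, c8, c9⟩ := id ctx
  refine Run.mono (τ := 150 + (3 + (300 + 45 * (if u.size + v.size ≤ x then Q.length + 1 else 0))))
    ?_ (by omega) fun _ => id
  refine Run.seq (((Run.of_wp_le (p := seamInit g) (W := W) (s := s) (τ := 150)
    (Q := fun s' => s'.nvar vM = m ∧ s'.nvar vU = u.label ∧ s'.nvar vV = v.label ∧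
      s'.nvar vSum = u.size + v.size) ?_
      (Nat.le_of_ble_eq_true rfl)).frame
      [vM, vU, vV, vSum] [] [] ?_ (by decide) (by decide)).mono le_rfl ?_)
  · simp [seamInit, hsp, hsplit, g2, g3, g5, ou, ov, lu, lv]
    omega
  · rcases c9 with rfl | rfl | rfl | rfl <;> decide
  rintro s1 ⟨⟨h1, h2, h3, h4⟩, hf⟩
  have ctx1 := ctx.frame hf (by decide)
  have rec1 := rec.frame hf (by simp) (by omega)
  have n1 : ∀ y, y ∉ [vM, vU, vV, vSum] → s1.nvar y = s.nvar y := hf.nvar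
  have a3 := hf.A (g + 3) (by simp) g3
  refine Run.ite (b := .nlt ↟vCap ↟vSum) ?_ (fun hb => ?_) fun hb => ?_
  · simp [n1, c5, h4]
    omega
  · simp [n1, c5, h4] at hb
    have hJ : joinBlocks x i (P ++ [u]) (v :: Q) = P ++ [u] ++ v :: Q := by
      rw [joinBlocks_eq, if_neg (by omega)]
    rw [hJ]
    refine Run.of_wp_le ?_ (by simp [Prog.maxCost]; omega)
    rw [Prog.wp_skip]
    refine ⟨by rw [n1 _ (by decide), hE, hm]; simp; omega, ?_, fun j _ => a3 j, L, rec1,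
      by rw [n1 _ (by decide), hcnt], fun _ h => h, fun b hb => (hbl b hb).2.1, by omega⟩
    intro j b hj
    rw [a3]
    by_cases hjl : j < (P ++ [u]).length
    · rw [List.getElem?_append_left hjl] at hj
      exact hl j b hj
    · rw [List.getElem?_append_right (by omega)] at hj
      have := hr _ b hj
      simp only [List.length_append, List.length_singleton] at this hjl
      rw [← this]
      congr 1
      omega
  · simp [n1, c5, h4] at hb
    rw [joinBlocks_eq, if_pos hb, if_pos hb]
    refine (mergeProg_run (e := m + Q.length + 1) ctx1 rec1 (by rw [n1 _ (by decide), hcnt])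
      (by rw [n1 _ (by decide), hX]) hi hβ h1 (by omega) (by rw [n1 _ (by decide), hE]) heZ (by omega)
      ?_ h2 h3 h4 hu1 hv1 hu2 hv2 (by omega)).mono (by omega) ?_
    · intro j hj hj'
      have hlt : j - m < (v :: Q).length := by rw [List.length_cons]; omega
      have h5 := hr (j - m) ((v :: Q)[j - m]) (List.getElem?_eq_getElem hlt)
      rw [Nat.add_sub_cancel' hj] at h5
      rw [a3, h5]
      have := rec.lt _ (hbl _ (List.mem_append_right _ (List.getElem_mem hlt))).2.1
      omega
    rintro s2 ⟨e1, e2, e3, e4, L', rec2, e5, e6, e7, e8⟩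
    refine ⟨by rw [e1, hm]; simp; omega, ?_, ?_, L', rec2, e5, e6, ?_, e8⟩
    · intro j b hj
      rcases Nat.lt_trichotomy j P.length with hjl | hjl | hjl
      · rw [List.getElem?_append_left hjl] at hj
        rw [e3 _ (by omega), a3]
        exact hl j b (by rw [List.getElem?_append_left hjl]; exact hj)
      · subst hjl
        simp at hj
        subst hj
        have : m₀ + P.length = m - 1 := by omega
        rw [this, e2]
        rfl
      · obtain ⟨d, rfl⟩ : ∃ d, j = P.length + 1 + d := ⟨j - (P.length + 1), by omega⟩
        rw [List.getElem?_append_right (by omega)] at hj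
        have hd : P.length + 1 + d - P.length = d + 1 := by omega
        rw [hd, List.getElem?_cons_succ] at hj
        have hdQ : d < Q.length := (List.getElem?_eq_some_iff.1 hj).1
        rw [e4 _ (by omega) (by omega), a3]
        have := hr (d + 1) b (by rw [List.getElem?_cons_succ]; exact hj)
        rw [← this]
        congr 1
        omega
    · intro j hj
      rw [e3 _ (by omega), a3]
    · intro b hb
      simp only [List.mem_append, List.mem_cons] at hb
      rcases hb with hb | rfl | hb
      · exact e6 (hbl b (by simp [hb])).2.1
      · exact e7
      · exact e6 (hbl b (by simp [hb])).2.1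

theorem peekProg_run {k X d : ℕ} {s : State} (ctx : VisitContext W Z n x g code s)
    (hsp : s.nvar vSp = k + 1) (hk : k + 1 < Z) (hX : s.A (g + 1) k = X) (hd : s.A g k = d)
    (hXW : X < W) (hdW : d < W) :
    Run W (peekProg g) s 50 (fun s' => (s'.nvar vX = X ∧ s'.nvar vKd = d) ∧
      Frame [vX, vKd] [] [] s s') := by
  have htag := ctx.tag_lt
  have g0 : g < 64 := by omega
  have g1 : g + 1 < 64 := by omega
  obtain ⟨c1, c2, c3, c4, c5, c6, c7, c8, c9⟩ := id ctx
  refine (Run.of_wp_le ?_ (Nat.le_of_ble_eq_true rfl)).frame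
    _ _ _ ?_ (by decide) (by decide)
  · simp [peekProg, hsp, g0, g1, hX, hd]
    omega
  · rcases c9 with rfl | rfl | rfl | rfl <;> decide

theorem leftProg_run {i k : ℕ} {s : State} (ctx : VisitContext W Z n x g code s)
    (hsp : s.nvar vSp = k + 1) (hk : k + 2 < Z) (hX : s.nvar vX = i) (hi : i < n) :
    Run W (leftProg g) s 100 (fun s' => (s'.nvar vSp = k + 2 ∧ s'.A g (k + 1) = 0 ∧
      s'.A (g + 1) (k + 1) = code (3 * i + 1) ∧ s'.A g k = 1 ∧
      (∀ j < k, s'.A g j = s.A g j) ∧ ∀ j < k + 1, s'.A (g + 1) j = s.A (g + 1) j) ∧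
      Frame [vSp] [g, g + 1] [] s s') := by
  have htag := ctx.tag_lt
  have g0 : g < 64 := by omega
  have g1 : g + 1 < 64 := by omega
  have hc := ctx.code_lt (3 * i + 1) (by omega)
  have hload := ctx.code_eq (3 * i + 1) (by omega)
  obtain ⟨c1, c2, c3, c4, c5, c6, c7, c8, c9⟩ := id ctx
  have hl : ((s.stA g k 1).stA g (k + 1) 0).nmem (s.nvar vRul + 3 * i + 1) = code (3 * i + 1) := by
    rw [State.stA_nmem_low _ _ _ _ _ (by simp; omega), State.stA_nmem_low _ _ _ _ _ (by omega),
      add_assoc, hload]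
  refine (Run.of_wp_le ?_ (Nat.le_of_ble_eq_true rfl)).frame
    _ _ _ ?_ (by decide) (by decide)
  · simp [leftProg, hsp, hX, g0, g1, hl]
    repeat refine And.intro (by omega) ?_
    refine ⟨fun j hj => ?_, fun j hj hj' => by omega⟩
    rw [if_neg (by omega), if_neg (by omega)]
  · rcases c9 with rfl | rfl | rfl | rfl <;> decide

theorem rightProg_run {i k m : ℕ} {s : State} (ctx : VisitContext W Z n x g code s)
    (hsp : s.nvar vSp = k + 1) (hk : k + 2 < Z) (hX : s.nvar vX = i) (hi : i < n)
    (hE : s.nvar vEnd = m) (hm : m < Z) :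
    Run W (rightProg g) s 150 (fun s' => (s'.nvar vSp = k + 2 ∧ s'.A g (k + 1) = 0 ∧
      s'.A (g + 1) (k + 1) = code (3 * i + 2) ∧ s'.A g k = 2 ∧ s'.A (g + 2) k = m ∧
      (∀ j < k, s'.A g j = s.A g j) ∧ (∀ j < k + 1, s'.A (g + 1) j = s.A (g + 1) j) ∧
      ∀ j < k, s'.A (g + 2) j = s.A (g + 2) j) ∧
      Frame [vSp] [g, g + 1, g + 2] [] s s') := by
  have htag := ctx.tag_lt
  have g0 : g < 64 := by omega
  have g1 : g + 1 < 64 := by omega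
  have g2 : g + 2 < 64 := by omega
  have hc := ctx.code_lt (3 * i + 2) (by omega)
  have hload := ctx.code_eq (3 * i + 2) (by omega)
  obtain ⟨c1, c2, c3, c4, c5, c6, c7, c8, c9⟩ := id ctx
  have hl : (((s.stA (g + 2) k m).stA g k 2).stA g (k + 1) 0).nmem (s.nvar vRul + 3 * i + 2) =
      code (3 * i + 2) := by
    rw [State.stA_nmem_low _ _ _ _ _ (by simp; omega), State.stA_nmem_low _ _ _ _ _ (by simp; omega),
      State.stA_nmem_low _ _ _ _ _ (by omega), add_assoc, hload]
  refine (Run.of_wp_le ?_ (Nat.le_of_ble_eq_true rfl)).frame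
    _ _ _ ?_ (by decide) (by decide)
  · simp [rightProg, hsp, hX, hE, g0, g1, g2, hl]
    repeat refine And.intro (by omega) ?_
    refine ⟨fun j hj => ?_, fun j hj hj' => by omega, fun j hj hj' => by omega⟩
    rw [if_neg (by omega), if_neg (by omega)]
  · rcases c9 with rfl | rfl | rfl | rfl <;> decide

end RAM

/-! ### Induction over the traversal -/

namespace RAM

variable {σ W Z n x g : ℕ} {code : ℕ → ℕ} {β : ℕ → SLPTree (Fin σ)}

/-- The effect of the visit of the tree `t`, which was on the top of a stack with `k` further
entries, when there were `m` blocks. -/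
structure Visited (W Z n x g : ℕ) (code : ℕ → ℕ) (β : ℕ → SLPTree (Fin σ)) (t : SLPTree (Fin σ))
    (k m : ℕ) (L : List ℕ) (s s' : State) : Prop where
  ctx : VisitContext W Z n x g code s'
  sp : s'.nvar vSp = k
  stack : ∀ j < k, s'.A g j = s.A g j ∧ s'.A (g + 1) j = s.A (g + 1) j ∧
    s'.A (g + 2) j = s.A (g + 2) j
  fin : s'.nvar vEnd = m + (t.blocks x).length
  out : ∀ (j : ℕ) b, (t.blocks x)[j]? = some b → s'.A (g + 3) (m + j) = b.label
  low : ∀ j < m, s'.A (g + 3) j = s.A (g + 3) j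
  record : ∃ L', Recorded g n x β L' s' ∧ s'.nvar vCnt = L'.length ∧ L ⊆ L' ∧
    (∀ b ∈ t.blocks x, b.label ∈ L') ∧ L'.length + 1 ≤ L.length + 2 * t.size

theorem Run.pop {p : Prog} {s : State} {τ k : ℕ} {Q : State → Prop} {V F R : List ℕ}
    (hW : 64 < W) (hk : k + 1 < W) (hsp : s.nvar vSp = k + 1)
    (h : Run W p s τ Q) (hp : p.writes V F R = true) (h3 : 3 ∉ V) (h4 : 4 ∉ V) (h8 : vSp ∉ V) :
    Run W (.seq p (.nset vSp (↟vSp - ♯1))) s (τ + 4) (fun s' => ∃ s₁, Q s₁ ∧ Frame V F R s s₁ ∧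
      s'.nvar vSp = k ∧ Frame [vSp] [] [] s₁ s') := by
  refine Run.seq ((h.frame V F R hp h3 h4).mono le_rfl ?_)
  rintro s1 ⟨h1, hf⟩
  have e : s1.nvar vSp = k + 1 := by rw [hf.nvar _ h8, hsp]
  refine ((Run.of_wp_le (Q := fun s' => s'.nvar vSp = k) ?_
    (Nat.le_of_ble_eq_true rfl)).frame [vSp] [] [] (by decide) (by decide) (by decide)).mono le_rfl ?_
  · simp [e]
    omega
  · rintro s2 ⟨h2, hf2⟩
    exact ⟨s1, h1, hf, h2, hf2⟩

theorem visitLoop_leaf {i k m τ' : ℕ} {a : Fin σ} {L : List ℕ} {s : State} {Q : State → Prop}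
    (hx : 1 ≤ x) (coh : (SLPTree.leaf i a).Coherent x n code β)
    (ctx : VisitContext W Z n x g code s) (rec : Recorded g n x β L s)
    (hcnt : s.nvar vCnt = L.length) (hsp : s.nvar vSp = k + 1) (hK : s.A g k = 0)
    (hX : s.A (g + 1) k = i) (hE : s.nvar vEnd = m) (hkZ : k + 1 < Z) (hmZ : m + 1 < Z)
    (hQ : ∀ s', Visited W Z n x g code β (.leaf i a) k m L s s' →
      Run W (.loop (.nlt ♯0 ↟vSp) (visitBody g)) s' τ' Q) :
    Run W (.loop (.nlt ♯0 ↟vSp) (visitBody g)) s (1000 + τ') Q := by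
  obtain ⟨hi, hc0, hc1, hβ⟩ := coh
  have htag := ctx.tag_lt
  obtain ⟨c1, c2, c3, c4, c5, c6, c7, c8, c9⟩ := id ctx
  have hcl := c8 (3 * i) (by omega)
  refine Run.mono (τ := 3 + (50 + (3 + (10 + (300 + 4)))) + τ') ?_ (by omega) fun _ => id
  refine Run.loop_step (by simp; omega) (by simp [hsp]) ?_
  refine Run.seq ((peekProg_run ctx hsp hkZ hX hK (by omega) (by omega)).mono le_rfl ?_)
  rintro s1 ⟨⟨h1, h2⟩, hf1⟩
  have ctx1 := ctx.frame hf1 (by decide)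
  have n1 : ∀ y, y ∉ [vX, vKd] → s1.nvar y = s.nvar y := hf1.nvar
  have hload := ctx1.code_eq (3 * i) (by omega)
  rw [n1 _ (by decide)] at hload
  refine Run.ite (b := .neq ↟vKd ♯0) (by simp [h2]; omega) (fun _ => ?_)
    (fun hb => absurd (by simpa using h2) hb)
  refine Run.mono (Run.ite (b := .neq (.load (↟vRul + ♯3 * ↟vX)) ♯0) (τ := 300 + 4)
    (by simp [h1, n1, hload]; omega) (fun _ => ?_) (fun hb => absurd ?_ hb))
    (Nat.le_of_ble_eq_true rfl) fun _ => id
  · refine (Run.pop (k := k) (V := [vEnd, vU, vV, vSum, vCnt]) (F := [g + 3, g + 4, g + 5, g + 6, g + 7,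
      g + 8, g + 9]) (R := []) (by omega) (by omega)
      (by rw [n1 _ (by decide), hsp])
      (termProg_run hx ctx1 (rec.frame hf1 (by simp) (by omega)) (by rw [n1 _ (by decide), hcnt]) h1 h2
      hi hc1 hβ (by rw [n1 _ (by decide), hE]) hmZ) ?_ (by decide) (by decide) (by decide)).mono
      le_rfl ?_
    · rcases c9 with rfl | rfl | rfl | rfl <;> decide
    rintro s3 ⟨s2, ⟨e1, e2, e3, L', e4, e5, e6, e7, e8⟩, hf2, e9, hf3⟩
    refine hQ s3 ⟨(ctx1.frame hf2 (by decide)).frame hf3 (by decide), e9, fun j hj => ⟨?_, ?_, ?_⟩,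
      ?_, ?_, ?_, L', e4.frame hf3 (by simp) (by omega), ?_, e6, ?_, ?_⟩
    · rw [hf3.A _ (by simp) (by omega), hf2.A _ (by simp) (by omega), hf1.A _ (by simp) (by omega)]
    · rw [hf3.A _ (by simp) (by omega), hf2.A _ (by simp) (by omega), hf1.A _ (by simp) (by omega)]
    · rw [hf3.A _ (by simp) (by omega), hf2.A _ (by simp) (by omega), hf1.A _ (by simp) (by omega)]
    · rw [hf3.nvar _ (by decide), e1]
      simp [SLPTree.blocks]
    · intro j b hj
      rw [SLPTree.blocks, List.getElem?_singleton] at hj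
      split_ifs at hj with h0
      simp only [Option.some.injEq] at hj
      subst h0 hj
      rw [hf3.A _ (by simp) (by omega)]
      exact e2
    · intro j hj
      rw [hf3.A _ (by simp) (by omega), e3 j hj, hf1.A _ (by simp) (by omega)]
    · rw [hf3.nvar _ (by decide), e5]
    · simpa [SLPTree.blocks, SLPTree.label] using e7
    · simp only [SLPTree.size]
      omega
  · simp [h1, n1, hload, hc0]

/-- The induction is on the tree, but the program has a single flat loop. So the claim is stated
with a continuation: if the loop can be completed in time `τ'` from every state in which the tree
has been visited, it can be completed from the present state with the cost of the visit added. The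
two factors are then handled by nesting the continuations. A tree with `k` leaves adds at most `2 *
k - 1` records, one per node. -/
theorem visitLoop_run (hx : 1 ≤ x) (t : SLPTree (Fin σ)) (coh : t.Coherent x n code β) :
    ∀ {k m τ' : ℕ} {L : List ℕ} {s : State} {Q : State → Prop},
    VisitContext W Z n x g code s → Recorded g n x β L s →
    s.nvar vCnt = L.length → s.nvar vSp = k + 1 → s.A g k = 0 →
    s.A (g + 1) k = t.label → s.nvar vEnd = m → k + t.size < Z → m + t.size < Z →
    (∀ s', Visited W Z n x g code β t k m L s s' →
      Run W (.loop (.nlt ♯0 ↟vSp) (visitBody g)) s' τ' Q) →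
    Run W (.loop (.nlt ♯0 ↟vSp) (visitBody g)) s (1000 * t.visitCost x + τ') Q := by
  induction t with
  | leaf i a =>
    intro k m τ' L s Q ctx rec hcnt hsp hK hX hE hkZ hmZ hQ
    exact visitLoop_leaf hx coh ctx rec hcnt hsp hK hX hE hkZ hmZ hQ
  | node i l r ihl ihr =>
    intro k m τ' L s Q ctx rec hcnt hsp hK hX hE hkZ hmZ hQ
    obtain ⟨hi, hc0, hc1, hc2, hβ, cohl, cohr⟩ := coh
    have htag := ctx.tag_lt
    obtain ⟨P, u, hP⟩ := l.exists_blocks_last x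
    obtain ⟨v, R, hR⟩ := r.exists_blocks_head x
    rw [SLPTree.top_node hP hR] at hβ
    have hPl := l.length_blocks_le x
    have hRl := r.length_blocks_le x
    rw [hP, List.length_append, List.length_singleton] at hPl
    rw [hR, List.length_cons] at hRl
    have hlab : (SLPTree.node i l r).label = i := rfl
    have hsz : (SLPTree.node i l r).size = l.size + r.size := rfl
    have hl0 := l.size_pos
    have hr0 := r.size_pos
    rw [hlab] at hX
    rw [hsz] at hkZ hmZ
    obtain ⟨c1, c2, c3, c4, c5, c6, c7, c8, c9⟩ := id ctx
    have hcl := c8 (3 * i) (by omega)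
    -- The number of blocks drops at the node exactly when the seam is merged.
    have hmerge : (if ((SLPTree.node i l r).blocks x).length < (l.blocks x).length +
        (r.blocks x).length then (r.blocks x).length else 0) =
        if u.size + v.size ≤ x then R.length + 1 else 0 := by
      rw [SLPTree.blocks, hP, hR, SLPTree.joinBlocks_eq]
      by_cases huv : u.size + v.size ≤ x
      · rw [if_pos huv, if_pos huv, if_pos (by simp), List.length_cons]
      · rw [if_neg huv, if_neg huv, if_neg (by simp; omega)]
    rw [SLPTree.visitCost, hmerge]
    obtain ⟨cm, hcm⟩ : ∃ cm, cm = if u.size + v.size ≤ x then R.length + 1 else 0 := ⟨_, rfl⟩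
    rw [← hcm]
    -- the first factor
    refine Run.mono (τ := (3 + (50 + (3 + (10 + 100)))) + (1000 * l.visitCost x +
      ((3 + (50 + (3 + (3 + 150)))) + (1000 * r.visitCost x +
      ((3 + (50 + (3 + (3 + (500 + 45 * cm + 4))))) + τ')))))
      ?_ (by omega) fun _ => id
    refine Run.loop_step (by simp; omega) (by simp [hsp]) ?_
    refine Run.seq ((peekProg_run ctx hsp (by omega) hX hK (by omega) (by omega)).mono le_rfl ?_)
    rintro s1 ⟨⟨h1, h2⟩, hf1⟩
    have ctx1 := ctx.frame hf1 (by decide)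
    have n1 : ∀ y, y ∉ [vX, vKd] → s1.nvar y = s.nvar y := hf1.nvar
    have hload := ctx1.code_eq (3 * i) (by omega)
    rw [n1 _ (by decide)] at hload
    refine Run.ite (b := .neq ↟vKd ♯0) (by simp [h2]; omega) (fun _ => ?_)
      (fun hb => absurd (by simpa using h2) hb)
    refine Run.mono (Run.ite (b := .neq (.load (↟vRul + ♯3 * ↟vX)) ♯0) (τ := 100)
      (by simp [h1, n1, hload]; omega) (fun hb => ?_) (fun _ => ?_))
      (Nat.le_of_ble_eq_true rfl) fun _ => id
    · simp [h1, n1, hload, hc0] at hb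
    refine (leftProg_run ctx1 (k := k) (by rw [n1 _ (by decide), hsp]) (by omega) h1 hi).mono
      le_rfl ?_
    rintro s2 ⟨⟨a1, a2, a3, a4, a5, a6⟩, hf2⟩
    have n2 : ∀ y, y ∉ [vX, vKd] → y ∉ [vSp] → s2.nvar y = s.nvar y := fun y hy hy' => by
      rw [hf2.nvar y hy', n1 y hy]
    refine ihl cohl (k := k + 1) (m := m) (L := L) (ctx1.frame hf2 (by decide))
      ((rec.frame hf1 (by simp) (by omega)).frame hf2 (by simp) (by omega))
      (by rw [n2 _ (by decide) (by decide), hcnt]) a1 a2 (by rw [a3, hc1])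
      (by rw [n2 _ (by decide) (by decide), hE]) (by omega) (by omega) ?_
    rintro s3 ⟨ctx3, sp3, st3, fin3, out3, low3, L3, rec3, cnt3, sub3, mem3, len3⟩
    rw [hP, List.length_append, List.length_singleton] at fin3
    -- the second factor
    refine Run.loop_step (by simp; omega) (by simp [sp3]) ?_
    refine Run.seq ((peekProg_run ctx3 sp3 (by omega)
      (by rw [(st3 k (by omega)).2.1, a6 k (by omega), hf1.A _ (by simp) (by omega), hX])
      (by rw [(st3 k (by omega)).1, a4]) (by omega) (by omega)).mono le_rfl ?_)
    rintro s4 ⟨⟨h3, h4⟩, hf4⟩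
    have ctx4 := ctx3.frame hf4 (by decide)
    have n4 : ∀ y, y ∉ [vX, vKd] → s4.nvar y = s3.nvar y := hf4.nvar
    refine Run.ite (b := .neq ↟vKd ♯0) (by simp [h4]; omega)
      (fun hb => absurd hb (by simp [h4])) (fun _ => ?_)
    refine Run.ite (b := .neq ↟vKd ♯1) (by simp [h4]; omega) (fun _ => ?_)
      (fun hb => absurd (by simpa using h4) hb)
    refine (rightProg_run ctx4 (k := k) (by rw [n4 _ (by decide), sp3]) (by omega) h3 hi
      (by rw [n4 _ (by decide), fin3]) (by omega)).mono le_rfl ?_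
    rintro s5 ⟨⟨b1, b2, b3, b4, b5, b6, b7, b8⟩, hf5⟩
    have n5 : ∀ y, y ∉ [vX, vKd] → y ∉ [vSp] → s5.nvar y = s3.nvar y := fun y hy hy' => by
      rw [hf5.nvar y hy', n4 y hy]
    refine ihr cohr (k := k + 1) (m := m + (P.length + 1)) (L := L3) (ctx4.frame hf5 (by decide))
      ((rec3.frame hf4 (by simp) (by omega)).frame hf5 (by simp) (by omega))
      (by rw [n5 _ (by decide) (by decide), cnt3]) b1 b2 (by rw [b3, hc2])
      (by rw [n5 _ (by decide) (by decide), fin3]) (by omega) (by omega) ?_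
    rintro s6 ⟨ctx6, sp6, st6, fin6, out6, low6, L6, rec6, cnt6, sub6, mem6, len6⟩
    rw [hR, List.length_cons] at fin6
    -- the seam
    refine Run.loop_step (by simp; omega) (by simp [sp6]) ?_
    refine Run.seq ((peekProg_run ctx6 sp6 (by omega)
      (by rw [(st6 k (by omega)).2.1, b7 k (by omega), hf4.A _ (by simp) (by omega),
        (st3 k (by omega)).2.1, a6 k (by omega), hf1.A _ (by simp) (by omega), hX])
      (by rw [(st6 k (by omega)).1, b4]) (by omega) (by omega)).mono le_rfl ?_)
    rintro s7 ⟨⟨h5, h6⟩, hf7⟩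
    have ctx7 := ctx6.frame hf7 (by decide)
    have n7 : ∀ y, y ∉ [vX, vKd] → s7.nvar y = s6.nvar y := hf7.nvar
    refine Run.ite (b := .neq ↟vKd ♯0) (by simp [h6]; omega)
      (fun hb => absurd hb (by simp [h6])) (fun _ => ?_)
    refine Run.ite (b := .neq ↟vKd ♯1) (by simp [h6]; omega)
      (fun hb => absurd hb (by simp [h6])) (fun _ => ?_)
    have o3 : ∀ j, s7.A (g + 3) j = s6.A (g + 3) j := hf7.A (g + 3) (by simp) (by omega)
    have low36 : ∀ j < m + (P.length + 1), s6.A (g + 3) j = s3.A (g + 3) j := fun j hj => by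
      rw [low6 j hj, hf5.A _ (by simp) (by omega), hf4.A _ (by simp) (by omega)]
    rw [hP] at out3 mem3
    rw [hR] at out6 mem6
    have seam := seamProg_run (m₀ := m) (m := m + (P.length + 1)) (k := k) (P := P) (Q := R)
      (u := u) (v := v) ctx7 (rec6.frame hf7 (by simp) (by omega)) (by rw [n7 _ (by decide), cnt6])
      h5 hi hβ (by rw [n7 _ (by decide), sp6]) (by omega)
      (by rw [hf7.A _ (by simp) (by omega), (st6 k (by omega)).2.2, b5]) (by omega)
      (by rw [n7 _ (by decide), fin6]; omega) (by omega)
      (fun j b hj => by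
        have hjl := (List.getElem?_eq_some_iff.1 hj).1
        rw [List.length_append, List.length_singleton] at hjl
        rw [o3, low36 _ (by omega), out3 j b hj])
      (fun j b hj => by rw [o3, out6 j b hj])
      (fun b hb => by
        rcases List.mem_append.1 hb with hb | hb
        · exact ⟨(cohl.block b (hP ▸ hb)).2, sub6 (mem3 b hb),
            SLPTree.size_le_of_mem_blocks hx l b (hP ▸ hb)⟩
        · exact ⟨(cohr.block b (hR ▸ hb)).2, mem6 b hb,
            SLPTree.size_le_of_mem_blocks hx r b (hR ▸ hb)⟩)
    rw [← hcm] at seam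
    refine (Run.pop (k := k) (V := [vM, vU, vV, vSum, vI, vEnd, vKd, vCnt]) (F := [g + 3, g + 4,
      g + 5, g + 6, g + 7, g + 8, g + 9]) (R := []) (by omega) (by omega)
      (by rw [n7 _ (by decide), sp6]) seam ?_ (by decide) (by decide) (by decide)).mono le_rfl ?_
    · rcases c9 with rfl | rfl | rfl | rfl <;> decide
    rintro s9 ⟨s8, ⟨e1, e2, e3, L', e4, e5, e6, e7, e8⟩, hf8, e9, hf9⟩
    have hst : ∀ f, f = g ∨ f = g + 1 ∨ f = g + 2 → ∀ j, s9.A f j = s6.A f j := by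
      intro f hf j
      rw [hf9.A f (by simp) (by omega), hf8.A f (by simp; omega) (by omega),
        hf7.A f (by simp) (by omega)]
    have hB : (SLPTree.node i l r).blocks x = SLPTree.joinBlocks x i (P ++ [u]) (v :: R) := by
      rw [SLPTree.blocks, hP, hR]
    have o9 : ∀ j, s9.A (g + 3) j = s8.A (g + 3) j := hf9.A (g + 3) (by simp) (by omega)
    refine hQ s9 ⟨(ctx7.frame hf8 (by decide)).frame hf9 (by decide), e9, fun j hj => ⟨?_, ?_, ?_⟩,
      ?_, ?_, ?_, L', e4.frame hf9 (by simp) (by omega), ?_, ?_, ?_, ?_⟩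
    · rw [hst _ (by simp), (st6 j (by omega)).1, b6 j hj, hf4.A _ (by simp) (by omega),
        (st3 j (by omega)).1, a5 j hj, hf1.A _ (by simp) (by omega)]
    · rw [hst _ (by simp), (st6 j (by omega)).2.1, b7 j (by omega), hf4.A _ (by simp) (by omega),
        (st3 j (by omega)).2.1, a6 j (by omega), hf1.A _ (by simp) (by omega)]
    · rw [hst _ (by simp), (st6 j (by omega)).2.2, b8 j hj, hf4.A _ (by simp) (by omega),
        (st3 j (by omega)).2.2, hf2.A _ (by simp) (by omega), hf1.A _ (by simp) (by omega)]
    · rw [hf9.nvar _ (by decide), e1, hB]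
    · intro j b hj
      rw [hB] at hj
      rw [o9, e2 j b hj]
    · intro j hj
      rw [o9, e3 j hj, o3, low36 j (by omega), low3 j hj, hf2.A _ (by simp) (by omega),
        hf1.A _ (by simp) (by omega)]
    · rw [hf9.nvar _ (by decide), e5]
    · exact fun X hX => e6 (sub6 (sub3 hX))
    · rw [hB]
      exact e7
    · rw [hsz]
      omega

/-- The list of blocks `bs` and the blocks with labels in `L` are in the memory. -/
structure Partition (g n x : ℕ) (β : ℕ → SLPTree (Fin σ)) (bs : List (SLPTree (Fin σ)))
    (L : List ℕ) (s : State) : Prop where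
  out : ∀ (j : ℕ) b, bs[j]? = some b → s.A (g + 3) j = b.label
  record : Recorded g n x β L s
  mem : ∀ b ∈ bs, b.label ∈ L
  block : ∀ b ∈ bs, β b.label = b

theorem Partition.frame {bs : List (SLPTree (Fin σ))} {L : List ℕ} {s s' : State}
    (h : Partition g n x β bs L s) {V F R : List ℕ} (hf : Frame V F R s s')
    (hF : ∀ x ∈ [g + 3, g + 4, g + 5, g + 6, g + 7, g + 8, g + 9], x ∉ F) (hg : g + 9 < 64) :
    Partition g n x β bs L s' :=
  ⟨fun j b hj => by rw [hf.A _ (hF _ (by simp)) (by omega), h.out j b hj],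
    h.record.frame hf (fun y hy => hF y (List.mem_cons_of_mem _ hy)) hg, h.mem, h.block⟩

theorem visitProg_run {s : State} (hx : 1 ≤ x) (t : SLPTree (Fin σ)) (coh : t.Coherent x n code β)
    (ctx : VisitContext W Z n x g code s) (hroot : s.nvar vRoot = t.label)
    (hzero : ∀ X, s.A (g + 4) X = 0) (hZ : t.size < Z) :
    Run W (visitProg g) s (1000 * t.visitCost x + 100) (fun s' => ∃ L,
      Partition g n x β (t.blocks x) L s' ∧ s'.nvar vEnd = (t.blocks x).length ∧
      s'.nvar vCnt = L.length ∧ L.length + 1 ≤ 2 * t.size) := by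
  have htag := ctx.tag_lt
  have g0 : g < 64 := by omega
  have g1 : g + 1 < 64 := by omega
  have g4 : g + 4 < 64 := by omega
  have hlt := coh.label_lt
  obtain ⟨c1, c2, c3, c4, c5, c6, c7, c8, c9⟩ := id ctx
  refine Run.mono (τ := 50 + (1000 * t.visitCost x + 3)) ?_ (by omega) fun _ => id
  refine Run.seq (((Run.of_wp_le (p := visitInit g) (W := W) (s := s) (τ := 50)
    (Q := fun s' => s'.nvar vSp = 1 ∧ s'.A g 0 = 0 ∧ s'.A (g + 1) 0 = t.label ∧
      s'.nvar vEnd = 0 ∧ s'.nvar vCnt = 0) ?_ (Nat.le_of_ble_eq_true rfl)).frame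
      [vSp, vEnd, vCnt] [g, g + 1] [] ?_ (by decide) (by decide)).mono le_rfl ?_)
  · simp [visitInit, hroot, g0, g1]
    omega
  · rcases c9 with rfl | rfl | rfl | rfl <;> decide
  rintro s1 ⟨⟨h1, h2, h3, h4, h5⟩, hf⟩
  have hrec : Recorded g n x β [] s1 := by
    constructor <;> simp
    intro X
    rw [hf.A _ (by simp) g4, hzero]
  refine visitLoop_run hx t coh (k := 0) (m := 0) (L := []) (ctx.frame hf (by decide)) hrec
    (by rw [h5]; rfl) h1 h2 h3 h4 (by omega) (by omega) ?_
  rintro s2 ⟨ctx2, sp2, -, fin2, out2, -, L, rec2, cnt2, -, mem2, len2⟩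
  refine Run.loop_exit (by simp [sp2]; omega) (by simp [sp2]) ⟨L, ⟨fun j b hj => ?_, rec2, mem2,
    fun b hb => (coh.block b hb).2⟩, ?_, cnt2, by simpa using len2⟩
  · have := out2 j b hj
    rwa [Nat.zero_add] at this
  · rw [fin2, Nat.zero_add]

end RAM

/-! ### Composition of blocks -/

namespace GridCosts

variable (G : GridCosts)

/-- Between two vertices of the same column the vertical path is the only one, so every vertex on it
splits the distance. -/
theorem dist_column {a b r : ℕ} (har : a ≤ r) : ∀ {i : ℕ}, r ≤ i →
    G.dist a b i b = G.dist a b r b + G.dist r b i b := by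
  have step : ∀ {a i : ℕ}, a ≤ i → G.dist a b (i + 1) b = G.dist a b i b + G.del i := by
    intro a i hai
    refine le_antisymm (G.dist_del_le a b i b) ?_
    have hne := G.dist_ne_top (a := a) (b := b) (i := i + 1) (j := b) (by omega) le_rfl
    rcases G.dist_cases (by omega) hne with ⟨i', h1, h2⟩ | ⟨j', h1, h2⟩ | ⟨i', j', h1, h3, h2⟩
    · obtain rfl : i' = i := by omega
      exact h2.ge
    · rw [G.dist_eq_top (j := j') (by omega), top_add] at h2
      exact absurd h2 hne
    · rw [G.dist_eq_top (j := j') (by omega), top_add] at h2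
      exact absurd h2 hne
  intro i hri
  induction i, hri using Nat.le_induction with
  | base => simp
  | succ i hi ih => rw [step (by omega), step hi, ih, add_assoc]

/-- The same for the only path between two vertices of a row. -/
theorem dist_row {a b c : ℕ} (hbc : b ≤ c) : ∀ {j : ℕ}, c ≤ j →
    G.dist a b a j = G.dist a b a c + G.dist a c a j := by
  have step : ∀ {b j : ℕ}, b ≤ j → G.dist a b a (j + 1) = G.dist a b a j + G.ins j := by
    intro b j hbj
    refine le_antisymm (G.dist_ins_le a b a j) ?_
    have hne := G.dist_ne_top (a := a) (b := b) (i := a) (j := j + 1) le_rfl (by omega)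
    rcases G.dist_cases (by omega) hne with ⟨i', h1, h2⟩ | ⟨j', h1, h2⟩ | ⟨i', j', h1, h3, h2⟩
    · rw [G.dist_eq_top (i := i') (by omega), top_add] at h2
      exact absurd h2 hne
    · obtain rfl : j' = j := by omega
      exact h2.ge
    · rw [G.dist_eq_top (i := i') (by omega), top_add] at h2
      exact absurd h2 hne
  intro j hcj
  induction j, hcj using Nat.le_induction with
  | base => simp
  | succ j hj ih => rw [step (by omega), step hj, ih, add_assoc]

end GridCosts

/-- The distances across the block with the rows `X` and the columns `Y`. -/
noncomputable def Scoring.blockDist {α : Type} (C : Scoring α) (X Y : List α) (i j : ℕ) :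
    WithTop ℝ :=
  (C.grid X Y).dist (inRow 0 X.length i) (inCol 0 X.length i) (outRow 0 X.length Y.length j)
    (outCol 0 Y.length j)

theorem GridCosts.Looks.blockDist {α : Type} {C : Scoring α} {X Y : List α} {G : GridCosts}
    {r c p q : ℕ} (hp : X.length = p) (hq : Y.length = q) (h : G.Looks (C.grid X Y) r c p q)
    (i j : ℕ) : G.dist (inRow r p i) (inCol c p i) (outRow r p q j) (outCol c q j) =
      C.blockDist X Y i j := by
  subst hp hq
  rw [Scoring.blockDist]
  unfold inRow inCol outRow outCol
  rw [h.dist_eq _ _ _ (by omega) _ (by omega)]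
  simp only [Nat.zero_add]

/-! ### A unit vector pushed across two adjacent blocks -/

namespace RAM

/-- The vector that is zero at the source and infinite elsewhere. -/
noncomputable def unitVal (i₀ k : ℕ) : WithTop ℝ := if k = i₀ then 0 else ⊤

/-- The vector after the propagation across the upper one of two blocks, with `p₁` and `p₂` rows. -/
noncomputable def upperVal (G : GridCosts) (p₁ p₂ q i₀ k : ℕ) : WithTop ℝ :=
  if p₂ ≤ k ∧ k ≤ p₂ + (p₁ + q) then
    G.dist (inRow 0 (p₁ + p₂) i₀) (inCol 0 (p₁ + p₂) i₀) (outRow 0 p₁ q (k - p₂))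
      (outCol 0 q (k - p₂))
  else unitVal i₀ k

/-- The vector after the propagation across the left one of two blocks, with `q₁` and `q₂`
columns. -/
noncomputable def leftVal (G : GridCosts) (p q₁ i₀ k : ℕ) : WithTop ℝ :=
  if k ≤ p + q₁ then
    G.dist (inRow 0 p i₀) (inCol 0 p i₀) (outRow 0 p q₁ k) (outCol 0 q₁ k)
  else unitVal i₀ k

/-- The vector after the propagation across a block. -/
noncomputable def blockVal (G : GridCosts) (p q i₀ k : ℕ) : WithTop ℝ :=
  if k ≤ p + q then
    G.dist (inRow 0 p i₀) (inCol 0 p i₀) (outRow 0 p q k) (outCol 0 q k)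
  else ⊤

variable {G : GridCosts} {D : ℕ → ℕ → ℝ} {i₀ : ℕ}

/-- Counted along the boundary of the union, the inputs of the upper block start at `p₂`. Two inputs
are comparable only along a side, so an input of the upper block at finite distance forces the
source to be one of its inputs as well, and the unit vector suffices. -/
theorem propagates_upper {p₁ p₂ q : ℕ}
    (tab : ∀ i ≤ p₁ + q, ∀ j ≤ p₁ + q, j ≤ i + q → i ≤ j + p₁ → (D i j : WithTop ℝ) =
      G.dist (inRow 0 p₁ i) (inCol 0 p₁ i) (outRow 0 p₁ q j) (outCol 0 q j)) :
    Propagates G (inRow 0 (p₁ + p₂) i₀) (inCol 0 (p₁ + p₂) i₀) 0 0 p₁ q p₂ D (unitVal i₀)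
      (upperVal G p₁ p₂ q i₀) where
  src := by unfold inRow inCol; omega
  before i hi := by
    unfold unitVal
    split_ifs with h
    · subst h
      rw [show inRow 0 p₁ i = inRow 0 (p₁ + p₂) (p₂ + i) by unfold inRow; omega,
        show inCol 0 p₁ i = inCol 0 (p₁ + p₂) (p₂ + i) by unfold inCol; omega, G.dist_self]
    · exact le_top
  base i hi hne := by
    have h := G.dist_ne_top_iff.1 hne
    unfold inRow inCol at h
    refine ⟨i₀ - p₂, by omega, ?_⟩
    have h1 : inRow 0 p₁ (i₀ - p₂) = inRow 0 (p₁ + p₂) i₀ := by unfold inRow; omega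
    have h2 : inCol 0 p₁ (i₀ - p₂) = inCol 0 (p₁ + p₂) i₀ := by unfold inCol; omega
    rw [h1, h2, unitVal, if_pos (by omega), zero_add]
  after j hj := by
    rw [upperVal, if_pos (by omega), Nat.add_sub_cancel_left]
  outside k hk := by
    rw [upperVal, if_neg (by omega)]
  tab := tab

/-- The lower side of the upper block is the upper side of the lower block, where the vector is
exact by now. Along the left side of the lower block it may be infinite although the distance is
finite; the column then passes through the source, or through the corner `p₂` if the source lies
above. This is why `base` does not ask for exact values everywhere. -/
theorem propagates_lower {p₁ p₂ q : ℕ} (hi₀ : i₀ ≤ p₁ + p₂ + q)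
    (tab : ∀ i ≤ p₂ + q, ∀ j ≤ p₂ + q, j ≤ i + q → i ≤ j + p₂ → (D i j : WithTop ℝ) =
      G.dist (inRow p₁ p₂ i) (inCol 0 p₂ i) (outRow p₁ p₂ q j) (outCol 0 q j)) :
    Propagates G (inRow 0 (p₁ + p₂) i₀) (inCol 0 (p₁ + p₂) i₀) p₁ 0 p₂ q 0 D
      (upperVal G p₁ p₂ q i₀) (blockVal G (p₁ + p₂) q i₀) := by
  have hup : ∀ i, p₂ ≤ i → i ≤ p₂ + q → upperVal G p₁ p₂ q i₀ i =
      G.dist (inRow 0 (p₁ + p₂) i₀) (inCol 0 (p₁ + p₂) i₀) (inRow p₁ p₂ i) (inCol 0 p₂ i) := by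
    intro i h1 h2
    rw [upperVal, if_pos (by omega),
      show outRow 0 p₁ q (i - p₂) = inRow p₁ p₂ i by unfold outRow inRow; omega,
      show outCol 0 q (i - p₂) = inCol 0 p₂ i by unfold outCol inCol; omega]
  refine ⟨by unfold inRow inCol; omega, fun i hi => ?_, fun i hi hne => ?_, fun j hj => ?_,
    fun k hk => ?_, tab⟩
  · rw [Nat.zero_add]
    by_cases h : p₂ ≤ i
    · rw [hup i h hi]
    · rw [upperVal, if_neg (by omega), unitVal]
      split_ifs with h'
      · subst h'
        rw [show inRow p₁ p₂ i = inRow 0 (p₁ + p₂) i by unfold inRow; omega,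
          show inCol 0 p₂ i = inCol 0 (p₁ + p₂) i by unfold inCol; omega, G.dist_self]
      · exact le_top
  · simp only [Nat.zero_add]
    by_cases h : p₂ ≤ i
    · exact ⟨i, hi, by rw [hup i h hi, G.dist_self, add_zero]⟩
    · by_cases h' : i₀ < p₂
      · refine ⟨i₀, by omega, ?_⟩
        rw [upperVal, if_neg (by omega), unitVal, if_pos rfl, zero_add,
          show inRow p₁ p₂ i₀ = inRow 0 (p₁ + p₂) i₀ by unfold inRow; omega,
          show inCol 0 p₂ i₀ = inCol 0 (p₁ + p₂) i₀ by unfold inCol; omega]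
      -- The source lies on the left side above the lower block, so the path runs down the first
      -- column and through the corner.
      · refine ⟨p₂, by omega, ?_⟩
        rw [hup p₂ le_rfl (by omega)]
        have h3 := G.dist_ne_top_iff.1 hne
        have e1 : inCol 0 p₂ i = 0 := by unfold inCol; omega
        have e2 : inCol 0 p₂ p₂ = 0 := by unfold inCol; omega
        have e3 : inCol 0 (p₁ + p₂) i₀ = 0 := by omega
        have e4 : inRow p₁ p₂ p₂ = p₁ := by unfold inRow; omega
        rw [e1, e2, e3, e4]
        refine G.dist_column ?_ ?_
        · unfold inCol at e3
          unfold inRow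
          omega
        · unfold inRow
          omega
  · rw [Nat.zero_add, blockVal, if_pos (by omega),
      show outRow 0 (p₁ + p₂) q j = outRow p₁ p₂ q j by unfold outRow; omega]
  · rw [blockVal, upperVal]
    by_cases h : k ≤ p₁ + p₂ + q
    · rw [if_pos h, if_pos (by omega),
        show outRow 0 (p₁ + p₂) q k = outRow 0 p₁ q (k - p₂) by unfold outRow; omega,
        show outCol 0 q k = outCol 0 q (k - p₂) by unfold outCol; omega]
    · rw [if_neg h, if_neg (by omega), unitVal, if_neg (by omega)]

/-- The inputs of the left block start at 0 in the union, so no shift is needed; again a finite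
distance between inputs puts the source among them. -/
theorem propagates_left {p q₁ : ℕ}
    (tab : ∀ i ≤ p + q₁, ∀ j ≤ p + q₁, j ≤ i + q₁ → i ≤ j + p → (D i j : WithTop ℝ) =
      G.dist (inRow 0 p i) (inCol 0 p i) (outRow 0 p q₁ j) (outCol 0 q₁ j)) :
    Propagates G (inRow 0 p i₀) (inCol 0 p i₀) 0 0 p q₁ 0 D (unitVal i₀)
      (leftVal G p q₁ i₀) where
  src := by unfold inRow inCol; omega
  before i hi := by
    rw [unitVal, Nat.zero_add]
    split_ifs with h
    · rw [h, G.dist_self]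
    · exact le_top
  base i hi hne := by
    have h := G.dist_ne_top_iff.1 hne
    unfold inRow inCol at h
    exact ⟨i₀, by omega, by rw [unitVal, if_pos (Nat.zero_add _), zero_add]⟩
  after j hj := by
    rw [leftVal, if_pos (by omega), Nat.zero_add]
  outside k hk := by
    rw [leftVal, if_neg (by omega)]
  tab := tab

/-- The mirror image of the vertical case: the left side of the right block is exact, and its upper
side is reached along a row, through the source or through the corner `p`. -/
theorem propagates_right {p q₁ q₂ : ℕ} (hi₀ : i₀ ≤ p + (q₁ + q₂))
    (tab : ∀ i ≤ p + q₂, ∀ j ≤ p + q₂, j ≤ i + q₂ → i ≤ j + p → (D i j : WithTop ℝ) =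
      G.dist (inRow 0 p i) (inCol q₁ p i) (outRow 0 p q₂ j) (outCol q₁ q₂ j)) :
    Propagates G (inRow 0 p i₀) (inCol 0 p i₀) 0 q₁ p q₂ q₁ D
      (leftVal G p q₁ i₀) (blockVal G p (q₁ + q₂) i₀) := by
  have hup : ∀ i, i ≤ p → leftVal G p q₁ i₀ (q₁ + i) =
      G.dist (inRow 0 p i₀) (inCol 0 p i₀) (inRow 0 p i) (inCol q₁ p i) := by
    intro i h1
    rw [leftVal, if_pos (by omega),
      show outRow 0 p q₁ (q₁ + i) = inRow 0 p i by unfold outRow inRow; omega,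
      show outCol 0 q₁ (q₁ + i) = inCol q₁ p i by unfold outCol inCol; omega]
  refine ⟨by unfold inRow inCol; omega, fun i hi => ?_, fun i hi hne => ?_, fun j hj => ?_,
    fun k hk => ?_, tab⟩
  · by_cases h : i ≤ p
    · rw [hup i h]
    · rw [leftVal, if_neg (by omega), unitVal]
      split_ifs with h'
      · subst h'
        rw [show inRow 0 p (q₁ + i) = inRow 0 p i by unfold inRow; omega,
          show inCol 0 p (q₁ + i) = inCol q₁ p i by unfold inCol; omega, G.dist_self]
      · exact le_top
  · by_cases h : i ≤ p
    · exact ⟨i, hi, by rw [hup i h, G.dist_self, add_zero]⟩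
    · by_cases h' : p + q₁ < i₀
      · refine ⟨i₀ - q₁, by omega, ?_⟩
        rw [leftVal, if_neg (by omega), unitVal, if_pos (by omega), zero_add,
          show inRow 0 p (i₀ - q₁) = inRow 0 p i₀ by unfold inRow; omega,
          show inCol q₁ p (i₀ - q₁) = inCol 0 p i₀ by unfold inCol; omega]
      · refine ⟨p, by omega, ?_⟩
        rw [hup p le_rfl]
        have h3 := G.dist_ne_top_iff.1 hne
        have e1 : inRow 0 p i = 0 := by unfold inRow; omega
        have e2 : inRow 0 p p = 0 := by unfold inRow; omega
        have e3 : inRow 0 p i₀ = 0 := by omega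
        have e4 : inCol q₁ p p = q₁ := by unfold inCol; omega
        rw [e1, e2, e3, e4]
        refine G.dist_row ?_ ?_
        · unfold inCol
          omega
        · unfold inCol
          omega
  · rw [blockVal, if_pos (by omega),
      show outRow 0 p (q₁ + q₂) (q₁ + j) = outRow 0 p q₂ j by unfold outRow; omega,
      show outCol 0 (q₁ + q₂) (q₁ + j) = outCol q₁ q₂ j by unfold outCol; omega]
  · rw [blockVal, leftVal]
    by_cases h : k ≤ p + (q₁ + q₂)
    · rw [if_pos h, if_pos (by omega),
        show outRow 0 p (q₁ + q₂) k = outRow 0 p q₁ k by unfold outRow; omega,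
        show outCol 0 (q₁ + q₂) k = outCol 0 q₁ k by unfold outCol; omega]
    · rw [if_neg h, if_neg (by omega), unitVal, if_neg (by omega)]

end RAM

/-! ### The sweep across the whole grid -/

namespace RAM

/-- The vector after the propagation of the distances from the origin across the first `r` of `m`
rows, in a grid with `l` columns. -/
noncomputable def rowVal (G : GridCosts) (m l r k : ℕ) : WithTop ℝ :=
  if k + r < m ∨ (r = 0 ∧ m < k) then ⊤
  else G.dist 0 0 (outRow 0 r l (k - (m - r))) (outCol 0 l (k - (m - r)))

/-- The vector after the propagation across the first `c` columns of the `p` rows below row `r`. -/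
noncomputable def sweepVal (G : GridCosts) (m l r p c k : ℕ) : WithTop ℝ :=
  if k < m - (r + p) + c then rowVal G m l (r + p) k
  else if k ≤ m - (r + p) + c + p then
    (if c = 0 ∧ k < m - r then ⊤ else G.dist 0 0 (r + p - (k - (m - (r + p) + c))) c)
  else rowVal G m l r k

variable {G : GridCosts} {m l r p c q : ℕ}

theorem rowVal_zero (k : ℕ) : rowVal G m l 0 k = unitVal m k := by
  rw [rowVal, unitVal]
  by_cases h : k = m
  · rw [if_neg (by omega), if_pos h, h]
    simp [outRow, outCol]
  · rw [if_pos (by omega), if_neg h]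

/-- Index `m` belongs to the origin and index `l` to the opposite corner, which lies on the diagonal
with column minus row equal to `l - m`. -/
theorem rowVal_full (hm : 0 < m) : rowVal G m l m l = G.dist 0 0 m l := by
  rw [rowVal, if_neg (by omega)]
  simp [outRow, outCol]

/-- Before the first block of a row of blocks only its upper left corner and the vertices above and
to the right of it are relevant; the left border further down is still infinite. -/
theorem sweepVal_zero (hr : r + p ≤ m) {k : ℕ} (hk : k ≤ m + l) :
    sweepVal G m l r p 0 k = rowVal G m l r k := by
  rw [sweepVal]
  split_ifs with h1 h2 h3
  · rw [rowVal, if_pos (by omega), rowVal, if_pos (by omega)]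
  · rw [rowVal, if_pos (by omega)]
  · rw [rowVal, if_neg (by omega)]
    congr 1
    · unfold outRow
      omega
    · unfold outCol
      omega
  · rfl

/-- After the last block the vector describes the staircase that belongs to `r + p` complete rows.
-/
theorem sweepVal_full (hr : r + p ≤ m) (hp : 0 < p) (hl : 0 < l) {k : ℕ} (hk : k ≤ m + l) :
    sweepVal G m l r p l k = rowVal G m l (r + p) k := by
  rw [sweepVal]
  split_ifs with h1 h2 h3
  · rfl
  · omega
  · rw [rowVal, if_neg (by omega)]
    congr 1
    · unfold outRow
      omega
    · unfold outCol
      omega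
  · rw [rowVal, if_neg (by omega), rowVal, if_neg (by omega)]
    congr 1
    · unfold outRow
      omega
    · unfold outCol
      omega

/-- The vector is exact on the inputs except along the left and the upper border of the grid, whose
vertices are reached only along that border, hence through the corner with index `p`. The offset `m
- (r + p) + c` is the index of the lower left corner of the block. -/
theorem propagates_sweep {D : ℕ → ℕ → ℝ} (hr : r + p ≤ m) (hc : c + q ≤ l) (hp : 0 < p)
    (hq : 0 < q)
    (tab : ∀ i ≤ p + q, ∀ j ≤ p + q, j ≤ i + q → i ≤ j + p → (D i j : WithTop ℝ) =
      G.dist (inRow r p i) (inCol c p i) (outRow r p q j) (outCol c q j)) :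
    Propagates G 0 0 r c p q (m - (r + p) + c) D (sweepVal G m l r p c)
      (sweepVal G m l r p (c + q)) := by
  have hleft : ∀ i ≤ p, ¬ (c = 0 ∧ i < p) → sweepVal G m l r p c (m - (r + p) + c + i) =
      G.dist 0 0 (inRow r p i) (inCol c p i) := by
    intro i hi h
    rw [sweepVal, if_neg (by omega), if_pos (by omega), if_neg (by omega)]
    congr 1
    · unfold inRow
      omega
    · unfold inCol
      omega
  have htop : ∀ i, p < i → i ≤ p + q → r ≠ 0 → sweepVal G m l r p c (m - (r + p) + c + i) =
      G.dist 0 0 (inRow r p i) (inCol c p i) := by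
    intro i h1 h2 h3
    rw [sweepVal, if_neg (by omega), if_neg (by omega), rowVal, if_neg (by omega)]
    congr 1
    · unfold outRow inRow
      omega
    · unfold outCol inCol
      omega
  refine ⟨by omega, fun i hi => ?_, fun i hi hne => ?_, fun j hj => ?_, fun k hk => ?_, tab⟩
  · by_cases h1 : i ≤ p
    · by_cases h2 : c = 0 ∧ i < p
      · rw [sweepVal, if_neg (by omega), if_pos (by omega), if_pos (by omega)]
        exact le_top
      · rw [hleft i h1 h2]
    · by_cases h2 : r = 0
      · rw [sweepVal, if_neg (by omega), if_neg (by omega), rowVal, if_pos (by omega)]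
        exact le_top
      · rw [htop i (by omega) hi h2]
  · by_cases h1 : i ≤ p
    · by_cases h2 : c = 0 ∧ i < p
      · refine ⟨p, by omega, ?_⟩
        rw [hleft p le_rfl (by omega),
          show inCol c p i = 0 by unfold inCol; omega, show inCol c p p = 0 by unfold inCol; omega]
        exact G.dist_column (Nat.zero_le _) (by unfold inRow; omega)
      · exact ⟨i, hi, by rw [hleft i h1 h2, G.dist_self, add_zero]⟩
    · by_cases h2 : r = 0
      · refine ⟨p, by omega, ?_⟩
        rw [hleft p le_rfl (by omega),
          show inRow r p i = 0 by unfold inRow; omega, show inRow r p p = 0 by unfold inRow; omega]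
        exact G.dist_row (Nat.zero_le _) (by unfold inCol; omega)
      · exact ⟨i, hi, by rw [htop i (by omega) hi h2, G.dist_self, add_zero]⟩
  · by_cases h1 : j < q
    · rw [sweepVal, if_pos (by omega), rowVal, if_neg (by omega)]
      congr 1
      · unfold outRow
        omega
      · unfold outCol
        omega
    · rw [sweepVal, if_neg (by omega), if_pos (by omega), if_neg (by omega)]
      congr 1
      · unfold outRow
        omega
      · unfold outCol
        omega
  · rw [sweepVal, sweepVal]
    by_cases h1 : k < m - (r + p) + c
    · rw [if_pos (by omega), if_pos h1]
    · rw [if_neg (by omega), if_neg (by omega), if_neg h1, if_neg (by omega)]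

end RAM

/-! ### Tables of distances across blocks -/

namespace RAM

notation "zN" => 18
notation "zX" => 19
notation "zY" => 20
notation "zPx" => 21
notation "zPy" => 22
notation "zI" => 23
notation "zK" => 25
notation "zP₁" => 26
notation "zQ₁" => 27
notation "zD₁" => 28
notation "zE₁" => 29
notation "zP₂" => 54
notation "zQ₂" => 55
notation "zD₂" => 56
notation "zE₂" => 57
notation "zB" => 58
notation "zU" => 59
notation "zV" => 60

def unitProg : Prog :=
  .stb bVec ↟zI .zero ;; .nset xLo ↟zI ;; .nset xHi ↟zI ;; .nset xP ↟zP₁ ;; .nset xQ ↟zQ₁ ;;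
  .nset xD ↟zD₁ ;; .nset xE ↟zE₁

def secondProg : Prog :=
  .nset xP ↟zP₂ ;; .nset xQ ↟zQ₂ ;; .nset xD ↟zD₂ ;; .nset xE ↟zE₂

def copyBody : Prog :=
  .stb bDist (↟zB + ↟zI * ↟xLx + ↟zK) (.ld bVec ↟zK) ;; .nset zK (↟zK + ♯1)

/-- Compute the row `zI` of the table of the union of two blocks. -/
def rowBody : Prog :=
  unitProg ;; applyProg ;; secondProg ;; applyProg ;; .nset zK ♯0 ;;
  .loop (.neg (.nlt (↟zPx + ↟zPy) ↟zK)) copyBody ;; .nset zI (↟zI + ♯1)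

/-- Compute the table of the union of two blocks. -/
def unionProg : Prog :=
  .nset zI ♯0 ;; .loop (.neg (.nlt (↟zPx + ↟zPy) ↟zI)) rowBody

/-- The word variables that `unionProg` changes. -/
def unionVars : List ℕ := applyVars ++ [xP, xQ, xD, xE, zI, zK]

/-- The parameters of the computation of the table of the union of two blocks fit into words. -/
structure PairContext (W Z : ℕ) (s : State) : Prop where
  base : s.nvar 3 + 64 * Z ≤ W
  rbase : s.nvar 4 + 4 * Z ≤ W
  large : 64 < W
  room : (s.nvar xLx + 3) * (s.nvar xLx + 1) < Z
  size : s.nvar zPx + s.nvar zPy < s.nvar xLx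
  window₁ : s.nvar zE₁ + (s.nvar zP₁ + s.nvar zQ₁) ≤ s.nvar zPx + s.nvar zPy
  window₂ : s.nvar zE₂ + (s.nvar zP₂ + s.nvar zQ₂) ≤ s.nvar zPx + s.nvar zPy
  table₁ : s.nvar zD₁ + s.nvar xLx * s.nvar xLx < Z
  table₂ : s.nvar zD₂ + s.nvar xLx * s.nvar xLx < Z
  table : s.nvar zB + s.nvar xLx * s.nvar xLx < Z

theorem PairContext.frame {W Z : ℕ} {s s' : State} (h : PairContext W Z s) {V F R : List ℕ}
    (hf : Frame V F R s s')
    (hV : ∀ x ∈ [3, 4, xLx, zPx, zPy, zP₁, zQ₁, zD₁, zE₁, zP₂, zQ₂, zD₂, zE₂, zB], x ∉ V) :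
    PairContext W Z s' := by
  obtain ⟨h1, h2, h3, h4, h5, h6, h7, h8, h9, h10⟩ := h
  have e : ∀ x ∈ [3, 4, xLx, zPx, zPy, zP₁, zQ₁, zD₁, zE₁, zP₂, zQ₂, zD₂, zE₂, zB],
      s'.nvar x = s.nvar x := fun x hx => hf.nvar x (hV x hx)
  simp only [List.mem_cons, List.not_mem_nil, or_false, forall_eq_or_imp, forall_eq] at e
  obtain ⟨e1, e2, e3, e4, e5, e6, e7, e8, e9, e10, e11, e12, e13, e14⟩ := e
  constructor <;> try simp only [e1, e2, e3, e4, e5, e6, e7, e8, e9, e10, e11, e12, e13, e14]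
  all_goals assumption

/-- The cell `(i, j)` of a table lies among its `L * L` cells, so tables placed `L * L` apart cannot
overlap. -/
theorem cell_lt {L i j : ℕ} (hi : i < L) (hj : j < L) : i * L + j < L * L := by
  have : (i + 1) * L ≤ L * L := Nat.mul_le_mul_right _ hi
  rw [Nat.add_mul, Nat.one_mul] at this
  omega

theorem copyLoop_run {W Z i p q L b : ℕ} {s : State} (ctx : PairContext W Z s)
    (hi : i ≤ p + q) (hI : s.nvar zI = i) (hp : s.nvar zPx = p) (hq : s.nvar zPy = q)
    (hL : s.nvar xLx = L) (hb : s.nvar zB = b) (hK : s.nvar zK = 0) :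
    Run W (.loop (.neg (.nlt (↟zPx + ↟zPy) ↟zK)) copyBody) s (106 * (p + q + 1) + 6) (fun s' =>
      (∀ j ≤ p + q, s'.B bDist (b + i * L + j) = s.B bVec j) ∧
      ∀ k, ¬ (b + i * L ≤ k ∧ k ≤ b + i * L + (p + q)) → s'.B bDist k = s.B bDist k) := by
  refine Run.mono (Run.loop_count (c := 100) [zK] [] [bDist] (by decide) (by decide) (by decide)
    (fun s' k => s'.nvar zK + k = p + q + 1 ∧
      (∀ j < s'.nvar zK, s'.B bDist (b + i * L + j) = s.B bVec j) ∧
      ∀ k, ¬ (b + i * L ≤ k ∧ k ≤ b + i * L + (p + q)) → s'.B bDist k = s.B bDist k)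
    (k₀ := p + q + 1) ?_ ?_) le_rfl fun _ => id
  · simp [hK]
  rintro s1 k hf ⟨h1, h2, h3⟩
  have ctx1 := ctx.frame hf (by decide)
  have e1 : s1.nvar zPx = p := by rw [hf.nvar _ (by decide), hp]
  have e2 : s1.nvar zPy = q := by rw [hf.nvar _ (by decide), hq]
  have e3 : s1.nvar xLx = L := by rw [hf.nvar _ (by decide), hL]
  have e4 : s1.nvar zB = b := by rw [hf.nvar _ (by decide), hb]
  have e5 : s1.nvar zI = i := by rw [hf.nvar _ (by decide), hI]
  have bv := hf.B bVec (by decide) (by decide)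
  obtain ⟨c1, c2, c3, c4, c5, c6, c7, c8, c9, c10⟩ := ctx1
  rw [e1, e2] at c5 c6 c7
  rw [e3] at c4 c5 c8 c9 c10
  rw [e4] at c10
  have hLZ : L + 3 < Z := by nlinarith
  obtain ⟨j, hj⟩ : ∃ j, s1.nvar zK = j := ⟨_, rfl⟩
  rw [hj] at h1
  simp only [hj] at h2
  refine ⟨by simp [e1, e2, hj]; omega, fun hlt => ?_, fun hlt => ?_⟩
  · simp [e1, e2, hj] at hlt
    have hcell := cell_lt (L := L) (i := i) (j := j) (by omega) (by omega)
    refine Run.of_wp_le ?_ (by decide)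
    simp [copyBody, e3, e4, e5, hj, bv]
    repeat refine And.intro (by omega) ?_
    refine ⟨k - 1, by omega, by omega, fun j' hj' => ?_, fun k' hk' => ?_⟩
    · by_cases h : j' = j
      · rw [if_pos h, h]
      · rw [if_neg h, h2 j' (by omega)]
    · rw [if_neg (by omega), h3 k' (by omega)]
  · simp [e1, e2, hj] at hlt
    exact ⟨fun j' hj' => h2 j' (by omega), h3⟩

/-- The table at `b` holds the distances across a block. -/
def IsTable (s : State) (L b p q : ℕ) (d : ℕ → ℕ → WithTop ℝ) : Prop :=
  ∀ i ≤ p + q, ∀ j ≤ p + q, j ≤ i + q → i ≤ j + p → (s.B bDist (b + i * L + j) : WithTop ℝ) = d i j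

theorem IsTable.of_eq {s s' : State} {L b p q : ℕ} {d : ℕ → ℕ → WithTop ℝ}
    (h : IsTable s L b p q d) (hpq : p + q < L)
    (hs : ∀ k, b ≤ k → k < b + L * L → s'.B bDist k = s.B bDist k) : IsTable s' L b p q d := by
  intro i hi j hj h1 h2
  have := cell_lt (L := L) (i := i) (j := j) (by omega) (by omega)
  rw [hs _ (by omega) (by omega)]
  exact h i hi j hj h1 h2

theorem PairContext.room₁ {W Z : ℕ} {s : State} (ctx : PairContext W Z s)
    (hP : s.nvar xP = s.nvar zP₁) (hQ : s.nvar xQ = s.nvar zQ₁) (hD : s.nvar xD = s.nvar zD₁)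
    (hE : s.nvar xE = s.nvar zE₁) : Room W Z (s.nvar zPx + s.nvar zPy) s := by
  obtain ⟨c1, c2, c3, c4, c5, c6, c7, c8, c9, c10⟩ := ctx
  have hLZ : s.nvar xLx + 3 < Z := by nlinarith
  refine ⟨c1, c2, c3, by omega, by omega, fun i j hi hj => ?_, by omega, ?_⟩
  · have := cell_lt (L := s.nvar xLx) (i := i) (j := j) (by omega) (by omega)
    omega
  · refine lt_of_le_of_lt (Nat.mul_le_mul ?_ ?_) c4 <;> omega

theorem PairContext.room₂ {W Z : ℕ} {s : State} (ctx : PairContext W Z s)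
    (hP : s.nvar xP = s.nvar zP₂) (hQ : s.nvar xQ = s.nvar zQ₂) (hD : s.nvar xD = s.nvar zD₂)
    (hE : s.nvar xE = s.nvar zE₂) : Room W Z (s.nvar zPx + s.nvar zPy) s := by
  obtain ⟨c1, c2, c3, c4, c5, c6, c7, c8, c9, c10⟩ := ctx
  have hLZ : s.nvar xLx + 3 < Z := by nlinarith
  refine ⟨c1, c2, c3, by omega, by omega, fun i j hi hj => ?_, by omega, ?_⟩
  · have := cell_lt (L := s.nvar xLx) (i := i) (j := j) (by omega) (by omega)
    omega
  · refine lt_of_le_of_lt (Nat.mul_le_mul ?_ ?_) c4 <;> omega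

/-- The propagation of a unit vector across two blocks, one after the other, yields the distances
across their union. -/
structure Composes (G : GridCosts) (p q p₁ q₁ e₁ p₂ q₂ e₂ : ℕ) (d₁ d₂ : ℕ → ℕ → WithTop ℝ)
    (i₀ : ℕ) : Prop where
  compose : ∃ r₁ c₁ r₂ c₂ val, (∀ D : ℕ → ℕ → ℝ,
    (∀ i ≤ p₁ + q₁, ∀ j ≤ p₁ + q₁, j ≤ i + q₁ → i ≤ j + p₁ → (D i j : WithTop ℝ) = d₁ i j) →
    Propagates G (inRow 0 p i₀) (inCol 0 p i₀) r₁ c₁ p₁ q₁ e₁ D (unitVal i₀) val) ∧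
    ∀ D : ℕ → ℕ → ℝ,
    (∀ i ≤ p₂ + q₂, ∀ j ≤ p₂ + q₂, j ≤ i + q₂ → i ≤ j + p₂ → (D i j : WithTop ℝ) = d₂ i j) →
    Propagates G (inRow 0 p i₀) (inCol 0 p i₀) r₂ c₂ p₂ q₂ e₂ D val (blockVal G p q i₀)

/-- A row of the table of the union is the vector of distances from one input. It arises from the
unit vector by two pushes, each linear in the perimeter. -/
theorem rowBody_run {W Z i p q L b p₁ q₁ e₁ p₂ q₂ e₂ : ℕ} {G : GridCosts}
    {d₁ d₂ : ℕ → ℕ → WithTop ℝ} {s : State} (ctx : PairContext W Z s)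
    (hcomp : Composes G p q p₁ q₁ e₁ p₂ q₂ e₂ d₁ d₂ i)
    (hi : i ≤ p + q) (hI : s.nvar zI = i) (hp : s.nvar zPx = p) (hq : s.nvar zPy = q)
    (hL : s.nvar xLx = L) (hb : s.nvar zB = b) (hp₁ : s.nvar zP₁ = p₁) (hq₁ : s.nvar zQ₁ = q₁)
    (he₁ : s.nvar zE₁ = e₁) (hp₂ : s.nvar zP₂ = p₂) (hq₂ : s.nvar zQ₂ = q₂)
    (he₂ : s.nvar zE₂ = e₂) (ht₁ : IsTable s L (s.nvar zD₁) p₁ q₁ d₁)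
    (ht₂ : IsTable s L (s.nvar zD₂) p₂ q₂ d₂) :
    Run W rowBody s (23000 * (p + q + 1)) (fun s' => s'.nvar zI = i + 1 ∧
      (∀ j ≤ p + q, j ≤ i + q → i ≤ j + p → (s'.B bDist (b + i * L + j) : WithTop ℝ) =
        G.dist (inRow 0 p i) (inCol 0 p i) (outRow 0 p q j) (outCol 0 q j)) ∧
      ∀ k, ¬ (b + i * L ≤ k ∧ k ≤ b + i * L + (p + q)) → s'.B bDist k = s.B bDist k) := by
  obtain ⟨r₁, c₁, r₂, c₂, val, hpr₁, hpr₂⟩ := hcomp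
  obtain ⟨c1, c2, c3, c4, c5, c6, c7, c8, c9, c10⟩ := id ctx
  have hLZ : s.nvar xLx + 3 < Z := by nlinarith
  have w₁ : e₁ + (p₁ + q₁) ≤ p + q := by omega
  have w₂ : e₂ + (p₂ + q₂) ≤ p + q := by omega
  refine Run.mono (τ := 50 + (11100 * (p₁ + q₁ + 1) + (20 + (11100 * (p₂ + q₂ + 1) + (2 +
    ((106 * (p + q + 1) + 6) + 4)))))) ?_ (by omega) fun _ => id
  refine Run.seq (((Run.of_wp_le (p := unitProg) (W := W) (s := s) (τ := 50) (Q := fun s' =>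
    (s'.nvar xP = p₁ ∧ s'.nvar xQ = q₁ ∧ s'.nvar xD = s.nvar zD₁ ∧ s'.nvar xE = e₁) ∧
    s'.nvar xLo = i ∧ s'.nvar xHi = i ∧ s'.B bVec i = 0) ?_ (by decide)).frame
    [xLo, xHi, xP, xQ, xD, xE] [] [bVec] (by decide) (by decide) (by decide)).mono le_rfl ?_)
  · simp [unitProg, hI, hp₁, hq₁, he₁]
    omega
  rintro s1 ⟨⟨⟨h1, h2, h3, h4⟩, h5, h6, h7⟩, hf1⟩
  have n1 : ∀ y, y ∉ [xLo, xHi, xP, xQ, xD, xE] → s1.nvar y = s.nvar y := hf1.nvar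
  have ctx1 := ctx.frame hf1 (by decide)
  have room1 := ctx1.room₁ (by rw [h1, n1 _ (by decide), hp₁]) (by rw [h2, n1 _ (by decide), hq₁])
    (by rw [h3, n1 _ (by decide)]) (by rw [h4, n1 _ (by decide), he₁])
  rw [n1 _ (by decide), n1 _ (by decide), hp, hq] at room1
  have fr1 : Frontier s1 (unitVal i) (p + q) := by
    refine ⟨by omega, by omega, fun k hk hk' => ?_, fun k hk hk' => ?_⟩
    · obtain rfl : k = i := by omega
      rw [h7, unitVal, if_pos rfl]
      rfl
    · rw [unitVal, if_neg (by omega)]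
  have bd1 := hf1.B bDist (by decide) (by decide)
  refine Run.seq (((applyProg_run room1 fr1 h1 h2 h4 (hpr₁ _ (fun i' hi' j hj h8 h9 => by
    rw [bd1, h3, n1 _ (by decide), hL]
    exact ht₁ i' hi' j hj h8 h9))).frame applyVars [aCol, aLen, aRes] [bVec, bTmp] (by decide)
    (by decide) (by decide)).mono le_rfl ?_)
  rintro s2 ⟨fr2, hf2⟩
  have n2 : ∀ y, y ∉ [xLo, xHi, xP, xQ, xD, xE] → y ∉ applyVars → s2.nvar y = s.nvar y :=
    fun y hy hy' => by rw [hf2.nvar y hy', n1 y hy]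
  have ctx2 := ctx1.frame hf2 (by decide)
  refine Run.seq (((Run.of_wp_le (p := secondProg) (W := W) (s := s2) (τ := 20) (Q := fun s' =>
    (s'.nvar xP = p₂ ∧ s'.nvar xQ = q₂ ∧ s'.nvar xD = s.nvar zD₂ ∧ s'.nvar xE = e₂)) ?_
    (by decide)).frame
    [xP, xQ, xD, xE] [] [] (by decide) (by decide) (by decide)).mono le_rfl ?_)
  · have a1 := n2 zP₂ (by decide) (by decide)
    have a2 := n2 zQ₂ (by decide) (by decide)
    have a3 := n2 zD₂ (by decide) (by decide)
    have a4 := n2 zE₂ (by decide) (by decide)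
    simp [secondProg, a1, a2, a3, a4, hp₂, hq₂, he₂]
    omega
  rintro s3 ⟨⟨h8, h9, h10, h11⟩, hf3⟩
  have n3 : ∀ y, y ∉ [xLo, xHi, xP, xQ, xD, xE] → y ∉ applyVars → s3.nvar y = s.nvar y :=
    fun y hy hy' => by
      rw [hf3.nvar y fun h => hy ((show [xP, xQ, xD, xE] ⊆ [xLo, xHi, xP, xQ, xD, xE] by decide) h),
        n2 y hy hy']
  have ctx3 := ctx2.frame hf3 (by decide)
  have room3 := ctx3.room₂ (by rw [h8, n3 _ (by decide) (by decide), hp₂])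
    (by rw [h9, n3 _ (by decide) (by decide), hq₂])
    (by rw [h10, n3 _ (by decide) (by decide)]) (by rw [h11, n3 _ (by decide) (by decide), he₂])
  rw [n3 _ (by decide) (by decide), n3 _ (by decide) (by decide), hp, hq] at room3
  have bd3 : ∀ j, s3.B bDist j = s.B bDist j := fun j => by
    rw [hf3.B _ (by decide) (by decide), hf2.B _ (by decide) (by decide), bd1]
  refine Run.seq (((applyProg_run room3 (fr2.frame hf3 (by decide) (by decide)) h8 h9 h11
    (hpr₂ _ (fun i' hi' j hj g1 g2 => by
      rw [bd3, h10, n3 _ (by decide) (by decide), hL]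
      exact ht₂ i' hi' j hj g1 g2))).frame applyVars [aCol, aLen, aRes] [bVec, bTmp] (by decide)
    (by decide) (by decide)).mono le_rfl ?_)
  rintro s4 ⟨fr4, hf4⟩
  refine Run.seq (((Run.of_wp_le (p := .nset zK ♯0) (W := W) (s := s4) (τ := 2) (Q := fun s' =>
    s'.nvar zK = 0) (by simp; omega) (by decide)).frame [zK] [] [] (by decide) (by decide)
    (by decide)).mono le_rfl ?_)
  rintro s5 ⟨h12, hf5⟩
  have n5 : ∀ y, y ∉ [xLo, xHi, xP, xQ, xD, xE] → y ∉ applyVars → y ≠ zK →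
      s5.nvar y = s.nvar y := fun y hy hy' hy'' => by
    rw [hf5.nvar y (by simpa using hy''), hf4.nvar y hy', n3 y hy hy']
  have ctx5 := (ctx3.frame hf4 (by decide)).frame hf5 (by decide)
  have fr5 := fr4.frame hf5 (by decide) (by decide)
  have bd5 : ∀ j, s5.B bDist j = s.B bDist j := fun j => by
    rw [hf5.B _ (by decide) (by decide), hf4.B _ (by decide) (by decide), bd3]
  refine Run.seq (((copyLoop_run ctx5 hi (by rw [n5 _ (by decide) (by decide) (by decide), hI])
    (by rw [n5 _ (by decide) (by decide) (by decide), hp])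
    (by rw [n5 _ (by decide) (by decide) (by decide), hq])
    (by rw [n5 _ (by decide) (by decide) (by decide), hL])
    (by rw [n5 _ (by decide) (by decide) (by decide), hb]) h12).frame [zK] [] [bDist] (by decide)
    (by decide) (by decide)).mono le_rfl ?_)
  rintro s6 ⟨⟨h13, h14⟩, hf6⟩
  have e6 : s6.nvar zI = i := by
    rw [hf6.nvar _ (by decide), n5 _ (by decide) (by decide) (by decide), hI]
  refine Run.of_wp_le ?_ (by decide)
  simp [e6]
  repeat refine And.intro (by omega) ?_
  refine ⟨fun j hj g1 g2 => ?_, fun k hk => ?_⟩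
  · rw [h13 j hj]
    have hne : blockVal G p q i j ≠ ⊤ := by
      rw [blockVal, if_pos hj, G.dist_ne_top_iff]
      exact (BlockData.in_le_out hi hj).2 ⟨g1, g2⟩
    -- The copy takes all entries of the vector, but for an output in the band the distance is
    -- finite, so its entry lies in the support and is meaningful.
    have hin : s5.nvar xLo ≤ j ∧ j ≤ s5.nvar xHi := by
      by_contra hcon
      exact hne (fr5.top j hj hcon)
    rw [fr5.coe j hin.1 hin.2, blockVal, if_pos hj]
  · rw [h14 k (by omega), bd5]

/-- At most `L` rows of cost O(`L`). The two tables that are read must stay intact while the third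
one is filled, hence the hypotheses that their address ranges are disjoint. -/
theorem unionProg_run {W Z p q L b p₁ q₁ e₁ p₂ q₂ e₂ : ℕ} {G : GridCosts}
    {d₁ d₂ : ℕ → ℕ → WithTop ℝ} {s : State} (ctx : PairContext W Z s)
    (hcomp : ∀ i ≤ p + q, Composes G p q p₁ q₁ e₁ p₂ q₂ e₂ d₁ d₂ i)
    (hp : s.nvar zPx = p) (hq : s.nvar zPy = q)
    (hL : s.nvar xLx = L) (hb : s.nvar zB = b) (hp₁ : s.nvar zP₁ = p₁) (hq₁ : s.nvar zQ₁ = q₁)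
    (he₁ : s.nvar zE₁ = e₁) (hp₂ : s.nvar zP₂ = p₂) (hq₂ : s.nvar zQ₂ = q₂)
    (he₂ : s.nvar zE₂ = e₂) (ht₁ : IsTable s L (s.nvar zD₁) p₁ q₁ d₁)
    (ht₂ : IsTable s L (s.nvar zD₂) p₂ q₂ d₂)
    (hd₁ : s.nvar zD₁ + L * L ≤ b ∨ b + L * L ≤ s.nvar zD₁)
    (hd₂ : s.nvar zD₂ + L * L ≤ b ∨ b + L * L ≤ s.nvar zD₂) :
    Run W unionProg s (24000 * (L * L)) (fun s' =>
      IsTable s' L b p q (fun i j =>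
        G.dist (inRow 0 p i) (inCol 0 p i) (outRow 0 p q j) (outCol 0 q j)) ∧
      ∀ k, ¬ (b ≤ k ∧ k < b + L * L) → s'.B bDist k = s.B bDist k) := by
  obtain ⟨c1, c2, c3, c4, c5, c6, c7, c8, c9, c10⟩ := id ctx
  rw [hp, hq] at c5 c6 c7
  rw [hL] at c5
  have hLZ : s.nvar xLx + 3 < Z := by nlinarith
  refine Run.mono (τ := 2 + ((23000 * (p + q + 1) + 6) * (p + q + 1) + 6)) ?_ ?_ fun _ => id
  · refine Run.seq (((Run.of_wp_le (p := .nset zI ♯0) (W := W) (s := s) (τ := 2) (Q := fun s' =>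
      s'.nvar zI = 0) (by simp; omega) (by decide)).frame [zI] [] [] (by decide) (by decide)
      (by decide)).mono le_rfl ?_)
    rintro s0 ⟨h0, hf0⟩
    have ctx0 := ctx.frame hf0 (by decide)
    have n0 : ∀ y, y ≠ zI → s0.nvar y = s.nvar y := fun y hy => hf0.nvar y (by simpa using hy)
    have bd0 := hf0.B bDist (by decide) (by decide)
    refine Run.loop_count unionVars [aCol, aLen, aRes] [bVec, bTmp, bDist] (by decide) (by decide)
      (by decide) (23000 * (p + q + 1))
      (fun s' k => s'.nvar zI + k = p + q + 1 ∧
        (∀ i < s'.nvar zI, ∀ j ≤ p + q, j ≤ i + q → i ≤ j + p →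
          (s'.B bDist (b + i * L + j) : WithTop ℝ) =
            G.dist (inRow 0 p i) (inCol 0 p i) (outRow 0 p q j) (outCol 0 q j)) ∧
        ∀ k, ¬ (b ≤ k ∧ k < b + L * L) → s'.B bDist k = s.B bDist k) (k₀ := p + q + 1) ?_ ?_
    · refine ⟨by omega, fun i hi => by omega, fun k _ => bd0 k⟩
    rintro s1 k hf ⟨h1, h2, h3⟩
    have n1 : ∀ y, y ∉ unionVars → y ≠ zI → s1.nvar y = s.nvar y := fun y hy hy' => by
      rw [hf.nvar y hy, n0 y hy']
    have e1 : s1.nvar zPx = p := by rw [n1 _ (by decide) (by decide), hp]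
    have e2 : s1.nvar zPy = q := by rw [n1 _ (by decide) (by decide), hq]
    obtain ⟨i, hi⟩ : ∃ i, s1.nvar zI = i := ⟨_, rfl⟩
    rw [hi] at h1
    simp only [hi] at h2
    refine ⟨by simp [e1, e2, hi]; omega, fun hlt => ?_, fun hlt => ?_⟩
    · simp [e1, e2, hi] at hlt
      refine (rowBody_run (ctx0.frame hf (by decide)) (hcomp i hlt) hlt hi e1 e2
        (by rw [n1 _ (by decide) (by decide), hL]) (by rw [n1 _ (by decide) (by decide), hb])
        (by rw [n1 _ (by decide) (by decide), hp₁]) (by rw [n1 _ (by decide) (by decide), hq₁])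
        (by rw [n1 _ (by decide) (by decide), he₁]) (by rw [n1 _ (by decide) (by decide), hp₂])
        (by rw [n1 _ (by decide) (by decide), hq₂]) (by rw [n1 _ (by decide) (by decide), he₂])
        ?_ ?_).mono le_rfl ?_
      · rw [n1 _ (by decide) (by decide)]
        exact ht₁.of_eq (by omega) fun k hk hk' => h3 k (by omega)
      · rw [n1 _ (by decide) (by decide)]
        exact ht₂.of_eq (by omega) fun k hk hk' => h3 k (by omega)
      · rintro s2 ⟨g1, g2, g3⟩
        have hcell := cell_lt (L := L) (i := i) (j := p + q) (by omega) (by omega)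
        refine ⟨k - 1, by omega, by omega, fun i' hi' j hj g4 g5 => ?_, fun k' hk' => ?_⟩
        · by_cases h : i' = i
          · subst h
            exact g2 j hj g4 g5
          · rw [g3 _ ?_]
            · exact h2 i' (by omega) j hj g4 g5
            · have : (i' + 1) * L ≤ i * L := Nat.mul_le_mul_right _ (by omega)
              rw [Nat.add_mul, Nat.one_mul] at this
              omega
        · rw [g3 k' (by omega), h3 k' hk']
    · simp [e1, e2, hi] at hlt
      exact ⟨fun i' hi' => h2 i' (by omega), h3⟩
  · have h1 : (p + q + 1) * (p + q + 1) ≤ L * L := Nat.mul_le_mul (by omega) (by omega)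
    have h2 : p + q + 1 ≤ (p + q + 1) * (p + q + 1) := Nat.le_mul_self _
    nlinarith

end RAM

/-! ### The table of one pair of blocks -/

namespace RAM

notation "zA" => 61
notation "zJ" => 62
notation "zCa" => 63
notation "zCb" => 64

/-- The address of the table of a pair of blocks. -/
def tableExp (X Y : NExp) : NExp := (X * ↟zN + Y) * (↟xLx * ↟xLx)

/-- The blocks of the first string are recorded under the tag 32 and those of the second under 48.
So 37 and 53 hold sizes, 38, 39, 54, 55 letters or children, and 40 and 56 kinds. -/
def pairInit : Prog :=
  .nset zPx (.ld 37 ↟zX) ;; .nset zPy (.ld 53 ↟zY) ;; .nset zB (tableExp ↟zX ↟zY)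

/-- The upper block comes first, with offset the number of rows of the lower one; the lower block
has offset 0. -/
def verticalInit : Prog :=
  .nset zU (.ld 38 ↟zX) ;; .nset zV (.ld 39 ↟zX) ;; .nset zP₁ (.ld 37 ↟zU) ;; .nset zQ₁ ↟zPy ;;
  .nset zD₁ (tableExp ↟zU ↟zY) ;; .nset zE₁ (.ld 37 ↟zV) ;; .nset zP₂ (.ld 37 ↟zV) ;;
  .nset zQ₂ ↟zPy ;; .nset zD₂ (tableExp ↟zV ↟zY) ;; .nset zE₂ ♯0

/-- The left block comes first, with offset 0; the right block is shifted by the width of the left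
one. -/
def horizontalInit : Prog :=
  .nset zU (.ld 54 ↟zY) ;; .nset zV (.ld 55 ↟zY) ;; .nset zP₁ ↟zPx ;; .nset zQ₁ (.ld 53 ↟zU) ;;
  .nset zD₁ (tableExp ↟zX ↟zU) ;; .nset zE₁ ♯0 ;; .nset zP₂ ↟zPx ;; .nset zQ₂ (.ld 53 ↟zV) ;;
  .nset zD₂ (tableExp ↟zX ↟zV) ;; .nset zE₂ (.ld 53 ↟zU)

/-- The cost of deleting the letter `zU`. -/
def delExp : RExp := .load (↟2 * ↟2 + ↟zU)

/-- The cost of inserting the letter `zV`. -/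
def insExp : RExp := .load (↟2 * ↟2 + ↟2 + ↟zV)

/-- The cost of replacing the letter `zU` by the letter `zV`. -/
def repExp : RExp := .load (↟zU * ↟2 + ↟zV)

def cellProg (i j : ℕ) (r : RExp) : Prog := .stb bDist (↟zB + ♯i * ↟xLx + ♯j) r

/-- Compute the table of a pair of letters. -/
def letterProg : Prog :=
  .nset zU (.ld 38 ↟zX) ;; .nset zV (.ld 54 ↟zY) ;; cellProg 0 0 .zero ;; cellProg 0 1 insExp ;;
  cellProg 1 0 delExp ;; cellProg 1 2 insExp ;; cellProg 2 1 delExp ;; cellProg 2 2 .zero ;;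
  .ite (.rle (delExp + insExp) repExp) (cellProg 1 1 (delExp + insExp)) (cellProg 1 1 repExp)

/-- Compute the table of the pair of blocks with labels `zX` and `zY`. -/
def tableProg : Prog :=
  pairInit ;; .ite (.neq (.ld 40 ↟zX) ♯1) (verticalInit ;; unionProg)
    (.ite (.neq (.ld 56 ↟zY) ♯1) (horizontalInit ;; unionProg) letterProg)

def tableVars : List ℕ :=
  unionVars ++ [zPx, zPy, zB, zU, zV, zP₁, zQ₁, zD₁, zE₁, zP₂, zQ₂, zD₂, zE₂]

variable {σ : ℕ} {C : Scoring (Fin σ)} {βA βB : ℕ → SLPTree (Fin σ)} {LA LB : List ℕ}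

/-- The costs and the blocks of both strings are in the memory, and the words are large enough for
the tables. -/
structure TableContext (W Z n x : ℕ) (C : Scoring (Fin σ)) (βA βB : ℕ → SLPTree (Fin σ))
    (LA LB : List ℕ) (s : State) : Prop where
  base : s.nvar 3 + 64 * Z ≤ W
  rbase : s.nvar 4 + 4 * Z ≤ W
  large : 64 < W
  room : (s.nvar xLx + 3) * (s.nvar xLx + 1) < Z
  tables : n * n * (s.nvar xLx * s.nvar xLx) < Z
  cap : s.nvar xLx = 2 * x + 1
  cap_pos : 1 ≤ x
  stride : s.nvar zN = n
  recA : Recorded 32 n x βA LA s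
  recB : Recorded 48 n x βB LB s
  sizeA : ∀ X ∈ LA, (βA X).size ≤ x
  sizeB : ∀ Y ∈ LB, (βB Y).size ≤ x
  letters : s.nvar 2 = σ
  costs : s.nvar 4 = σ * σ + 2 * σ
  costs_eq : ∀ m < s.nvar 4, s.rmem m = costTable C m

theorem TableContext.frame {W Z n x : ℕ} {s s' : State}
    (h : TableContext W Z n x C βA βB LA LB s) {V F R : List ℕ} (hf : Frame V F R s s')
    (hV : ∀ x ∈ [2, 3, 4, xLx, zN], x ∉ V)
    (hF : ∀ x ∈ [36, 37, 38, 39, 40, 41, 52, 53, 54, 55, 56, 57], x ∉ F) :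
    TableContext W Z n x C βA βB LA LB s' := by
  obtain ⟨h1, h2, h3, h4, h5, h6, h7, h8, h9, h10, h11, h12, h13, h14, h15⟩ := h
  have e : ∀ x ∈ [2, 3, 4, xLx, zN], s'.nvar x = s.nvar x := fun x hx => hf.nvar x (hV x hx)
  simp only [List.mem_cons, List.not_mem_nil, or_false, forall_eq_or_imp, forall_eq] at e
  obtain ⟨e1, e2, e3, e4, e5⟩ := e
  refine ⟨by rw [e2]; exact h1, by rw [e3]; exact h2, h3, by rw [e4]; exact h4,
    by rw [e4]; exact h5, by rw [e4]; exact h6, h7, by rw [e5]; exact h8,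
    h9.frame hf (fun y hy => hF y ?_) (by decide), h10.frame hf (fun y hy => hF y ?_) (by decide),
    h11, h12, by rw [e1]; exact h13, by rw [e3]; exact h14, fun m hm => ?_⟩
  · revert hy
    simp
    omega
  · revert hy
    simp
    omega
  · rw [e3] at hm
    rw [hf.rlow m hm, h15 m hm]

/-- The address of the table of the pair of blocks with labels `X` and `Y`. -/
def tableAt (n L X Y : ℕ) : ℕ := (X * n + Y) * (L * L)

/-- A pair of labels is read as a two-digit number in base `n`, so different pairs have different
numbers, and tables are `L * L` cells apart. -/
theorem tableAt_disjoint {n L X Y X' Y' : ℕ} (hY : Y < n) (hY' : Y' < n)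
    (h : X ≠ X' ∨ Y ≠ Y') :
    tableAt n L X Y + L * L ≤ tableAt n L X' Y' ∨ tableAt n L X' Y' + L * L ≤ tableAt n L X Y := by
  have key : ∀ {K K' : ℕ}, K < K' → K * (L * L) + L * L ≤ K' * (L * L) := by
    intro K K' hK
    have : (K + 1) * (L * L) ≤ K' * (L * L) := Nat.mul_le_mul_right _ hK
    rwa [Nat.add_mul, Nat.one_mul] at this
  have hne : X * n + Y ≠ X' * n + Y' := by
    intro he
    rcases Nat.lt_trichotomy X X' with hX | hX | hX
    · have : (X + 1) * n ≤ X' * n := Nat.mul_le_mul_right _ hX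
      rw [Nat.add_mul, Nat.one_mul] at this
      omega
    · subst hX
      omega
    · have : (X' + 1) * n ≤ X * n := Nat.mul_le_mul_right _ hX
      rw [Nat.add_mul, Nat.one_mul] at this
      omega
  rcases Nat.lt_or_gt_of_ne hne with h | h
  · exact Or.inl (key h)
  · exact Or.inr (key h)

theorem tableAt_lt {n L X Y Z : ℕ} (hX : X < n) (hY : Y < n) (hZ : n * n * (L * L) < Z) :
    tableAt n L X Y + L * L < Z := by
  have h1 : (X + 1) * n ≤ n * n := Nat.mul_le_mul_right _ hX
  rw [Nat.add_mul, Nat.one_mul] at h1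
  have h2 : (X * n + Y + 1) * (L * L) ≤ n * n * (L * L) := Nat.mul_le_mul_right _ (by omega)
  rw [Nat.add_mul, Nat.one_mul] at h2
  unfold tableAt
  omega

/-- The table of the pair of blocks with labels `X` and `Y` has been computed. -/
def HasTable (C : Scoring (Fin σ)) (βA βB : ℕ → SLPTree (Fin σ)) (n L : ℕ) (s : State)
    (X Y : ℕ) : Prop :=
  IsTable s L (tableAt n L X Y) (βA X).size (βB Y).size (C.blockDist (βA X).word (βB Y).word)

/-- Both parts of the union look like grids of their own, so the tables of the children are valid
inside it. -/
theorem composes_vertical {α : Type} (C : Scoring α) (U V Y : List α) {p₁ p₂ q : ℕ}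
    (h1 : U.length = p₁) (h2 : V.length = p₂) (h3 : Y.length = q) {i : ℕ}
    (hi : i ≤ p₁ + p₂ + q) :
    Composes (C.grid (U ++ V) Y) (p₁ + p₂) q p₁ q p₂ p₂ q 0 (C.blockDist U Y) (C.blockDist V Y)
      i := by
  have l1 : (C.grid (U ++ V) Y).Looks (C.grid U Y) 0 0 p₁ q := by
    have := C.grid_looks [] U V [] Y []
    simpa [h1, h3] using this
  have l2 : (C.grid (U ++ V) Y).Looks (C.grid V Y) p₁ 0 p₂ q := by
    have := C.grid_looks U V [] [] Y []
    simpa [h1, h2, h3] using this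
  refine ⟨0, 0, p₁, 0, upperVal (C.grid (U ++ V) Y) p₁ p₂ q i, fun D hD => ?_, fun D hD => ?_⟩
  · refine propagates_upper fun a ha b hb g1 g2 => ?_
    rw [hD a ha b hb g1 g2, l1.blockDist h1 h3]
  · refine propagates_lower hi fun a ha b hb g1 g2 => ?_
    rw [hD a ha b hb g1 g2, l2.blockDist h2 h3]

theorem composes_horizontal {α : Type} (C : Scoring α) (X U V : List α) {p q₁ q₂ : ℕ}
    (h1 : X.length = p) (h2 : U.length = q₁) (h3 : V.length = q₂) {i : ℕ}
    (hi : i ≤ p + (q₁ + q₂)) :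
    Composes (C.grid X (U ++ V)) p (q₁ + q₂) p q₁ 0 p q₂ q₁ (C.blockDist X U) (C.blockDist X V)
      i := by
  have l1 : (C.grid X (U ++ V)).Looks (C.grid X U) 0 0 p q₁ := by
    have := C.grid_looks [] X [] [] U V
    simpa [h1, h2] using this
  have l2 : (C.grid X (U ++ V)).Looks (C.grid X V) 0 q₁ p q₂ := by
    have := C.grid_looks [] X [] U V []
    simpa [h1, h2, h3] using this
  refine ⟨0, 0, 0, q₁, leftVal (C.grid X (U ++ V)) p q₁ i, fun D hD => ?_, fun D hD => ?_⟩
  · refine propagates_left fun a ha b hb g1 g2 => ?_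
    rw [hD a ha b hb g1 g2, l1.blockDist h1 h2]
  · refine propagates_right hi fun a ha b hb g1 g2 => ?_
    rw [hD a ha b hb g1 g2, l2.blockDist h1 h3]

/-- The distances across the block of two letters. -/
theorem blockDist_letters {α : Type} (C : Scoring α) (a b : α) (d : ℕ → ℕ → ℝ)
    (h00 : d 0 0 = 0) (h01 : d 0 1 = C.insert b) (h10 : d 1 0 = C.delete a)
    (h12 : d 1 2 = C.insert b) (h21 : d 2 1 = C.delete a) (h22 : d 2 2 = 0)
    (h11 : d 1 1 = min (C.delete a + C.insert b) (C.replace a b)) :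
    ∀ i ≤ 1 + 1, ∀ j ≤ 1 + 1, j ≤ i + 1 → i ≤ j + 1 →
      (d i j : WithTop ℝ) = C.blockDist [a] [b] i j := by
  intro i hi j hj g1 g2
  obtain ⟨c1, c2, c3⟩ : C.deleteAt [a] 0 = C.delete a ∧ C.insertAt [b] 0 = C.insert b ∧
      C.replaceAt [a] [b] 0 0 = C.replace a b := by
    simp [Scoring.deleteAt, Scoring.insertAt, Scoring.replaceAt]
  -- Of the nine pairs, two are outside the band and six are trivial or single edges. Only the way
  -- between the opposite corners of the unit square is left.
  interval_cases i <;> interval_cases j <;>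
    first
    | omega
    | simp [Scoring.blockDist, inRow, inCol, outRow, outCol, GridCosts.dist, Scoring.grid, c1, c2,
        c3, h00, h01, h10, h12, h21, h22]
  simp [Scoring.blockDist, inRow, inCol, outRow, outCol, GridCosts.dist, Scoring.grid, c1, c2,
        c3, h11]
  exact Or.inl (add_comm _ _).le

end RAM

namespace RAM

variable {σ : ℕ} {C : Scoring (Fin σ)} {βA βB : ℕ → SLPTree (Fin σ)} {LA LB : List ℕ}

theorem costTable_delete (C : Scoring (Fin σ)) (a : Fin σ) :
    costTable C (σ * σ + a) = C.delete a := by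
  unfold costTable
  rw [dif_neg (by omega), dif_pos (by omega)]
  congr 1
  ext
  simp

theorem costTable_insert (C : Scoring (Fin σ)) (a : Fin σ) :
    costTable C (σ * σ + σ + a) = C.insert a := by
  unfold costTable
  rw [dif_neg (by omega), dif_neg (by omega), dif_pos (by omega)]
  congr 1
  ext
  simp

theorem mul_add_lt {a b : Fin σ} : (a : ℕ) * σ + b < σ * σ := by
  have h : ((a : ℕ) + 1) * σ ≤ σ * σ := Nat.mul_le_mul_right _ a.2
  rw [Nat.add_mul, Nat.one_mul] at h
  omega

theorem costTable_replace (C : Scoring (Fin σ)) (a b : Fin σ) :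
    costTable C (a * σ + b) = C.replace a b := by
  have hσ : 0 < σ := a.pos
  unfold costTable
  rw [dif_pos mul_add_lt]
  congr 1
  · ext
    simp [Nat.mul_comm (a : ℕ) σ, Nat.mul_add_div hσ]
  · ext
    simp [Nat.mul_comm (a : ℕ) σ, Nat.mod_eq_of_lt b.2]

/-- Assignment to the entry `(i, j)` of the table at `zB`. -/
theorem wp_cellProg {W Z L b i j : ℕ} {r : RExp} {Q : State → Prop} {s : State}
    (hi : i < 3) (hj : j < 3) (hL : s.nvar xLx = L) (hb : s.nvar zB = b)
    (h : b + L * L < Z) (h3 : 3 ≤ L) (hZ : s.nvar 4 + 4 * Z ≤ W) (hr : r.Fits W s)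
    (hQ : Q (s.stB bDist (b + i * L + j) (r.eval s))) : (cellProg i j r).wp W Q s := by
  have h1 : i * L + j < L * L := by
    have : i * L + L ≤ L * L := by
      rw [← Nat.succ_mul]
      exact Nat.mul_le_mul_right _ (by omega)
    omega
  have h2 : 3 * L ≤ L * L := Nat.mul_le_mul_right _ h3
  have h4 : i * L ≤ L * L := by omega
  simp [cellProg, hL, hb]
  refine ⟨?_, hr, hQ⟩
  omega

theorem letterProg_run {W Z n x X Y L t : ℕ} {s : State} {a b : Fin σ} {i j : ℕ}
    (ctx : TableContext W Z n x C βA βB LA LB s) (hX : X ∈ LA) (hY : Y ∈ LB)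
    (eX : s.nvar zX = X) (eY : s.nvar zY = Y) (hL : s.nvar xLx = L) (eB : s.nvar zB = t)
    (ht : tableAt n L X Y = t)     (hA : βA X = .leaf i a) (hB : βB Y = .leaf j b) :
    Run W letterProg s 400 (fun s' => HasTable C βA βB n L s' X Y ∧
      ∀ k, ¬ (t ≤ k ∧ k < t + L * L) → s'.B bDist k = s.B bDist k) := by
  obtain ⟨c1, c2, c3, c4, c5, c6, c7, c8, c9, c10, c11, c12, c13, c14, c15⟩ := id ctx
  rw [hL] at c4 c5 c6
  have hlt := tableAt_lt (c9.lt X hX) (c10.lt Y hY) c5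
  rw [ht] at hlt
  have hnZ : n < Z := by
    have : 1 ≤ L * L := Nat.mul_pos (by omega) (by omega)
    have hn : 0 < n := (Nat.zero_le _).trans_lt (c9.lt X hX)
    nlinarith
  have h3 : 3 ≤ L := by omega
  have hXn := c9.lt X hX
  have hYn := c10.lt Y hY
  have fX := c9.fst X hX
  have fY := c10.fst Y hY
  rw [hA] at fX
  rw [hB] at fY
  simp only [SLPTree.fst, Nat.reduceAdd] at fX fY
  have ha := a.2
  have hb := b.2
  have hrep := mul_add_lt (a := a) (b := b)
  have d1 := c15 (σ * σ + a) (by omega)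
  have d2 := c15 (σ * σ + σ + b) (by omega)
  have d3 := c15 (a * σ + b) (by omega)
  rw [costTable_delete] at d1
  rw [costTable_insert] at d2
  rw [costTable_replace] at d3
  obtain ⟨s0, hs0⟩ : ∃ s0, (s.setN zU a).setN zV b = s0 := ⟨_, rfl⟩
  -- All stores go above the cost table, so the costs can be read again after each of them.
  obtain ⟨Good, hGood⟩ : ∃ Good : State → Prop, Good = fun s1 => s1.nvar = s0.nvar ∧
      ∀ m < s.nvar 4, s1.rmem m = s.rmem m := ⟨_, rfl⟩
  have g0 : Good s0 := by
    rw [hGood, ← hs0]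
    exact ⟨rfl, fun _ _ => rfl⟩
  have vars : ∀ {s1}, Good s1 → s1.nvar 2 = σ ∧ s1.nvar 4 = s.nvar 4 ∧ s1.nvar xLx = L ∧
      s1.nvar zB = t ∧ s1.nvar zU = a ∧ s1.nvar zV = b := by
    intro s1 h
    rw [hGood] at h
    rw [h.1, ← hs0]
    simp [c13, hL, eB]
  have main : ∀ {s1}, Good s1 → (delExp.Fits W s1 ∧ insExp.Fits W s1 ∧ repExp.Fits W s1) ∧
      delExp.eval s1 = C.delete a ∧ insExp.eval s1 = C.insert b ∧
      repExp.eval s1 = C.replace a b := by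
    intro s1 h
    obtain ⟨e1, e2, e3, e4, e5, e6⟩ := vars h
    rw [hGood] at h
    refine ⟨?_, ?_, ?_, ?_⟩
    · simp [delExp, insExp, repExp, e1, e5, e6]
      omega
    · simp [delExp, e1, e5, h.2 (σ * σ + a) (by omega), d1]
    · simp [insExp, e1, e6, h.2 (σ * σ + σ + b) (by omega), d2]
    · simp [repExp, e1, e5, e6, h.2 (a * σ + b) (by omega), d3]
  have low : ∀ {s1} (k : ℕ) (r : ℝ), Good s1 → Good (s1.stB bDist k r) := by
    intro s1 k r h
    have e := (vars h).2.1
    rw [hGood] at h ⊢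
    refine ⟨h.1, fun m hm => ?_⟩
    rw [State.stB_rmem_low _ _ _ _ _ (by omega), h.2 m hm]
  have cell : ∀ {s1 : State} {Q : State → Prop} (i j : ℕ) {e : RExp} (r : ℝ), Good s1 → i < 3 →
      j < 3 → e.Fits W s1 → e.eval s1 = r → (Good (s1.stB bDist (t + i * L + j) r) →
      Q (s1.stB bDist (t + i * L + j) r)) → (cellProg i j e).wp W Q s1 := by
    intro s1 Q i j e r h hi hj he hr hQ
    obtain ⟨e1, e2, e3, e4, e5, e6⟩ := vars h
    subst hr
    exact wp_cellProg hi hj e3 e4 hlt h3 (by omega) he (hQ (low _ _ h))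
  obtain ⟨u, hu⟩ : ∃ u, min (C.delete a + C.insert b) (C.replace a b) = u := ⟨_, rfl⟩
  obtain ⟨f, hf⟩ : ∃ f : State, ((((((((s0.stB bDist (t + 0 * L + 0) 0).stB bDist (t + 0 * L + 1)
    (C.insert b)).stB bDist (t + 1 * L + 0) (C.delete a)).stB bDist (t + 1 * L + 2)
    (C.insert b)).stB bDist (t + 2 * L + 1) (C.delete a)).stB bDist (t + 2 * L + 2) 0).stB
    bDist (t + 1 * L + 1) u)) = f := ⟨_, rfl⟩
  refine (Run.of_wp_le (τ := 400) (Q := fun s' => s' = f) ?_ (by decide)).mono le_rfl ?_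
  · simp only [letterProg, Prog.wp_seq]
    refine ⟨by simp [eX, fX]; omega, by simp [eX, eY, fX, fY]; omega, ?_⟩
    have hs : (s.setN zU (NExp.eval s (.ld 38 ↟zX))).setN zV (NExp.eval (s.setN zU
        (NExp.eval s (.ld 38 ↟zX))) (.ld 54 ↟zY)) = s0 := by
      rw [← hs0]
      simp [eX, eY, fX, fY]
    rw [hs]
    refine cell 0 0 0 g0 (by omega) (by omega) trivial rfl fun g1 => ?_
    refine cell 0 1 _ g1 (by omega) (by omega) (main g1).1.2.1 (main g1).2.2.1 fun g2 => ?_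
    refine cell 1 0 _ g2 (by omega) (by omega) (main g2).1.1 (main g2).2.1 fun g3 => ?_
    refine cell 1 2 _ g3 (by omega) (by omega) (main g3).1.2.1 (main g3).2.2.1 fun g4 => ?_
    refine cell 2 1 _ g4 (by omega) (by omega) (main g4).1.1 (main g4).2.1 fun g5 => ?_
    refine cell 2 2 0 g5 (by omega) (by omega) trivial rfl fun g6 => ?_
    obtain ⟨⟨f1, f2, f3⟩, v1, v2, v3⟩ := main g6
    refine ⟨⟨⟨f1, f2⟩, f3⟩, fun h => ?_, fun h => ?_⟩
    · refine cell 1 1 u g6 (by omega) (by omega) ⟨f1, f2⟩ ?_ fun _ => hf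
      rw [Test.holds_rle, RExp.eval_add, v1, v2, v3] at h
      rw [RExp.eval_add, v1, v2, ← hu, min_eq_left h]
    · refine cell 1 1 u g6 (by omega) (by omega) f3 ?_ fun _ => hf
      rw [Test.holds_rle, RExp.eval_add, v1, v2, v3] at h
      rw [v3, ← hu, min_eq_right (not_le.1 h).le]
  · rintro s' rfl
    have hB' : ∀ k, s'.B bDist k = if k = t + 1 * L + 1 then u else if k = t + 2 * L + 2 then 0
        else if k = t + 2 * L + 1 then C.delete a else if k = t + 1 * L + 2 then C.insert b
        else if k = t + 1 * L + 0 then C.delete a else if k = t + 0 * L + 1 then C.insert b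
        else if k = t + 0 * L + 0 then 0 else s.B bDist k := by
      intro k
      rw [← hf, ← hs0]
      simp
    constructor
    · unfold HasTable IsTable
      rw [hA, hB, ht]
      refine blockDist_letters C a b (fun i j => s'.B bDist (t + i * L + j)) ?_ ?_ ?_ ?_ ?_ ?_ ?_
        <;> rw [hB']
      · rw [if_neg (by omega), if_neg (by omega), if_neg (by omega), if_neg (by omega),
          if_neg (by omega), if_neg (by omega), if_pos rfl]
      · rw [if_neg (by omega), if_neg (by omega), if_neg (by omega), if_neg (by omega),
          if_neg (by omega), if_pos rfl]
      · rw [if_neg (by omega), if_neg (by omega), if_neg (by omega), if_neg (by omega),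
          if_pos rfl]
      · rw [if_neg (by omega), if_neg (by omega), if_neg (by omega), if_pos rfl]
      · rw [if_neg (by omega), if_neg (by omega), if_pos rfl]
      · rw [if_neg (by omega), if_pos rfl]
      · rw [if_pos rfl, hu]
    · intro k hk
      have h2 : 3 * L ≤ L * L := Nat.mul_le_mul_right _ h3
      rw [hB', if_neg (by omega), if_neg (by omega), if_neg (by omega), if_neg (by omega),
          if_neg (by omega), if_neg (by omega), if_neg (by omega)]

end RAM

namespace RAM

variable {σ : ℕ} {C : Scoring (Fin σ)} {βA βB : ℕ → SLPTree (Fin σ)} {LA LB : List ℕ}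

/-- A child stands strictly earlier in a list without repetitions, so its label differs from that of
its parent and its table occupies other cells. -/
theorem Recorded.child_of_mem {g n x X : ℕ} {β : ℕ → SLPTree (Fin σ)} {L : List ℕ} {s : State}
    (h : Recorded g n x β L s) (hX : X ∈ L) {c : SLPTree (Fin σ)} (hc : c ∈ (β X).children) :
    β c.label = c ∧ c.label ∈ L ∧ c.label ≠ X := by
  obtain ⟨j, hj⟩ := List.mem_iff_getElem?.1 hX
  obtain ⟨h1, i, hi, h2⟩ := h.child j X hj c hc
  refine ⟨h1, List.mem_of_getElem? h2, fun he => ?_⟩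
  rw [he, ← hj] at h2
  have := (List.getElem?_inj ((hi.trans (List.getElem?_eq_some_iff.1 hj).1)) h.nodup).1 h2
  omega

/-- The table of the labels `X` and `Y` has been computed, and nothing else is changed. -/
def TableDone (C : Scoring (Fin σ)) (βA βB : ℕ → SLPTree (Fin σ)) (n L X Y : ℕ) (s s' : State) :
    Prop :=
  HasTable C βA βB n L s' X Y ∧ ∀ k, ¬ (tableAt n L X Y ≤ k ∧ k < tableAt n L X Y + L * L) →
    s'.B bDist k = s.B bDist k

theorem lt_of_tables {n L Z : ℕ} (hn : 0 < n) (hL : 0 < L) (h : n * n * (L * L) < Z) : n < Z :=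
  (Nat.le_mul_of_pos_right n hn).trans_lt
    ((Nat.le_mul_of_pos_right (n * n) (Nat.mul_pos hL hL)).trans_lt h)

theorem tableExp_fits {W Z n L X Y : ℕ} {s : State} {e f : NExp} (he : e.Fits W s) (hf : f.Fits W s)
    (eX : e.eval s = X) (eY : f.eval s = Y) (hX : X < n) (hY : Y < n) (eL : s.nvar xLx = L)
    (eN : s.nvar zN = n) (hZ : n * n * (L * L) < Z) (hW : Z ≤ W) (hL : 0 < L) :
    (tableExp e f).Fits W s ∧ (tableExp e f).eval s = tableAt n L X Y := by
  have h1 : (X + 1) * n ≤ n * n := Nat.mul_le_mul_right _ hX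
  rw [Nat.add_mul, Nat.one_mul] at h1
  have h2 := tableAt_lt hX hY hZ
  have h3 : 0 < L * L := Nat.mul_pos hL hL
  have h4 : n * n ≤ n * n * (L * L) := Nat.le_mul_of_pos_right _ h3
  have h5 : L ≤ L * L := Nat.le_mul_of_pos_right _ hL
  have h6 : n ≤ n * n := Nat.le_mul_of_pos_right _ (by omega)
  refine ⟨?_, by simp [tableExp, eX, eY, eL, eN, tableAt]⟩
  unfold tableAt at h2
  simp [tableExp, eX, eY, eL, eN, he, hf]
  omega

theorem verticalProg_run {W Z n x X Y L : ℕ} {s : State} {i : ℕ} {u v : SLPTree (Fin σ)}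
    (ctx : TableContext W Z n x C βA βB LA LB s) (hX : X ∈ LA) (hY : Y ∈ LB)
    (eX : s.nvar zX = X) (eY : s.nvar zY = Y) (hL : s.nvar xLx = L)
    (eB : s.nvar zB = tableAt n L X Y) (eP : s.nvar zPx = (βA X).size)
    (eQ : s.nvar zPy = (βB Y).size) (hA : βA X = .node i u v)
    (hu : HasTable C βA βB n L s u.label Y) (hv : HasTable C βA βB n L s v.label Y) :
    Run W (verticalInit ;; unionProg) s (24100 * (L * L)) (TableDone C βA βB n L X Y s) := by
  obtain ⟨c1, c2, c3, c4, c5, c6, c7, c8, c9, c10, c11, c12, c13, c14, c15⟩ := id ctx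
  rw [hL] at c4 c5 c6
  obtain ⟨bu, mu, nu⟩ := c9.child_of_mem hX (c := u) (by simp [hA, SLPTree.children])
  obtain ⟨bv, mv, nv⟩ := c9.child_of_mem hX (c := v) (by simp [hA, SLPTree.children])
  have hXn := c9.lt X hX
  have hYn := c10.lt Y hY
  have hun := c9.lt _ mu
  have hvn := c9.lt _ mv
  have fX := c9.fst X hX
  have gX := c9.snd X hX
  have lu := c9.len _ mu
  have lv := c9.len _ mv
  have sX := c11 X hX
  have sY := c12 Y hY
  have hLL : 3 * 3 ≤ L * L := Nat.mul_le_mul (by omega) (by omega)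
  rw [hA] at fX gX sX eP
  rw [bu] at lu
  rw [bv] at lv
  simp only [SLPTree.fst, SLPTree.snd, Nat.reduceAdd, SLPTree.size] at fX gX sX lu lv eP
  have hnZ := lt_of_tables (by omega) (by omega) c5
  have hLZ : L + 3 < Z := (Nat.le_mul_of_pos_right (L + 3) L.succ_pos).trans_lt c4
  have t1 := tableAt_lt hun hYn c5
  have t2 := tableAt_lt hvn hYn c5
  have t3 := tableAt_lt hXn hYn c5
  refine Run.mono (τ := 400 + 24000 * (L * L)) ?_ (by omega) fun _ => id
  refine Run.seq (((Run.of_wp_le (p := verticalInit) (W := W) (s := s) (τ := 400)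
    (Q := fun s' => s'.nvar zP₁ = u.size ∧ s'.nvar zQ₁ = (βB Y).size ∧
      s'.nvar zD₁ = tableAt n L u.label Y ∧ s'.nvar zE₁ = v.size ∧ s'.nvar zP₂ = v.size ∧
      s'.nvar zQ₂ = (βB Y).size ∧ s'.nvar zD₂ = tableAt n L v.label Y ∧ s'.nvar zE₂ = 0)
    ?_ (by decide)).frame [zU, zV, zP₁, zQ₁, zD₁, zE₁, zP₂, zQ₂, zD₂, zE₂] [] []
    (by decide) (by decide) (by decide)).mono le_rfl ?_)
  · have := fun (s1 : State) (h1 : s1.nvar zU = u.label) (h2 : s1.nvar zY = Y)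
      (h3 : s1.nvar xLx = L) (h4 : s1.nvar zN = n) => tableExp_fits (W := W) (e := ↟zU) (f := ↟zY)
      (by simp; omega) (by simp; omega) h1 h2 hun hYn h3 h4 c5 (by omega) (by omega)
    have := fun (s1 : State) (h1 : s1.nvar zV = v.label) (h2 : s1.nvar zY = Y)
      (h3 : s1.nvar xLx = L) (h4 : s1.nvar zN = n) => tableExp_fits (W := W) (e := ↟zV) (f := ↟zY)
      (by simp; omega) (by simp; omega) h1 h2 hvn hYn h3 h4 c5 (by omega) (by omega)
    simp [verticalInit, *]
    omega
  rintro s1 ⟨⟨e1, e2, e3, e4, e5, e6, e7, e8⟩, hf⟩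
  have b1 := hf.B bDist (by decide) (by decide)
  have n1 : ∀ y, y ∉ [zU, zV, zP₁, zQ₁, zD₁, zE₁, zP₂, zQ₂, zD₂, zE₂] → s1.nvar y = s.nvar y :=
    hf.nvar
  have l1 : s1.nvar xLx = L := by rw [n1 _ (by decide), hL]
  have p1 : s1.nvar zPx = u.size + v.size := by rw [n1 _ (by decide), eP]
  have q1 : s1.nvar zPy = (βB Y).size := by rw [n1 _ (by decide), eQ]
  have b2 : s1.nvar zB = tableAt n L X Y := by rw [n1 _ (by decide), eB]
  have pc : PairContext W Z s1 := by
    refine ⟨by rw [n1 _ (by decide)]; exact c1, by rw [n1 _ (by decide)]; exact c2, c3,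
      by rw [l1]; exact c4, ?_, ?_, ?_, ?_, ?_, ?_⟩ <;>
      simp only [l1, p1, q1, b2, e1, e2, e3, e4, e5, e6, e7, e8] <;> omega
  unfold HasTable at hu hv
  rw [bu] at hu
  rw [bv] at hv
  refine (unionProg_run (G := C.grid (u.word ++ v.word) (βB Y).word) pc
    (fun i hi => composes_vertical C u.word v.word (βB Y).word (SLPTree.length_word _)
      (SLPTree.length_word _) (SLPTree.length_word _) hi) p1 q1 l1 b2 e1 e2 e4 e5 e6 e8
    (by rw [e3]; exact hu.of_eq (by omega) fun k _ _ => b1 k)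
    (by rw [e7]; exact hv.of_eq (by omega) fun k _ _ => b1 k)
    (by rw [e3]; exact tableAt_disjoint hYn hYn (Or.inl nu))
    (by rw [e7]; exact tableAt_disjoint hYn hYn (Or.inl nv))).mono le_rfl ?_
  rintro s2 ⟨h1, h2⟩
  refine ⟨?_, fun k hk => by rw [h2 k hk, b1]⟩
  unfold HasTable Scoring.blockDist
  rw [hA]
  simpa [SLPTree.size, SLPTree.word] using h1

end RAM

namespace RAM

variable {σ : ℕ} {C : Scoring (Fin σ)} {βA βB : ℕ → SLPTree (Fin σ)} {LA LB : List ℕ}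

theorem horizontalProg_run {W Z n x X Y L : ℕ} {s : State} {i : ℕ} {u v : SLPTree (Fin σ)}
    (ctx : TableContext W Z n x C βA βB LA LB s) (hX : X ∈ LA) (hY : Y ∈ LB)
    (eX : s.nvar zX = X) (eY : s.nvar zY = Y) (hL : s.nvar xLx = L)
    (eB : s.nvar zB = tableAt n L X Y) (eP : s.nvar zPx = (βA X).size)
    (eQ : s.nvar zPy = (βB Y).size) (hB : βB Y = .node i u v)
    (hu : HasTable C βA βB n L s X u.label) (hv : HasTable C βA βB n L s X v.label) :
    Run W (horizontalInit ;; unionProg) s (24100 * (L * L)) (TableDone C βA βB n L X Y s) := by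
  obtain ⟨c1, c2, c3, c4, c5, c6, c7, c8, c9, c10, c11, c12, c13, c14, c15⟩ := id ctx
  rw [hL] at c4 c5 c6
  obtain ⟨bu, mu, nu⟩ := c10.child_of_mem hY (c := u) (by simp [hB, SLPTree.children])
  obtain ⟨bv, mv, nv⟩ := c10.child_of_mem hY (c := v) (by simp [hB, SLPTree.children])
  have hXn := c9.lt X hX
  have hYn := c10.lt Y hY
  have hun := c10.lt _ mu
  have hvn := c10.lt _ mv
  have fY := c10.fst Y hY
  have gY := c10.snd Y hY
  have lu := c10.len _ mu
  have lv := c10.len _ mv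
  have sX := c11 X hX
  have sY := c12 Y hY
  have hLL : 3 * 3 ≤ L * L := Nat.mul_le_mul (by omega) (by omega)
  rw [hB] at fY gY sY eQ
  rw [bu] at lu
  rw [bv] at lv
  simp only [SLPTree.fst, SLPTree.snd, Nat.reduceAdd, SLPTree.size] at fY gY sY lu lv eQ
  have hnZ := lt_of_tables (by omega) (by omega) c5
  have hLZ : L + 3 < Z := (Nat.le_mul_of_pos_right (L + 3) L.succ_pos).trans_lt c4
  have t1 := tableAt_lt hXn hun c5
  have t2 := tableAt_lt hXn hvn c5
  have t3 := tableAt_lt hXn hYn c5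
  refine Run.mono (τ := 400 + 24000 * (L * L)) ?_ (by omega) fun _ => id
  refine Run.seq (((Run.of_wp_le (p := horizontalInit) (W := W) (s := s) (τ := 400)
    (Q := fun s' => s'.nvar zP₁ = (βA X).size ∧ s'.nvar zQ₁ = u.size ∧
      s'.nvar zD₁ = tableAt n L X u.label ∧ s'.nvar zE₁ = 0 ∧ s'.nvar zP₂ = (βA X).size ∧
      s'.nvar zQ₂ = v.size ∧ s'.nvar zD₂ = tableAt n L X v.label ∧ s'.nvar zE₂ = u.size)
    ?_ (by decide)).frame [zU, zV, zP₁, zQ₁, zD₁, zE₁, zP₂, zQ₂, zD₂, zE₂] [] []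
    (by decide) (by decide) (by decide)).mono le_rfl ?_)
  · have := fun (s1 : State) (h1 : s1.nvar zX = X) (h2 : s1.nvar zU = u.label)
      (h3 : s1.nvar xLx = L) (h4 : s1.nvar zN = n) => tableExp_fits (W := W) (e := ↟zX) (f := ↟zU)
      (by simp; omega) (by simp; omega) h1 h2 hXn hun h3 h4 c5 (by omega) (by omega)
    have := fun (s1 : State) (h1 : s1.nvar zX = X) (h2 : s1.nvar zV = v.label)
      (h3 : s1.nvar xLx = L) (h4 : s1.nvar zN = n) => tableExp_fits (W := W) (e := ↟zX) (f := ↟zV)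
      (by simp; omega) (by simp; omega) h1 h2 hXn hvn h3 h4 c5 (by omega) (by omega)
    simp [horizontalInit, *]
    omega
  rintro s1 ⟨⟨e1, e2, e3, e4, e5, e6, e7, e8⟩, hf⟩
  have b1 := hf.B bDist (by decide) (by decide)
  have n1 : ∀ y, y ∉ [zU, zV, zP₁, zQ₁, zD₁, zE₁, zP₂, zQ₂, zD₂, zE₂] → s1.nvar y = s.nvar y :=
    hf.nvar
  have l1 : s1.nvar xLx = L := by rw [n1 _ (by decide), hL]
  have p1 : s1.nvar zPx = (βA X).size := by rw [n1 _ (by decide), eP]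
  have q1 : s1.nvar zPy = u.size + v.size := by rw [n1 _ (by decide), eQ]
  have b2 : s1.nvar zB = tableAt n L X Y := by rw [n1 _ (by decide), eB]
  have pc : PairContext W Z s1 := by
    refine ⟨by rw [n1 _ (by decide)]; exact c1, by rw [n1 _ (by decide)]; exact c2, c3,
      by rw [l1]; exact c4, ?_, ?_, ?_, ?_, ?_, ?_⟩ <;>
      simp only [l1, p1, q1, b2, e1, e2, e3, e4, e5, e6, e7, e8] <;> omega
  unfold HasTable at hu hv
  rw [bu] at hu
  rw [bv] at hv
  refine (unionProg_run (G := C.grid (βA X).word (u.word ++ v.word)) pc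
    (fun i hi => composes_horizontal C (βA X).word u.word v.word (SLPTree.length_word _)
      (SLPTree.length_word _) (SLPTree.length_word _) hi) p1 q1 l1 b2 e1 e2 e4 e5 e6 e8
    (by rw [e3]; exact hu.of_eq (by omega) fun k _ _ => b1 k)
    (by rw [e7]; exact hv.of_eq (by omega) fun k _ _ => b1 k)
    (by rw [e3]; exact tableAt_disjoint hun hYn (Or.inr nu))
    (by rw [e7]; exact tableAt_disjoint hvn hYn (Or.inr nv))).mono le_rfl ?_
  rintro s2 ⟨h1, h2⟩
  refine ⟨?_, fun k hk => by rw [h2 k hk, b1]⟩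
  unfold HasTable Scoring.blockDist
  rw [hB]
  simpa [SLPTree.size, SLPTree.word] using h1

/-- The first block is split as long as it is not a letter, then the second one. Each union needs
only tables of a child of one block with the whole other block. -/
theorem tableProg_run {W Z n x X Y L : ℕ} {s : State}
    (ctx : TableContext W Z n x C βA βB LA LB s) (hX : X ∈ LA) (hY : Y ∈ LB)
    (eX : s.nvar zX = X) (eY : s.nvar zY = Y) (hL : s.nvar xLx = L)
    (hA : ∀ c ∈ (βA X).children, HasTable C βA βB n L s c.label Y)
    (hB : ∀ c ∈ (βB Y).children, HasTable C βA βB n L s X c.label) :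
    Run W tableProg s (25000 * (L * L)) (TableDone C βA βB n L X Y s) := by
  obtain ⟨c1, c2, c3, c4, c5, c6, c7, c8, c9, c10, c11, c12, c13, c14, c15⟩ := id ctx
  rw [hL] at c4 c5 c6
  have hXn := c9.lt X hX
  have hYn := c10.lt Y hY
  have lX := c9.len _ hX
  have lY := c10.len _ hY
  have sX := c11 X hX
  have sY := c12 Y hY
  have kX := c9.kind X hX
  have kY := c10.kind Y hY
  have hLL : 3 * 3 ≤ L * L := Nat.mul_le_mul (by omega) (by omega)
  have hnZ := lt_of_tables (by omega) (by omega) c5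
  have hLZ : L + 3 < Z := (Nat.le_mul_of_pos_right (L + 3) L.succ_pos).trans_lt c4
  have small : ∀ {X' Y' : ℕ}, X' ∈ LA → Y' ∈ LB → (βA X').size + (βB Y').size < L := by
    intro X' Y' h1 h2
    have := c11 X' h1
    have := c12 Y' h2
    omega
  refine Run.mono (τ := 100 + (10 + (10 + 24100 * (L * L)))) ?_ (by omega) fun _ => id
  refine Run.seq (((Run.of_wp_le (p := pairInit) (W := W) (s := s) (τ := 100)
    (Q := fun s' => s'.nvar zPx = (βA X).size ∧ s'.nvar zPy = (βB Y).size ∧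
      s'.nvar zB = tableAt n L X Y) ?_ (by decide)).frame [zPx, zPy, zB] [] []
    (by decide) (by decide) (by decide)).mono le_rfl ?_)
  · have := fun (s1 : State) (h1 : s1.nvar zX = X) (h2 : s1.nvar zY = Y)
      (h3 : s1.nvar xLx = L) (h4 : s1.nvar zN = n) => tableExp_fits (W := W) (e := ↟zX) (f := ↟zY)
      (by simp; omega) (by simp; omega) h1 h2 hXn hYn h3 h4 c5 (by omega) (by omega)
    simp [pairInit, eX, eY, hL, c8, lX, lY, this]
    omega
  rintro s1 ⟨⟨e1, e2, e3⟩, hf⟩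
  have ctx1 := ctx.frame hf (by decide) (by decide)
  have b1 := hf.B bDist (by decide) (by decide)
  have n1 : ∀ y, y ∉ [zPx, zPy, zB] → s1.nvar y = s.nvar y := hf.nvar
  have l1 : s1.nvar xLx = L := by rw [n1 _ (by decide), hL]
  have x1 : s1.nvar zX = X := by rw [n1 _ (by decide), eX]
  have y1 : s1.nvar zY = Y := by rw [n1 _ (by decide), eY]
  have a1 : s1.A 40 X = (βA X).kind := by rw [hf.A _ (by decide) (by decide), kX]
  have a2 : s1.A 56 Y = (βB Y).kind := by rw [hf.A _ (by decide) (by decide), kY]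
  have v1 : s1.nvar 3 = s.nvar 3 := n1 _ (by decide)
  have done : ∀ s2, TableDone C βA βB n L X Y s1 s2 → TableDone C βA βB n L X Y s s2 :=
    fun s2 h => ⟨h.1, fun k hk => by rw [h.2 k hk, b1]⟩
  have move : ∀ {X' Y' : ℕ}, X' ∈ LA → Y' ∈ LB → HasTable C βA βB n L s X' Y' →
      HasTable C βA βB n L s1 X' Y' :=
    fun h1 h2 h => IsTable.of_eq h (small h1 h2) fun k _ _ => b1 k
  have kA : (βA X).kind ≤ 1 := by cases βA X <;> simp [SLPTree.kind]
  have kB : (βB Y).kind ≤ 1 := by cases βB Y <;> simp [SLPTree.kind]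
  refine Run.ite (b := .neq (.ld 40 ↟zX) ♯1) (by simp [x1, a1, v1]; omega) (fun h => ?_)
    fun h => ?_
  · simp only [Test.holds_neq, NExp.eval_ld, NExp.eval_var, NExp.eval_lit, x1, a1] at h
    cases hA' : βA X with
    | leaf i a => simp [hA', SLPTree.kind] at h
    | node i u v =>
      obtain ⟨-, mu, -⟩ := c9.child_of_mem hX (c := u) (by simp [hA', SLPTree.children])
      obtain ⟨-, mv, -⟩ := c9.child_of_mem hX (c := v) (by simp [hA', SLPTree.children])
      exact (verticalProg_run ctx1 hX hY x1 y1 l1 e3 e1 e2 hA'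
        (move mu hY (hA u (by simp [hA', SLPTree.children])))
        (move mv hY (hA v (by simp [hA', SLPTree.children])))).mono (by omega) done
  · simp only [Test.holds_neq, NExp.eval_ld, NExp.eval_var, NExp.eval_lit, x1, a1] at h
    refine Run.ite (b := .neq (.ld 56 ↟zY) ♯1) (by simp [y1, a2, v1]; omega) (fun h' => ?_)
      fun h' => ?_
    · simp only [Test.holds_neq, NExp.eval_ld, NExp.eval_var, NExp.eval_lit, y1, a2] at h'
      cases hB' : βB Y with
      | leaf i a => simp [hB', SLPTree.kind] at h'
      | node i u v =>
        obtain ⟨-, mu, -⟩ := c10.child_of_mem hY (c := u) (by simp [hB', SLPTree.children])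
        obtain ⟨-, mv, -⟩ := c10.child_of_mem hY (c := v) (by simp [hB', SLPTree.children])
        exact (horizontalProg_run ctx1 hX hY x1 y1 l1 e3 e1 e2 hB'
          (move hX mu (hB u (by simp [hB', SLPTree.children])))
          (move hX mv (hB v (by simp [hB', SLPTree.children])))).mono (by omega) done
    · simp only [Test.holds_neq, NExp.eval_ld, NExp.eval_var, NExp.eval_lit, y1, a2] at h'
      cases hA' : βA X with
      | node i u v => simp [hA', SLPTree.kind] at h
      | leaf i a =>
        cases hB' : βB Y with
        | node i u v => simp [hB', SLPTree.kind] at h'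
        | leaf j b =>
          exact (letterProg_run ctx1 hX hY x1 y1 l1 e3 rfl hA' hB').mono (by omega) done

end RAM

/-! ### The tables of all pairs, children first -/

namespace RAM

variable {σ : ℕ} {C : Scoring (Fin σ)} {βA βB : ℕ → SLPTree (Fin σ)} {LA LB : List ℕ}

def tableRowBody : Prog :=
  .nset zY (.ld 57 ↟zJ) ;; tableProg ;; .nset zJ (↟zJ + ♯1)

def tableRow : Prog :=
  .nset zX (.ld 41 ↟zA) ;; .nset zJ ♯0 ;; .loop (.nlt ↟zJ ↟zCb) tableRowBody ;;
    .nset zA (↟zA + ♯1)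

/-- Compute the tables of all pairs of blocks, children first. -/
def tablesProg : Prog := .nset zA ♯0 ;; .loop (.nlt ↟zA ↟zCa) tableRow

def tablesVars : List ℕ := tableVars ++ [zX, zY, zA, zJ]

/-- The tables of the pairs before the pair `(a, b)` of positions have been computed. -/
def Tabled (C : Scoring (Fin σ)) (βA βB : ℕ → SLPTree (Fin σ)) (n L : ℕ) (LA LB : List ℕ)
    (a b : ℕ) (s : State) : Prop :=
  ∀ i j X Y : ℕ, LA[i]? = some X → LB[j]? = some Y → (i < a ∨ i = a ∧ j < b) →
    HasTable C βA βB n L s X Y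

/-- Tables of other pairs survive because they lie in disjoint ranges; that different positions
carry different labels uses that the lists have no repetitions. -/
theorem TableDone.tabled {W Z n x X Y L a b : ℕ} {s s' : State}
    (ctx : TableContext W Z n x C βA βB LA LB s) (hL : s.nvar xLx = L)
    (h : TableDone C βA βB n L X Y s s') (hX : LA[a]? = some X) (hY : LB[b]? = some Y)
    (ht : Tabled C βA βB n L LA LB a b s) : Tabled C βA βB n L LA LB a (b + 1) s' := by
  intro i j X' Y' hi hj hij
  by_cases hc : i = a ∧ j = b
  · obtain ⟨rfl, rfl⟩ := hc
    rw [hX] at hi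
    rw [hY] at hj
    injection hi with hi
    injection hj with hj
    subst hi hj
    exact h.1
  have mX := List.mem_of_getElem? hi
  have mY := List.mem_of_getElem? hj
  have hne : X' ≠ X ∨ Y' ≠ Y := by
    by_contra! hn
    refine hc ⟨?_, ?_⟩
    · rw [hn.1, ← hX] at hi
      exact (List.getElem?_inj (by
        by_contra! hh
        rw [List.getElem?_eq_none hh, hX] at hi
        simp at hi) ctx.recA.nodup).1 hi
    · rw [hn.2, ← hY] at hj
      exact (List.getElem?_inj (by
        by_contra! hh
        rw [List.getElem?_eq_none hh, hY] at hj
        simp at hj) ctx.recB.nodup).1 hj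
  have hdis := tableAt_disjoint (L := L) (ctx.recB.lt _ mY)
    (ctx.recB.lt _ (List.mem_of_getElem? hY)) hne
  have h1 := ctx.sizeA _ mX
  have h2 := ctx.sizeB _ mY
  have h3 := ctx.cap
  refine IsTable.of_eq (ht i j X' Y' hi hj (by omega)) (by omega) fun k hk1 hk2 => h.2 k ?_
  omega

theorem Tabled.frame {W Z n x L a b : ℕ} {s s' : State} {V F R : List ℕ}
    (ctx : TableContext W Z n x C βA βB LA LB s) (hL : s.nvar xLx = L)
    (ht : Tabled C βA βB n L LA LB a b s) (hf : Frame V F R s s') (hR : bDist ∉ R) :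
    Tabled C βA βB n L LA LB a b s' := by
  intro i j X Y hi hj hij
  have h1 := ctx.sizeA _ (List.mem_of_getElem? hi)
  have h2 := ctx.sizeB _ (List.mem_of_getElem? hj)
  have h3 := ctx.cap
  exact IsTable.of_eq (ht i j X Y hi hj hij) (by omega) fun k _ _ => hf.B _ hR (by decide) k

/-- Children precede parents in both lists, so the tables needed were made in an earlier row or
earlier in the same row. -/
theorem tableRowBody_run {W Z n x X Y L a b : ℕ} {s : State}
    (ctx : TableContext W Z n x C βA βB LA LB s) (hL : s.nvar xLx = L) (hX : LA[a]? = some X)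
    (hY : LB[b]? = some Y) (eX : s.nvar zX = X) (eJ : s.nvar zJ = b)
    (ht : Tabled C βA βB n L LA LB a b s) :
    Run W tableRowBody s (26000 * (L * L)) (fun s' => s'.nvar zJ = b + 1 ∧
      Tabled C βA βB n L LA LB a (b + 1) s') := by
  obtain ⟨c1, c2, c3, c4, c5, c6, c7, c8, c9, c10, c11, c12, c13, c14, c15⟩ := id ctx
  rw [hL] at c4 c5 c6
  have mX := List.mem_of_getElem? hX
  have mY := List.mem_of_getElem? hY
  have hYn := c10.lt Y mY
  have hnZ := lt_of_tables (by omega) (by omega) c5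
  have hbn : b < LB.length := (List.getElem?_eq_some_iff.1 hY).1
  have hlen := c10.length_le
  have oY := c10.ord b Y hY
  have hLL : 3 * 3 ≤ L * L := Nat.mul_le_mul (by omega) (by omega)
  refine Run.mono (τ := 30 + (25000 * (L * L) + 10)) ?_ (by omega) fun _ => id
  refine Run.seq (((Run.of_wp_le (p := .nset zY (.ld 57 ↟zJ)) (W := W) (s := s) (τ := 30)
    (Q := fun s' => s'.nvar zY = Y) (by simp [eJ, oY]; omega) (by decide)).frame [zY] [] []
    (by decide) (by decide) (by decide)).mono le_rfl ?_)
  rintro s1 ⟨e1, hf⟩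
  have ctx1 := ctx.frame hf (by decide) (by decide)
  have n1 : ∀ y, y ∉ [zY] → s1.nvar y = s.nvar y := hf.nvar
  have l1 : s1.nvar xLx = L := by rw [n1 _ (by decide), hL]
  have ht1 := ht.frame ctx hL hf (by decide)
  refine Run.seq (((tableProg_run ctx1 mX mY (by rw [n1 _ (by decide), eX]) e1 l1
    (fun c hc => ?_) fun c hc => ?_).frame tableVars [aCol, aLen, aRes] [bVec, bTmp, bDist]
    (by decide) (by decide) (by decide)).mono le_rfl ?_)
  · obtain ⟨-, i, hi, h2⟩ := c9.child a X hX c hc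
    exact ht1 i b _ _ h2 hY (Or.inl hi)
  · obtain ⟨-, i, hi, h2⟩ := c10.child b Y hY c hc
    exact ht1 a i _ _ hX h2 (Or.inr ⟨rfl, hi⟩)
  rintro s2 ⟨h2, hf2⟩
  have ht2 := h2.tabled ctx1 l1 hX hY ht1
  have ctx2 := ctx1.frame hf2 (by decide) (by decide)
  have j2 : s2.nvar zJ = b := by rw [hf2.nvar _ (by decide), n1 _ (by decide), eJ]
  have l2 : s2.nvar xLx = L := by rw [hf2.nvar _ (by decide), l1]
  refine ((Run.of_wp_le (p := .nset zJ (↟zJ + ♯1)) (W := W) (s := s2) (τ := 10)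
    (Q := fun s' => s'.nvar zJ = b + 1) (by simp [j2]; omega) (by decide)).frame [zJ] [] []
    (by decide) (by decide) (by decide)).mono le_rfl ?_
  rintro s3 ⟨e3, hf3⟩
  exact ⟨e3, ht2.frame ctx2 l2 hf3 (by decide)⟩

theorem tableRow_run {W Z n x X L a : ℕ} {s : State}
    (ctx : TableContext W Z n x C βA βB LA LB s) (hL : s.nvar xLx = L) (hX : LA[a]? = some X)
    (eA : s.nvar zA = a) (eC : s.nvar zCb = LB.length)
    (ht : Tabled C βA βB n L LA LB a 0 s) :
    Run W tableRow s ((26000 * (L * L) + 3) * LB.length + 100) (fun s' => s'.nvar zA = a + 1 ∧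
      Tabled C βA βB n L LA LB (a + 1) 0 s') := by
  obtain ⟨c1, c2, c3, c4, c5, c6, c7, c8, c9, c10, c11, c12, c13, c14, c15⟩ := id ctx
  rw [hL] at c4 c5 c6
  have mX := List.mem_of_getElem? hX
  have hXn := c9.lt X mX
  have hnZ := lt_of_tables (by omega) (by omega) c5
  have han : a < LA.length := (List.getElem?_eq_some_iff.1 hX).1
  have hlen := c9.length_le
  have hlenB := c10.length_le
  have oX := c9.ord a X hX
  refine Run.mono (τ := 30 + (2 + (((26000 * (L * L) + 3) * LB.length + 3) + 10))) ?_ (by omega)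
    fun _ => id
  refine Run.seq (((Run.of_wp_le (p := .nset zX (.ld 41 ↟zA)) (W := W) (s := s) (τ := 30)
    (Q := fun s' => s'.nvar zX = X) (by simp [eA, oX]; omega) (by decide)).frame [zX] [] []
    (by decide) (by decide) (by decide)).mono le_rfl ?_)
  rintro s1 ⟨e1, hf1⟩
  have ctx1 := ctx.frame hf1 (by decide) (by decide)
  have ht1 := ht.frame ctx hL hf1 (by decide)
  have l1 : s1.nvar xLx = L := by rw [hf1.nvar _ (by decide), hL]
  refine Run.seq (((Run.of_wp_le (p := .nset zJ ♯0) (W := W) (s := s1) (τ := 2)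
    (Q := fun s' => s'.nvar zJ = 0) (by simp; omega) (by decide)).frame [zJ] [] []
    (by decide) (by decide) (by decide)).mono le_rfl ?_)
  rintro s2 ⟨e2, hf2⟩
  have ctx2 := ctx1.frame hf2 (by decide) (by decide)
  have ht2 := ht1.frame ctx1 l1 hf2 (by decide)
  have n2 : ∀ y, y ∉ [zX, zJ] → s2.nvar y = s.nvar y := fun y hy => by
    rw [hf2.nvar y (by simp at hy ⊢; omega), hf1.nvar y (by simp at hy ⊢; omega)]
  have x2 : s2.nvar zX = X := by rw [hf2.nvar _ (by decide), e1]
  refine Run.seq (Run.mono ((Run.loop_count (b := .nlt ↟zJ ↟zCb) (p := tableRowBody)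
    (tableVars ++ [zY, zJ]) [aCol, aLen, aRes] [bVec, bTmp, bDist] (by decide) (by decide)
    (by decide) (26000 * (L * L)) (Q := fun s' => Tabled C βA βB n L LA LB (a + 1) 0 s')
    (fun s' k => s'.nvar zJ + k = LB.length ∧ Tabled C βA βB n L LA LB a (s'.nvar zJ) s')
    (s₀ := s2) (k₀ := LB.length) ?_ ?_).frame (tableVars ++ [zY, zJ]) [aCol, aLen, aRes]
      [bVec, bTmp, bDist] (by decide) (by decide) (by decide)) le_rfl ?_)
  · rw [e2]
    exact ⟨by omega, ht2⟩
  · rintro s3 k hf3 ⟨h1, h2⟩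
    have ctx3 := ctx2.frame hf3 (by decide) (by decide)
    have b3 : s3.nvar zCb = LB.length := by
      rw [hf3.nvar _ (by decide), n2 _ (by decide), eC]
    refine ⟨by simp [b3]; omega, fun hh => ?_, fun hh => ?_⟩
    · simp only [Test.holds_nlt, NExp.eval_var, b3] at hh
      refine (tableRowBody_run ctx3 (by rw [hf3.nvar _ (by decide), n2 _ (by decide), hL]) hX
        (List.getElem?_eq_getElem hh) (by rw [hf3.nvar _ (by decide), x2]) rfl h2).mono le_rfl ?_
      rintro s4 ⟨g1, g2⟩
      exact ⟨k - 1, by omega, by omega, by rw [g1]; exact g2⟩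
    · simp only [Test.holds_nlt, NExp.eval_var, b3] at hh
      intro i j X' Y' hi hj hij
      have := (List.getElem?_eq_some_iff.1 hj).1
      exact h2 i j X' Y' hi hj (by omega)
  rintro s3 ⟨ht3, hf3⟩
  have ctx3 := ctx2.frame hf3 (by decide) (by decide)
  have a3 : s3.nvar zA = a := by rw [hf3.nvar _ (by decide), n2 _ (by decide), eA]
  have l3 : s3.nvar xLx = L := by rw [hf3.nvar _ (by decide), n2 _ (by decide), hL]
  refine ((Run.of_wp_le (p := .nset zA (↟zA + ♯1)) (W := W) (s := s3) (τ := 10)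
    (Q := fun s' => s'.nvar zA = a + 1) (by simp [a3]; omega) (by decide)).frame [zA] [] []
    (by decide) (by decide) (by decide)).mono le_rfl ?_
  rintro s4 ⟨e4, hf4⟩
  exact ⟨e4, ht3.frame ctx3 l3 hf4 (by decide)⟩

theorem tablesProg_run {W Z n x L : ℕ} {s : State}
    (ctx : TableContext W Z n x C βA βB LA LB s) (hL : s.nvar xLx = L)
    (eA : s.nvar zCa = LA.length) (eB : s.nvar zCb = LB.length) :
    Run W tablesProg s (26200 * (L * L) * ((LA.length + 1) * (LB.length + 1))) (fun s' =>
      ∀ X ∈ LA, ∀ Y ∈ LB, HasTable C βA βB n L s' X Y) := by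
  obtain ⟨c1, c2, c3, c4, c5, c6, c7, c8, c9, c10, c11, c12, c13, c14, c15⟩ := id ctx
  rw [hL] at c4 c5 c6
  have hlen := c9.length_le
  refine Run.mono (τ := 2 + (((26000 * (L * L) + 3) * LB.length + 100 + 3) * LA.length + 3)) ?_
    ?_ fun _ => id
  rotate_left
  · obtain ⟨a, ha⟩ : ∃ a, LA.length = a := ⟨_, rfl⟩
    obtain ⟨b, hb⟩ : ∃ b, LB.length = b := ⟨_, rfl⟩
    obtain ⟨K, hK⟩ : ∃ K, L * L = K + 1 :=
      Nat.exists_eq_succ_of_ne_zero (Nat.mul_pos (by omega) (by omega)).ne'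
    rw [ha, hb, hK]
    ring_nf
    omega
  refine Run.seq (((Run.of_wp_le (p := .nset zA ♯0) (W := W) (s := s) (τ := 2)
    (Q := fun s' => s'.nvar zA = 0) (by simp; omega) (by decide)).frame [zA] [] []
    (by decide) (by decide) (by decide)).mono le_rfl ?_)
  rintro s1 ⟨e1, hf1⟩
  have ctx1 := ctx.frame hf1 (by decide) (by decide)
  refine Run.loop_count (b := .nlt ↟zA ↟zCa) (p := tableRow) tablesVars [aCol, aLen, aRes]
    [bVec, bTmp, bDist] (by decide) (by decide) (by decide)
    ((26000 * (L * L) + 3) * LB.length + 100)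
    (fun s' k => s'.nvar zA + k = LA.length ∧ Tabled C βA βB n L LA LB (s'.nvar zA) 0 s')
    (s₀ := s1) (k₀ := LA.length) ?_ ?_
  · rw [e1]
    exact ⟨by omega, fun i j X Y _ _ h => by omega⟩
  rintro s3 k hf3 ⟨h1, h2⟩
  have ctx3 := ctx1.frame hf3 (by decide) (by decide)
  have b3 : s3.nvar zCa = LA.length := by
    rw [hf3.nvar _ (by decide), hf1.nvar _ (by decide), eA]
  have hnZ : LA.length < W := by
    rcases Nat.eq_zero_or_pos n with h | h
    · omega
    · have := lt_of_tables h (by omega) c5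
      omega
  refine ⟨by simp [b3]; omega, fun hh => ?_, fun hh => ?_⟩
  · simp only [Test.holds_nlt, NExp.eval_var, b3] at hh
    refine (tableRow_run ctx3 (by rw [hf3.nvar _ (by decide), hf1.nvar _ (by decide), hL])
      (List.getElem?_eq_getElem hh) rfl
      (by rw [hf3.nvar _ (by decide), hf1.nvar _ (by decide), eB]) h2).mono le_rfl ?_
    rintro s4 ⟨g1, g2⟩
    exact ⟨k - 1, by omega, by omega, by rw [g1]; exact g2⟩
  · simp only [Test.holds_nlt, NExp.eval_var, b3] at hh
    intro X hX Y hY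
    obtain ⟨i, hi⟩ := List.mem_iff_getElem?.1 hX
    obtain ⟨j, hj⟩ := List.mem_iff_getElem?.1 hY
    have := (List.getElem?_eq_some_iff.1 hi).1
    exact h2 i j X Y hi hj (by omega)

end RAM

/-! ### The sweep program -/

namespace RAM

notation "zEA" => 65
notation "zEB" => 66
notation "zLA" => 67
notation "zLB" => 68
notation "zR" => 69
notation "zCc" => 70
notation "zRi" => 71
notation "zCi" => 72

variable {σ : ℕ} {C : Scoring (Fin σ)} {βA βB : ℕ → SLPTree (Fin σ)} {LA LB : List ℕ}
  {bsA bsB : List (SLPTree (Fin σ))}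

/-- The offset is computed from the column counter before this counter moves past the block. -/
def sweepCellInit : Prog :=
  .nset zY (.ld 51 ↟zCi) ;; .nset xQ (.ld 53 ↟zY) ;; .nset xP (.ld 37 ↟zX) ;;
  .nset xD (tableExp ↟zX ↟zY) ;; .nset xE ((↟zLA - (↟zR + ↟xP)) + ↟zCc) ;;
  .nset zCc (↟zCc + ↟xQ) ;; .nset zCi (↟zCi + ♯1)

def sweepCell : Prog := sweepCellInit ;; applyProg

def sweepRowInit : Prog := .nset zX (.ld 35 ↟zRi) ;; .nset zCc ♯0 ;; .nset zCi ♯0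

def sweepRowEnd : Prog := .nset zR (↟zR + .ld 37 ↟zX) ;; .nset zRi (↟zRi + ♯1)

def sweepRow : Prog :=
  sweepRowInit ;; .loop (.nlt ↟zCi ↟zEB) sweepCell ;; sweepRowEnd

def sweepInit : Prog :=
  .stb bVec ↟zLA .zero ;; .nset xLo ↟zLA ;; .nset xHi ↟zLA ;; .nset zR ♯0 ;; .nset zRi ♯0

/-- Propagate the distances from the upper left corner across all pairs of blocks. -/
def sweepProg : Prog := sweepInit ;; .loop (.nlt ↟zRi ↟zEA) sweepRow

def sweepCellVars : List ℕ := applyVars ++ [zY, xQ, xP, xD, xE, zCc, zCi]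

def sweepVars : List ℕ := sweepCellVars ++ [zX, zR, zRi]

/-- Both strings are partitioned into blocks, and the tables of all pairs of blocks have been
computed. -/
structure SweepContext (W Z n x : ℕ) (C : Scoring (Fin σ)) (βA βB : ℕ → SLPTree (Fin σ))
    (LA LB : List ℕ) (bsA bsB : List (SLPTree (Fin σ))) (s : State) : Prop where
  table : TableContext W Z n x C βA βB LA LB s
  partA : Partition 32 n x βA bsA LA s
  partB : Partition 48 n x βB bsB LB s
  tabs : ∀ X ∈ LA, ∀ Y ∈ LB, HasTable C βA βB n (2 * x + 1) s X Y
  lenA : s.nvar zLA = (bsA.flatMap SLPTree.word).length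
  lenB : s.nvar zLB = (bsB.flatMap SLPTree.word).length
  cntA : s.nvar zEA = bsA.length
  cntB : s.nvar zEB = bsB.length
  room : s.nvar zLA + s.nvar zLB < Z

theorem SweepContext.frame {W Z n x : ℕ} {s s' : State}
    (h : SweepContext W Z n x C βA βB LA LB bsA bsB s) {V F R : List ℕ} (hf : Frame V F R s s')
    (hV : ∀ x ∈ [2, 3, 4, xLx, zN, zLA, zLB, zEA, zEB], x ∉ V)
    (hF : ∀ x ∈ [35, 36, 37, 38, 39, 40, 41, 51, 52, 53, 54, 55, 56, 57], x ∉ F) (hR : bDist ∉ R) :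
    SweepContext W Z n x C βA βB LA LB bsA bsB s' := by
  obtain ⟨h1, h2, h3, h4, h5, h6, h7, h8, h9⟩ := h
  have v1 := hf.nvar zLA (hV _ (by simp))
  have v2 := hf.nvar zLB (hV _ (by simp))
  refine ⟨h1.frame hf (fun y hy => hV y ?_) fun y hy => hF y ?_, h2.frame hf
    (fun y hy => hF y ?_) (by decide), h3.frame hf (fun y hy => hF y ?_) (by decide),
    fun X hX Y hY => (h4 X hX Y hY).of_eq ?_ fun k _ _ => hf.B _ hR (by decide) k, by rw [v1, h5],
    by rw [v2, h6], by rw [hf.nvar _ (hV _ (by simp)), h7], by rw [hf.nvar _ (hV _ (by simp)), h8],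
    by rw [v1, v2]; exact h9⟩
  · revert hy
    simp
    omega
  · revert hy
    simp
    omega
  · revert hy
    simp
    omega
  · revert hy
    simp
    omega
  · have := h1.sizeA X hX
    have := h1.sizeB Y hY
    omega

theorem Frontier.congr {s : State} {val val' : ℕ → WithTop ℝ} {n : ℕ} (h : Frontier s val n)
    (hv : ∀ k ≤ n, val' k = val k) : Frontier s val' n := by
  obtain ⟨f1, f2, f3, f4⟩ := h
  exact ⟨f1, f2, fun k h1 h2 => by rw [hv k (by omega), f3 k h1 h2],
    fun k h1 h2 => by rw [hv k h1, f4 k h1 h2]⟩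

theorem length_flatMap_word_ge (P : List (SLPTree (Fin σ))) :
    P.length ≤ (P.flatMap SLPTree.word).length := by
  induction P with
  | nil => simp
  | cons t P ih =>
    have := t.size_pos
    simp
    simp at ih
    omega

/-- The table of the two labels is valid at the present place because the weights depend only on the
two factors. -/
theorem sweepCell_run {W Z n x r c m l : ℕ} {s : State} {P P' Q Q' : List (SLPTree (Fin σ))}
    {X Y : SLPTree (Fin σ)} {G : GridCosts}
    (hG : G = C.grid (bsA.flatMap SLPTree.word) (bsB.flatMap SLPTree.word))
    (ctx : SweepContext W Z n x C βA βB LA LB bsA bsB s) (hA : bsA = P ++ X :: P')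
    (hB : bsB = Q ++ Y :: Q') (eX : s.nvar zX = X.label)
    (hr : (P.flatMap SLPTree.word).length = r) (hc : (Q.flatMap SLPTree.word).length = c)
    (hm : (bsA.flatMap SLPTree.word).length = m) (hl : (bsB.flatMap SLPTree.word).length = l)
    (eR : s.nvar zR = r) (eC : s.nvar zCc = c) (eI : s.nvar zCi = Q.length)
    (hfr : Frontier s (sweepVal G m l r X.size c) (m + l)) :
    Run W sweepCell s (34000 * x) (fun s' => s'.nvar zCc = c + Y.size ∧
      s'.nvar zCi = Q.length + 1 ∧ Frontier s' (sweepVal G m l r X.size (c + Y.size)) (m + l)) := by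
  obtain ⟨ctxT, d2, d3, d4, d5, d6, d7, d8, d9⟩ := id ctx
  obtain ⟨c1, c2, c3, c4, c5, c6, c7, c8, c9, c10, c11, c12, c13, c14, c15⟩ := id ctxT
  obtain ⟨L, hL⟩ : ∃ L, s.nvar xLx = L := ⟨_, rfl⟩
  rw [hL] at c4 c5 c6
  rw [d5, d6, hm, hl] at d9
  rw [hm] at d5
  have mX := d2.mem X (by rw [hA]; simp)
  have mY := d3.mem Y (by rw [hB]; simp)
  have bX := d2.block X (by rw [hA]; simp)
  have bY := d3.block Y (by rw [hB]; simp)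
  have oY := d3.out Q.length Y (by rw [hB]; simp)
  have hXn := c9.lt _ mX
  have hYn := c10.lt _ mY
  have lX := c9.len _ mX
  have lY := c10.len _ mY
  have sX := c11 _ mX
  have sY := c12 _ mY
  rw [bX] at lX sX
  rw [bY] at lY sY
  have pX := X.size_pos
  have pY := Y.size_pos
  have hnZ := lt_of_tables (by omega) (by omega) c5
  have hLZ : L + 3 < Z := (Nat.le_mul_of_pos_right (L + 3) L.succ_pos).trans_lt c4
  have hrm : r + X.size ≤ m := by
    rw [← hr, ← hm, hA]
    simp
  have hcl : c + Y.size ≤ l := by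
    rw [← hc, ← hl, hB]
    simp
  have hQ : Q.length < Z := by
    have := length_flatMap_word_ge Q
    omega
  have htab := tableAt_lt hXn hYn c5
  have tab := d4 _ mX _ mY
  unfold HasTable at tab
  rw [bX, bY, ← c6] at tab
  refine Run.mono (τ := 200 + 11100 * (X.size + Y.size + 1)) ?_ (by omega) fun _ => id
  refine Run.seq (((Run.of_wp_le (p := sweepCellInit) (W := W) (s := s) (τ := 200)
    (Q := fun s' => s'.nvar xQ = Y.size ∧ s'.nvar xP = X.size ∧
      s'.nvar xD = tableAt n L X.label Y.label ∧ s'.nvar xE = m - (r + X.size) + c ∧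
      s'.nvar zCc = c + Y.size ∧ s'.nvar zCi = Q.length + 1)
    ?_ (by decide)).frame [zY, xQ, xP, xD, xE, zCc, zCi] [] []
    (by decide) (by decide) (by decide)).mono le_rfl ?_)
  · have := fun (s1 : State) (h1 : s1.nvar zX = X.label) (h2 : s1.nvar zY = Y.label)
      (h3 : s1.nvar xLx = L) (h4 : s1.nvar zN = n) => tableExp_fits (W := W) (e := ↟zX) (f := ↟zY)
      (by simp; omega) (by simp; omega) h1 h2 hXn hYn h3 h4 c5 (by omega) (by omega)
    simp [sweepCellInit, eX, eI, oY, lX, lY, hL, c8, eR, eC, d5, this]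
    omega
  rintro s1 ⟨⟨e1, e2, e3, e4, e5, e6⟩, hf⟩
  have n1 : ∀ y, y ∉ [zY, xQ, xP, xD, xE, zCc, zCi] → s1.nvar y = s.nvar y := hf.nvar
  have l1 : s1.nvar xLx = L := by rw [n1 _ (by decide), hL]
  have b1 := hf.B bDist (by decide) (by decide)
  have room : Room W Z (m + l) s1 := by
    refine ⟨by rw [n1 _ (by decide)]; exact c1, by rw [n1 _ (by decide)]; exact c2, c3, d9, ?_, ?_,
      by rw [l1]; omega, ?_⟩
    · rw [e1, e2, e4]
      omega
    · rw [e1, e2, e3, l1]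
      intro i j hi hj
      have := cell_lt (L := L) (i := i) (j := j) (by omega) (by omega)
      omega
    · rw [e1, e2]
      refine lt_of_le_of_lt (Nat.mul_le_mul ?_ ?_) c4 <;> omega
  have looks := (C.grid_looks (P.flatMap SLPTree.word) X.word (P'.flatMap SLPTree.word)
    (Q.flatMap SLPTree.word) Y.word (Q'.flatMap SLPTree.word)).blockDist rfl rfl
  have eA : P.flatMap SLPTree.word ++ X.word ++ P'.flatMap SLPTree.word =
      bsA.flatMap SLPTree.word := by rw [hA]; simp
  have eB : Q.flatMap SLPTree.word ++ Y.word ++ Q'.flatMap SLPTree.word =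
      bsB.flatMap SLPTree.word := by rw [hB]; simp
  rw [eA, eB, ← hG, hr, hc, SLPTree.length_word, SLPTree.length_word] at looks
  refine ((applyProg_run room (hfr.frame hf (by decide) (by decide)) e2 e1 e4
    (propagates_sweep hrm hcl pX pY fun i hi j hj h1 h2 => ?_)).frame applyVars
    [aCol, aLen, aRes] [bVec, bTmp] (by decide) (by decide) (by decide)).mono le_rfl ?_
  · rw [looks, e3, l1, b1]
    exact tab i hi j hj h1 h2
  rintro s2 ⟨h2, hf2⟩
  exact ⟨by rw [hf2.nvar _ (by decide), e5], by rw [hf2.nvar _ (by decide), e6], h2⟩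

theorem sweepRow_run {W Z n x r m l : ℕ} {s : State} {P P' : List (SLPTree (Fin σ))}
    {X : SLPTree (Fin σ)} {G : GridCosts}
    (hG : G = C.grid (bsA.flatMap SLPTree.word) (bsB.flatMap SLPTree.word))
    (ctx : SweepContext W Z n x C βA βB LA LB bsA bsB s) (hA : bsA = P ++ X :: P')
    (hr : (P.flatMap SLPTree.word).length = r)
    (hm : (bsA.flatMap SLPTree.word).length = m) (hl : (bsB.flatMap SLPTree.word).length = l)
    (hl0 : 0 < l) (eR : s.nvar zR = r) (eI : s.nvar zRi = P.length)
    (hfr : Frontier s (rowVal G m l r) (m + l)) :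
    Run W sweepRow s ((34000 * x + 3) * bsB.length + 100) (fun s' => s'.nvar zR = r + X.size ∧
      s'.nvar zRi = P.length + 1 ∧ Frontier s' (rowVal G m l (r + X.size)) (m + l)) := by
  obtain ⟨ctxT, d2, d3, d4, d5, d6, d7, d8, d9⟩ := id ctx
  obtain ⟨c1, c2, c3, c4, c5, c6, c7, c8, c9, c10, c11, c12, c13, c14, c15⟩ := id ctxT
  obtain ⟨L, hL⟩ : ∃ L, s.nvar xLx = L := ⟨_, rfl⟩
  rw [hL] at c4 c5 c6
  rw [d5, d6, hm, hl] at d9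
  have mX := d2.mem X (by rw [hA]; simp)
  have bX := d2.block X (by rw [hA]; simp)
  have oX := d2.out P.length X (by rw [hA]; simp)
  have hXn := c9.lt _ mX
  have lX := c9.len _ mX
  have sX := c11 _ mX
  rw [bX] at lX sX
  have pX := X.size_pos
  have hnZ := lt_of_tables (by omega) (by omega) c5
  have hrm : r + X.size ≤ m := by
    rw [← hr, ← hm, hA]
    simp
  have hP : P.length < Z := by
    have := length_flatMap_word_ge P
    omega
  have hbB : bsB.length < Z := by
    have := length_flatMap_word_ge bsB
    omega
  refine Run.mono (τ := 30 + (((34000 * x + 3) * bsB.length + 3) + 30)) ?_ (by omega) fun _ => id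
  refine Run.seq (((Run.of_wp_le (p := sweepRowInit) (W := W) (s := s) (τ := 30)
    (Q := fun s' => s'.nvar zX = X.label ∧ s'.nvar zCc = 0 ∧ s'.nvar zCi = 0)
    (by simp [sweepRowInit, eI, oX]; omega) (by decide)).frame [zX, zCc, zCi] [] []
    (by decide) (by decide) (by decide)).mono le_rfl ?_)
  rintro s1 ⟨⟨e1, e2, e3⟩, hf1⟩
  have n1 : ∀ y, y ∉ [zX, zCc, zCi] → s1.nvar y = s.nvar y := hf1.nvar
  have ctx1 := ctx.frame hf1 (by decide) (by decide) (by decide)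
  refine Run.seq (Run.mono ((Run.loop_count (b := .nlt ↟zCi ↟zEB) (p := sweepCell) (W := W)
    sweepCellVars [aCol, aLen, aRes] [bVec, bTmp] (by decide) (by decide)
    (by decide) (34000 * x) (Q := fun s' => Frontier s' (rowVal G m l (r + X.size)) (m + l))
    (fun s' k => ∃ Q Q', bsB = Q ++ Q' ∧ Q'.length = k ∧ s'.nvar zCi = Q.length ∧
      s'.nvar zCc = (Q.flatMap SLPTree.word).length ∧
      Frontier s' (sweepVal G m l r X.size (Q.flatMap SLPTree.word).length) (m + l))
    (s₀ := s1) (k₀ := bsB.length) ?_ ?_).frame sweepCellVars [aCol, aLen, aRes] [bVec, bTmp]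
      (by decide) (by decide) (by decide)) le_rfl ?_)
  · refine ⟨[], bsB, rfl, rfl, e3, e2, ?_⟩
    exact (hfr.frame hf1 (by decide) (by decide)).congr fun k hk => sweepVal_zero hrm hk
  · rintro s2 k hf2 ⟨Q, Q', h1, h2, h3, h4, h5⟩
    have ctx2 := ctx1.frame hf2 (by decide) (by decide) (by decide)
    have b2 := ctx2.cntB
    have hQ : Q.length + Q'.length = bsB.length := by rw [h1, List.length_append]
    refine ⟨by simp [b2, h3]; omega, fun hh => ?_, fun hh => ?_⟩
    · simp only [Test.holds_nlt, NExp.eval_var, b2, h3] at hh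
      obtain ⟨Y, Q'', rfl⟩ : ∃ Y Q'', Q' = Y :: Q'' :=
        List.exists_cons_of_ne_nil (by rintro rfl; simp at hQ; omega)
      refine (sweepCell_run hG ctx2 hA h1 (by rw [hf2.nvar _ (by decide), e1]) hr rfl hm hl
        (by rw [hf2.nvar _ (by decide), n1 _ (by decide), eR]) h4 h3 h5).mono le_rfl ?_
      rintro s3 ⟨g1, g2, g3⟩
      refine ⟨Q''.length, by rw [← h2]; simp, Q ++ [Y], Q'', by simp [h1], rfl, ?_, ?_, ?_⟩
      · rw [g2]
        simp
      · rw [g1]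
        simp
      · simpa using g3
    · simp only [Test.holds_nlt, NExp.eval_var, b2, h3] at hh
      have : Q' = [] := List.eq_nil_of_length_eq_zero (by omega)
      rw [this, List.append_nil] at h1
      rw [← h1, hl] at h5
      exact h5.congr fun k hk => (sweepVal_full hrm pX hl0 hk).symm
  rintro s2 ⟨h2, hf2⟩
  have n2 : ∀ y, y ∉ zX :: sweepCellVars → s2.nvar y = s.nvar y := fun y hy => by
    rw [hf2.nvar y fun h => hy (List.mem_cons_of_mem _ h), n1 y fun h => hy ?_]
    revert h
    simp only [List.mem_cons, List.not_mem_nil, or_false]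
    rintro (rfl | rfl | rfl) <;> decide
  have x2 : s2.nvar zX = X.label := by rw [hf2.nvar _ (by decide), e1]
  have r2 : s2.nvar zR = r := by rw [n2 _ (by decide), eR]
  have i2 : s2.nvar zRi = P.length := by rw [n2 _ (by decide), eI]
  have v2 : s2.nvar 3 = s.nvar 3 := n2 _ (by decide)
  have a2 : s2.A 37 X.label = X.size := by
    rw [hf2.A _ (by decide) (by decide), hf1.A _ (by decide) (by decide), lX]
  refine ((Run.of_wp_le (p := sweepRowEnd) (W := W) (s := s2) (τ := 30)
    (Q := fun s' => s'.nvar zR = r + X.size ∧ s'.nvar zRi = P.length + 1)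
    (by simp [sweepRowEnd, i2, x2, r2, a2, v2]; omega) (by decide)).frame [zR, zRi] [] []
    (by decide) (by decide) (by decide)).mono le_rfl ?_
  rintro s3 ⟨⟨e4, e5⟩, hf3⟩
  exact ⟨e4, e5, h2.frame hf3 (by decide) (by decide)⟩

/-- One linear push for each pair of positions in the two lists of blocks. Here repetitions count,
in contrast to the computation of the tables. -/
theorem sweepProg_run {W Z n x m l : ℕ} {s : State} {G : GridCosts}
    (hG : G = C.grid (bsA.flatMap SLPTree.word) (bsB.flatMap SLPTree.word))
    (ctx : SweepContext W Z n x C βA βB LA LB bsA bsB s)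
    (hm : (bsA.flatMap SLPTree.word).length = m) (hl : (bsB.flatMap SLPTree.word).length = l)
    (hl0 : 0 < l) :
    Run W sweepProg s (35000 * x * ((bsA.length + 1) * (bsB.length + 1))) (fun s' =>
      s'.nvar zLB = l ∧ Frontier s' (rowVal G m l m) (m + l)) := by
  obtain ⟨ctxT, d2, d3, d4, d5, d6, d7, d8, d9⟩ := id ctx
  obtain ⟨c1, c2, c3, c4, c5, c6, c7, c8, c9, c10, c11, c12, c13, c14, c15⟩ := id ctxT
  rw [d5, d6, hm, hl] at d9
  rw [hm] at d5
  have hbA : bsA.length < Z := by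
    have := length_flatMap_word_ge bsA
    omega
  refine Run.mono (τ := 50 + (((34000 * x + 3) * bsB.length + 100 + 3) * bsA.length + 3)) ?_ ?_
    fun _ => id
  rotate_left
  · obtain ⟨a, ha⟩ : ∃ a, bsA.length = a := ⟨_, rfl⟩
    obtain ⟨b, hb⟩ : ∃ b, bsB.length = b := ⟨_, rfl⟩
    obtain ⟨K, rfl⟩ : ∃ K, x = K + 1 := Nat.exists_eq_succ_of_ne_zero (by omega)
    rw [ha, hb]
    ring_nf
    omega
  refine Run.seq (((Run.of_wp_le (p := sweepInit) (W := W) (s := s) (τ := 50)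
    (Q := fun s' => s'.nvar xLo = m ∧ s'.nvar xHi = m ∧ s'.nvar zR = 0 ∧ s'.nvar zRi = 0 ∧
      s'.B bVec m = 0) (by simp [sweepInit, d5]; omega) (by decide)).frame [xLo, xHi, zR, zRi] []
      [bVec] (by decide) (by decide) (by decide)).mono le_rfl ?_)
  rintro s1 ⟨⟨e1, e2, e3, e4, e5⟩, hf1⟩
  have ctx1 := ctx.frame hf1 (by decide) (by decide) (by decide)
  have fr1 : Frontier s1 (rowVal G m l 0) (m + l) := by
    refine ⟨by omega, by omega, fun k h1 h2 => ?_, fun k h1 h2 => ?_⟩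
    · have : k = m := by omega
      rw [this, rowVal_zero, unitVal, if_pos rfl, e5]
      rfl
    · rw [rowVal_zero, unitVal, if_neg (by omega)]
  refine Run.loop_count (b := .nlt ↟zRi ↟zEA) (p := sweepRow) (W := W) sweepVars [aCol, aLen, aRes]
    [bVec, bTmp] (by decide) (by decide) (by decide) ((34000 * x + 3) * bsB.length + 100)
    (fun s' k => ∃ P P', bsA = P ++ P' ∧ P'.length = k ∧ s'.nvar zRi = P.length ∧
      s'.nvar zR = (P.flatMap SLPTree.word).length ∧
      Frontier s' (rowVal G m l (P.flatMap SLPTree.word).length) (m + l))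
    (s₀ := s1) (k₀ := bsA.length) ⟨[], bsA, rfl, rfl, e4, e3, fr1⟩ ?_
  rintro s2 k hf2 ⟨P, P', h1, h2, h3, h4, h5⟩
  have ctx2 := ctx1.frame hf2 (by decide) (by decide) (by decide)
  have a2 := ctx2.cntA
  have hP : P.length + P'.length = bsA.length := by rw [h1, List.length_append]
  refine ⟨by simp [a2, h3]; omega, fun hh => ?_, fun hh => ?_⟩
  · simp only [Test.holds_nlt, NExp.eval_var, a2, h3] at hh
    obtain ⟨X, P'', rfl⟩ : ∃ X P'', P' = X :: P'' :=
      List.exists_cons_of_ne_nil (by rintro rfl; simp at hP; omega)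
    refine (sweepRow_run hG ctx2 h1 rfl hm hl hl0 h4 h3 h5).mono le_rfl ?_
    rintro s3 ⟨g1, g2, g3⟩
    refine ⟨P''.length, by rw [← h2]; simp, P ++ [X], P'', by simp [h1], rfl, ?_, ?_, ?_⟩
    · rw [g2]
      simp
    · rw [g1]
      simp
    · simpa using g3
  · simp only [Test.holds_nlt, NExp.eval_var, a2, h3] at hh
    have : P' = [] := List.eq_nil_of_length_eq_zero (by omega)
    rw [this, List.append_nil] at h1
    rw [← h1, hm] at h5
    exact ⟨by rw [ctx2.lenB, hl], h5⟩

end RAM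

namespace SLP

variable {σ : ℕ}

/-- The derivation tree of the last variable. -/
def root (S : SLP (Fin σ)) : SLPTree (Fin σ) :=
  S.tree (S.size - 1) (Nat.sub_lt S.size_pos Nat.one_pos)

@[simp] theorem word_root (S : SLP (Fin σ)) : S.root.word = S.word := S.word_tree _ _

theorem size_root (S : SLP (Fin σ)) : S.root.size = S.word.length := by
  rw [← word_root, SLPTree.length_word]

theorem code_lt (S : SLP (Fin σ)) (m : ℕ) : S.code m < S.size + σ + 1 := by
  unfold code
  split_ifs with h
  · cases S.rule ⟨m / 3, h⟩ with
    | term a =>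
      unfold SLPRule.code
      dsimp only
      split_ifs <;> omega
    | pair p q =>
      have hp := p.2
      have hq := q.2
      dsimp only at hp hq
      unfold SLPRule.code
      dsimp only
      split_ifs <;> omega
  · omega

end SLP

/-! ### Set-up and choice of the block size -/

namespace RAM

notation "zXc" => 73
notation "zT" => 74
notation "zS" => 75

variable {σ : ℕ} {C : Scoring (Fin σ)} {S T : SLP (Fin σ)}

theorem Partition.mono {g n n' x : ℕ} {β : ℕ → SLPTree (Fin σ)} {bs : List (SLPTree (Fin σ))}
    {L : List ℕ} {s : State} (h : Partition g n x β bs L s) (hn : n ≤ n') :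
    Partition g n' x β bs L s := by
  obtain ⟨h1, ⟨r1, r2, r3, r4, r5, r6, r7, r8, r9, r10, r11⟩, h3, h4⟩ := h
  exact ⟨h1, ⟨r1, r2, r3, fun X hX => (r4 X hX).trans_le hn, r5, r6, r7, r8, r9, r10, r11⟩, h3, h4⟩

/-- The words are large enough for the whole computation. -/
structure Sizes (W Z n N σ : ℕ) : Prop where
  base : 3 * n + 64 * Z ≤ W
  rbase : σ * σ + 2 * σ + 4 * Z ≤ W
  alphabet : n + σ + 1 < Z
  length : 2 * N + 4 < Z
  room : (2 * N + 4) * (2 * N + 2) < Z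
  tables : n * n * ((2 * N + 1) * (2 * N + 1)) < Z
  cube : (N + 1) * (N + 1) * (N + 1) * (n * n) < Z

/-- The input is in the memory, and the work space begins behind it. -/
structure Loaded (C : Scoring (Fin σ)) (S T : SLP (Fin σ)) (s : State) : Prop where
  size₁ : s.nvar 0 = S.size
  size₂ : s.nvar 1 = T.size
  letters : s.nvar 2 = σ
  base : s.nvar 3 = 3 * (S.size + T.size)
  rbase : s.nvar 4 = σ * σ + 2 * σ
  code₁ : ∀ m < 3 * S.size, s.nmem (0 + m) = S.code m
  code₂ : ∀ m < 3 * T.size, s.nmem (3 * S.size + m) = T.code m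
  costs : ∀ m < s.nvar 4, s.rmem m = costTable C m

theorem Loaded.frame {s s' : State} (h : Loaded C S T s) {V F R : List ℕ} (hf : Frame V F R s s')
    (hV : ∀ x ∈ [0, 1, 2, 3, 4], x ∉ V) : Loaded C S T s' := by
  obtain ⟨h1, h2, h3, h4, h5, h6, h7, h8⟩ := h
  have e : ∀ x ∈ [0, 1, 2, 3, 4], s'.nvar x = s.nvar x := fun x hx => hf.nvar x (hV x hx)
  simp only [List.mem_cons, List.not_mem_nil, or_false, forall_eq_or_imp, forall_eq] at e
  obtain ⟨e0, e1, e2, e3, e4⟩ := e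
  refine ⟨by rw [e0, h1], by rw [e1, h2], by rw [e2, h3], by rw [e3, h4], by rw [e4, h5],
    fun m hm => by rw [hf.low _ (by omega), h6 m hm], fun m hm => by
      rw [hf.low _ (by omega), h7 m hm], fun m hm => ?_⟩
  rw [e4] at hm
  rw [hf.rlow m hm, h8 m hm]

def setupProg : Prog := .nset 3 (♯3 * (↟0 + ↟1)) ;; .nset 4 (↟2 * ↟2 + ♯2 * ↟2)

theorem setupProg_run {W Z N : ℕ} (hW : Sizes W Z (S.size + T.size) N σ) :
    Run W setupProg (initialState C S T) 20 (fun s => Loaded C S T s ∧ ∀ f j, s.A f j = 0) := by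
  obtain ⟨w1, w2, w3, w4, w5, w6, w7⟩ := hW
  refine Run.of_wp_le ?_ (by decide)
  have i0 : (initialState C S T).nvar 0 = S.size := rfl
  have i1 : (initialState C S T).nvar 1 = T.size := rfl
  have i2 : (initialState C S T).nvar 2 = σ := rfl
  simp [setupProg, i0, i1, i2]
  refine ⟨by omega, by omega, ⟨by simp [i0], by simp [i1], by simp [i2], by simp, by simp, ?_, ?_,
    fun m hm => rfl⟩, fun f j => ?_⟩
  · intro m hm
    simp [initialState, hm]
  · intro m hm
    simp [initialState]
  · have h1 : ¬ (3 * (S.size + T.size) + 64 * j + f < 3 * S.size) := by omega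
    simp only [State.A, State.setN_nvar, State.setN_nmem, initialState]
    simp [h1, SLP.code]
    intro h
    omega

theorem partition_run {W Z n N g x a : ℕ} {s : State} (U : SLP (Fin σ)) (hW : Sizes W Z n N σ)
    (hn : U.size ≤ n) (hN : U.word.length ≤ N) (hx : 1 ≤ x) (hxN : x ≤ N)
    (hg : g = 0 ∨ g = 16 ∨ g = 32 ∨ g = 48) (h3 : s.nvar 3 = 3 * n)
    (hroot : s.nvar vRoot = U.size - 1) (hrul : s.nvar vRul = a) (hcap : s.nvar vCap = x)
    (ha : a + 3 * U.size ≤ 3 * n) (hcode : ∀ m < 3 * U.size, s.nmem (a + m) = U.code m)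
    (hzero : ∀ X, s.A (g + 4) X = 0) :
    Run W (visitProg g) s (1000 * U.root.visitCost x + 100) (fun s' => ∃ L,
      Partition g n x (U.block x) (U.root.blocks x) L s' ∧
      s'.nvar vEnd = (U.root.blocks x).length ∧ s'.nvar vCnt = L.length ∧
      L.length + 1 ≤ 2 * U.word.length ∧ L.length ≤ U.size) := by
  obtain ⟨w1, w2, w3, w4, w5, w6, w7⟩ := hW
  have ctx : VisitContext W Z U.size x g U.code s := by
    refine ⟨by omega, by omega, by omega, by omega, hcap, by omega, ?_, fun m hm => ?_, hg⟩
    · rw [hrul]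
      exact hcode
    · have := U.code_lt m
      omega
  refine (visitProg_run hx U.root (U.coherent_tree x _ _) ctx (by rw [hroot, SLP.root, U.label_tree])
    hzero (by rw [U.size_root]; omega)).mono le_rfl ?_
  rintro s' ⟨L, h1, h2, h3, h4⟩
  rw [U.size_root] at h4
  exact ⟨L, h1.mono hn, h2, h3, h4, h1.record.length_le⟩

def capBody : Prog := .nset zXc (↟zXc + ♯1)

/-- The next candidate for the block size is accepted while its cube times `n²` is at most `N²`, so
the block size is essentially `(N / n) ^ (2/3)`, found without roots. -/
def capTest : Test := .neg (.nlt ↟zT ((↟zXc + ♯1) * (↟zXc + ♯1) * (↟zXc + ♯1) * ↟zS))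

/-- Choose the bound on the size of the blocks. -/
def capProg : Prog :=
  .nset zN (↟0 + ↟1) ;; .nset zT ((↟zLA + ↟zLB) * (↟zLA + ↟zLB)) ;; .nset zS (↟zN * ↟zN) ;;
  .nset zXc ♯1 ;; .loop capTest capBody

/-- The bound on the size of the blocks. -/
structure IsCap (n N x : ℕ) : Prop where
  pos : 1 ≤ x
  le : x ≤ N
  le_cube : x = 1 ∨ x * x * x * (n * n) ≤ N * N
  lt_cube : N * N < (x + 1) * (x + 1) * (x + 1) * (n * n)

/-- An accepted candidate is at most `N`, so linear search stays within time O(`N`) and all products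
within words. -/
theorem lt_of_cube_le {n N x : ℕ} (hn : 0 < n) (hN : 0 < N)
    (h : (x + 1) * (x + 1) * (x + 1) * (n * n) ≤ N * N) : x < N := by
  by_contra! hx
  have h1 : (N + 1) * (N + 1) * (N + 1) * (1 * 1) ≤ (x + 1) * (x + 1) * (x + 1) * (n * n) := by
    gcongr <;> omega
  nlinarith

theorem capProg_run {W Z n N : ℕ} {s : State} (hW : Sizes W Z n N σ) (hn : S.size + T.size = n)
    (hs : Loaded C S T s) (hN : s.nvar zLA + s.nvar zLB = N) (hN0 : 0 < N) :
    Run W capProg s (50 + 20 * N) (fun s' => s'.nvar zN = n ∧ IsCap n N (s'.nvar zXc)) := by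
  obtain ⟨w1, w2, w3, w4, w5, w6, w7⟩ := id hW
  have hn0 : 0 < n := hn ▸ Nat.add_pos_left S.size_pos _
  have e0 := hs.size₁
  have e1 := hs.size₂
  have hNN : N * N < Z := by nlinarith
  have hnn : n * n < Z := (Nat.le_mul_of_pos_left _ (by positivity)).trans_lt w7
  refine Run.mono (τ := 4 + (10 + (6 + (2 + ((4 + 16) * N + 16))))) ?_ (by omega) fun _ => id
  refine Run.seq ((Run.of_wp_le (p := .nset zN (↟0 + ↟1)) (W := W) (s := s) (τ := 4)
    (Q := fun s1 => s1 = s.setN zN n) (by simp [e0, e1, hn]; omega) (by decide)).mono le_rfl ?_)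
  rintro s1 rfl
  refine Run.seq ((Run.of_wp_le (p := .nset zT ((↟zLA + ↟zLB) * (↟zLA + ↟zLB))) (W := W) (τ := 10)
    (Q := fun s1 => s1 = (s.setN zN n).setN zT (N * N)) (by simp [hN]; omega) (by decide)).mono
    le_rfl ?_)
  rintro s1 rfl
  refine Run.seq ((Run.of_wp_le (p := .nset zS (↟zN * ↟zN)) (W := W) (τ := 6)
    (Q := fun s1 => s1 = ((s.setN zN n).setN zT (N * N)).setN zS (n * n)) (by simp; omega)
    (by decide)).mono le_rfl ?_)
  rintro s1 rfl
  refine Run.seq ((Run.of_wp_le (p := .nset zXc ♯1) (W := W) (τ := 2)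
    (Q := fun s1 => s1.nvar zXc = 1 ∧ s1.nvar zN = n ∧ s1.nvar zT = N * N ∧ s1.nvar zS = n * n)
    (by simp; omega) (by decide)).mono le_rfl ?_)
  rintro s1 ⟨h1, h2, h3, h4⟩
  refine Run.loop_count (b := capTest) (p := capBody) (W := W) [zXc] [] [] (by decide) (by decide)
    (by decide) 4 (fun s' k => s'.nvar zXc + k = N + 1 ∧ 1 ≤ s'.nvar zXc ∧ s'.nvar zXc ≤ N ∧
      (s'.nvar zXc = 1 ∨ s'.nvar zXc * s'.nvar zXc * s'.nvar zXc * (n * n) ≤ N * N))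
    (s₀ := s1) (k₀ := N) ⟨by omega, by omega, by omega, Or.inl h1⟩ ?_
  rintro s2 k hf ⟨g1, g2, g3, g4⟩
  have v1 : s2.nvar zT = N * N := by rw [hf.nvar _ (by decide), h3]
  have v2 : s2.nvar zS = n * n := by rw [hf.nvar _ (by decide), h4]
  have v3 : s2.nvar zN = n := by rw [hf.nvar _ (by decide), h2]
  obtain ⟨x, hx⟩ : ∃ x, s2.nvar zXc = x := ⟨_, rfl⟩
  rw [hx] at g1 g2 g3 g4
  have b4 : (x + 1) * (x + 1) * (x + 1) * (n * n) < Z := by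
    refine lt_of_le_of_lt ?_ w7
    gcongr
  have b3 : (x + 1) * (x + 1) * (x + 1) < Z :=
    (Nat.le_mul_of_pos_right _ (by positivity)).trans_lt b4
  have b2 : (x + 1) * (x + 1) < Z := (Nat.le_mul_of_pos_right _ (by positivity)).trans_lt b3
  refine ⟨by simp [capTest, v1, v2, hx]; omega, fun hh => ?_, fun hh => ?_⟩
  · simp only [capTest, Test.holds_neg, Test.holds_nlt, NExp.eval_var, NExp.eval_mul, NExp.eval_add,
      NExp.eval_lit, v1, v2, hx, not_lt] at hh
    have := lt_of_cube_le hn0 hN0 hh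
    refine Run.of_wp_le ?_ (by decide)
    refine ⟨by simp [hx]; omega, N - x, by omega, ?_, ?_, ?_, Or.inr ?_⟩
    · simp [hx]
      omega
    · simp
    · simp [hx]
      omega
    · simpa [hx] using hh
  · simp only [capTest, Test.holds_neg, Test.holds_nlt, NExp.eval_var, NExp.eval_mul, NExp.eval_add,
      NExp.eval_lit, v1, v2, hx, not_not] at hh
    exact ⟨v3, by rw [hx]; exact ⟨g2, g3, g4, hh⟩⟩

end RAM

/-! ### The whole program -/

namespace RAM

variable {σ : ℕ} {C : Scoring (Fin σ)} {S T : SLP (Fin σ)}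

def blockInit (root rul cap : NExp) : Prog :=
  .nset vRoot root ;; .nset vRul rul ;; .nset vCap cap

/-- Compute the partition of the string of a straight-line program into blocks; the number of blocks
is stored in `e`, and the number of different blocks and subblocks in `c`. -/
def blockProg (g e c : ℕ) (root rul cap : NExp) : Prog :=
  blockInit root rul cap ;; visitProg g ;; .nset e ↟vEnd ;; .nset c ↟vCnt

def blockVars (e c : ℕ) : List ℕ := [vRoot, vRul, vCap] ++ visitVars ++ [e, c]

theorem blockProg_run {W Z n N g e c x a : ℕ} {root rul cap : NExp} {s : State} (U : SLP (Fin σ))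
    (hW : Sizes W Z n N σ) (hn : U.size ≤ n) (hN : U.word.length ≤ N) (hx : 1 ≤ x) (hxN : x ≤ N)
    (hg : g = 0 ∨ g = 16 ∨ g = 32 ∨ g = 48) (he : e ∉ [3, 4, vCnt, c]) (hc : c ∉ [3, 4])
    (h3 : s.nvar 3 = 3 * n)
    (hstart : (blockInit root rul cap).wp W (fun s' => s'.nvar vRoot = U.size - 1 ∧
      s'.nvar vRul = a ∧ s'.nvar vCap = x) s) (hcost : (blockInit root rul cap).maxCost ≤ 50)
    (ha : a + 3 * U.size ≤ 3 * n) (hcode : ∀ m < 3 * U.size, s.nmem (a + m) = U.code m)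
    (hzero : ∀ X, s.A (g + 4) X = 0) :
    Run W (blockProg g e c root rul cap) s (1000 * U.root.visitCost x + 200) (fun s' =>
      (∃ L, Partition g n x (U.block x) (U.root.blocks x) L s' ∧
        s'.nvar e = (U.root.blocks x).length ∧ s'.nvar c = L.length ∧
        L.length + 1 ≤ 2 * U.word.length ∧ L.length ≤ U.size) ∧
      Frame (blockVars e c) (visitArrays g) [] s s') := by
  obtain ⟨w1, w2, w3, w4, w5, w6, w7⟩ := id hW
  simp only [List.mem_cons, List.not_mem_nil, or_false, not_or] at he hc
  refine Run.mono (τ := 50 + (1000 * U.root.visitCost x + 100 + 4)) ?_ (by omega) fun _ => id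
  refine Run.seq (((Run.of_wp_le hstart hcost).frame [vRoot, vRul, vCap] [] [] ?_ (by decide)
    (by decide)).mono le_rfl ?_)
  · simp [blockInit, Prog.writes]
  rintro s1 ⟨⟨h1, h2, h4⟩, hf1⟩
  refine Run.seq (((partition_run U hW hn hN hx hxN hg (by rw [hf1.nvar _ (by decide), h3]) h1 h2 h4
    ha (fun m hm => by rw [hf1.low _ (by omega), hcode m hm])
    (fun X => by rw [hf1.A _ (by simp) (by omega), hzero])).frame visitVars (visitArrays g) [] ?_
    (by decide) (by decide)).mono le_rfl ?_)
  · rcases hg with rfl | rfl | rfl | rfl <;> decide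
  rintro s2 ⟨⟨L, g1, g2, g3, g4, g5⟩, hf2⟩
  have g6 := SLPTree.length_blocks_le x U.root
  rw [U.size_root] at g6
  refine ((Run.of_wp_le (p := .nset e ↟vEnd ;; .nset c ↟vCnt) (W := W) (s := s2) (τ := 4)
    (Q := fun s' => s'.nvar e = (U.root.blocks x).length ∧ s'.nvar c = L.length)
    ?_ (Nat.le_of_ble_eq_true rfl)).frame [e, c] [] [] ?_ ?_ ?_).mono le_rfl ?_
  · simp [g2, g3, he.2.2.2, Ne.symm he.2.2.1]
    omega
  · simp [Prog.writes]
  · simp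
    omega
  · simp
    omega
  rintro s3 ⟨⟨e1, e2⟩, hf3⟩
  have i3 : 3 ∉ blockVars e c := by
    simp [blockVars, visitVars]
    omega
  have i4 : 4 ∉ blockVars e c := by
    simp [blockVars, visitVars]
    omega
  refine ⟨⟨L, g1.frame hf3 (by simp) (by omega), e1, e2, g4, g5⟩, ((hf1.mono ?_ (by simp)
    (by simp)).trans i3 i4 (hf2.mono ?_ (by simp) (by simp))).trans i3 i4 (hf3.mono ?_ (by simp)
    (by simp))⟩ <;>
  · intro y hy
    simp only [blockVars, List.mem_append]
    tauto

/-- With the bound 1 every block is a single letter, so the same traversal counts the letters of the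
strings, which the choice of the block size requires. It uses the tags 0 and 16, so that the flags
of the tags 32 and 48 are still zero for the real partition. -/
def lengthsProg : Prog :=
  blockProg 0 zLA zCa (↟0 - ♯1) ♯0 ♯1 ;; blockProg 16 zLB zCb (↟1 - ♯1) (♯3 * ↟0) ♯1

def partitionsProg : Prog :=
  blockProg 32 zEA zCa (↟0 - ♯1) ♯0 ↟zXc ;; blockProg 48 zEB zCb (↟1 - ♯1) (♯3 * ↟0) ↟zXc ;;
  .nset xLx (♯2 * ↟zXc + ♯1)

/-- Compute the edit distance of the strings of two straight-line programs. -/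
def mainProg : Prog :=
  setupProg ;; lengthsProg ;; capProg ;; partitionsProg ;; tablesProg ;; sweepProg ;;
    .rset 0 (.ld bVec ↟zLB)

theorem lengthsProg_run {W Z n N : ℕ} {s : State} (hW : Sizes W Z n N σ)
    (hn : S.size + T.size = n) (hN : S.word.length + T.word.length = N) (hs : Loaded C S T s)
    (hN0 : 0 < N) (h4 : ∀ X, s.A 4 X = 0) (h20 : ∀ X, s.A 20 X = 0) (h36 : ∀ X, s.A 36 X = 0)
    (h52 : ∀ X, s.A 52 X = 0) :
    Run W lengthsProg s (2000 * N + 400) (fun s' => Loaded C S T s' ∧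
      s'.nvar zLA = S.word.length ∧ s'.nvar zLB = T.word.length ∧ (∀ X, s'.A 36 X = 0) ∧
      ∀ X, s'.A 52 X = 0) := by
  obtain ⟨w1, w2, w3, w4, w5, w6, w7⟩ := id hW
  have vS := S.root.visitCost_one
  have vT := T.root.visitCost_one
  rw [SLP.size_root] at vS vT
  refine Run.mono (τ := (1000 * S.root.visitCost 1 + 200) + (1000 * T.root.visitCost 1 + 200)) ?_
    (by omega) fun _ => id
  obtain ⟨l0, l1, l2, l3, l4, l5, l6, l7⟩ := id hs
  refine Run.seq ((blockProg_run (a := 0) S hW (by omega) (by omega) le_rfl (by omega) (by simp)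
    (by decide) (by decide) (by omega) (by simp [blockInit, l0]; omega) (by decide) (by omega) l5
    h4).mono le_rfl ?_)
  rintro s1 ⟨⟨L, -, h1, -, -, -⟩, hf1⟩
  have hs1 := hs.frame hf1 (by decide)
  obtain ⟨l0, l1, l2, l3, l4, l5, l6, l7⟩ := id hs1
  refine (blockProg_run (a := 3 * S.size) T hW (by omega) (by omega) le_rfl (by omega) (by simp)
    (by decide) (by decide) (by omega) (by simp [blockInit, l0, l1]; omega) (by decide) (by omega) l6
    (fun X => by rw [hf1.A _ (by decide) (by decide), h20])).mono le_rfl ?_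
  rintro s2 ⟨⟨L', -, h2, -, -, -⟩, hf2⟩
  refine ⟨hs1.frame hf2 (by decide), ?_, ?_, fun X => ?_, fun X => ?_⟩
  · rw [hf2.nvar _ (by decide), h1, SLPTree.blocks_one_length, SLP.size_root]
  · rw [h2, SLPTree.blocks_one_length, SLP.size_root]
  · rw [hf2.A _ (by decide) (by decide), hf1.A _ (by decide) (by decide), h36]
  · rw [hf2.A _ (by decide) (by decide), hf1.A _ (by decide) (by decide), h52]

theorem partitionsProg_run {W Z n N x : ℕ} {s : State} (hW : Sizes W Z n N σ)
    (hn : S.size + T.size = n) (hN : S.word.length + T.word.length = N) (hs : Loaded C S T s)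
    (eA : s.nvar zLA = S.word.length) (eB : s.nvar zLB = T.word.length) (eN : s.nvar zN = n)
    (eX : s.nvar zXc = x) (hx : 1 ≤ x) (hxN : x ≤ N) (h36 : ∀ X, s.A 36 X = 0)
    (h52 : ∀ X, s.A 52 X = 0) :
    Run W partitionsProg s (1000 * S.root.visitCost x + 1000 * T.root.visitCost x + 500)
      (fun s' => ∃ LA LB, TableContext W Z n x C (S.block x) (T.block x) LA LB s' ∧
        Partition 32 n x (S.block x) (S.root.blocks x) LA s' ∧
        Partition 48 n x (T.block x) (T.root.blocks x) LB s' ∧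
        s'.nvar zLA = S.word.length ∧ s'.nvar zLB = T.word.length ∧
        s'.nvar zEA = (S.root.blocks x).length ∧ s'.nvar zEB = (T.root.blocks x).length ∧
        s'.nvar zCa = LA.length ∧ s'.nvar zCb = LB.length ∧
        LA.length + 1 ≤ 2 * S.word.length ∧ LA.length ≤ S.size ∧
        LB.length + 1 ≤ 2 * T.word.length ∧ LB.length ≤ T.size) := by
  obtain ⟨w1, w2, w3, w4, w5, w6, w7⟩ := id hW
  refine Run.mono (τ := (1000 * S.root.visitCost x + 200) + ((1000 * T.root.visitCost x + 200) + 6))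
    ?_ (by omega) fun _ => id
  obtain ⟨l0, l1, l2, l3, l4, l5, l6, l7⟩ := id hs
  refine Run.seq ((blockProg_run (a := 0) (x := x) S hW (by omega) (by omega) hx hxN (by simp)
    (by decide) (by decide) (by omega) (by simp [blockInit, l0, eX]; omega) (by decide) (by omega) l5
    h36).mono le_rfl ?_)
  rintro s1 ⟨⟨LA, p1, h1, c1, b1, b2⟩, hf1⟩
  have hs1 := hs.frame hf1 (by decide)
  obtain ⟨l0, l1, l2, l3, l4, l5, l6, l7⟩ := id hs1
  have x1 : s1.nvar zXc = x := by rw [hf1.nvar _ (by decide), eX]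
  refine Run.seq ((blockProg_run (a := 3 * S.size) (x := x) T hW (by omega) (by omega) hx hxN
    (by simp) (by decide) (by decide) (by omega) (by simp [blockInit, l0, l1, x1]; omega)
    (by decide) (by omega) l6
    (fun X => by rw [hf1.A _ (by decide) (by decide), h52])).mono le_rfl ?_)
  rintro s2 ⟨⟨LB, p2, h2, c2, b3, b4⟩, hf2⟩
  have hs2 := hs1.frame hf2 (by decide)
  have x2 : s2.nvar zXc = x := by rw [hf2.nvar _ (by decide), x1]
  refine ((Run.of_wp_le (p := .nset xLx (♯2 * ↟zXc + ♯1)) (W := W) (s := s2) (τ := 6)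
    (Q := fun s' => s'.nvar xLx = 2 * x + 1) (by simp [x2]; omega) (by decide)).frame [xLx] [] []
    (by decide) (by decide) (by decide)).mono le_rfl ?_
  rintro s3 ⟨e3, hf3⟩
  have p1' := (p1.frame hf2 (by decide) (by decide)).frame hf3 (by decide) (by decide)
  have p2' := p2.frame hf3 (by decide) (by decide)
  obtain ⟨l0, l1, l2, l3, l4, l5, l6, l7⟩ := hs2.frame hf3 (by decide)
  have room : (2 * x + 1 + 3) * (2 * x + 1 + 1) ≤ (2 * N + 4) * (2 * N + 2) :=
    Nat.mul_le_mul (by omega) (by omega)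
  have tabs : n * n * ((2 * x + 1) * (2 * x + 1)) ≤ n * n * ((2 * N + 1) * (2 * N + 1)) := by
    gcongr
  refine ⟨LA, LB, ⟨by omega, by omega, by omega, by rw [e3]; omega, by rw [e3]; omega, e3, hx, ?_,
    p1'.record, p2'.record, p1'.record.size, p2'.record.size, l2, l4, l7⟩, p1', p2', ?_, ?_, ?_, ?_,
    ?_, ?_, b1, b2, b3, b4⟩
  · rw [hf3.nvar _ (by decide), hf2.nvar _ (by decide), hf1.nvar _ (by decide), eN]
  · rw [hf3.nvar _ (by decide), hf2.nvar _ (by decide), hf1.nvar _ (by decide), eA]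
  · rw [hf3.nvar _ (by decide), hf2.nvar _ (by decide), hf1.nvar _ (by decide), eB]
  · rw [hf3.nvar _ (by decide), hf2.nvar _ (by decide), h1]
  · rw [hf3.nvar _ (by decide), h2]
  · rw [hf3.nvar _ (by decide), hf2.nvar _ (by decide), c1]
  · rw [hf3.nvar _ (by decide), c2]

end RAM

namespace RAM

variable {σ : ℕ} {C : Scoring (Fin σ)} {S T : SLP (Fin σ)}

/-- A bound on the number of pairs of blocks and subblocks. -/
def pairBound (S T : SLP (Fin σ)) : ℕ :=
  min (2 * S.word.length) (S.size + 1) * min (2 * T.word.length) (T.size + 1)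

/-- A bound on the running time with blocks of size at most `x`, after the choice of `x`. -/
def blockTime (S T : SLP (Fin σ)) (x : ℕ) : ℕ :=
  (1000 * S.root.visitCost x + 1000 * T.root.visitCost x + 500) +
    (26200 * ((2 * x + 1) * (2 * x + 1)) * pairBound S T +
      (35000 * x * (((S.root.blocks x).length + 1) * ((T.root.blocks x).length + 1)) + 20))

theorem word_length_pos (S : SLP (Fin σ)) : 0 < S.word.length := by
  rw [← SLP.size_root]
  exact S.root.size_pos

/-- After all rows the entry with index the length of the second string belongs to the last corner
of the grid. It is finite, hence in the support. -/
theorem readOut_run {W Z N : ℕ} {s : State} (hW : Sizes W Z (S.size + T.size) N σ)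
    (hN : S.word.length + T.word.length = N) (h4 : s.nvar 4 = σ * σ + 2 * σ)
    (hs : s.nvar zLB = T.word.length)
    (hfr : Frontier s (rowVal (C.grid S.word T.word) S.word.length T.word.length S.word.length)
      (S.word.length + T.word.length)) :
    Run W (.rset 0 (.ld bVec ↟zLB)) s 20 (fun s' =>
      s'.rvar 0 = C.editDistance S.word T.word) := by
  obtain ⟨w1, w2, w3, w4, w5, w6, w7⟩ := hW
  refine Run.of_wp_le ?_ (by decide)
  have hv := rowVal_full (G := C.grid S.word T.word) (l := T.word.length) (word_length_pos S)
  rw [C.grid_dist_zero] at hv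
  have hin : s.nvar xLo ≤ T.word.length ∧ T.word.length ≤ s.nvar xHi := by
    by_contra hc
    have := hfr.top T.word.length (by omega) hc
    rw [hv] at this
    exact WithTop.coe_ne_top this
  have hb := hfr.coe _ hin.1 hin.2
  rw [hv] at hb
  simp [hs, h4]
  exact ⟨by omega, by exact_mod_cast hb⟩

/-- The bound `B` must hold for every admissible block size, since the size is known only once it
has been computed. -/
theorem mainProg_run {W Z n N B : ℕ} (hW : Sizes W Z n N σ) (hn : S.size + T.size = n)
    (hN : S.word.length + T.word.length = N) (hB : ∀ x, IsCap n N x → blockTime S T x ≤ B) :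
    Run W mainProg (initialState C S T) (2020 * N + 470 + B)
      (fun s' => s'.rvar 0 = C.editDistance S.word T.word) := by
  subst hn
  have pS := word_length_pos S
  have pT := word_length_pos T
  obtain ⟨w1, w2, w3, w4, w5, w6, w7⟩ := id hW
  refine Run.mono (τ := 20 + ((2000 * N + 400) + ((50 + 20 * N) + B))) ?_ (by omega) fun _ => id
  refine Run.seq ((setupProg_run hW).mono le_rfl ?_)
  rintro s1 ⟨l1, z1⟩
  refine Run.seq ((lengthsProg_run hW rfl hN l1 (by omega) (z1 4) (z1 20) (z1 36) (z1 52)).mono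
    le_rfl ?_)
  rintro s2 ⟨l2, a2, b2, z2, z2'⟩
  refine Run.seq (((capProg_run hW rfl l2 (by omega) (by omega)).frame [zN, zT, zS, zXc] [] []
    (by decide) (by decide) (by decide)).mono le_rfl ?_)
  rintro s3 ⟨⟨n3, c3⟩, hf3⟩
  have l3 := l2.frame hf3 (by decide)
  obtain ⟨x, hx⟩ : ∃ x, s3.nvar zXc = x := ⟨_, rfl⟩
  rw [hx] at c3
  refine Run.mono (τ := blockTime S T x) ?_ (hB x c3) fun _ => id
  unfold blockTime
  refine Run.seq ((partitionsProg_run hW rfl hN l3 (by rw [hf3.nvar _ (by decide), a2])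
    (by rw [hf3.nvar _ (by decide), b2]) n3 hx c3.pos c3.le
    (fun X => by rw [hf3.A _ (by decide) (by decide), z2])
    (fun X => by rw [hf3.A _ (by decide) (by decide), z2'])).mono le_rfl ?_)
  rintro s4 ⟨LA, LB, ctx4, pA, pB, e1, e2, e3, e4, e5, e6, k1, k2, k3, k4⟩
  have hK : (LA.length + 1) * (LB.length + 1) ≤ pairBound S T :=
    Nat.mul_le_mul (le_min k1 (by omega)) (le_min k3 (by omega))
  refine Run.seq ((((tablesProg_run ctx4 ctx4.cap e5 e6).mono (Nat.mul_le_mul_left _ hK)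
    fun _ => id).frame tablesVars [aCol, aLen, aRes] [bVec, bTmp, bDist] (by decide) (by decide)
    (by decide)).mono le_rfl ?_)
  rintro s5 ⟨t5, hf5⟩
  have wS : (S.root.blocks x).flatMap SLPTree.word = S.word := by
    rw [SLPTree.flatMap_word_blocks, SLP.word_root]
  have wT : (T.root.blocks x).flatMap SLPTree.word = T.word := by
    rw [SLPTree.flatMap_word_blocks, SLP.word_root]
  have ctx5 : SweepContext W Z (S.size + T.size) x C (S.block x) (T.block x) LA LB
      (S.root.blocks x) (T.root.blocks x) s5 := by
    refine ⟨ctx4.frame hf5 (by decide) (by decide), pA.frame hf5 (by decide) (by decide),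
      pB.frame hf5 (by decide) (by decide), t5, ?_, ?_, ?_, ?_, ?_⟩
    · rw [hf5.nvar _ (by decide), e1, wS]
    · rw [hf5.nvar _ (by decide), e2, wT]
    · rw [hf5.nvar _ (by decide), e3]
    · rw [hf5.nvar _ (by decide), e4]
    · rw [hf5.nvar _ (by decide), hf5.nvar _ (by decide), e1, e2]
      omega
  refine Run.seq (((sweepProg_run (by rw [wS, wT]) ctx5 (by rw [wS]) (by rw [wT]) pT).frame
    sweepVars [aCol, aLen, aRes] [bVec, bTmp] (by decide) (by decide) (by decide)).mono le_rfl ?_)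
  rintro s6 ⟨⟨b6, f6⟩, hf6⟩
  exact readOut_run hW hN (by rw [hf6.nvar _ (by decide), ctx5.table.costs]) b6 f6

end RAM

/-! ### Word size and running time -/

namespace RAM

/-- With M = `n + N + σ ≥ 5`, each further factor M gains a factor 5. The fifth power exceeds all
array indices, and four more factors, at least 625, cover the interleaving of 64 arrays and the
input. -/
theorem sizes_of_pow_le {W n N σ : ℕ} (hn : 2 ≤ n) (hN : 2 ≤ N) (hσ : 1 ≤ σ)
    (hW : (n + N + σ) ^ 9 ≤ W) : Sizes W ((n + N + σ) ^ 5) n N σ := by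
  obtain ⟨M, hM⟩ : ∃ M, n + N + σ = M := ⟨_, rfl⟩
  rw [hM] at hW ⊢
  have h5 : 5 ≤ M := by omega
  have hpow : ∀ k, 5 * M ^ k ≤ M ^ (k + 1) := fun k => by
    rw [pow_succ, Nat.mul_comm]
    exact Nat.mul_le_mul_left _ h5
  have p0 := hpow 0
  have p1 := hpow 1
  have p2 := hpow 2
  have p3 := hpow 3
  have p4 := hpow 4
  have p5 := hpow 5
  have p6 := hpow 6
  have p7 := hpow 7
  have p8 := hpow 8
  simp only [Nat.reduceAdd, pow_zero, pow_one] at p0 p1 p2 p3 p4 p5 p6 p7 p8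
  have hσ2 : σ * σ ≤ M ^ 2 := by
    rw [pow_two]
    exact Nat.mul_le_mul (by omega) (by omega)
  refine ⟨by omega, by omega, by omega, by omega, ?_, ?_, ?_⟩
  · calc (2 * N + 4) * (2 * N + 2) ≤ (2 * M) * (2 * M) := Nat.mul_le_mul (by omega) (by omega)
      _ = 4 * M ^ 2 := by ring
      _ < M ^ 5 := by omega
  · calc n * n * ((2 * N + 1) * (2 * N + 1)) ≤ M * M * ((2 * M) * (2 * M)) := by gcongr <;> omega
      _ = 4 * M ^ 4 := by ring
      _ < M ^ 5 := by omega
  · calc (N + 1) * (N + 1) * (N + 1) * (n * n) ≤ (M - 1) * M * M * (M * M) := by gcongr <;> omega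
      _ < M * M * M * (M * M) := by gcongr; omega
      _ = M ^ 5 := by ring

/-- The target R satisfies `R³ = n²N⁴`, so comparisons are made between cubes and fractional
exponents disappear. -/
theorem le_of_cube_le {a b : ℝ} (hb : 0 ≤ b) (h : a ^ 3 ≤ b ^ 3) : a ≤ b :=
  le_of_pow_le_pow_left₀ (by norm_num) hb h

variable {σ : ℕ} {S T : SLP (Fin σ)} {n N x : ℕ} {R : ℝ}

/-- By maximality of the cap `N² < (x + 1)³n² ≤ 8x³n²`; multiplication by `N⁴` gives the cube of the
claim. So every term of size `N²/x` is O(R). -/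
theorem length_sq_le (hx : IsCap n N x) (hR : 0 ≤ R) (h : R ^ 3 = (n : ℝ) ^ 2 * (N : ℝ) ^ 4) :
    (N : ℝ) ^ 2 ≤ 2 * x * R := by
  refine le_of_cube_le (by positivity) ?_
  have h1 : (N : ℝ) ^ 2 ≤ 8 * x ^ 3 * n ^ 2 := by
    have h2 : N * N ≤ (2 * x) * (2 * x) * (2 * x) * (n * n) := by
      refine hx.lt_cube.le.trans ?_
      have := hx.pos
      gcongr <;> omega
    have h3 : ((N * N : ℕ) : ℝ) ≤ (((2 * x) * (2 * x) * (2 * x) * (n * n) : ℕ) : ℝ) := by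
      exact_mod_cast h2
    push_cast at h3
    linarith
  calc ((N : ℝ) ^ 2) ^ 3 = (N : ℝ) ^ 2 * (N : ℝ) ^ 4 := by ring
    _ ≤ 8 * x ^ 3 * n ^ 2 * (N : ℝ) ^ 4 := by gcongr
    _ = 8 * x ^ 3 * R ^ 3 := by rw [h]; ring
    _ = (2 * x * R) ^ 3 := by ring

/-- If `x³n² ≤ N²`, the number of pairs is at most `n²` and `(x²n²)³ = n²(x³n²)² ≤ R³`. Otherwise `x
= 1`, the number of pairs is at most four times the product of the lengths, hence at most `N²`, and
`N² ≤ 2R`. -/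
theorem sq_mul_pairBound_le (hn : S.size + T.size = n) (hN : S.word.length + T.word.length = N)
    (hx : IsCap n N x) (hR : 0 ≤ R) (h : R ^ 3 = (n : ℝ) ^ 2 * (N : ℝ) ^ 4) :
    (x : ℝ) ^ 2 * pairBound S T ≤ 8 * R := by
  rcases hx.le_cube with h1 | h1
  · have h2 : pairBound S T ≤ N ^ 2 := by
      refine (Nat.mul_le_mul (min_le_left _ _) (min_le_left _ _)).trans ?_
      rw [← hN]
      nlinarith [four_mul_le_sq_add S.word.length T.word.length]
    have h3 : (pairBound S T : ℝ) ≤ (N : ℝ) ^ 2 := by exact_mod_cast h2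
    have h4 := length_sq_le hx hR h
    rw [h1] at h4 ⊢
    norm_num at h4 ⊢
    linarith
  · have h2 : pairBound S T ≤ n ^ 2 := by
      have := S.size_pos
      have := T.size_pos
      rw [pow_two]
      exact Nat.mul_le_mul ((min_le_right _ _).trans (by omega))
        ((min_le_right _ _).trans (by omega))
    have h3 : (pairBound S T : ℝ) ≤ (n : ℝ) ^ 2 := by exact_mod_cast h2
    have h4 : (x : ℝ) ^ 3 * (n : ℝ) ^ 2 ≤ (N : ℝ) ^ 2 := by
      have : ((x * x * x * (n * n) : ℕ) : ℝ) ≤ ((N * N : ℕ) : ℝ) := by exact_mod_cast h1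
      push_cast at this
      linarith
    have h5 : (x : ℝ) ^ 2 * (n : ℝ) ^ 2 ≤ R := by
      refine le_of_cube_le hR ?_
      calc ((x : ℝ) ^ 2 * (n : ℝ) ^ 2) ^ 3 = (n : ℝ) ^ 2 * ((x : ℝ) ^ 3 * (n : ℝ) ^ 2) ^ 2 := by ring
        _ ≤ (n : ℝ) ^ 2 * ((N : ℝ) ^ 2) ^ 2 := by gcongr
        _ = R ^ 3 := by rw [h]; ring
    calc (x : ℝ) ^ 2 * pairBound S T ≤ (x : ℝ) ^ 2 * (n : ℝ) ^ 2 := by gcongr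
      _ ≤ 8 * R := by linarith

theorem visitCost_le {t : SLPTree (Fin σ)} (ht : t.size ≤ N) (hx : IsCap n N x) (hR : 0 ≤ R)
    (h : R ^ 3 = (n : ℝ) ^ 2 * (N : ℝ) ^ 4) : (t.visitCost x : ℝ) ≤ 3 * N + 4 * R := by
  have h1 : t.visitCost x * x ≤ N * (3 * x + 2 * N) :=
    (Nat.le_add_right _ _).trans ((t.visitCost_mul_le x N ht).trans (Nat.mul_le_mul_right _ ht))
  have h2 : (t.visitCost x : ℝ) * x ≤ N * (3 * x + 2 * N) := by exact_mod_cast h1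
  have h3 := length_sq_le hx hR h
  have h4 : (0 : ℝ) < x := by exact_mod_cast hx.pos
  refine le_of_mul_le_mul_right ?_ h4
  nlinarith

/-- Each string has O(`N / x`) blocks, so the sweep costs O(`N² / x`). -/
theorem mul_blocks_le (hS : S.word.length ≤ N) (hT : T.word.length ≤ N) (hx : IsCap n N x)
    (hR : 0 ≤ R) (h : R ^ 3 = (n : ℝ) ^ 2 * (N : ℝ) ^ 4) :
    (x : ℝ) * (((S.root.blocks x).length + 1) * ((T.root.blocks x).length + 1)) ≤ 32 * R := by
  have h4 : (0 : ℝ) < x := by exact_mod_cast hx.pos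
  have key : ∀ U : SLP (Fin σ), U.word.length ≤ N →
      (((U.root.blocks x).length : ℝ) + 1) * x ≤ 4 * N := by
    intro U hU
    have h1 := U.root.length_blocks_mul_le x
    rw [U.size_root] at h1
    have h2 := hx.le
    have h3 : ((U.root.blocks x).length + 1) * x ≤ 4 * N := by
      rw [Nat.add_mul]
      omega
    exact_mod_cast h3
  have h1 := mul_le_mul (key S hS) (key T hT) (by positivity) (by positivity)
  have h3 := length_sq_le hx hR h
  refine le_of_mul_le_mul_right ?_ h4
  nlinarith

theorem blockTime_le (hn : S.size + T.size = n) (hN : S.word.length + T.word.length = N)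
    (hx : IsCap n N x) (hNR : (N : ℝ) ≤ R) (h : R ^ 3 = (n : ℝ) ^ 2 * (N : ℝ) ^ 4) :
    (blockTime S T x : ℝ) ≤ 3500000 * R := by
  have hR : 0 ≤ R := (Nat.cast_nonneg N).trans hNR
  have h1 := visitCost_le (t := S.root) (by rw [S.size_root]; omega) hx hR h
  have h2 := visitCost_le (t := T.root) (by rw [T.size_root]; omega) hx hR h
  have h3 := sq_mul_pairBound_le hn hN hx hR h
  have h4 := mul_blocks_le (S := S) (T := T) (by omega) (by omega) hx hR h
  have hx1 : (1 : ℝ) ≤ x := by exact_mod_cast hx.pos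
  have h5 : (1 : ℝ) ≤ N := by exact_mod_cast hx.pos.trans hx.le
  have h6 : ((2 : ℝ) * x + 1) * (2 * x + 1) * pairBound S T ≤ 9 * (x ^ 2 * pairBound S T) := by
    have : ((2 : ℝ) * x + 1) * (2 * x + 1) ≤ 9 * x ^ 2 := by nlinarith
    calc _ ≤ 9 * (x : ℝ) ^ 2 * pairBound S T := by gcongr
      _ = _ := by ring
  unfold blockTime
  push_cast
  linarith

end RAM

/-! ### Edit distance and transformations -/

variable {α : Type} {C : Scoring α}

/-- `Aligns C A B d`: there is an alignment of `A` and `B` of cost `d`. -/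
inductive Aligns (C : Scoring α) : List α → List α → ℝ → Prop
  | nil : Aligns C [] [] 0
  | delete {A B : List α} {d : ℝ} (a : α) :
      Aligns C A B d → Aligns C (A ++ [a]) B (d + C.delete a)
  | insert {A B : List α} {d : ℝ} (b : α) :
      Aligns C A B d → Aligns C A (B ++ [b]) (d + C.insert b)
  | replace {A B : List α} {d : ℝ} (a b : α) :
      Aligns C A B d → Aligns C (A ++ [a]) (B ++ [b]) (d + C.replace a b)

theorem EditStep.append_right {A B : List α} {d : ℝ} (h : EditStep C A B d) (w : List α) :
    EditStep C (A ++ w) (B ++ w) d := by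
  cases h with
  | delete u v a => simpa using EditStep.delete (C := C) u (v ++ w) a
  | insert u v b => simpa using EditStep.insert (C := C) u (v ++ w) b
  | replace u v a b => simpa using EditStep.replace (C := C) u (v ++ w) a b

theorem Transforms.append_right {A B : List α} {d : ℝ} (h : Transforms C A B d) (w : List α) :
    Transforms C (A ++ w) (B ++ w) d := by
  induction h with
  | refl => exact .refl _
  | step _ h ih => exact ih.step (h.append_right w)

theorem Aligns.transforms {A B : List α} {d : ℝ} (h : Aligns C A B d) :
    Transforms C A B d := by
  induction h with
  | nil => exact .refl []
  | @delete A B d a _ ih =>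
    have := EditStep.delete (C := C) B [] a
    rw [List.append_nil] at this
    exact (ih.append_right [a]).step this
  | @insert A B d b _ ih =>
    have := EditStep.insert (C := C) B [] b
    rw [List.append_nil] at this
    exact ih.step this
  | @replace A B d a b _ ih => exact (ih.append_right [a]).step (.replace B [] a b)

/-- An operation on a string that ends in `b` happens before `b`, deletes it, replaces it, or
inserts a letter behind it. -/
theorem EditStep.concat_cases {B D : List α} {b : α} {d : ℝ} (h : EditStep C (B ++ [b]) D d) :
    (∃ D', D = D' ++ [b] ∧ EditStep C B D' d) ∨ (D = B ∧ d = C.delete b) ∨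
      (∃ b', D = B ++ [b'] ∧ d = C.replace b b') ∨
      ∃ b', D = B ++ [b] ++ [b'] ∧ d = C.insert b' := by
  generalize hX : B ++ [b] = X at h
  cases h with
  | delete u v a =>
    rcases List.eq_nil_or_concat' v with rfl | ⟨v, c, rfl⟩
    · obtain ⟨rfl, rfl⟩ := List.append_singleton_inj.1 hX
      exact Or.inr (Or.inl ⟨by simp, rfl⟩)
    · have hX' : B ++ [b] = (u ++ a :: v) ++ [c] := by simpa using hX
      obtain ⟨rfl, rfl⟩ := List.append_singleton_inj.1 hX'
      exact Or.inl ⟨u ++ v, by simp, .delete u v a⟩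
  | insert u v a =>
    rcases List.eq_nil_or_concat' v with rfl | ⟨v, c, rfl⟩
    · rw [List.append_nil] at hX
      exact Or.inr (Or.inr (Or.inr ⟨a, by simp, rfl⟩))
    · have hX' : B ++ [b] = (u ++ v) ++ [c] := by simpa using hX
      obtain ⟨rfl, rfl⟩ := List.append_singleton_inj.1 hX'
      exact Or.inl ⟨u ++ a :: v, by simp, .insert u v a⟩
  | replace u v a c =>
    rcases List.eq_nil_or_concat' v with rfl | ⟨v, e, rfl⟩
    · obtain ⟨rfl, rfl⟩ := List.append_singleton_inj.1 hX
      exact Or.inr (Or.inr (Or.inl ⟨c, rfl, rfl⟩))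
    · have hX' : B ++ [b] = (u ++ a :: v) ++ [e] := by simpa using hX
      obtain ⟨rfl, rfl⟩ := List.append_singleton_inj.1 hX'
      exact Or.inl ⟨u ++ c :: v, by simp, .replace u v a c⟩

theorem Aligns.refl (hC : IsMetricScoring C) (A : List α) : Aligns C A A 0 := by
  induction A using List.reverseRecOn with
  | nil => exact .nil
  | append_singleton A a ih => simpa [hC.replace_self] using Aligns.replace a a ih

/-- An elementary operation after an alignment can be absorbed into the alignment. -/
theorem Aligns.step (hC : IsMetricScoring C) {A B : List α} {c : ℝ} (h : Aligns C A B c) :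
    ∀ {D : List α} {d : ℝ}, EditStep C B D d → ∃ e ≤ c + d, Aligns C A D e := by
  induction h with
  | nil =>
    intro D d h
    generalize hX : ([] : List α) = X at h
    cases h with
    | delete u v a => simp at hX
    | insert u v b =>
      obtain ⟨rfl, rfl⟩ := List.append_eq_nil_iff.1 hX.symm
      exact ⟨_, le_rfl, Aligns.insert b .nil⟩
    | replace u v a b => simp at hX
  | delete a _ ih =>
    intro D d h
    obtain ⟨e, he, h'⟩ := ih h
    exact ⟨_, by linarith, h'.delete a⟩
  -- The last letter was inserted by the alignment. Deleting it again undoes both operations, which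
  -- is no more expensive by nonnegativity; replacing it amounts to inserting the other letter at
  -- once.
  | insert b h₀ ih =>
    intro D d h
    rcases h.concat_cases with ⟨D', rfl, h1⟩ | ⟨rfl, rfl⟩ | ⟨b', rfl, rfl⟩ | ⟨b', rfl, rfl⟩
    · obtain ⟨e, he, h'⟩ := ih h1
      exact ⟨_, by linarith, h'.insert b⟩
    · exact ⟨_, by linarith [hC.insert_nonneg b, hC.delete_nonneg b], h₀⟩
    · exact ⟨_, by linarith [hC.insert_triangle b b'], h₀.insert b'⟩
    · exact ⟨_, le_rfl, (h₀.insert b).insert b'⟩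
  -- The last letter stems from `a`: deleting it amounts to deleting `a`, and replacing it to
  -- replacing `a` directly, each by a triangle inequality.
  | replace a b h₀ ih =>
    intro D d h
    rcases h.concat_cases with ⟨D', rfl, h1⟩ | ⟨rfl, rfl⟩ | ⟨b', rfl, rfl⟩ | ⟨b', rfl, rfl⟩
    · obtain ⟨e, he, h'⟩ := ih h1
      exact ⟨_, by linarith, h'.replace a b⟩
    · exact ⟨_, by linarith [hC.delete_triangle a b], h₀.delete a⟩
    · exact ⟨_, by linarith [hC.replace_triangle a b b'], h₀.replace a b'⟩
    · exact ⟨_, le_rfl, (h₀.replace a b).insert b'⟩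

theorem Transforms.alignment (hC : IsMetricScoring C) {A B : List α} {d : ℝ}
    (h : Transforms C A B d) : ∃ e ≤ d, Aligns C A B e := by
  induction h with
  | refl => exact ⟨0, le_rfl, .refl hC _⟩
  | step _ h ih =>
    obtain ⟨e, he, h'⟩ := ih
    obtain ⟨e', he', h''⟩ := h'.step hC h
    exact ⟨e', by linarith, h''⟩

/-! ### Table entries as cheapest alignments -/

namespace Scoring

theorem deleteAt_eq {A : List α} {i : ℕ} (h : i < A.length) : C.deleteAt A i = C.delete A[i] :=
  dif_pos h

theorem insertAt_eq {B : List α} {j : ℕ} (h : j < B.length) : C.insertAt B j = C.insert B[j] :=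
  dif_pos h

theorem replaceAt_eq {A B : List α} {i j : ℕ} (hi : i < A.length) (hj : j < B.length) :
    C.replaceAt A B i j = C.replace A[i] B[j] :=
  dif_pos ⟨hi, hj⟩

/-- The table entry is the cost of the alignment obtained by following a choice that attains the
minimum. No assumption on the costs is needed. -/
theorem alignment_table (C : Scoring α) (A B : List α) : ∀ i j, i ≤ A.length → j ≤ B.length →
    Aligns C (A.take i) (B.take j) (C.table A B i j)
  | 0, 0, _, _ => by simpa [table] using Aligns.nil
  | i + 1, 0, hi, hj => by
    rw [table, deleteAt_eq hi, List.take_succ_eq_append_getElem hi]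
    exact (alignment_table C A B i 0 (by omega) hj).delete _
  | 0, j + 1, hi, hj => by
    rw [table, insertAt_eq hj, List.take_succ_eq_append_getElem hj]
    exact (alignment_table C A B 0 j hi (by omega)).insert _
  | i + 1, j + 1, hi, hj => by
    have h1 := (alignment_table C A B i (j + 1) (by omega) hj).delete A[i]
    have h2 := (alignment_table C A B (i + 1) j hi (by omega)).insert B[j]
    have h3 := (alignment_table C A B i j (by omega) (by omega)).replace A[i] B[j]
    rw [← List.take_succ_eq_append_getElem] at h1 h2 h3
    rw [← List.take_succ_eq_append_getElem] at h3
    rw [table, deleteAt_eq hi, insertAt_eq hj, replaceAt_eq hi hj]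
    rcases min_choice (C.table A B i (j + 1) + C.delete A[i])
      (min (C.table A B (i + 1) j + C.insert B[j]) (C.table A B i j + C.replace A[i] B[j])) with
      h | h <;> rw [h]
    · exact h1
    · rcases min_choice (C.table A B (i + 1) j + C.insert B[j])
        (C.table A B i j + C.replace A[i] B[j]) with h | h <;> rw [h]
      · exact h2
      · exact h3

theorem table_succ_le_delete (C : Scoring α) (A B : List α) (i j : ℕ) :
    C.table A B (i + 1) j ≤ C.table A B i j + C.deleteAt A i := by
  cases j with
  | zero => rw [table]
  | succ j => rw [table]; exact min_le_left _ _

theorem table_succ_le_insert (C : Scoring α) (A B : List α) (i j : ℕ) :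
    C.table A B i (j + 1) ≤ C.table A B i j + C.insertAt B j := by
  cases i with
  | zero => rw [table]
  | succ i => rw [table]; exact (min_le_right _ _).trans (min_le_left _ _)

theorem take_eq_concat {A X : List α} {a : α} {i : ℕ} (hi : i ≤ A.length) (h : A.take i = X ++ [a]) :
    ∃ k, ∃ hk : k < A.length, i = k + 1 ∧ A.take k = X ∧ A[k] = a := by
  cases i with
  | zero => simp at h
  | succ k =>
    rw [List.take_succ_eq_append_getElem hi] at h
    obtain ⟨h1, h2⟩ := List.append_singleton_inj.1 h
    exact ⟨k, hi, rfl, h1, h2⟩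

/-- The last operation of the alignment is one of the options in the minimum. -/
theorem table_le_alignment (C : Scoring α) (A B : List α) {X Y : List α} {d : ℝ}
    (h : Aligns C X Y d) : ∀ i j, i ≤ A.length → j ≤ B.length → A.take i = X → B.take j = Y →
      C.table A B i j ≤ d := by
  induction h with
  | nil =>
    intro i j hi hj hX hY
    have h1 : i = 0 := by simpa [hi] using congrArg List.length hX
    have h2 : j = 0 := by simpa [hj] using congrArg List.length hY
    rw [h1, h2, table]
  | delete a _ ih =>
    intro i j hi hj hX hY
    obtain ⟨k, hk, rfl, h1, rfl⟩ := take_eq_concat hi hX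
    have := ih k j (by omega) hj h1 hY
    have h2 := C.table_succ_le_delete A B k j
    rw [deleteAt_eq hk] at h2
    linarith
  | insert b _ ih =>
    intro i j hi hj hX hY
    obtain ⟨k, hk, rfl, h1, rfl⟩ := take_eq_concat hj hY
    have := ih i k hi (by omega) hX h1
    have h2 := C.table_succ_le_insert A B i k
    rw [insertAt_eq hk] at h2
    linarith
  | replace a b _ ih =>
    intro i j hi hj hX hY
    obtain ⟨k, hk, rfl, h1, rfl⟩ := take_eq_concat hi hX
    obtain ⟨m, hm, rfl, h2, rfl⟩ := take_eq_concat hj hY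
    have := ih k m (by omega) (by omega) h1 h2
    rw [table, replaceAt_eq hk hm]
    exact ((min_le_right _ _).trans (min_le_right _ _)).trans (by linarith)

/-- Under the triangle inequalities, the edit distance is the minimum cost of a transformation. -/
theorem isLeast_editDistance (hC : IsMetricScoring C) (A B : List α) :
    IsLeast {d : ℝ | Transforms C A B d} (C.editDistance A B) := by
  constructor
  · have := C.alignment_table A B _ _ le_rfl le_rfl
    rw [List.take_length, List.take_length] at this
    exact this.transforms
  · intro d hd
    obtain ⟨e, he, h⟩ := hd.alignment hC
    exact (C.table_le_alignment A B h _ _ le_rfl le_rfl List.take_length List.take_length).trans he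

end Scoring

/-- There are a program `P` and constants `c`, `k` such that, for all alphabets, all scoring
functions and all pairs of straight-line programs of total size `n` that represent strings of total
length `N`, the program `P`, on a machine with words of `k * log₂ (n + N + σ)` bits or more, halts
within time `c * n ^ (2/3) * N ^ (4/3)`, with the edit distance of the two strings in the real
variable `0`. -/
theorem mainTheorem2 :
    ∃ (P : RAM.Prog) (c k : ℕ),
      ∀ (σ : ℕ) (C : Scoring (Fin σ)) (S T : SLP (Fin σ)) (n N W : ℕ),
        n = S.size + T.size →
        N = S.word.length + T.word.length →
        (n + N + σ) ^ k ≤ W →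
        ∃ (t : ℕ) (s : RAM.State),
          RAM.Exec W P (initialState C S T) t s ∧
          (t : ℝ) ≤ c * (n : ℝ) ^ (2 / 3 : ℝ) * (N : ℝ) ^ (4 / 3 : ℝ) ∧
          s.rvar 0 = C.editDistance S.word T.word ∧
          (IsMetricScoring C → IsLeast {d : ℝ | Transforms C S.word T.word d} (s.rvar 0)) := by
  refine ⟨RAM.mainProg, 4000000, 9, fun σ C S T n N W hn hN hW => ?_⟩
  have pS := RAM.word_length_pos S
  have pT := RAM.word_length_pos T
  have qS := S.size_pos
  have qT := T.size_pos
  have hσ : 1 ≤ σ := (S.word[0]'pS).pos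
  -- Only the cube of R and `N ≤ R` are used below.
  obtain ⟨R, hR⟩ : ∃ R : ℝ, (n : ℝ) ^ (2 / 3 : ℝ) * (N : ℝ) ^ (4 / 3 : ℝ) = R := ⟨_, rfl⟩
  have hR0 : 0 ≤ R := by
    rw [← hR]
    positivity
  have hR3 : R ^ 3 = (n : ℝ) ^ 2 * (N : ℝ) ^ 4 := by
    rw [← hR, mul_pow, ← Real.rpow_mul_natCast (by positivity),
      ← Real.rpow_mul_natCast (by positivity)]
    rw [← Real.rpow_natCast (n : ℝ) 2, ← Real.rpow_natCast (N : ℝ) 4]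
    norm_num
  have hn1 : (1 : ℝ) ≤ n := by
    have : 1 ≤ n := by omega
    exact_mod_cast this
  have hN1 : (1 : ℝ) ≤ N := by
    have : 1 ≤ N := by omega
    exact_mod_cast this
  -- As `n ≥ 1` and `N ≥ 1`, the linear costs of reading the strings and choosing the block size are
  -- absorbed, and 4000000 covers 3500000 + 2020 + 470.
  have hNR : (N : ℝ) ≤ R := by
    refine RAM.le_of_cube_le hR0 ?_
    rw [hR3]
    calc (N : ℝ) ^ 3 = 1 * (N : ℝ) ^ 3 := (one_mul _).symm
      _ ≤ (n : ℝ) ^ 2 * (N : ℝ) ^ 4 :=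
        mul_le_mul (one_le_pow₀ hn1) (pow_le_pow_right₀ hN1 (by norm_num)) (by positivity)
          (by positivity)
  obtain ⟨t, s, h1, h2, h3⟩ := RAM.mainProg_run (C := C) (S := S) (T := T)
    (B := ⌊3500000 * R⌋₊) (RAM.sizes_of_pow_le (by omega) (by omega) hσ hW) hn.symm hN.symm
    fun x hx => Nat.le_floor (RAM.blockTime_le hn.symm hN.symm hx hNR hR3)
  refine ⟨t, s, h1, ?_, h3, fun hC => ?_⟩
  · have h4 : (t : ℝ) ≤ 2020 * N + 470 + (⌊3500000 * R⌋₊ : ℕ) := by exact_mod_cast h2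
    have h5 := Nat.floor_le (a := 3500000 * R) (by positivity)
    rw [mul_assoc, hR]
    push_cast
    linarith
  · rw [h3]
    exact Scoring.isLeast_editDistance hC _ _
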